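/- \textbf{The multimodal Lambek calculus.} Let $I$ be a set of modes, $J$ a set of modalities ($I\cap J=\emptyset$), $C\subseteq I$ the commutative and $\mathcal A\subseteq I$ the associative modes. Formulas of $\mathrm{NL}\Diamond$ are built from primitive formulas by $A\bullet_iB$, $B\backslash_iA$, $A/_iB$ ($i\in I$), $\Diamond_jA$, $\Box_jA$ ($j\in J$). Structured databases are given by $\Pi ::= A\mid(\Pi,\Pi)^i\mid\langle\Pi\rangle^j$; sequents are $\Pi\to A$. The axiom is $A\to A$, and the rules are the usual cut-free ones: from $\Delta[(A,B)^i]\to D$ infer $\Delta[A\bullet_iB]\to D$; from $\Pi_1\to A_1$ and $\Pi_2\to A_2$ infer $(\Pi_1,\Pi_2)^i\to A_1\bullet_iA_2$; from $\Delta[A]\to D$ and $\Pi\to B$ infer $\Delta[(\Pi,B\backslash_iA)^i]\to D$ and $\Delta[(A/_iB,\Pi)^i]\to D$; from $(B,\Pi)^i\to A$ infer $\Pi\to B\backslash_iA$; from $(\Pi,B)^i\to A$ infer $\Pi\to A/_iB$; from $\Delta[\langle A\rangle^j]\to D$ infer $\Delta[\Diamond_jA]\to D$; from $\Pi\to A$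 infer $\langle\Pi\rangle^j\to\Diamond_jA$; from $\Delta[A]\to D$ infer $\Delta[\langle\Box_jA\rangle^j]\to D$; from $\langle\Pi\rangle^j\to A$ infer $\Pi\to\Box_jA$; for $c\in C$, $(\Pi_1,\Pi_2)^c$ may be replaced by $(\Pi_2,\Pi_1)^c$ inside an antecedent, and for $a\in\mathcal A$, $((\Pi_1,\Pi_2)^a,\Pi_3)^a$ and $(\Pi_1,(\Pi_2,\Pi_3)^a)^a$ may be replaced by each other inside an antecedent. \textbf{The hypergraph Lambek calculus.} Let $Pr$ be a ranked set of primitive formulas. A hypergraph of rank $k$ has finitely many nodes and hyperedges and a string of $k$ external nodes; every hyperedge has a string of attachment nodes, and its label has rank equal to the length of this string. Hypergraphs are taken up to isomorphism, also inside formulas. $G[e/H]$ is hyperedge replacement (the $t$-th attachment node of $e$ is glued with the $t$-th external node of $H$), and $a^\bullet$ is the handle of $a$. Formulas of $\mathrm{HL}$ are: $p\in Pr$; $\times(M)$ of rank $\mathrm{rk}(M)$ for a hypergraph $M$ labelled by formulas; $N\div D$ of rank $d$, where $D$ is a hypergraph with $\mathrm{rk}(D)=\mathrm{rk}(N)$ in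 which one hyperedge $e_D$ is labelled by a hole symbol $\$_d$ of rank $d$ and all others $d_1,\dots,d_k$ by formulas. A sequent $H\to A$ consists of a hypergraph $H$ labelled by formulas and a formula $A$ of the same rank. The axiom is $A^\bullet\to A$, and the rules are: from $H[e/M]\to A$ infer $H[e/(\times(M))^\bullet]\to A$; from $H_t\to lab_M(m_t)$ for all hyperedges $m_1,\dots,m_l$ of $M$ infer $M[m_1/H_1,\dots,m_l/H_l]\to\times(M)$; from $H[e/N^\bullet]\to A$ and $H_t\to lab_D(d_t)$ for all $t$ infer $H[e/D[e_D/(N\div D)^\bullet,d_1/H_1,\dots,d_k/H_k]]\to A$; from $D[e_D/F]\to N$ infer $F\to N\div D$. \textbf{Translations.} A \emph{translation of rank $k$} consists of an injection of the primitive formulas of $\mathrm{NL}\Diamond$ into the primitive formulas of $\mathrm{HL}$ of rank $k$ (written as an inclusion), and, for each mode $i$ (each modality $j$), a hypergraph $R^i(\cdot,\cdot)$ ($U^j(\cdot)$) of rank $k$ which is labelled by primitive formulas of $\mathrm{HL}$ except for two distinguished hyperedges $r_1,r_2$ (one distinguished hyperedge $u_1$) of rank $k$ whose labels are left open. It determines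 $$\mu(p)=p,\quad \mu(A\bullet_iB)=\times(R^i(\mu(A),\mu(B))),\quad \mu(B\backslash_iA)=\mu(A)\div R^i(\mu(B),\$_k),\quad \mu(A/_iB)=\mu(A)\div R^i(\$_k,\mu(B)),$$ $$\mu(\Diamond_jA)=\times(U^j(\mu(A))),\quad \mu(\Box_jA)=\mu(A)\div U^j(\$_k),$$ $$\mathrm{htree}(A)=\mu(A)^\bullet,\quad \mathrm{htree}((\Pi_1,\Pi_2)^i)=R^i[r_1/\mathrm{htree}(\Pi_1),r_2/\mathrm{htree}(\Pi_2)],\quad \mathrm{htree}(\langle\Pi\rangle^j)=U^j[u_1/\mathrm{htree}(\Pi)].$$ It \emph{embeds} $\mathrm{NL}\Diamond$ in $\mathrm{HL}$ if: (1) for every structured database $\Pi$ and formula $T$, if $\mathrm{NL}\Diamond\vdash\Pi\to T$ then $\mathrm{HL}\vdash\mathrm{htree}(\Pi)\to\mu(T)$; (2) conversely, for every $\Pi$ and $T$, if $\mathrm{HL}\vdash\mathrm{htree}(\Pi)\to\mu(T)$ then $\mathrm{NL}\Diamond\vdash\Pi\to T$; (3) whenever $\mathrm{HL}\vdash G\to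 X$, where every label of $G$ is of the form $\mu(A)$ or is one of the primitive labels occurring in the hypergraphs $R^i,U^j$, and $X$ is of the form $\mu(A)$, there are $\Pi$ and $T$ with $G=\mathrm{htree}(\Pi)$, $X=\mu(T)$ and $\mathrm{NL}\Diamond\vdash\Pi\to T$. \textbf{Theorem.} (a) Let $\mathcal A=\{O\}$ with $O\notin C$, and let $C$, $I$, $J$ be otherwise arbitrary. Let modes and modalities be represented by pairwise distinct primitive formulas of $\mathrm{HL}$: $O$ of rank $1$, $c\in C$ and $j\in J$ of rank $4$, and $i\in I\setminus(C\cup\{O\})$ of rank $6$. Consider the translation $(\bar\mu,\overline{\mathrm{htree}})$ of rank $2$ with the following hypergraphs (an edge $A:v\to w$ is a hyperedge labelled $A$ with attachment string $vw$): for $i\in I\setminus(C\cup\{O\})$, $\bar R^i(A,B)$ has nodes $v_1,\dots,v_6$, external nodes $v_1v_2$, a hyperedge $i$ attached to $v_1\cdots v_6$, and edges $A:v_3\to v_4$, $B:v_5\to v_6$; for $c\in C$, $\bar K^c(A,B)$ has nodes $v_1,\dots,v_4$, external nodes $v_1v_2$, a hyperedge $c$ attached to $v_1\cdots v_4$, and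 two parallel edges $A:v_3\to v_4$, $B:v_3\to v_4$; for $j\in J$, $\bar U^j(A)$ has nodes $v_1,\dots,v_4$, external nodes $v_1v_2$, a hyperedge $j$ attached to $v_1\cdots v_4$, and an edge $A:v_3\to v_4$; $\bar R^O(A,B)$ has nodes $v_1,v_2,v_3$, external nodes $v_1v_3$, edges $A:v_1\to v_2$, $B:v_2\to v_3$, and a hyperedge $O$ attached to $v_2$. Then this translation embeds $\mathrm{NL}\Diamond$ in $\mathrm{HL}$. (b) Let $|\mathcal A|\le1$, with $I$, $J$, $C\subseteq I$ arbitrary, and suppose that for every rank $n$ the primitive formulas, modes and modalities of $\mathrm{NL}\Diamond$ can be injected jointly into the set of primitive formulas of $\mathrm{HL}$ of rank $n$. Then there are a rank $k$ and a translation of rank $k$ that embeds $\mathrm{NL}\Diamond$ in $\mathrm{HL}$. -/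

import Mathlib

universe u v w x

/-! ## The multimodal Lambek calculus -/

namespace NLM

/-- Formulas over primitive formulas `At`, modes `I` and modalities `J`. -/
inductive Formula (At : Type u) (I : Type v) (J : Type w) : Type (max u v w)
  | atom (p : At) : Formula At I J
  /-- `prod i A B` is the product of `A` and `B` in mode `i`. -/
  | prod (i : I) (A B : Formula At I J) : Formula At I J
  /-- `under i B A` is `B \_i A`. -/
  | under (i : I) (B A : Formula At I J) : Formula At I J
  /-- `over i A B` is `A /_i B`. -/
  | over (i : I) (A B : Formula At I J) : Formula At I J
  | dia (j : J) (A : Formula At I J) : Formula At I J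
  | box (j : J) (A : Formula At I J) : Formula At I J

/-- Structured databases. -/
inductive Database (At : Type u) (I : Type v) (J : Type w) : Type (max u v w)
  | form (A : Formula At I J) : Database At I J
  | pair (i : I) (P Q : Database At I J) : Database At I J
  | bracket (j : J) (P : Database At I J) : Database At I J

/-- Structured databases with one distinguished position (a hole). -/
inductive Ctx (At : Type u) (I : Type v) (J : Type w) : Type (max u v w)
  | hole : Ctx At I J
  | pairL (i : I) (D : Ctx At I J) (Q : Database At I J) : Ctx At I J
  | pairR (i : I) (P : Database At I J) (D : Ctx At I J) : Ctx At I J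
  | bracket (j : J) (D : Ctx At I J) : Ctx At I J

variable {At : Type u} {I : Type v} {J : Type w}

/-- `D.fill P` is `D[P]`. -/
def Ctx.fill : Ctx At I J → Database At I J → Database At I J
  | .hole, P => P
  | .pairL i D Q, P => .pair i (D.fill P) Q
  | .pairR i Q D, P => .pair i Q (D.fill P)
  | .bracket j D, P => .bracket j (D.fill P)

/-- Derivability of a sequent `P → T`, where `C` is the set of commutative modes and `A` the set of
associative modes. -/
inductive Derivable (C A : Set I) : Database At I J → Formula At I J → Prop
  | ax (X : Formula At I J) : Derivable C A (.form X) X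
  | prodL (D : Ctx At I J) (i : I) (X Y Z : Formula At I J) :
      Derivable C A (D.fill (.pair i (.form X) (.form Y))) Z →
      Derivable C A (D.fill (.form (.prod i X Y))) Z
  | prodR (i : I) (P Q : Database At I J) (X Y : Formula At I J) :
      Derivable C A P X → Derivable C A Q Y → Derivable C A (.pair i P Q) (.prod i X Y)
  | underL (D : Ctx At I J) (i : I) (P : Database At I J) (X Y Z : Formula At I J) :
      Derivable C A (D.fill (.form X)) Z → Derivable C A P Y →
      Derivable C A (D.fill (.pair i P (.form (.under i Y X)))) Z
  | underR (i : I) (P : Database At I J) (X Y : Formula At I J) :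
      Derivable C A (.pair i (.form Y) P) X → Derivable C A P (.under i Y X)
  | overL (D : Ctx At I J) (i : I) (P : Database At I J) (X Y Z : Formula At I J) :
      Derivable C A (D.fill (.form X)) Z → Derivable C A P Y →
      Derivable C A (D.fill (.pair i (.form (.over i X Y)) P)) Z
  | overR (i : I) (P : Database At I J) (X Y : Formula At I J) :
      Derivable C A (.pair i P (.form Y)) X → Derivable C A P (.over i X Y)
  | diaL (D : Ctx At I J) (j : J) (X Z : Formula At I J) :
      Derivable C A (D.fill (.bracket j (.form X))) Z → Derivable C A (D.fill (.form (.dia j X))) Z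
  | diaR (j : J) (P : Database At I J) (X : Formula At I J) :
      Derivable C A P X → Derivable C A (.bracket j P) (.dia j X)
  | boxL (D : Ctx At I J) (j : J) (X Z : Formula At I J) :
      Derivable C A (D.fill (.form X)) Z → Derivable C A (D.fill (.bracket j (.form (.box j X)))) Z
  | boxR (j : J) (P : Database At I J) (X : Formula At I J) :
      Derivable C A (.bracket j P) X → Derivable C A P (.box j X)
  | perm (D : Ctx At I J) (c : I) (hc : c ∈ C) (P Q : Database At I J) (Z : Formula At I J) :
      Derivable C A (D.fill (.pair c P Q)) Z → Derivable C A (D.fill (.pair c Q P)) Z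
  | assocL (D : Ctx At I J) (a : I) (ha : a ∈ A) (P Q R : Database At I J) (Z : Formula At I J) :
      Derivable C A (D.fill (.pair a P (.pair a Q R))) Z →
      Derivable C A (D.fill (.pair a (.pair a P Q) R)) Z
  | assocR (D : Ctx At I J) (a : I) (ha : a ∈ A) (P Q R : Database At I J) (Z : Formula At I J) :
      Derivable C A (D.fill (.pair a (.pair a P Q) R)) Z →
      Derivable C A (D.fill (.pair a P (.pair a Q R))) Z

end NLM

/-! ## Hypergraphs and hyperedge replacement -/

/-- A hypergraph of rank `k` (it has `k` external nodes) over a ranked set of labels, where `L n` is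
the set of labels of rank `n`.  The hyperedges are sorted by rank: `E n` is the set of hyperedges
with `n` attachment nodes. -/
structure HGraph (L : ℕ → Type u) (k : ℕ) : Type (max 1 u) where
  V : Type
  E : ℕ → Type
  att : ∀ n, E n → Fin n → V
  lab : ∀ n, E n → L n
  ext : Fin k → V
  finV : Finite V
  finE : Finite (Σ n, E n)

/-- The index set of a single hyperedge of rank `d`. -/
inductive OneEdge (d : ℕ) : ℕ → Type
  | mk : OneEdge d d

namespace OneEdge

instance (d : ℕ) : Finite (Σ n, OneEdge d n) :=
  Finite.of_surjective (fun _ : Unit => (⟨d, .mk⟩ : Σ n, OneEdge d n))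
    (fun y => ⟨(), by rcases y with ⟨_, ⟨⟩⟩; rfl⟩)

/-- Transport along the equality of ranks witnessed by an element of `OneEdge d n`. -/
def elim {L : ℕ → Sort u} {d : ℕ} (a : L d) : ∀ {n : ℕ}, OneEdge d n → L n
  | _, .mk => a

end OneEdge

namespace HGraph

variable {L : ℕ → Type u} {L₁ : ℕ → Type v} {k d : ℕ}

/-- All hyperedges of a hypergraph; the first component is the rank. -/
abbrev Edge (G : HGraph L k) : Type := Σ n, G.E n

/-- The hypergraph without hyperedges on the node set `Fin m`. -/
def discrete (m : ℕ) (ext : Fin k → Fin m) : HGraph L k where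
  V := Fin m
  E := fun _ => Empty
  att := fun _ e => e.elim
  lab := fun _ e => e.elim
  ext := ext
  finV := inferInstance
  finE := by
    have : IsEmpty (Σ _ : ℕ, Empty) := ⟨fun e => e.2.elim⟩
    exact Finite.of_subsingleton

/-- `G.addEdge pos a` is `G` with a new hyperedge labelled `a` and attached to the nodes `pos`. -/
def addEdge (G : HGraph L k) (pos : Fin d → G.V) (a : L d) : HGraph L k where
  V := G.V
  E := fun n => G.E n ⊕ OneEdge d n
  att := fun n => Sum.elim (G.att n) (OneEdge.elim (L := fun n => Fin n → G.V) pos)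
  lab := fun n => Sum.elim (G.lab n) (OneEdge.elim a)
  ext := G.ext
  finV := G.finV
  finE := by
    have := G.finE
    exact Finite.of_equiv _ (Equiv.sigmaSumDistrib G.E (OneEdge d)).symm

/-- The handle of a label. -/
def handle (a : L k) : HGraph L k := (discrete k id).addEdge id a

/-- Replacing the labels (possibly by labels from another ranked set). -/
def relabel (G : HGraph L k) (f : ∀ y : G.Edge, L₁ y.1) : HGraph L₁ k where
  V := G.V
  E := G.E
  att := G.att
  lab := fun n e => f ⟨n, e⟩
  ext := G.ext
  finV := G.finV
  finE := G.finE

/-- The gluing relation of hyperedge replacement: the `i`-th attachment node of a hyperedge `y` is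
glued with the `i`-th external node of the hypergraph (with node set `W y`) that replaces `y`. -/
inductive Glue {V : Type} {E : ℕ → Type} (att : ∀ n, E n → Fin n → V) {W : (Σ n, E n) → Type}
    (ext : ∀ y : Σ n, E n, Fin y.1 → W y) : (V ⊕ Σ y, W y) → (V ⊕ Σ y, W y) → Prop
  | mk (y : Σ n, E n) (i : Fin y.1) :
      Glue att ext (Sum.inl (att y.1 y.2 i)) (Sum.inr ⟨y, ext y i⟩)

/-- Simultaneous replacement of every hyperedge `y` of `G` by the hypergraph `H y`.  (A hyperedge
that is replaced by its own handle remains as it is.)  `Quot` is the quotient by the smallest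
equivalence relation containing the gluing relation. -/
def subst (G : HGraph L k) (H : ∀ y : G.Edge, HGraph L₁ y.1) : HGraph L₁ k where
  V := Quot (Glue G.att fun y => (H y).ext)
  E := fun n => Σ y, (H y).E n
  att := fun n e i => Quot.mk _ (Sum.inr ⟨e.1, (H e.1).att n e.2 i⟩)
  lab := fun n e => (H e.1).lab n e.2
  ext := fun i => Quot.mk _ (Sum.inl (G.ext i))
  finV := by
    have := G.finV
    have := G.finE
    have := fun y => (H y).finV
    infer_instance
  finE := by
    have := G.finE
    have := fun y => (H y).finE
    refine Finite.of_injective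
      (fun e : Σ n, Σ y, (H y).E n => (⟨e.2.1, e.1, e.2.2⟩ : Σ y, Σ n, (H y).E n)) ?_
    rintro ⟨n, y, e⟩ ⟨n₁, y₁, e₁⟩ h
    simp only [Sigma.mk.injEq] at h
    obtain ⟨rfl, h⟩ := h
    simp only [heq_eq_eq, Sigma.mk.injEq] at h
    obtain ⟨rfl, h⟩ := h
    simp only [heq_eq_eq] at h
    rw [h]

/-- Simultaneous replacement of every hyperedge by the hypergraph that labels it. -/
def join (G : HGraph (fun n => HGraph L n) k) : HGraph L k := G.subst fun y => G.lab y.1 y.2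

open Classical in
/-- `G.replace e H` is `G[e/H]`. -/
noncomputable def replace (G : HGraph L k) (e : G.Edge) (H : HGraph L e.1) : HGraph L k :=
  G.subst (Function.update (fun y : G.Edge => handle (G.lab y.1 y.2)) e H)

/-- `G` and `G'` are isomorphic, labels being compared by `R`. -/
def IsoBy (R : ∀ n, L n → L n → Prop) (G G' : HGraph L k) : Prop :=
  ∃ (f : G.V ≃ G'.V) (g : ∀ n, G.E n ≃ G'.E n),
    (∀ n e i, f (G.att n e i) = G'.att n (g n e) i) ∧
    (∀ n e, R n (G.lab n e) (G'.lab n (g n e))) ∧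
    (∀ i, f (G.ext i) = G'.ext i)

end HGraph

/-- A hypergraph of rank `k` with exactly one hyperedge labelled by the hole symbol `$_d`, which is
attached to the nodes `hole`; the fields of `toHGraph` describe all other hyperedges. -/
structure HoleGraph (L : ℕ → Type u) (k d : ℕ) : Type (max 1 u) extends HGraph L k where
  hole : Fin d → V

/-- `D.fill F H` results from `D` by replacing the hole by `F` and every other hyperedge `y` by
`H y`. -/
def HoleGraph.fill {L : ℕ → Type u} {L₁ : ℕ → Type v} {k d : ℕ} (D : HoleGraph L k d)
    (F : HGraph L₁ d) (H : ∀ y : D.toHGraph.Edge, HGraph L₁ y.1) : HGraph L₁ k :=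
  ((D.toHGraph.relabel H).addEdge D.hole F).join

/-! ## The hypergraph Lambek calculus -/

namespace HL

/-- Formulas of rank `n`, where `Pr n` is the set of primitive formulas of rank `n`.  The last two
constructors list the components of a hypergraph; see `Formula.times` and `Formula.div`. -/
inductive Formula (Pr : ℕ → Type u) : ℕ → Type (max 1 u)
  | prim {n : ℕ} (p : Pr n) : Formula Pr n
  | mkTimes {k : ℕ} (V : Type) (E : ℕ → Type) (att : ∀ n, E n → Fin n → V)
      (lab : ∀ n, E n → Formula Pr n) (ext : Fin k → V) (finV : Finite V)
      (finE : Finite (Σ n, E n)) : Formula Pr k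
  | mkDiv {k d : ℕ} (N : Formula Pr k) (V : Type) (E : ℕ → Type) (att : ∀ n, E n → Fin n → V)
      (lab : ∀ n, E n → Formula Pr n) (ext : Fin k → V) (finV : Finite V)
      (finE : Finite (Σ n, E n)) (hole : Fin d → V) : Formula Pr d

variable {Pr : ℕ → Type u}

/-- The product `×(M)`. -/
def Formula.times {k : ℕ} (M : HGraph (Formula Pr) k) : Formula Pr k :=
  .mkTimes M.V M.E M.att M.lab M.ext M.finV M.finE

/-- The division `N ÷ D`. -/
def Formula.div {k d : ℕ} (N : Formula Pr k) (D : HoleGraph (Formula Pr) k d) : Formula Pr d :=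
  .mkDiv N D.V D.E D.att D.lab D.ext D.finV D.finE D.hole

/-- Identity of formulas.  Hypergraphs are considered up to isomorphism, also those which occur
inside formulas, at any depth. -/
inductive Formula.Iso : ∀ {n : ℕ}, Formula Pr n → Formula Pr n → Prop
  | prim {n : ℕ} (p : Pr n) : Formula.Iso (.prim p) (.prim p)
  | times {k : ℕ} (M M' : HGraph (Formula Pr) k) (f : M.V ≃ M'.V) (g : ∀ n, M.E n ≃ M'.E n)
      (hatt : ∀ n e i, f (M.att n e i) = M'.att n (g n e) i)
      (hlab : ∀ n e, Formula.Iso (M.lab n e) (M'.lab n (g n e)))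
      (hext : ∀ i, f (M.ext i) = M'.ext i) :
      Formula.Iso (.times M) (.times M')
  | div {k d : ℕ} (N N' : Formula Pr k) (hN : Formula.Iso N N')
      (D D' : HoleGraph (Formula Pr) k d) (f : D.V ≃ D'.V) (g : ∀ n, D.E n ≃ D'.E n)
      (hatt : ∀ n e i, f (D.att n e i) = D'.att n (g n e) i)
      (hlab : ∀ n e, Formula.Iso (D.lab n e) (D'.lab n (g n e)))
      (hext : ∀ i, f (D.ext i) = D'.ext i) (hhole : ∀ i, f (D.hole i) = D'.hole i) :
      Formula.Iso (.div N D) (.div N' D')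

/-- Identity (isomorphism) of hypergraphs labelled by formulas. -/
abbrev GraphIso {k : ℕ} (G G' : HGraph (Formula Pr) k) : Prop :=
  HGraph.IsoBy (fun _ => Formula.Iso) G G'

/-- Derivability of a sequent `H → X`.  The rule `iso` says that hypergraphs are considered up to
isomorphism. -/
inductive Derivable : ∀ {k : ℕ}, HGraph (Formula Pr) k → Formula Pr k → Prop
  | iso {k : ℕ} {G G' : HGraph (Formula Pr) k} {X X' : Formula Pr k} :
      GraphIso G G' → Formula.Iso X X' → Derivable G X → Derivable G' X'
  | ax {k : ℕ} (X : Formula Pr k) : Derivable (HGraph.handle X) X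
  | timesL {k : ℕ} (H : HGraph (Formula Pr) k) (e : H.Edge) (M : HGraph (Formula Pr) e.1)
      (X : Formula Pr k) :
      Derivable (H.replace e M) X → Derivable (H.replace e (HGraph.handle (.times M))) X
  | timesR {k : ℕ} (M : HGraph (Formula Pr) k) (H : ∀ y : M.Edge, HGraph (Formula Pr) y.1) :
      (∀ y : M.Edge, Derivable (H y) (M.lab y.1 y.2)) → Derivable (M.subst H) (.times M)
  | divL {k d : ℕ} (H : HGraph (Formula Pr) k) (e : H.Edge) (N : Formula Pr e.1)
      (D : HoleGraph (Formula Pr) e.1 d) (F : ∀ y : D.toHGraph.Edge, HGraph (Formula Pr) y.1)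
      (X : Formula Pr k) :
      Derivable (H.replace e (HGraph.handle N)) X →
      (∀ y : D.toHGraph.Edge, Derivable (F y) (D.lab y.1 y.2)) →
      Derivable (H.replace e (D.fill (HGraph.handle (.div N D)) F)) X
  | divR {k d : ℕ} (N : Formula Pr k) (D : HoleGraph (Formula Pr) k d)
      (F : HGraph (Formula Pr) d) :
      Derivable (D.fill F fun y => HGraph.handle (D.lab y.1 y.2)) N → Derivable F (.div N D)

end HL

/-! ## Translations -/

/-- A hypergraph of rank `k` labelled by primitive formulas, together with the attachment nodes
of two further hyperedges of rank `k` whose labels are left open. -/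
structure BinGadget (Pr : ℕ → Type u) (k : ℕ) : Type (max 1 u) where
  base : HGraph Pr k
  left : Fin k → base.V
  right : Fin k → base.V

/-- As `BinGadget`, with one further hyperedge instead of two. -/
structure UnGadget (Pr : ℕ → Type u) (k : ℕ) : Type (max 1 u) where
  base : HGraph Pr k
  slot : Fin k → base.V

namespace BinGadget

variable {Pr : ℕ → Type u} {k : ℕ} (R : BinGadget Pr k)

/-- The hypergraph `R(A, B)`. -/
def graph (A B : HL.Formula Pr k) : HGraph (HL.Formula Pr) k :=
  ((R.base.relabel fun y => HL.Formula.prim (R.base.lab y.1 y.2)).addEdge R.left A).addEdge R.right B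

/-- The hypergraph `R($_k, B)`. -/
def holeLeft (B : HL.Formula Pr k) : HoleGraph (HL.Formula Pr) k k where
  toHGraph := (R.base.relabel fun y => HL.Formula.prim (R.base.lab y.1 y.2)).addEdge R.right B
  hole := R.left

/-- The hypergraph `R(A, $_k)`. -/
def holeRight (A : HL.Formula Pr k) : HoleGraph (HL.Formula Pr) k k where
  toHGraph := (R.base.relabel fun y => HL.Formula.prim (R.base.lab y.1 y.2)).addEdge R.left A
  hole := R.right

/-- The hypergraph `R[r₁/G, r₂/H]`, where `r₁` and `r₂` are the two open hyperedges. -/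
def compose (G H : HGraph (HL.Formula Pr) k) : HGraph (HL.Formula Pr) k :=
  HGraph.join (((R.base.relabel fun y =>
    HGraph.handle (HL.Formula.prim (R.base.lab y.1 y.2))).addEdge R.left G).addEdge R.right H)

end BinGadget

namespace UnGadget

variable {Pr : ℕ → Type u} {k : ℕ} (U : UnGadget Pr k)

/-- The hypergraph `U(A)`. -/
def graph (A : HL.Formula Pr k) : HGraph (HL.Formula Pr) k :=
  (U.base.relabel fun y => HL.Formula.prim (U.base.lab y.1 y.2)).addEdge U.slot A

/-- The hypergraph `U($_k)`. -/
def holeGraph : HoleGraph (HL.Formula Pr) k k where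
  toHGraph := U.base.relabel fun y => HL.Formula.prim (U.base.lab y.1 y.2)
  hole := U.slot

/-- The hypergraph `U[u₁/G]`, where `u₁` is the open hyperedge. -/
def compose (G : HGraph (HL.Formula Pr) k) : HGraph (HL.Formula Pr) k :=
  HGraph.join ((U.base.relabel fun y =>
    HGraph.handle (HL.Formula.prim (U.base.lab y.1 y.2))).addEdge U.slot G)

end UnGadget

/-- The data of a translation of rank `k`: primitive formulas of the multimodal calculus become
primitive formulas of rank `k`, and a hypergraph is chosen for every mode and every modality. -/
structure Translation (At : Type u) (I : Type v) (J : Type w) (Pr : ℕ → Type x) (k : ℕ) where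
  atom : At ↪ Pr k
  bin : I → BinGadget Pr k
  un : J → UnGadget Pr k

namespace Translation

variable {At : Type u} {I : Type v} {J : Type w} {Pr : ℕ → Type x} {k : ℕ}
  (τ : Translation At I J Pr k)

/-- The translation of formulas. -/
def mu : NLM.Formula At I J → HL.Formula Pr k
  | .atom p => .prim (τ.atom p)
  | .prod i A B => .times ((τ.bin i).graph (mu A) (mu B))
  | .under i B A => .div (mu A) ((τ.bin i).holeRight (mu B))
  | .over i A B => .div (mu A) ((τ.bin i).holeLeft (mu B))
  | .dia j A => .times ((τ.un j).graph (mu A))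
  | .box j A => .div (mu A) (τ.un j).holeGraph

/-- The translation of structured databases. -/
def htree : NLM.Database At I J → HGraph (HL.Formula Pr) k
  | .form A => HGraph.handle (τ.mu A)
  | .pair i P Q => (τ.bin i).compose (htree P) (htree Q)
  | .bracket j P => (τ.un j).compose (htree P)

/-- The labels from which translated antecedents are built: translations of formulas, and the
primitive formulas which represent modes and modalities. -/
inductive IsLabel : ∀ {n : ℕ}, HL.Formula Pr n → Prop
  | form (A : NLM.Formula At I J) (X : HL.Formula Pr k) (h : HL.Formula.Iso X (τ.mu A)) : IsLabel X
  | bin (i : I) (n : ℕ) (e : (τ.bin i).base.E n) : IsLabel (.prim ((τ.bin i).base.lab n e))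
  | un (j : J) (n : ℕ) (e : (τ.un j).base.E n) : IsLabel (.prim ((τ.un j).base.lab n e))

/-- The translation embeds the multimodal calculus with commutative modes `C` and associative modes
`A` into the hypergraph Lambek calculus. -/
def Embeds (C A : Set I) : Prop :=
  (∀ (P : NLM.Database At I J) (T : NLM.Formula At I J),
    NLM.Derivable C A P T → HL.Derivable (τ.htree P) (τ.mu T)) ∧
  (∀ (P : NLM.Database At I J) (T : NLM.Formula At I J),
    HL.Derivable (τ.htree P) (τ.mu T) → NLM.Derivable C A P T) ∧
  (∀ (G : HGraph (HL.Formula Pr) k) (X : HL.Formula Pr k),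
    (∀ n (e : G.E n), τ.IsLabel (G.lab n e)) → (∃ T, HL.Formula.Iso X (τ.mu T)) →
    HL.Derivable G X →
    ∃ (P : NLM.Database At I J) (T : NLM.Formula At I J),
      HL.GraphIso G (τ.htree P) ∧ HL.Formula.Iso X (τ.mu T) ∧ NLM.Derivable C A P T)

end Translation

section Bar

variable {Pr : ℕ → Type x}

/-- The tree-like hypergraph for a mode that is neither commutative nor associative. -/
def barR (p : Pr 6) : BinGadget Pr 2 where
  base := (HGraph.discrete 6 ![0, 1]).addEdge (id : Fin 6 → Fin 6) p
  left := (![2, 3] : Fin 2 → Fin 6)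
  right := (![4, 5] : Fin 2 → Fin 6)

/-- The hypergraph (parallel composition) for a commutative mode. -/
def barK (p : Pr 4) : BinGadget Pr 2 where
  base := (HGraph.discrete 4 ![0, 1]).addEdge (id : Fin 4 → Fin 4) p
  left := (![2, 3] : Fin 2 → Fin 4)
  right := (![2, 3] : Fin 2 → Fin 4)

/-- The hypergraph for a modality. -/
def barU (p : Pr 4) : UnGadget Pr 2 where
  base := (HGraph.discrete 4 ![0, 1]).addEdge (id : Fin 4 → Fin 4) p
  slot := (![2, 3] : Fin 2 → Fin 4)

/-- The hypergraph (series composition) for the associative, non-commutative mode. -/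
def barO (p : Pr 1) : BinGadget Pr 2 where
  base := (HGraph.discrete 3 ![0, 2]).addEdge (![1] : Fin 1 → Fin 3) p
  left := (![0, 1] : Fin 2 → Fin 3)
  right := (![1, 2] : Fin 2 → Fin 3)

open Classical in
/-- The rank-2 translation in which modes and modalities are represented by pairwise distinct
primitive formulas, given by `tree`, `quad` and `assoc`. -/
noncomputable def barTranslation {At : Type u} {I : Type v} {J : Type w} (C A : Set I)
    (atom : At ↪ Pr 2) (tree : {i : I // i ∉ C ∧ i ∉ A} ↪ Pr 6)
    (quad : {i : I // i ∈ C} ⊕ J ↪ Pr 4) (assoc : {i : I // i ∈ A} ↪ Pr 1) :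
    Translation At I J Pr 2 where
  atom := atom
  bin := fun i =>
    if hC : i ∈ C then barK (quad (Sum.inl ⟨i, hC⟩))
    else if hA : i ∈ A then barO (assoc ⟨i, hA⟩)
    else barR (tree ⟨i, hC, hA⟩)
  un := fun j => barU (quad (Sum.inr j))

end Bar

/-! ### Isomorphism of formulas and of hypergraphs. -/

namespace HL

variable {Pr : ℕ → Type x}

/-! Soundness is a rule-by-rule simulation: each logical rule of the multimodal calculus is an
instance of a rule of the hypergraph calculus, and the structural rules disappear because both sides
of such a rule have isomorphic hypergraphs. For the converse, the absence of cut confines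
derivations: if the labels of a sequent are translated formulas or mode labels, the same holds for
all premises, and since mode labels do not have rank `k`, a sequent with a mode label on the right
can only be an axiom (`claim_of_derivable`). What remains is the restricted calculus `Rest`. By
induction on it, every derivable antecedent is the hypergraph of some database `W` from which the
succedent is derivable (`Parses.exists_tree`).

The difficulty is readability up to structural rules. If the hypergraph of `W` contains a copy of a
gadget with two labelled slots, then `W` must be convertible, by the rules of the modes, to a
database in which the two formulas stand next to each other in that mode; this is needed for the
product on the left. If the hypergraph of `W` is a gadget with one labelled slot and some graph in
the other, that graph must be the hypergraph of a database; this is needed for the divisions on the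
right. The structure `Parses` collects these demands.

To verify them, a hypergraph is replaced by the multiset of its facts, one per hyperedge: the label
up to isomorphism together with the tuple of node names. `Tree W t S` says that `S` can be read as
`W` with external points `t`. Nothing is lost, because in all graphs that occur each node is either
external, once, or sits at exactly one output port of exactly one hyperedge (`Gen`). So a naming of
nodes that is bijective on facts is an isomorphism (`Gen.iso_of_facts`), and the points of a tree
are pairwise distinct (`Gen.nodup`). Distinct labels then identify the mode, and the privacy of the
inner nodes of a gadget forces the contents of its slots to be what they should be.

The map `mu` is not injective: if `c` is commutative, the two orders of a product, and the two
divisions, have isomorphic translations. These are the only coincidences (`FEq`,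
`kindTranslation_injective`), and derivability is invariant under them (`Derivable.of_refines`). The
latter lemma also contains the invertibility of the left rules for products and diamonds. This
yields faithfulness: collapse the antecedent to a single formula, read the resulting one-leaf
hypergraph, and expand again.

For part (b) with a mode that is associative and commutative, series composition is replaced by
parallel composition: two edges on the external nodes and a label of rank 0 (`parGadget`). The
gadget `barK` of the other commutative modes must then change as well, because its slots share both
nodes and a parallel composition in one slot could be redistributed over the two slots. In
`symGadget` the slots share only the source; their targets are tied to the mode label by two equal
arms. Both translations are instances of `kindTranslation`, and `KindSpec` states what is needed of
the choice of gadgets. -/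

theorem Formula.times_injective {k : ℕ} {M M' : HGraph (Formula Pr) k}
    (h : Formula.times M = Formula.times M') : M = M' := by
  cases M; cases M'
  simp only [Formula.times, Formula.mkTimes.injEq] at h
  obtain ⟨rfl, rfl, h1, h2, h3⟩ := h
  cases h1; cases h2; cases h3
  rfl

theorem Formula.div_injective {k k' d : ℕ} {N : Formula Pr k} {N' : Formula Pr k'}
    {D : HoleGraph (Formula Pr) k d} {D' : HoleGraph (Formula Pr) k' d}
    (h : Formula.div N D = Formula.div N' D') : ∃ e : k = k', e ▸ N = N' ∧ e ▸ D = D' := by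
  rcases D with ⟨D, hole⟩
  rcases D' with ⟨D', hole'⟩
  cases D; cases D'
  simp only [Formula.div, Formula.mkDiv.injEq] at h
  obtain ⟨rfl, h0, rfl, rfl, h1, h2, h3, h4⟩ := h
  cases h0; cases h1; cases h2; cases h3; cases h4
  exact ⟨rfl, rfl, rfl⟩

/-- Isomorphism of graphs with a hole. -/
def HoleIso {k d : ℕ} (D D' : HoleGraph (Formula Pr) k d) : Prop :=
  ∃ (f : D.V ≃ D'.V) (g : ∀ n, D.E n ≃ D'.E n),
    (∀ n e i, f (D.att n e i) = D'.att n (g n e) i) ∧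
    (∀ n e, Formula.Iso (D.lab n e) (D'.lab n (g n e))) ∧
    (∀ i, f (D.ext i) = D'.ext i) ∧ (∀ i, f (D.hole i) = D'.hole i)

theorem Formula.Iso.refl {n : ℕ} (X : Formula Pr n) : Formula.Iso X X := by
  induction X with
  | prim p => exact .prim p
  | mkTimes V E att lab ext finV finE ih =>
    exact .times ⟨V, E, att, lab, ext, finV, finE⟩ ⟨V, E, att, lab, ext, finV, finE⟩
      (Equiv.refl _) (fun _ => Equiv.refl _) (fun _ _ _ => rfl) (fun n e => ih n e)
      (fun _ => rfl)
  | mkDiv N V E att lab ext finV finE hole ihN ih =>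
    exact .div N N ihN ⟨⟨V, E, att, lab, ext, finV, finE⟩, hole⟩
      ⟨⟨V, E, att, lab, ext, finV, finE⟩, hole⟩
      (Equiv.refl _) (fun _ => Equiv.refl _) (fun _ _ _ => rfl) (fun n e => ih n e)
      (fun _ => rfl) (fun _ => rfl)

theorem Formula.Iso.symm {n : ℕ} {X Y : Formula Pr n} (h : Formula.Iso X Y) :
    Formula.Iso Y X := by
  induction h with
  | prim p => exact .prim p
  | times M M' f g hatt _ hext ih =>
    refine .times M' M f.symm (fun n => (g n).symm) ?_ ?_ ?_
    · intro n e i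
      rw [Equiv.symm_apply_eq, hatt, Equiv.apply_symm_apply]
    · intro n e
      simpa using ih n ((g n).symm e)
    · intro i
      rw [Equiv.symm_apply_eq, hext]
  | div N N' _ D D' f g hatt _ hext hhole ihN ih =>
    refine .div N' N ihN D' D f.symm (fun n => (g n).symm) ?_ ?_ ?_ ?_
    · intro n e i
      rw [Equiv.symm_apply_eq, hatt, Equiv.apply_symm_apply]
    · intro n e
      simpa using ih n ((g n).symm e)
    · intro i
      rw [Equiv.symm_apply_eq, hext]
    · intro i
      rw [Equiv.symm_apply_eq, hhole]

theorem Formula.Iso.eq_of_prim {n : ℕ} {p : Pr n} {Y : Formula Pr n}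
    (h : Formula.Iso (.prim p) Y) : Y = .prim p := by
  generalize hX : Formula.prim p = X at h
  cases h with
  | prim q => rfl
  | times M M' => cases hX
  | div N N' _ D D' => cases hX

theorem Formula.Iso.exists_of_times {k : ℕ} {M : HGraph (Formula Pr) k} {Y : Formula Pr k}
    (h : Formula.Iso (.times M) Y) : ∃ M', Y = .times M' ∧ GraphIso M M' := by
  -- `times` and `div` are functions rather than constructors, so the index is generalized and its
  -- components are recovered by injectivity.
  generalize hX : Formula.times M = X at h
  cases h with
  | prim q => cases hX
  | times M₁ M' f g h1 h2 h3 =>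
    obtain rfl := Formula.times_injective hX
    exact ⟨M', rfl, f, g, h1, h2, h3⟩
  | div N N' _ D D' => cases hX

theorem Formula.Iso.exists_of_div {k d : ℕ} {N : Formula Pr k} {D : HoleGraph (Formula Pr) k d}
    {Y : Formula Pr d} (h : Formula.Iso (.div N D) Y) :
    ∃ N' D', Y = .div (k := k) N' D' ∧ Formula.Iso N N' ∧ HoleIso D D' := by
  generalize hX : Formula.div N D = X at h
  cases h with
  | prim q => cases hX
  | times M₁ M' f g h1 h2 h3 => cases hX
  | div N₁ N' hN D₁ D' f g h1 h2 h3 h4 =>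
    obtain ⟨rfl, h⟩ := Formula.div_injective hX
    obtain ⟨rfl, rfl⟩ : N = N₁ ∧ D = D₁ := h
    exact ⟨N', D', rfl, hN, f, g, h1, h2, h3, h4⟩

theorem Formula.Iso.trans {n : ℕ} {X Y Z : Formula Pr n} (h : Formula.Iso X Y)
    (h' : Formula.Iso Y Z) : Formula.Iso X Z := by
  induction h with
  | prim p => exact h'
  | times M M' f g hatt _ hext ih =>
    obtain ⟨M'', rfl, f', g', h1, h2, h3⟩ := h'.exists_of_times
    refine .times M M'' (f.trans f') (fun n => (g n).trans (g' n)) ?_ ?_ ?_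
    · intro n e i
      simp [hatt, h1]
    · intro n e
      exact ih n e (h2 _ _)
    · intro i
      simp [hext, h3]
  | div N N' _ D D' f g hatt _ hext hhole ihN ih =>
    obtain ⟨N'', D'', rfl, hN, f', g', h1, h2, h3, h4⟩ := h'.exists_of_div
    refine .div N N'' (ihN hN) D D'' (f.trans f') (fun n => (g n).trans (g' n)) ?_ ?_ ?_ ?_
    · intro n e i
      simp [hatt, h1]
    · intro n e
      exact ih n e (h2 _ _)
    · intro i
      simp [hext, h3]
    · intro i
      simp [hhole, h4]

theorem GraphIso.times {k : ℕ} {M M' : HGraph (Formula Pr) k} (h : GraphIso M M') :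
    Formula.Iso (.times M) (.times M') := by
  obtain ⟨f, g, h1, h2, h3⟩ := h
  exact .times M M' f g h1 h2 h3

theorem HoleIso.div {k d : ℕ} {N N' : Formula Pr k} {D D' : HoleGraph (Formula Pr) k d}
    (hN : Formula.Iso N N') (h : HoleIso D D') : Formula.Iso (.div N D) (.div N' D') := by
  obtain ⟨f, g, h1, h2, h3, h4⟩ := h
  exact .div N N' hN D D' f g h1 h2 h3 h4

theorem GraphIso.refl {k : ℕ} (G : HGraph (Formula Pr) k) : GraphIso G G :=
  ⟨Equiv.refl _, fun _ => Equiv.refl _, fun _ _ _ => rfl, fun _ _ => .refl _, fun _ => rfl⟩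

theorem GraphIso.symm {k : ℕ} {G G' : HGraph (Formula Pr) k} (h : GraphIso G G') :
    GraphIso G' G := by
  obtain ⟨f, g, h1, h2, h3⟩ := h
  refine ⟨f.symm, fun n => (g n).symm, ?_, ?_, ?_⟩
  · intro n e i
    rw [Equiv.symm_apply_eq, h1, Equiv.apply_symm_apply]
  · intro n e
    simpa using (h2 n ((g n).symm e)).symm
  · intro i
    rw [Equiv.symm_apply_eq, h3]

theorem GraphIso.trans {k : ℕ} {G G' G'' : HGraph (Formula Pr) k} (h : GraphIso G G')
    (h' : GraphIso G' G'') : GraphIso G G'' := by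
  obtain ⟨f, g, h1, h2, h3⟩ := h
  obtain ⟨f', g', h1', h2', h3'⟩ := h'
  refine ⟨f.trans f', fun n => (g n).trans (g' n), ?_, ?_, ?_⟩
  · intro n e i
    simp [h1, h1']
  · intro n e
    exact (h2 n e).trans (h2' _ _)
  · intro i
    simp [h3, h3']

theorem GraphIso.of_eq {k : ℕ} {G G' : HGraph (Formula Pr) k} (h : G = G') : GraphIso G G' :=
  h ▸ .refl G

/-- Changing labels up to isomorphism. -/
theorem GraphIso.addEdge {k d : ℕ} {G G' : HGraph (Formula Pr) k} {f : G.V ≃ G'.V}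
    {g : ∀ n, G.E n ≃ G'.E n}
    (h1 : ∀ n e i, f (G.att n e i) = G'.att n (g n e) i)
    (h2 : ∀ n e, Formula.Iso (G.lab n e) (G'.lab n (g n e)))
    (h3 : ∀ i, f (G.ext i) = G'.ext i) {pos : Fin d → G.V} {pos' : Fin d → G'.V}
    (h4 : ∀ i, f (pos i) = pos' i)
    {a a' : Formula Pr d} (ha : Formula.Iso a a') :
    GraphIso (G.addEdge pos a) (G'.addEdge pos' a') := by
  refine ⟨f, fun n => Equiv.sumCongr (g n) (Equiv.refl _), ?_, ?_, h3⟩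
  · rintro n (e | e) i
    · exact h1 n e i
    · cases e
      exact h4 i
  · rintro n (e | e)
    · exact h2 n e
    · cases e
      exact ha

theorem GraphIso.handle {k : ℕ} {a a' : Formula Pr k} (ha : Formula.Iso a a') :
    GraphIso (HGraph.handle a) (HGraph.handle a') :=
  GraphIso.addEdge (G := HGraph.discrete k id) (G' := HGraph.discrete k id) (f := Equiv.refl _)
    (g := fun _ => Equiv.refl _) (fun _ _ _ => rfl) (fun _ e => Empty.elim e) (fun _ => rfl)
    (fun _ => rfl) ha

end HL

/-! ### Hyperedge replacement respects isomorphism. -/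

namespace HGraph

variable {L : ℕ → Type u} {L' : ℕ → Type v} {L₁ : ℕ → Type w} {k : ℕ}

/-- The bijection between all hyperedges given by bijections for every rank. -/
def edgeEquiv {G : HGraph L k} {G' : HGraph L' k} (g : ∀ n, G.E n ≃ G'.E n) : G.Edge ≃ G'.Edge :=
  Equiv.sigmaCongrRight g

/-- The bijections of the pieces form a bijection of the disjoint unions that preserves and reflects
the gluing relation, hence descend to the quotients. The labels of `G` and `G'` play no role and may
even have different types, which allows comparing graphs whose hyperedges are to be replaced in
different descriptions. -/
theorem subst_congr {R : ∀ n, L₁ n → L₁ n → Prop} {G : HGraph L k} {G' : HGraph L' k}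
    {H : ∀ y : G.Edge, HGraph L₁ y.1} {H' : ∀ y : G'.Edge, HGraph L₁ y.1}
    (f : G.V ≃ G'.V) (g : ∀ n, G.E n ≃ G'.E n)
    (hatt : ∀ n e i, f (G.att n e i) = G'.att n (g n e) i) (hext : ∀ i, f (G.ext i) = G'.ext i)
    (hH : ∀ y : G.Edge, IsoBy R (H y) (H' ⟨y.1, g y.1 y.2⟩)) :
    IsoBy R (G.subst H) (G'.subst H') := by
  choose fy gy h1 h2 h3 using hH
  let φ : (G.V ⊕ Σ y, (H y).V) ≃ (G'.V ⊕ Σ y, (H' y).V) :=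
    Equiv.sumCongr f (Equiv.sigmaCongr (edgeEquiv g) fy)
  have hφ : ∀ y i, φ (Sum.inr ⟨y, (H y).ext i⟩) =
      Sum.inr ⟨edgeEquiv g y, (H' (edgeEquiv g y)).ext i⟩ := by
    intro y i
    change Sum.inr (⟨_, fy y ((H y).ext i)⟩ : Σ y, (H' y).V) = _
    rw [h3]
    rfl
  have hφ' : ∀ (y : G.Edge) i, φ (Sum.inl (G.att y.1 y.2 i)) =
      Sum.inl (G'.att (edgeEquiv g y).1 (edgeEquiv g y).2 i) := by
    intro y i
    exact congrArg Sum.inl (hatt _ _ _)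
  have hiff : ∀ a b, Glue G.att (fun y => (H y).ext) a b ↔
      Glue G'.att (fun y => (H' y).ext) (φ a) (φ b) := by
    intro a b
    constructor
    · rintro ⟨y, i⟩
      rw [hφ, hφ']
      exact ⟨edgeEquiv g y, i⟩
    · intro h
      generalize ha : φ a = a' at h
      generalize hb : φ b = b' at h
      obtain ⟨y', i⟩ := h
      obtain ⟨y, rfl⟩ := (edgeEquiv g).surjective y'
      have e1 := (hφ' y i).trans ha.symm
      have e2 := (hφ y i).trans hb.symm
      rw [← φ.injective e1, ← φ.injective e2]
      exact ⟨y, i⟩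
  refine ⟨Quot.congr φ hiff, fun n => Equiv.sigmaCongr (edgeEquiv g) fun y => gy y n, ?_, ?_, ?_⟩
  · rintro n ⟨y, e⟩ i
    refine congrArg (Quot.mk _) ?_
    change Sum.inr (⟨_, fy y _⟩ : Σ y, (H' y).V) = _
    rw [h1]
    rfl
  · rintro n ⟨y, e⟩
    exact h2 y n e
  · intro i
    exact congrArg (Quot.mk _) (congrArg Sum.inl (hext i))

end HGraph

/-! ### Filling the slots of a hypergraph, as a pushout. -/

namespace HL

variable {Pr : ℕ → Type x} {k d : ℕ}

/-- The result of filling several holes, all of rank `d`, of the graph `B`. -/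
structure IsFill (B : HGraph (Formula Pr) k) {ι : Type} (slot : ι → Fin d → B.V)
    (Z : ι → HGraph (Formula Pr) d) (T : HGraph (Formula Pr) k) where
  inl : B.V → T.V
  inr : ∀ s, (Z s).V → T.V
  glue : ∀ s i, inl (slot s i) = inr s ((Z s).ext i)
  ext : ∀ i, T.ext i = inl (B.ext i)
  -- `desc` and `hom_ext` are the existence and uniqueness halves of the universal property of a
  -- pushout. Arguments about nodes can rest on them instead of on the quotient.
  desc : ∀ {P : Type} (ν₀ : B.V → P) (ν₁ : ∀ s, (Z s).V → P),
    (∀ s i, ν₀ (slot s i) = ν₁ s ((Z s).ext i)) →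
    ∃ ν : T.V → P, (∀ v, ν (inl v) = ν₀ v) ∧ ∀ s v, ν (inr s v) = ν₁ s v
  hom_ext : ∀ {P : Type} (ν ν' : T.V → P), (∀ v, ν (inl v) = ν' (inl v)) →
    (∀ s v, ν (inr s v) = ν' (inr s v)) → ν = ν'
  edge : ∀ n, T.E n ≃ B.E n ⊕ Σ s, (Z s).E n
  lab_inl : ∀ n e, T.lab n ((edge n).symm (Sum.inl e)) = B.lab n e
  lab_inr : ∀ n s e, T.lab n ((edge n).symm (Sum.inr ⟨s, e⟩)) = (Z s).lab n e
  att_inl : ∀ n e i, T.att n ((edge n).symm (Sum.inl e)) i = inl (B.att n e i)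
  att_inr : ∀ n s e i, T.att n ((edge n).symm (Sum.inr ⟨s, e⟩)) i = inr s ((Z s).att n e i)

instance (ι : Type) [Finite ι] (d : ℕ) (E : ℕ → Type) [Finite (Σ n, E n)] :
    Finite (Σ n, (E n ⊕ ι × OneEdge d n)) := by
  have : Finite (Σ n, ι × OneEdge d n) :=
    Finite.of_injective (fun y : Σ n, ι × OneEdge d n => (y.2.1, (⟨y.1, y.2.2⟩ : Σ n, OneEdge d n)))
      (by
        rintro ⟨n, s, o⟩ ⟨m, s', o'⟩ h
        cases o; cases o'
        simp only [Prod.mk.injEq] at h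
        rw [h.1])
  exact Finite.of_equiv _ (Equiv.sigmaSumDistrib E fun n => ι × OneEdge d n).symm

/-- The graph whose hyperedges are labelled by handles, except for the slots. -/
def multi (B : HGraph (Formula Pr) k) {ι : Type} [Finite ι] (slot : ι → Fin d → B.V)
    (Z : ι → HGraph (Formula Pr) d) : HGraph (fun n => HGraph (Formula Pr) n) k where
  V := B.V
  E := fun n => B.E n ⊕ ι × OneEdge d n
  att := fun n => Sum.elim (B.att n)
    (fun p => OneEdge.elim (L := fun n => Fin n → B.V) (slot p.1) p.2)
  lab := fun n => Sum.elim (fun e => HGraph.handle (B.lab n e))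
    (fun p => OneEdge.elim (L := fun n => HGraph (Formula Pr) n) (Z p.1) p.2)
  ext := B.ext
  finV := B.finV
  finE := by
    have := B.finE
    infer_instance

/-- `multi.join` fills all slots. -/
def multiIsFill (B : HGraph (Formula Pr) k) {ι : Type} [Finite ι] (slot : ι → Fin d → B.V)
    (Z : ι → HGraph (Formula Pr) d) : IsFill B slot Z (multi B slot Z).join where
  inl := fun v => Quot.mk _ (Sum.inl v)
  inr := fun s v => Quot.mk _ (Sum.inr ⟨⟨d, Sum.inr (s, .mk)⟩, v⟩)
  glue := fun s i => Quot.sound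
    (HGraph.Glue.mk (att := (multi B slot Z).att) (⟨d, Sum.inr (s, .mk)⟩ : (multi B slot Z).Edge) i)
  ext := fun _ => rfl
  desc := by
    intro P ν₀ ν₁ h
    -- A node of the handle that stands for an ordinary hyperedge goes where the attachment node
    -- glued to it goes.
    let F : ((multi B slot Z).V ⊕ Σ y : (multi B slot Z).Edge, ((multi B slot Z).lab y.1 y.2).V)
        → P := fun a => match a with
      | Sum.inl v => ν₀ v
      | Sum.inr ⟨⟨n, Sum.inl e⟩, i⟩ => ν₀ (B.att n e i)
      | Sum.inr ⟨⟨_, Sum.inr (s, .mk)⟩, v⟩ => ν₁ s v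
    refine ⟨Quot.lift F ?_, fun _ => rfl, fun _ _ => rfl⟩
    rintro _ _ ⟨⟨n, e | ⟨s, o⟩⟩, i⟩
    · rfl
    · cases o
      exact h s i
  hom_ext := by
    intro P ν ν' h0 h1
    funext q
    induction q using Quot.ind with | _ a
    rcases a with v | ⟨⟨n, e | ⟨s, o⟩⟩, v⟩
    · exact h0 v
    · have hs : (Quot.mk _ (Sum.inr ⟨⟨n, Sum.inl e⟩, v⟩) : (multi B slot Z).join.V) =
          Quot.mk _ (Sum.inl (B.att n e v)) :=
        (Quot.sound (HGraph.Glue.mk (att := (multi B slot Z).att)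
          (⟨n, Sum.inl e⟩ : (multi B slot Z).Edge) v)).symm
      rw [hs]
      exact h0 _
    · cases o
      exact h1 s v
  edge := fun n =>
    { toFun := fun e => match e with
        | ⟨⟨_, Sum.inl e⟩, Sum.inr .mk⟩ => Sum.inl e
        | ⟨⟨_, Sum.inr (s, .mk)⟩, e⟩ => Sum.inr ⟨s, e⟩
      invFun := fun e => match e with
        | Sum.inl e => ⟨⟨n, Sum.inl e⟩, Sum.inr .mk⟩
        | Sum.inr ⟨s, e⟩ => ⟨⟨d, Sum.inr (s, .mk)⟩, e⟩
      left_inv := by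
        rintro ⟨⟨m, e | ⟨s, o⟩⟩, e'⟩
        · rcases e' with e' | e'
          · exact Empty.elim e'
          · cases e'
            rfl
        · cases o
          rfl
      right_inv := by
        rintro (e | ⟨s, e⟩) <;> rfl }
  lab_inl := fun _ _ => rfl
  lab_inr := fun _ _ _ => rfl
  att_inl := fun n e i => (Quot.sound (HGraph.Glue.mk (att := (multi B slot Z).att)
    (⟨n, Sum.inl e⟩ : (multi B slot Z).Edge) i)).symm
  att_inr := fun _ _ _ _ => rfl

/-- Filling slots is invariant under isomorphism with equal labels. -/
theorem IsFill.congr {B : HGraph (Formula Pr) k} {ι : Type} {slot : ι → Fin d → B.V}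
    {Z : ι → HGraph (Formula Pr) d} {T T' : HGraph (Formula Pr) k} (F : IsFill B slot Z T)
    (h : HGraph.IsoBy (fun _ => Eq) T T') : Nonempty (IsFill B slot Z T') := by
  obtain ⟨f, g, h1, h2, h3⟩ := h
  refine ⟨{
    inl := fun v => f (F.inl v)
    inr := fun s v => f (F.inr s v)
    glue := fun s i => congrArg f (F.glue s i)
    ext := fun i => by rw [← h3, F.ext]
    desc := ?_
    hom_ext := ?_
    edge := fun n => (g n).symm.trans (F.edge n)
    lab_inl := fun n e => by rw [← F.lab_inl, h2]; rfl
    lab_inr := fun n s e => by rw [← F.lab_inr, h2]; rfl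
    att_inl := fun n e i => by rw [← F.att_inl, h1]; rfl
    att_inr := fun n s e i => by rw [← F.att_inr, h1]; rfl }⟩
  · intro P ν₀ ν₁ h
    obtain ⟨ν, ha, hb⟩ := F.desc ν₀ ν₁ h
    exact ⟨fun v => ν (f.symm v), by simpa using ha, by simpa using hb⟩
  · intro P ν ν' ha hb
    have := F.hom_ext (fun v => ν (f v)) (fun v => ν' (f v)) ha hb
    funext v
    simpa using congrFun this (f.symm v)

/-- The hole of `K` is replaced by `Z`; all other hyperedges remain. -/
abbrev plug (K : HoleGraph (Formula Pr) k d) (Z : HGraph (Formula Pr) d) :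
    HGraph (Formula Pr) k :=
  K.fill Z fun y => HGraph.handle (K.lab y.1 y.2)

theorem plug_isFill (K : HoleGraph (Formula Pr) k d) (Z : HGraph (Formula Pr) d) :
    Nonempty (IsFill K.toHGraph (fun _ : Unit => K.hole) (fun _ => Z) (plug K Z)) := by
  refine (multiIsFill K.toHGraph (fun _ : Unit => K.hole) (fun _ => Z)).congr ?_
  refine HGraph.subst_congr (Equiv.refl _)
    (fun n => Equiv.sumCongr (Equiv.refl _) (Equiv.uniqueProd _ Unit)) ?_ (fun _ => rfl) ?_
  · rintro n (e | ⟨s, o⟩) i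
    · rfl
    · rfl
  · rintro ⟨n, e | ⟨s, o⟩⟩
    · exact ⟨Equiv.refl _, fun _ => Equiv.refl _, fun _ _ _ => rfl, fun _ _ => rfl, fun _ => rfl⟩
    · cases o
      exact ⟨Equiv.refl _, fun _ => Equiv.refl _, fun _ _ _ => rfl, fun _ _ => rfl, fun _ => rfl⟩

end HL

namespace BinGadget

open HL

variable {Pr : ℕ → Type x} {k : ℕ} (R : BinGadget Pr k)

/-- The part of a gadget that consists of primitive labels. -/
def prims : HGraph (HL.Formula Pr) k :=
  R.base.relabel fun y => HL.Formula.prim (R.base.lab y.1 y.2)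

/-- The two slots. -/
def slot : Bool → Fin k → R.prims.V
  | false => R.left
  | true => R.right

theorem compose_isFill (G H : HGraph (HL.Formula Pr) k) :
    Nonempty (IsFill R.prims R.slot (fun s => cond s H G) (R.compose G H)) := by
  refine (multiIsFill R.prims R.slot (fun s => cond s H G)).congr ?_
  refine HGraph.subst_congr (Equiv.refl _) (fun n =>
    { toFun := fun e => match e with
        | Sum.inl e => Sum.inl (Sum.inl e)
        | Sum.inr (false, o) => Sum.inl (Sum.inr o)
        | Sum.inr (true, o) => Sum.inr o
      invFun := fun e => match e with
        | Sum.inl (Sum.inl e) => Sum.inl e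
        | Sum.inl (Sum.inr o) => Sum.inr (false, o)
        | Sum.inr o => Sum.inr (true, o)
      left_inv := by rintro (e | ⟨_ | _, o⟩) <;> rfl
      right_inv := by rintro ((e | o) | o) <;> rfl }) ?_ (fun _ => rfl) ?_
  · rintro n (e | ⟨_ | _, o⟩) i <;> rfl
  · rintro ⟨n, e | ⟨_ | _, o⟩⟩
    · exact ⟨Equiv.refl _, fun _ => Equiv.refl _, fun _ _ _ => rfl, fun _ _ => rfl, fun _ => rfl⟩
    · cases o
      exact ⟨Equiv.refl _, fun _ => Equiv.refl _, fun _ _ _ => rfl, fun _ _ => rfl, fun _ => rfl⟩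
    · cases o
      exact ⟨Equiv.refl _, fun _ => Equiv.refl _, fun _ _ _ => rfl, fun _ _ => rfl, fun _ => rfl⟩

end BinGadget

namespace UnGadget

open HL

variable {Pr : ℕ → Type x} {k : ℕ} (U : UnGadget Pr k)

/-- The part of a gadget that consists of primitive labels. -/
def prims : HGraph (HL.Formula Pr) k :=
  U.base.relabel fun y => HL.Formula.prim (U.base.lab y.1 y.2)

theorem compose_isFill (G : HGraph (HL.Formula Pr) k) :
    Nonempty (IsFill U.prims (fun _ : Unit => U.slot) (fun _ => G) (U.compose G)) :=
  plug_isFill U.holeGraph G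

end UnGadget

/-! ### Replacing a hyperedge as plugging a hole. -/

namespace HL

variable {Pr : ℕ → Type x} {k d : ℕ}

open Classical in
/-- Removing a hyperedge leaves a hole. -/
def remove (H : HGraph (Formula Pr) k) (e : H.Edge) : HoleGraph (Formula Pr) k e.1 where
  V := H.V
  E := fun n => {e' : H.E n // (⟨n, e'⟩ : H.Edge) ≠ e}
  att := fun n e' => H.att n e'.1
  lab := fun n e' => H.lab n e'.1
  ext := H.ext
  finV := H.finV
  finE := by
    have := H.finE
    refine Finite.of_injective
      (fun y : Σ n, {e' : H.E n // (⟨n, e'⟩ : H.Edge) ≠ e} => (⟨y.1, y.2.1⟩ : H.Edge)) ?_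
    rintro ⟨n, e1, h1⟩ ⟨m, e2, h2⟩ h
    simp only [Sigma.mk.injEq] at h
    obtain ⟨rfl, h⟩ := h
    cases h
    rfl
  hole := H.att e.1 e.2

open Classical in
/-- A hyperedge is either the removed one or remains. -/
noncomputable def removeEquiv {E : ℕ → Type} {m : ℕ} (e : E m) (n : ℕ) :
    E n ≃ {e' : E n // (⟨n, e'⟩ : Σ n, E n) ≠ ⟨m, e⟩} ⊕ OneEdge m n where
  toFun e' := if h : (⟨n, e'⟩ : Σ n, E n) = ⟨m, e⟩ then
    Sum.inr (by cases h; exact OneEdge.mk) else Sum.inl ⟨e', h⟩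
  invFun := Sum.elim (fun e' => e'.1) (fun o => OneEdge.elim (L := E) e o)
  left_inv e' := by
    by_cases h : (⟨n, e'⟩ : Σ n, E n) = ⟨m, e⟩
    · cases h
      simp [OneEdge.elim]
    · change Sum.elim _ _ (dite _ _ _) = e'
      rw [dif_neg h]
      rfl
  right_inv := by
    rintro (⟨e', h⟩ | o)
    · exact dif_neg h
    · cases o
      exact dif_pos rfl

/-- The rules of the calculus speak of `replace`, for which the label of the replaced hyperedge is
irrelevant. Deleting that hyperedge brings every such antecedent into the form `plug`. -/
theorem replace_iso_plug (H : HGraph (Formula Pr) k) (e : H.Edge) (Z : HGraph (Formula Pr) e.1) :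
    GraphIso (H.replace e Z) (plug (remove H e) Z) := by
  classical
  rcases e with ⟨m, e⟩
  refine GraphIso.symm (HGraph.subst_congr (Equiv.refl _) (fun n => (removeEquiv e n).symm) ?_
    (fun _ => rfl) ?_)
  · rintro n (⟨e', h⟩ | o) i
    · rfl
    · cases o
      rfl
  · rintro ⟨n, ⟨e', h⟩ | o⟩
    · have := Function.update_of_ne h Z (fun y : H.Edge => HGraph.handle (H.lab y.1 y.2))
      exact GraphIso.of_eq this.symm
    · cases o
      have := Function.update_self (⟨m, e⟩ : H.Edge) Z
        (fun y : H.Edge => HGraph.handle (H.lab y.1 y.2))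
      exact GraphIso.of_eq this.symm

/-- Conversely, closing a hole by a hyperedge with an arbitrary label `a` presents every `plug` as a
`replace`, so that the rules can be applied to it. -/
theorem addEdge_replace_iso_plug (K : HoleGraph (Formula Pr) k d) (a : Formula Pr d)
    (Z : HGraph (Formula Pr) d) :
    GraphIso ((K.toHGraph.addEdge K.hole a).replace ⟨d, Sum.inr .mk⟩ Z) (plug K Z) := by
  classical
  refine HGraph.subst_congr (Equiv.refl _) (fun n => Equiv.refl _) (fun _ _ _ => rfl)
    (fun _ => rfl) ?_
  rintro ⟨n, e | o⟩
  · rw [Function.update_of_ne (by rintro h; cases h)]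
    exact GraphIso.refl _
  · cases o
    rw [Function.update_self]
    exact GraphIso.refl _

theorem plug_congr (K : HoleGraph (Formula Pr) k d) {Z Z' : HGraph (Formula Pr) d}
    (h : GraphIso Z Z') : GraphIso (plug K Z) (plug K Z') := by
  refine HGraph.subst_congr (Equiv.refl _) (fun n => Equiv.refl _) (fun _ _ _ => rfl)
    (fun _ => rfl) ?_
  rintro ⟨n, e | o⟩
  · exact GraphIso.refl _
  · cases o
    exact h

end HL

/-! ### Hyperedges as facts: labels up to isomorphism with tuples of points. -/

namespace HL

variable {Pr : ℕ → Type x} {k d : ℕ}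

/-- Isomorphism of formulas as a setoid. -/
def labSetoid (Pr : ℕ → Type x) (n : ℕ) : Setoid (Formula Pr n) where
  r := Formula.Iso
  iseqv := ⟨Formula.Iso.refl, Formula.Iso.symm, Formula.Iso.trans⟩

/-- Labels up to isomorphism. -/
abbrev Lab (Pr : ℕ → Type x) (n : ℕ) : Type (max 1 x) := Quotient (labSetoid Pr n)

/-- The isomorphism class of a formula. -/
def Formula.cls {n : ℕ} (X : Formula Pr n) : Lab Pr n := Quotient.mk _ X

theorem Formula.cls_eq_iff {n : ℕ} {X Y : Formula Pr n} : X.cls = Y.cls ↔ Formula.Iso X Y :=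
  ⟨fun h => Quotient.exact (s := labSetoid Pr n) h, fun h => Quotient.sound (s := labSetoid Pr n) h⟩

theorem Formula.Iso.cls_eq {n : ℕ} {X Y : Formula Pr n} (h : Formula.Iso X Y) : X.cls = Y.cls :=
  Formula.cls_eq_iff.2 h

/-- A label together with a tuple of points. -/
abbrev Fact (Pr : ℕ → Type x) (P : Type) : Type (max 1 x) := Σ n, Lab Pr n × (Fin n → P)

/-- The constructor of facts. -/
abbrev fact {P : Type} {n : ℕ} (a : Lab Pr n) (t : Fin n → P) : Fact Pr P := ⟨n, a, t⟩

/-- Renaming the points of a fact. -/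
def Fact.map {P Q : Type} (h : P → Q) (f : Fact Pr P) : Fact Pr Q :=
  ⟨f.1, f.2.1, fun i => h (f.2.2 i)⟩

noncomputable instance {L : ℕ → Type u} (G : HGraph L k) : Fintype G.Edge :=
  @Fintype.ofFinite _ G.finE

/-- The fact given by a hyperedge under a naming of the nodes. -/
def factAt {P : Type} (G : HGraph (Formula Pr) k) (ν : G.V → P) (y : G.Edge) : Fact Pr P :=
  fact (G.lab y.1 y.2).cls fun i => ν (G.att y.1 y.2 i)

/-- The multiset of all facts of a graph under a naming of the nodes. -/
noncomputable def facts {P : Type} (G : HGraph (Formula Pr) k) (ν : G.V → P) :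
    Multiset (Fact Pr P) :=
  ∑ y : G.Edge, {factAt G ν y}

theorem facts_map {P Q : Type} (G : HGraph (Formula Pr) k) (ν : G.V → P) (h : P → Q) :
    facts G (fun v => h (ν v)) = (facts G ν).map (Fact.map h) := by
  rw [facts, facts, ← Multiset.coe_mapAddMonoidHom, map_sum]
  simp [Fact.map, factAt]

theorem facts_addEdge {P : Type} (G : HGraph (Formula Pr) k) (pos : Fin d → G.V)
    (a : Formula Pr d) (ν : G.V → P) :
    facts (G.addEdge pos a) ν = facts G ν + {fact a.cls fun i => ν (pos i)} := by
  refine (Fintype.sum_equiv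
    ({ toFun := fun y => match y with
        | ⟨n, Sum.inl y⟩ => Sum.inl ⟨n, y⟩
        | ⟨_, Sum.inr .mk⟩ => Sum.inr ()
       invFun := fun y => match y with
        | Sum.inl ⟨n, y⟩ => ⟨n, Sum.inl y⟩
        | Sum.inr () => ⟨d, Sum.inr .mk⟩
       left_inv := by
        rintro ⟨n, y | y⟩
        · rfl
        · cases y
          rfl
       right_inv := by rintro (y | y) <;> rfl } : (G.addEdge pos a).Edge ≃ G.Edge ⊕ Unit)
    _ (Sum.elim (fun y => {factAt G ν y}) (fun _ => {fact a.cls fun i => ν (pos i)})) ?_).trans ?_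
  · rintro ⟨n, y | y⟩
    · rfl
    · cases y
      rfl
  · rw [Fintype.sum_sum_type]
    simp [facts]

theorem facts_eq_zero {P : Type} (G : HGraph (Formula Pr) k) (ν : G.V → P) [IsEmpty G.Edge] :
    facts G ν = 0 :=
  Finset.sum_eq_zero fun y _ => isEmptyElim y

instance (m : ℕ) (ext : Fin k → Fin m) {L : ℕ → Type u} :
    IsEmpty (HGraph.discrete (L := L) m ext).Edge :=
  ⟨fun e => Empty.elim e.2⟩

theorem facts_handle {P : Type} (a : Formula Pr k) (ν : Fin k → P) :
    facts (HGraph.handle a) ν = {fact a.cls ν} := by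
  refine (facts_addEdge (HGraph.discrete k id) id a ν).trans ?_
  have h0 : facts (HGraph.discrete (L := Formula Pr) k id) ν = 0 := facts_eq_zero _ _
  exact (congrArg (· + _) h0).trans (zero_add _)

/-- The hyperedges of a filled graph are those of its parts, so facts add up. This is what turns the
shape of a hypergraph into a recursion over databases in `Tree`. -/
theorem IsFill.facts {B T : HGraph (Formula Pr) k} {ι : Type} [Fintype ι] {slot : ι → Fin d → B.V}
    {Z : ι → HGraph (Formula Pr) d} (F : IsFill B slot Z T) {P : Type} (ν : T.V → P) :
    facts T ν = HL.facts B (fun v => ν (F.inl v)) +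
      ∑ s, HL.facts (Z s) fun v => ν (F.inr s v) := by
  let c : (Σ n, Σ s, (Z s).E n) ≃ Σ s, (Z s).Edge :=
    ⟨fun y => ⟨y.2.1, y.1, y.2.2⟩, fun y => ⟨y.2.1, y.1, y.2.2⟩, fun _ => rfl, fun _ => rfl⟩
  refine (Fintype.sum_equiv
    ((Equiv.sigmaCongrRight F.edge).trans ((Equiv.sigmaSumDistrib _ _).trans
      (Equiv.sumCongr (Equiv.refl _) c))).symm
    (Sum.elim (fun y : B.Edge => ({factAt B (fun v => ν (F.inl v)) y} : Multiset (Fact Pr P)))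
      (fun y : Σ s, (Z s).Edge => {factAt (Z y.1) (fun v => ν (F.inr y.1 v)) y.2}))
    (fun y : T.Edge => {factAt T ν y}) ?_).symm.trans ?_
  · rintro (⟨n, y⟩ | ⟨s, n, y⟩)
    · refine congrArg (fun f : Fact Pr P => ({f} : Multiset (Fact Pr P))) ?_
      change fact _ _ = fact (T.lab n ((F.edge n).symm (Sum.inl y))).cls
        (fun i => ν (T.att n ((F.edge n).symm (Sum.inl y)) i))
      simp only [F.lab_inl, F.att_inl]
    · refine congrArg (fun f : Fact Pr P => ({f} : Multiset (Fact Pr P))) ?_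
      change fact _ _ = fact (T.lab n ((F.edge n).symm (Sum.inr ⟨s, y⟩))).cls
        (fun i => ν (T.att n ((F.edge n).symm (Sum.inr ⟨s, y⟩)) i))
      simp only [F.lab_inr, F.att_inr]
  · rw [Fintype.sum_sum_type, Fintype.sum_sigma]
    rfl

theorem GraphIso.facts {G G' : HGraph (Formula Pr) k} (h : GraphIso G G') :
    ∃ f : G.V ≃ G'.V, (∀ i, f (G.ext i) = G'.ext i) ∧
      ∀ {P : Type} (ν : G'.V → P), facts G (fun v => ν (f v)) = facts G' ν := by
  obtain ⟨f, g, h1, h2, h3⟩ := h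
  refine ⟨f, h3, fun {P} ν => ?_⟩
  refine Fintype.sum_equiv (HGraph.edgeEquiv g) _ _ ?_
  rintro ⟨n, e⟩
  change {fact _ _} = ({fact (G'.lab n (g n e)).cls (fun i => ν (G'.att n (g n e) i))} :
    Multiset (Fact Pr P))
  simp only [← h1, ← (h2 n e).cls_eq]

/-! ### Generated graphs -/

variable (Out : ∀ n, Fin n → Prop)

/-- Every node of the graph is exactly one of the following: an external node, or the node at an
output port of a hyperedge. -/
def Gen (G : HGraph (Formula Pr) k) : Prop :=
  ∀ (P : Type) (t : Fin k → P) (o : ∀ n, G.E n → Fin n → P),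
    ∃! ν : G.V → P, (∀ i, ν (G.ext i) = t i) ∧
      ∀ n e i, Out n i → ν (G.att n e i) = o n e i

variable {Out}

theorem Gen.iso {G G' : HGraph (Formula Pr) k} (hG : Gen Out G) (h : GraphIso G G') :
    Gen Out G' := by
  obtain ⟨f, g, h1, -, h3⟩ := h
  intro P t o
  obtain ⟨ν, ⟨ha, hb⟩, huniq⟩ := hG P t fun n e => o n (g n e)
  refine ⟨fun v => ν (f.symm v), ⟨?_, ?_⟩, ?_⟩
  · intro i
    simp [← h3, ha]
  · intro n e i hi
    obtain ⟨e, rfl⟩ := (g n).surjective e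
    simp [← h1, hb n e i hi]
  · rintro ν' ⟨ha', hb'⟩
    have := huniq (fun v => ν' (f v)) ⟨fun i => by simp [h3, ha'], fun n e i hi => by
      simp only [h1]; exact hb' n (g n e) i hi⟩
    funext v
    simpa using congrFun this (f.symm v)

theorem Gen.addEdge {G : HGraph (Formula Pr) k} (hG : Gen Out G) (hd : ∀ i : Fin d, ¬ Out d i)
    (pos : Fin d → G.V) (a : Formula Pr d) : Gen Out (G.addEdge pos a) := by
  intro P t o
  obtain ⟨ν, ⟨ha, hb⟩, huniq⟩ := hG P t fun n e => o n (Sum.inl e)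
  refine ⟨ν, ⟨ha, ?_⟩, ?_⟩
  · rintro n (e | e) i hi
    · exact hb n e i hi
    · cases e
      exact absurd hi (hd i)
  · rintro ν' ⟨ha', hb'⟩
    exact huniq ν' ⟨ha', fun n e i hi => hb' n (Sum.inl e) i hi⟩

theorem Gen.discrete : Gen Out (HGraph.discrete (L := Formula Pr) k id) := fun _ t _ =>
  ⟨t, ⟨fun _ => rfl, fun _ e => Empty.elim e⟩, fun _ h => funext h.1⟩

theorem Gen.handle (hk : ∀ i : Fin k, ¬ Out k i) (a : Formula Pr k) :
    Gen Out (HGraph.handle a) :=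
  Gen.addEdge .discrete hk _ _

theorem Gen.ext_injective {G : HGraph (Formula Pr) k} (hG : Gen Out G) :
    Function.Injective G.ext := by
  intro i j h
  obtain ⟨ν, ⟨ha, -⟩, -⟩ := hG (Fin k) id fun _ _ _ => i
  have h1 := ha i
  rw [h, ha j] at h1
  exact h1.symm

section Fill

variable {B T : HGraph (Formula Pr) k} {ι : Type} {slot : ι → Fin d → B.V}
  {Z : ι → HGraph (Formula Pr) d} (F : IsFill B slot Z T)
include F

/-- Since `Gen` is phrased as unique extension of values prescribed at external nodes and output
ports, it composes with the pushout property: extend over `B`, then over each `Z s` with the values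
obtained at the slot. -/
theorem IsFill.gen (hB : Gen Out B) (hZ : ∀ s, Gen Out (Z s)) : Gen Out T := by
  intro P t o
  obtain ⟨ν₀, ⟨ha, hb⟩, hu⟩ := hB P t fun n e => o n ((F.edge n).symm (Sum.inl e))
  have hZ' := fun s => hZ s P (fun i => ν₀ (slot s i))
    fun n e => o n ((F.edge n).symm (Sum.inr ⟨s, e⟩))
  choose ν₁ h1 hu1 using hZ'
  obtain ⟨ν, hν0, hν1⟩ := F.desc ν₀ ν₁ fun s i => ((h1 s).1 i).symm
  refine ⟨ν, ⟨?_, ?_⟩, ?_⟩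
  · intro i
    rw [F.ext, hν0, ha]
  · intro n e i hi
    obtain ⟨e, rfl⟩ := (F.edge n).symm.surjective e
    rcases e with e | ⟨s, e⟩
    · rw [F.att_inl, hν0, hb n e i hi]
    · rw [F.att_inr, hν1, (h1 s).2 n e i hi]
  · rintro ν' ⟨ha', hb'⟩
    have e0 : (fun v => ν' (F.inl v)) = ν₀ := hu _ ⟨fun i => by simp only [← F.ext, ha'],
      fun n e i hi => by simp only [← F.att_inl]; exact hb' _ _ _ hi⟩
    refine F.hom_ext _ _ (fun v => ?_) fun s v => ?_
    · rw [hν0]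
      exact congrFun e0 v
    · rw [hν1]
      refine congrFun (hu1 s (fun v => ν' (F.inr s v)) ⟨fun i => ?_, fun n e i hi => ?_⟩) v
      · simp only [← F.glue]
        exact congrFun e0 _
      · simp only [← F.att_inr]
        exact hb' _ _ _ hi

/-- This serves the left rules, which take one graph out of a context and put another one in. Values
prescribed on `B` are extended to `T` by arbitrary values at the output ports of the `Z s`;
uniqueness on `T` then restricts to `B`. -/
theorem IsFill.gen_base (hk : 0 < k) (hT : Gen Out T) (hZ : ∀ s, Gen Out (Z s)) : Gen Out B := by
  classical
  intro P t o
  -- The default value at the output ports inside the slots; positive rank is used only to have one.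
  have p : P := t ⟨0, hk⟩
  let oT : ∀ n, T.E n → Fin n → P := fun n e =>
    Sum.elim (o n) (fun _ _ => p) (F.edge n e)
  have extend : ∀ ν₀ : B.V → P, (∀ i, ν₀ (B.ext i) = t i) →
      (∀ n e i, Out n i → ν₀ (B.att n e i) = o n e i) →
      ∃ ν : T.V → P, (∀ v, ν (F.inl v) = ν₀ v) ∧ ((∀ i, ν (T.ext i) = t i) ∧
        ∀ n e i, Out n i → ν (T.att n e i) = oT n e i) := by
    intro ν₀ ha hb
    have hZ' := fun s => (hZ s P (fun i => ν₀ (slot s i)) fun n e _ => p).exists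
    choose ν₁ h1 using hZ'
    obtain ⟨ν, hν0, hν1⟩ := F.desc ν₀ ν₁ fun s i => ((h1 s).1 i).symm
    refine ⟨ν, hν0, fun i => by rw [F.ext, hν0, ha], fun n e i hi => ?_⟩
    obtain ⟨e, rfl⟩ := (F.edge n).symm.surjective e
    rcases e with e | ⟨s, e⟩
    · rw [F.att_inl, hν0, hb n e i hi]
      simp [oT]
    · rw [F.att_inr, hν1, (h1 s).2 n e i hi]
      simp [oT]
  obtain ⟨ν, ⟨ha, hb⟩, hu⟩ := hT P t oT
  refine ⟨fun v => ν (F.inl v), ⟨fun i => by simp only [← F.ext, ha], fun n e i hi => ?_⟩, ?_⟩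
  · simp only [← F.att_inl]
    rw [hb _ _ _ hi]
    simp [oT]
  · rintro ν₀ ⟨ha', hb'⟩
    obtain ⟨ν', hν0, h'⟩ := extend ν₀ ha' hb'
    rw [← hu ν' h']
    funext v
    exact (hν0 v).symm

end Fill

/-- This serves the right rules for divisions, where the graph in the hole becomes the new
antecedent. Any values at the external nodes of `Z` are realized by some naming of `B`, which `Gen`
for `B` then fixes inside `T`. -/
theorem IsFill.gen_slot {B T : HGraph (Formula Pr) k} {slot : Unit → Fin d → B.V}
    {Z : HGraph (Formula Pr) d} (F : IsFill B slot (fun _ => Z) T) (hd : 0 < d) (hT : Gen Out T)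
    (hB : Gen Out B) (hslot : Function.Injective (slot ())) : Gen Out Z := by
  classical
  intro P t o
  have p : P := t ⟨0, hd⟩
  -- Injectivity of the slot is essential here: the external nodes of `Z` must be free to take
  -- arbitrary values.
  obtain ⟨ν₀, hν₀⟩ : ∃ ν₀ : B.V → P, ∀ i, ν₀ (slot () i) = t i :=
    ⟨Function.extend (slot ()) t fun _ => p, fun i => hslot.extend_apply _ _ _⟩
  let oT : ∀ n, T.E n → Fin n → P := fun n e => Sum.elim (fun e i => ν₀ (B.att n e i))
    (fun e => o n e.2) (F.edge n e)
  obtain ⟨ν, ⟨ha, hb⟩, hu⟩ := hT P (fun i => ν₀ (B.ext i)) oT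
  have e0 : ∀ v, ν (F.inl v) = ν₀ v := by
    obtain ⟨ν₀', h', hu'⟩ := hB P (fun i => ν₀ (B.ext i)) fun n e i => ν₀ (B.att n e i)
    have h1 := hu' ν₀ ⟨fun _ => rfl, fun _ _ _ _ => rfl⟩
    have h2 := hu' (fun v => ν (F.inl v)) ⟨fun i => by simp only [← F.ext, ha],
      fun n e i hi => by
        simp only [← F.att_inl]
        rw [hb _ _ _ hi]
        simp [oT]⟩
    intro v
    rw [h1, ← h2]
  refine ⟨fun v => ν (F.inr () v), ⟨fun i => ?_, fun n e i hi => ?_⟩, ?_⟩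
  · have := F.glue () i
    simp only [← this, e0, hν₀]
  · have := F.att_inr n () e i
    simp only [← this]
    rw [hb _ _ _ hi]
    simp [oT]
  · rintro ν₁ ⟨ha', hb'⟩
    obtain ⟨ν', h0, h1⟩ := F.desc ν₀ (fun _ => ν₁) fun _ i => by rw [hν₀, ha']
    have := hu ν' ⟨fun i => by rw [F.ext, h0], fun n e i hi => by
      obtain ⟨e, rfl⟩ := (F.edge n).symm.surjective e
      rcases e with e | ⟨s, e⟩
      · rw [F.att_inl, h0]
        simp [oT]
      · rw [F.att_inr, h1, hb' n e i hi]
        simp [oT]⟩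
    rw [← this]
    funext v
    exact (h1 () v).symm

/-- Equal multisets of values mean fibres of equal cardinality, and bijections of the fibres are
assembled. -/
theorem exists_equiv_of_map_univ_eq {α β γ : Type*} [Fintype α] [Fintype β] (f : α → γ)
    (g : β → γ) (h : ∑ a, ({f a} : Multiset γ) = ∑ b, {g b}) : ∃ e : α ≃ β, ∀ a, f a = g (e a) := by
  classical
  have hc : ∀ c, Nonempty ({a // f a = c} ≃ {b // g b = c}) := by
    intro c
    rw [← Fintype.card_eq, Fintype.card_subtype, Fintype.card_subtype]
    have := congrArg (Multiset.count c) h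
    simp only [Multiset.count_sum', Multiset.count_singleton] at this
    simpa only [Finset.card_filter, eq_comm] using this
  let e := fun c => Classical.choice (hc c)
  exact ⟨Equiv.ofFiberEquiv e, fun a => (Equiv.ofFiberEquiv_map e a).symm⟩

/-- A naming of the nodes of `G'` by nodes of `G` that is bijective on hyperedges is an
isomorphism. -/
theorem Gen.iso_of_facts {G G' : HGraph (Formula Pr) k} (hG : Gen Out G) (hG' : Gen Out G')
    (ν : G'.V → G.V) (hext : ∀ i, ν (G'.ext i) = G.ext i) (h : HL.facts G' ν = HL.facts G id) :
    GraphIso G' G := by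
  obtain ⟨ψ, hψ⟩ := exists_equiv_of_map_univ_eq _ _ h
  have hψ1 : ∀ y, y.1 = (ψ y).1 := fun y => congrArg Sigma.fst (hψ y)
  -- A bijection that preserves facts preserves ranks, hence splits into one bijection for every
  -- rank.
  let g : ∀ n, G'.E n ≃ G.E n := fun n => (Equiv.sigmaSubtype n).symm.trans
    ((ψ.subtypeEquiv (fun y => by rw [hψ1 y])).trans (Equiv.sigmaSubtype n))
  have hg : ∀ n e, (⟨n, g n e⟩ : G.Edge) = ψ ⟨n, e⟩ := by
    intro n e
    have := (Equiv.sigmaSubtype (β := G.E) n).symm_apply_apply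
      ((ψ.subtypeEquiv (p := fun y : G'.Edge => y.1 = n) (q := fun y : G.Edge => y.1 = n)
        (fun y => by rw [hψ1 y])) ((Equiv.sigmaSubtype n).symm e))
    exact congrArg Subtype.val this
  have hfact : ∀ n e, (G'.lab n e).cls = (G.lab n (g n e)).cls ∧
      (fun i => ν (G'.att n e i)) = G.att n (g n e) := by
    intro n e
    have h1 : factAt G' ν ⟨n, e⟩ = factAt G id ⟨n, g n e⟩ := by rw [hψ, hg]
    simpa [factAt, fact] using h1
  have hatt : ∀ n e i, ν (G'.att n e i) = G.att n (g n e) i := fun n e i =>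
    congrFun (hfact n e).2 i
  -- The inverse naming: external nodes and output ports of `G` are sent to their counterparts in
  -- `G'`. Both composites are identities by uniqueness.
  obtain ⟨ξ, ⟨hξ1, hξ2⟩, -⟩ := hG G'.V G'.ext fun n e => G'.att n ((g n).symm e)
  have e1 : (fun v => ν (ξ v)) = id := by
    refine (hG G.V G.ext G.att).unique ⟨fun i => by rw [hξ1, hext], fun n e i hi => ?_⟩
      ⟨fun _ => rfl, fun _ _ _ _ => rfl⟩
    rw [hξ2 n e i hi, hatt, Equiv.apply_symm_apply]
  have e2 : (fun v => ξ (ν v)) = id := by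
    refine (hG' G'.V G'.ext G'.att).unique ⟨fun i => by rw [hext, hξ1], fun n e i hi => ?_⟩
      ⟨fun _ => rfl, fun _ _ _ _ => rfl⟩
    rw [hatt, hξ2 n _ i hi, Equiv.symm_apply_apply]
  exact ⟨⟨ν, ξ, congrFun e2, congrFun e1⟩, g, hatt,
    fun n e => Formula.cls_eq_iff.1 (hfact n e).1, hext⟩

end HL

/-! ### Rearrangements, commutative variants and expansion of products in the multimodal calculus.
-/

namespace NLM

variable {At : Type u} {I : Type v} {J : Type w} {C A : Set I}

/-- Composition of contexts. -/
def Ctx.comp : Ctx At I J → Ctx At I J → Ctx At I J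
  | .hole, E => E
  | .pairL i D Q, E => .pairL i (D.comp E) Q
  | .pairR i Q D, E => .pairR i Q (D.comp E)
  | .bracket j D, E => .bracket j (D.comp E)

@[simp]
theorem Ctx.fill_comp (D E : Ctx At I J) (P : Database At I J) :
    (D.comp E).fill P = D.fill (E.fill P) := by
  induction D <;> simp_all [Ctx.comp, Ctx.fill]

/-- In every context, what is derivable from `P` is derivable from `Q`. -/
def Entails (C A : Set I) (P Q : Database At I J) : Prop :=
  ∀ (D : Ctx At I J) (T : Formula At I J), Derivable C A (D.fill P) T → Derivable C A (D.fill Q) T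

namespace Entails

theorem refl (P : Database At I J) : Entails C A P P := fun _ _ h => h

theorem trans {P Q R : Database At I J} (h : Entails C A P Q) (h' : Entails C A Q R) :
    Entails C A P R := fun D T hd => h' D T (h D T hd)

theorem fill {P Q : Database At I J} (h : Entails C A P Q) (D : Ctx At I J) :
    Entails C A (D.fill P) (D.fill Q) := fun E T hd => by
  have := h (E.comp D) T
  simp only [Ctx.fill_comp] at this
  exact this hd

theorem pair {P P' Q Q' : Database At I J} (i : I) (h : Entails C A P P')
    (h' : Entails C A Q Q') : Entails C A (.pair i P Q) (.pair i P' Q') :=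
  (h.fill (.pairL i .hole Q)).trans (h'.fill (.pairR i P' .hole))

theorem swap {c : I} (hc : c ∈ C) (P Q : Database At I J) :
    Entails C A (.pair c P Q) (.pair c Q P) := fun D _ h => .perm D c hc P Q _ h

theorem assocL {a : I} (ha : a ∈ A) (P Q R : Database At I J) :
    Entails C A (.pair a P (.pair a Q R)) (.pair a (.pair a P Q) R) :=
  fun D _ h => .assocL D a ha P Q R _ h

theorem assocR {a : I} (ha : a ∈ A) (P Q R : Database At I J) :
    Entails C A (.pair a (.pair a P Q) R) (.pair a P (.pair a Q R)) :=
  fun D _ h => .assocR D a ha P Q R _ h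

theorem derivable {P Q : Database At I J} (h : Entails C A P Q) {T : Formula At I J}
    (hd : Derivable C A P T) : Derivable C A Q T := h .hole T hd

end Entails

/-- Equality of formulas up to the commutativity of the modes in `C`. -/
inductive FEq (C : Set I) : Formula At I J → Formula At I J → Prop
  | atom (p : At) : FEq C (.atom p) (.atom p)
  | prod {i : I} {X X' Y Y' : Formula At I J} :
      FEq C X X' → FEq C Y Y' → FEq C (.prod i X Y) (.prod i X' Y')
  | prodSwap {i : I} {X X' Y Y' : Formula At I J} (hi : i ∈ C) :
      FEq C X X' → FEq C Y Y' → FEq C (.prod i X Y) (.prod i Y' X')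
  | underCongr {i : I} {X X' Y Y' : Formula At I J} :
      FEq C X X' → FEq C Y Y' → FEq C (.under i Y X) (.under i Y' X')
  | overCongr {i : I} {X X' Y Y' : Formula At I J} :
      FEq C X X' → FEq C Y Y' → FEq C (.over i X Y) (.over i X' Y')
  | underOver {i : I} {X X' Y Y' : Formula At I J} (hi : i ∈ C) :
      FEq C X X' → FEq C Y Y' → FEq C (.under i Y X) (.over i X' Y')
  | overUnder {i : I} {X X' Y Y' : Formula At I J} (hi : i ∈ C) :
      FEq C X X' → FEq C Y Y' → FEq C (.over i X Y) (.under i Y' X')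
  | dia {j : J} {X X' : Formula At I J} : FEq C X X' → FEq C (.dia j X) (.dia j X')
  | box {j : J} {X X' : Formula At I J} : FEq C X X' → FEq C (.box j X) (.box j X')

theorem FEq.refl (X : Formula At I J) : FEq C X X := by
  induction X with
  | atom p => exact .atom p
  | prod i A B h h' => exact .prod h h'
  | under i A B h h' => exact .underCongr h' h
  | dia j A h => exact .dia h
  | box j A h => exact .box h
  | _ i A B h h' => exact .overCongr h h'

/-- `Refines C P Q`: the database `Q` results from `P` by replacing formulas by equal ones (in the
sense of `FEq`) and by decomposing products and diamonds. -/
inductive Refines (C : Set I) : Database At I J → Database At I J → Prop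
  | form {X X' : Formula At I J} : FEq C X X' → Refines C (.form X) (.form X')
  | split {i : I} {X Y : Formula At I J} {P Q : Database At I J} :
      Refines C (.form X) P → Refines C (.form Y) Q → Refines C (.form (.prod i X Y)) (.pair i P Q)
  | splitDia {j : J} {X : Formula At I J} {P : Database At I J} :
      Refines C (.form X) P → Refines C (.form (.dia j X)) (.bracket j P)
  | pair {i : I} {P P' Q Q' : Database At I J} :
      Refines C P P' → Refines C Q Q' → Refines C (.pair i P Q) (.pair i P' Q')
  | bracket {j : J} {P P' : Database At I J} :
      Refines C P P' → Refines C (.bracket j P) (.bracket j P')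

theorem Refines.refl (P : Database At I J) : Refines C P P := by
  induction P with
  | form X => exact .form (.refl X)
  | pair i P Q h h' => exact .pair h h'
  | bracket j P h => exact .bracket h

/-- A context consists of pairs and brackets only, and these refine to pairs and brackets of the
same mode; so a refinement of `D[P]` acts on `D` and on `P` separately. -/
theorem Refines.of_fill {D : Ctx At I J} {P R : Database At I J} (h : Refines C (D.fill P) R) :
    ∃ (D' : Ctx At I J) (P' : Database At I J), R = D'.fill P' ∧ Refines C P P' ∧
      ∀ Q Q', Refines C Q Q' → Refines C (D.fill Q) (D'.fill Q') := by
  induction D generalizing R with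
  | hole => exact ⟨.hole, R, rfl, h, fun _ _ h => h⟩
  | pairL i D S ih =>
    cases h with
    | pair h1 h2 =>
      obtain ⟨D', P', rfl, hP, hD⟩ := ih h1
      exact ⟨.pairL i D' _, P', rfl, hP, fun Q Q' hq => .pair (hD Q Q' hq) h2⟩
  | pairR i S D ih =>
    cases h with
    | pair h1 h2 =>
      obtain ⟨D', P', rfl, hP, hD⟩ := ih h2
      exact ⟨.pairR i _ D', P', rfl, hP, fun Q Q' hq => .pair h1 (hD Q Q' hq)⟩
  | bracket j D ih =>
    cases h with
    | bracket h1 =>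
      obtain ⟨D', P', rfl, hP, hD⟩ := ih h1
      exact ⟨.bracket j D', P', rfl, hP, fun Q Q' hq => .bracket (hD Q Q' hq)⟩

/-- The axiom case of `Derivable.of_refines`. Antecedent and succedent are both variants of one
formula `X`, so that neither symmetry nor transitivity of `FEq` is needed. -/
theorem derivable_of_refines_form {X X' : Formula At I J} {P : Database At I J}
    (h : Refines C (.form X) P) (h' : FEq C X X') : Derivable C A P X' := by
  induction X generalizing P X' with
  | atom p =>
    cases h' with
    | atom =>
      cases h with
      | form h => cases h; exact .ax _
  | prod i Y Z ihY ihZ =>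
    have hpair : ∀ P Q, Refines C (.form Y) P → Refines C (.form Z) Q →
        Derivable C A (.pair i P Q) X' := by
      intro P Q hP hQ
      cases h' with
      | prod h1 h2 => exact .prodR _ _ _ _ _ (ihY hP h1) (ihZ hQ h2)
      | prodSwap hi h1 h2 =>
        exact .perm .hole _ hi _ _ _ (.prodR _ _ _ _ _ (ihZ hQ h2) (ihY hP h1))
    cases h with
    | split hP hQ => exact hpair _ _ hP hQ
    | form h =>
      cases h with
      | prod h1 h2 => exact .prodL .hole _ _ _ _ (hpair _ _ (.form h1) (.form h2))
      | prodSwap hi h1 h2 =>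
        exact .prodL .hole _ _ _ _ (.perm .hole _ hi _ _ _ (hpair _ _ (.form h1) (.form h2)))
  | under i Z Y ihZ ihY =>
    -- The argument of a division is contravariant: the variant on the right must entail the variant
    -- on the left.
    have main : ∀ Z₁ Z₂ Y₁ Y₂, FEq C Z Z₁ → FEq C Z Z₂ → FEq C Y Y₁ → FEq C Y Y₂ →
        Derivable C A (.form Y₁) Y₂ ∧ Derivable C A (.form Z₂) Z₁ :=
      fun Z₁ Z₂ Y₁ Y₂ h1 h2 h3 h4 => ⟨ihY (.form h3) h4, ihZ (.form h2) h1⟩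
    cases h with
    | form h =>
      cases h with
      | underCongr h1 h2 =>
        cases h' with
        | underCongr h1' h2' =>
          obtain ⟨a, b⟩ := main _ _ _ _ h2 h2' h1 h1'
          exact .underR _ _ _ _ (.underL .hole _ _ _ _ _ a b)
        | underOver hi h1' h2' =>
          obtain ⟨a, b⟩ := main _ _ _ _ h2 h2' h1 h1'
          exact .overR _ _ _ _ (.perm .hole _ hi _ _ _ (.underL .hole _ _ _ _ _ a b))
      | underOver hi h1 h2 =>
        cases h' with
        | underCongr h1' h2' =>
          obtain ⟨a, b⟩ := main _ _ _ _ h2 h2' h1 h1'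
          exact .underR _ _ _ _ (.perm .hole _ hi _ _ _ (.overL .hole _ _ _ _ _ a b))
        | underOver hi h1' h2' =>
          obtain ⟨a, b⟩ := main _ _ _ _ h2 h2' h1 h1'
          exact .overR _ _ _ _ (.overL .hole _ _ _ _ _ a b)
  | dia j Y ihY =>
    cases h' with
    | dia h' =>
      cases h with
      | splitDia h => exact .diaR _ _ _ (ihY h h')
      | form h =>
        cases h with
        | dia h => exact .diaL .hole _ _ _ (.diaR _ _ _ (ihY (.form h) h'))
  | box j Y ihY =>
    cases h' with
    | box h' =>
      cases h with
      | form h =>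
        cases h with
        | box h => exact .boxR _ _ _ (.boxL .hole _ _ _ (ihY (.form h) h'))
  | _ i Y Z ihY ihZ =>
    have main : ∀ Z₁ Z₂ Y₁ Y₂, FEq C Z Z₁ → FEq C Z Z₂ → FEq C Y Y₁ → FEq C Y Y₂ →
        Derivable C A (.form Y₁) Y₂ ∧ Derivable C A (.form Z₂) Z₁ :=
      fun Z₁ Z₂ Y₁ Y₂ h1 h2 h3 h4 => ⟨ihY (.form h3) h4, ihZ (.form h2) h1⟩
    cases h with
    | form h =>
      cases h with
      | overCongr h1 h2 =>
        cases h' with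
        | overCongr h1' h2' =>
          obtain ⟨a, b⟩ := main _ _ _ _ h2 h2' h1 h1'
          exact .overR _ _ _ _ (.overL .hole _ _ _ _ _ a b)
        | overUnder hi h1' h2' =>
          obtain ⟨a, b⟩ := main _ _ _ _ h2 h2' h1 h1'
          exact .underR _ _ _ _ (.perm .hole _ hi _ _ _ (.overL .hole _ _ _ _ _ a b))
      | overUnder hi h1 h2 =>
        cases h' with
        | overCongr h1' h2' =>
          obtain ⟨a, b⟩ := main _ _ _ _ h2 h2' h1 h1'
          exact .overR _ _ _ _ (.perm .hole _ hi _ _ _ (.underL .hole _ _ _ _ _ a b))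
        | overUnder hi h1' h2' =>
          obtain ⟨a, b⟩ := main _ _ _ _ h2 h2' h1 h1'
          exact .underR _ _ _ _ (.underL .hole _ _ _ _ _ a b)

/-- Invertibility of the left rules for products and diamonds, together with invariance under
commutative variants. Proving both in one induction is natural, since a left rule meets its
principal formula either decomposed or replaced by a variant; a variant with exchanged arguments
costs one permutation. -/
theorem Derivable.of_refines {P Q : Database At I J} {T T' : Formula At I J}
    (hd : Derivable C A P T) (h : Refines C P Q) (hT : FEq C T T') : Derivable C A Q T' := by
  induction hd generalizing Q T' with
  | ax X => exact derivable_of_refines_form h hT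
  | prodL D i X Y Z _ ih =>
    obtain ⟨D', P', rfl, hP, hD⟩ := h.of_fill
    cases hP with
    -- The principal product has already been decomposed, so the rule is dropped.
    | split h1 h2 => exact ih (hD _ _ (.pair h1 h2)) hT
    | form h' =>
      cases h' with
      | prod h1 h2 => exact .prodL _ _ _ _ _ (ih (hD _ _ (.pair (.form h1) (.form h2))) hT)
      | prodSwap hi h1 h2 =>
        exact .prodL _ _ _ _ _ (.perm _ _ hi _ _ _
          (ih (hD _ _ (.pair (.form h1) (.form h2))) hT))
  | prodR i P Q X Y _ _ ih1 ih2 =>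
    cases h with
    | pair h1 h2 =>
      cases hT with
      | prod hX hY => exact .prodR _ _ _ _ _ (ih1 h1 hX) (ih2 h2 hY)
      | prodSwap hi hX hY =>
        exact .perm .hole _ hi _ _ _ (.prodR _ _ _ _ _ (ih2 h2 hY) (ih1 h1 hX))
  | underL D i P X Y Z _ _ ih1 ih2 =>
    obtain ⟨D', P', rfl, hP, hD⟩ := h.of_fill
    cases hP with
    | pair h1 h2 =>
      cases h2 with
      | form h2 =>
        cases h2 with
        | underCongr hX hY =>
          exact .underL _ _ _ _ _ _ (ih1 (hD _ _ (.form hX)) hT) (ih2 h1 hY)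
        | underOver hi hX hY =>
          exact .perm _ _ hi _ _ _ (.overL _ _ _ _ _ _ (ih1 (hD _ _ (.form hX)) hT) (ih2 h1 hY))
  | underR i P X Y _ ih =>
    cases hT with
    | underCongr hX hY => exact .underR _ _ _ _ (ih (.pair (.form hY) h) hX)
    | underOver hi hX hY =>
      exact .overR _ _ _ _ (.perm .hole _ hi _ _ _ (ih (.pair (.form hY) h) hX))
  | overL D i P X Y Z _ _ ih1 ih2 =>
    obtain ⟨D', P', rfl, hP, hD⟩ := h.of_fill
    cases hP with
    | pair h2 h1 =>
      cases h2 with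
      | form h2 =>
        cases h2 with
        | overCongr hX hY =>
          exact .overL _ _ _ _ _ _ (ih1 (hD _ _ (.form hX)) hT) (ih2 h1 hY)
        | overUnder hi hX hY =>
          exact .perm _ _ hi _ _ _ (.underL _ _ _ _ _ _ (ih1 (hD _ _ (.form hX)) hT) (ih2 h1 hY))
  | overR i P X Y _ ih =>
    cases hT with
    | overCongr hX hY => exact .overR _ _ _ _ (ih (.pair h (.form hY)) hX)
    | overUnder hi hX hY =>
      exact .underR _ _ _ _ (.perm .hole _ hi _ _ _ (ih (.pair h (.form hY)) hX))
  | diaL D j X Z _ ih =>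
    obtain ⟨D', P', rfl, hP, hD⟩ := h.of_fill
    cases hP with
    | splitDia h1 => exact ih (hD _ _ (.bracket h1)) hT
    | form h' =>
      cases h' with
      | dia h0 => exact .diaL _ _ _ _ (ih (hD _ _ (.bracket (.form h0))) hT)
  | diaR j P X _ ih =>
    cases h with
    | bracket h =>
      cases hT with
      | dia hX => exact .diaR _ _ _ (ih h hX)
  | boxL D j X Z _ ih =>
    obtain ⟨D', P', rfl, hP, hD⟩ := h.of_fill
    cases hP with
    | bracket h' =>
      cases h' with
      | form h' =>
        cases h' with
        | box h0 => exact .boxL _ _ _ _ (ih (hD _ _ (.form h0)) hT)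
  | boxR j P X _ ih =>
    cases hT with
    | box hX => exact .boxR _ _ _ (ih (.bracket h) hX)
  | perm D c hc P Q Z _ ih =>
    obtain ⟨D', P', rfl, hP, hD⟩ := h.of_fill
    cases hP with
    | pair h1 h2 => exact .perm _ _ hc _ _ _ (ih (hD _ _ (.pair h2 h1)) hT)
  | assocL D a ha P Q R Z _ ih =>
    obtain ⟨D', P', rfl, hP, hD⟩ := h.of_fill
    cases hP with
    | pair h1 h2 =>
      cases h1 with
      | pair h0 h1 => exact .assocL _ _ ha _ _ _ _ (ih (hD _ _ (.pair h0 (.pair h1 h2))) hT)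
  | assocR D a ha P Q R Z _ ih =>
    obtain ⟨D', P', rfl, hP, hD⟩ := h.of_fill
    cases hP with
    | pair h1 h2 =>
      cases h2 with
      | pair h2 h3 => exact .assocR _ _ ha _ _ _ _ (ih (hD _ _ (.pair (.pair h1 h2) h3)) hT)

/-- The formula that corresponds to a database. -/
def Database.toFormula : Database At I J → Formula At I J
  | .form X => X
  | .pair i P Q => .prod i P.toFormula Q.toFormula
  | .bracket j P => .dia j P.toFormula

theorem refines_toFormula (P : Database At I J) : Refines C (.form P.toFormula) P := by
  induction P with
  | form X => exact .form (.refl X)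
  | pair i P Q h h' => exact .split h h'
  | bracket j P h => exact .splitDia h

end NLM

/-! ### Congruence of holes and gadgets. -/

namespace HL

variable {Pr : ℕ → Type x} {k d : ℕ}

theorem HoleIso.symm {D D' : HoleGraph (Formula Pr) k d} (h : HoleIso D D') : HoleIso D' D := by
  obtain ⟨f, g, h1, h2, h3, h4⟩ := h
  refine ⟨f.symm, fun n => (g n).symm, ?_, ?_, ?_, ?_⟩
  · intro n e i
    rw [Equiv.symm_apply_eq, h1, Equiv.apply_symm_apply]
  · intro n e
    simpa using (h2 n ((g n).symm e)).symm
  · intro i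
    rw [Equiv.symm_apply_eq, h3]
  · intro i
    rw [Equiv.symm_apply_eq, h4]

theorem HoleIso.trans {D D' D'' : HoleGraph (Formula Pr) k d} (h : HoleIso D D')
    (h' : HoleIso D' D'') : HoleIso D D'' := by
  obtain ⟨f, g, h1, h2, h3, h4⟩ := h
  obtain ⟨f', g', h1', h2', h3', h4'⟩ := h'
  refine ⟨f.trans f', fun n => (g n).trans (g' n), ?_, ?_, ?_, ?_⟩
  · intro n e i
    simp [h1, h1']
  · intro n e
    exact (h2 n e).trans (h2' _ _)
  · intro i
    simp [h3, h3']
  · intro i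
    simp [h4, h4']

theorem HoleIso.toHGraph {D D' : HoleGraph (Formula Pr) k d} (h : HoleIso D D') :
    GraphIso D.toHGraph D'.toHGraph := by
  obtain ⟨f, g, h1, h2, h3, h4⟩ := h
  exact ⟨f, g, h1, h2, h3⟩

theorem HoleIso.plug {D D' : HoleGraph (Formula Pr) k d} (h : HoleIso D D')
    (F : HGraph (Formula Pr) d) : GraphIso (plug D F) (plug D' F) := by
  obtain ⟨f, g, h1, h2, h3, h4⟩ := h
  refine HGraph.subst_congr f (fun n => Equiv.sumCongr (g n) (Equiv.refl _)) ?_ h3 ?_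
  · rintro n (e | o) i
    · exact h1 n e i
    · cases o
      exact h4 i
  · rintro ⟨n, e | o⟩
    · exact GraphIso.handle (h2 n e)
    · cases o
      exact GraphIso.refl _

end HL

namespace BinGadget

open HL

variable {Pr : ℕ → Type x} {k : ℕ} (R : BinGadget Pr k)

theorem graph_congr {X X' Y Y' : HL.Formula Pr k} (hX : HL.Formula.Iso X X')
    (hY : HL.Formula.Iso Y Y') : GraphIso (R.graph X Y) (R.graph X' Y') := by
  refine ⟨Equiv.refl _, fun _ => Equiv.refl _, fun _ _ _ => rfl, ?_, fun _ => rfl⟩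
  rintro n ((e | e) | e)
  · exact .refl _
  · cases e
    exact hX
  · cases e
    exact hY

theorem holeRight_congr {X X' : HL.Formula Pr k} (hX : HL.Formula.Iso X X') :
    HoleIso (R.holeRight X) (R.holeRight X') := by
  refine ⟨Equiv.refl _, fun _ => Equiv.refl _, fun _ _ _ => rfl, ?_, fun _ => rfl, fun _ => rfl⟩
  rintro n (e | e)
  · exact .refl _
  · cases e
    exact hX

theorem holeLeft_congr {X X' : HL.Formula Pr k} (hX : HL.Formula.Iso X X') :
    HoleIso (R.holeLeft X) (R.holeLeft X') := by
  refine ⟨Equiv.refl _, fun _ => Equiv.refl _, fun _ _ _ => rfl, ?_, fun _ => rfl, fun _ => rfl⟩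
  rintro n (e | e)
  · exact .refl _
  · cases e
    exact hX

end BinGadget

/-! ### Derivations of translated sequents stay among translated sequents. -/

namespace Translation

open HL

variable {At : Type u} {I : Type v} {J : Type w} {Pr : ℕ → Type x} {k : ℕ}
  (τ : Translation At I J Pr k)

/-- The restriction of the hypergraph Lambek calculus to translated sequents. -/
inductive Rest : HGraph (HL.Formula Pr) k → NLM.Formula At I J → Prop
  | iso {G G' T} : GraphIso G G' → Rest G T → Rest G' T
  | ax (T) : Rest (HGraph.handle (τ.mu T)) T
  | prodL (K : HoleGraph (HL.Formula Pr) k k) (i A B T) :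
      Rest (plug K ((τ.bin i).graph (τ.mu A) (τ.mu B))) T →
      Rest (plug K (HGraph.handle (τ.mu (.prod i A B)))) T
  | diaL (K : HoleGraph (HL.Formula Pr) k k) (j A T) :
      Rest (plug K ((τ.un j).graph (τ.mu A))) T →
      Rest (plug K (HGraph.handle (τ.mu (.dia j A)))) T
  | prodR {G H} (i) {A B} : Rest G A → Rest H B → Rest ((τ.bin i).compose G H) (.prod i A B)
  | diaR {G} (j) {A} : Rest G A → Rest ((τ.un j).compose G) (.dia j A)
  | underL (K : HoleGraph (HL.Formula Pr) k k) (i A B F T) :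
      Rest (plug K (HGraph.handle (τ.mu A))) T → Rest F B →
      Rest (plug K ((τ.bin i).compose F (HGraph.handle (τ.mu (.under i B A))))) T
  | overL (K : HoleGraph (HL.Formula Pr) k k) (i A B F T) :
      Rest (plug K (HGraph.handle (τ.mu A))) T → Rest F B →
      Rest (plug K ((τ.bin i).compose (HGraph.handle (τ.mu (.over i A B))) F)) T
  | boxL (K : HoleGraph (HL.Formula Pr) k k) (j A T) :
      Rest (plug K (HGraph.handle (τ.mu A))) T →
      Rest (plug K ((τ.un j).compose (HGraph.handle (τ.mu (.box j A))))) T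
  | underR {F} (i A B) : Rest (plug ((τ.bin i).holeRight (τ.mu B)) F) A → Rest F (.under i B A)
  | overR {F} (i A B) : Rest (plug ((τ.bin i).holeLeft (τ.mu B)) F) A → Rest F (.over i A B)
  | boxR {F} (j A) : Rest (plug (τ.un j).holeGraph F) A → Rest F (.box j A)

/-- The two kinds of translated sequents. -/
inductive Claim : ∀ {n : ℕ}, HGraph (HL.Formula Pr) n → HL.Formula Pr n → Prop
  | form {G X} (T) (hX : HL.Formula.Iso X (τ.mu T)) (h : τ.Rest G T) : Claim G X
  | mode {n} {G} {X : HL.Formula Pr n} (hn : n ≠ k) (h : GraphIso G (HGraph.handle X)) : Claim G X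

/-- The graphs that occur under products of translated formulas. -/
inductive TimesLabel : ∀ {n : ℕ}, HGraph (HL.Formula Pr) n → Prop
  | prod {M} (i A B) (h : GraphIso M ((τ.bin i).graph (τ.mu A) (τ.mu B))) : TimesLabel M
  | dia {M} (j A) (h : GraphIso M ((τ.un j).graph (τ.mu A))) : TimesLabel M

/-- The components of divisions that are translated formulas. -/
inductive DivLabel : ∀ {n m : ℕ}, HL.Formula Pr n → HoleGraph (HL.Formula Pr) n m → Prop
  | under {N D} (i A B) (hN : HL.Formula.Iso N (τ.mu A))
      (hD : HoleIso D ((τ.bin i).holeRight (τ.mu B))) : DivLabel N D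
  | over {N D} (i A B) (hN : HL.Formula.Iso N (τ.mu A))
      (hD : HoleIso D ((τ.bin i).holeLeft (τ.mu B))) : DivLabel N D
  | box {N D} (j A) (hN : HL.Formula.Iso N (τ.mu A))
      (hD : HoleIso D (τ.un j).holeGraph) : DivLabel N D

variable {τ}

theorem timesLabel_of_iso {M : HGraph (HL.Formula Pr) k} {A : NLM.Formula At I J}
    (h : HL.Formula.Iso (.times M) (τ.mu A)) : τ.TimesLabel M := by
  obtain ⟨M', e, h⟩ := h.exists_of_times
  cases A with
  | prod i A B =>
    obtain rfl := HL.Formula.times_injective e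
    exact .prod _ _ _ h
  | dia j A =>
    obtain rfl := HL.Formula.times_injective e
    exact .dia _ _ h
  | _ => cases e

theorem divLabel_of_iso {n : ℕ} {N : HL.Formula Pr n} {D : HoleGraph (HL.Formula Pr) n k}
    {A : NLM.Formula At I J} (h : HL.Formula.Iso (.div N D) (τ.mu A)) : τ.DivLabel N D := by
  obtain ⟨N', D', e, hN, hD⟩ := h.exists_of_div
  cases A with
  | atom p => cases e
  | prod i A B => cases e
  | dia j A => cases e
  | under i A B =>
    obtain ⟨rfl, h1⟩ := HL.Formula.div_injective e
    obtain ⟨rfl, rfl⟩ : _ = N' ∧ _ = D' := h1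
    exact .under _ _ _ hN hD
  | box j A =>
    obtain ⟨rfl, h1⟩ := HL.Formula.div_injective e
    obtain ⟨rfl, rfl⟩ : _ = N' ∧ _ = D' := h1
    exact .box _ _ hN hD
  | _ i A B =>
    obtain ⟨rfl, h1⟩ := HL.Formula.div_injective e
    obtain ⟨rfl, rfl⟩ : _ = N' ∧ _ = D' := h1
    exact .over _ _ _ hN hD

theorem IsLabel.iso {n : ℕ} {X Y : HL.Formula Pr n} (hX : τ.IsLabel X)
    (h : HL.Formula.Iso X Y) : τ.IsLabel Y := by
  cases hX with
  | form A _ h' => exact .form A _ (h.symm.trans h')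
  | bin i n e =>
    rw [h.eq_of_prim]
    exact .bin i n e
  | un j n e =>
    rw [h.eq_of_prim]
    exact .un j n e

theorem IsLabel.times {n : ℕ} {M : HGraph (HL.Formula Pr) n} (h : τ.IsLabel (.times M)) :
    τ.TimesLabel M := by
  generalize hX : HL.Formula.times M = X at h
  cases h with
  | form A _ h =>
    subst hX
    exact timesLabel_of_iso h
  | bin i n e => cases hX
  | un j n e => cases hX

theorem IsLabel.div {n m : ℕ} {N : HL.Formula Pr n} {D : HoleGraph (HL.Formula Pr) n m}
    (h : τ.IsLabel (.div N D)) : τ.DivLabel N D := by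
  generalize hX : HL.Formula.div N D = X at h
  cases h with
  | form A _ h =>
    subst hX
    exact divLabel_of_iso h
  | bin i n e => cases hX
  | un j n e => cases hX

variable (τ) in
/-- All labels of the graph are labels of translated antecedents. -/
def Labelled {n : ℕ} (G : HGraph (HL.Formula Pr) n) : Prop := ∀ m (e : G.E m), τ.IsLabel (G.lab m e)

theorem Labelled.iso {n : ℕ} {G G' : HGraph (HL.Formula Pr) n} (hG : τ.Labelled G)
    (h : GraphIso G G') : τ.Labelled G' := by
  obtain ⟨f, g, h1, h2, h3⟩ := h
  intro m e
  obtain ⟨e, rfl⟩ := (g m).surjective e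
  exact (hG m e).iso (h2 m e)

theorem Labelled.handle {n : ℕ} {X : HL.Formula Pr n} (h : τ.IsLabel X) :
    τ.Labelled (HGraph.handle X) := by
  rintro m (e | e)
  · exact Empty.elim e
  · cases e
    exact h

theorem Labelled.of_handle {n : ℕ} {X : HL.Formula Pr n} (h : τ.Labelled (HGraph.handle X)) :
    τ.IsLabel X := h n (Sum.inr .mk)

theorem labelled_plug {n m : ℕ} {K : HoleGraph (HL.Formula Pr) n m} {Z : HGraph (HL.Formula Pr) m} :
    τ.Labelled (plug K Z) ↔ τ.Labelled K.toHGraph ∧ τ.Labelled Z := by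
  obtain ⟨F⟩ := plug_isFill K Z
  constructor
  · intro h
    refine ⟨fun p e => ?_, fun p e => ?_⟩
    · rw [← F.lab_inl]
      exact h _ _
    · rw [← F.lab_inr p () e]
      exact h _ _
  · rintro ⟨h1, h2⟩ p e
    obtain ⟨e, rfl⟩ := (F.edge p).symm.surjective e
    rcases e with e | ⟨s, e⟩
    · rw [F.lab_inl]
      exact h1 _ _
    · rw [F.lab_inr]
      exact h2 _ _

theorem isLabel_mu (A : NLM.Formula At I J) : τ.IsLabel (τ.mu A) := .form A _ (.refl _)

theorem TimesLabel.labelled {n : ℕ} {M : HGraph (HL.Formula Pr) n} (h : τ.TimesLabel M) :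
    τ.Labelled M := by
  cases h with
  | prod i A B h =>
    refine Labelled.iso ?_ h.symm
    rintro m ((e | e) | e)
    · exact .bin i m e
    · cases e
      exact isLabel_mu A
    · cases e
      exact isLabel_mu B
  | dia j A h =>
    refine Labelled.iso ?_ h.symm
    rintro m (e | e)
    · exact .un j m e
    · cases e
      exact isLabel_mu A

theorem DivLabel.labelled {n m : ℕ} {N : HL.Formula Pr n} {D : HoleGraph (HL.Formula Pr) n m}
    (h : τ.DivLabel N D) : τ.Labelled D.toHGraph := by
  cases h with
  | under i A B _ h =>
    refine Labelled.iso ?_ h.toHGraph.symm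
    rintro m (e | e)
    · exact .bin i m e
    · cases e
      exact isLabel_mu B
  | box j A _ h =>
    refine Labelled.iso ?_ h.toHGraph.symm
    rintro m e
    exact .un j m e
  | _ i A B _ h =>
    refine Labelled.iso ?_ h.toHGraph.symm
    rintro m (e | e)
    · exact .bin i m e
    · cases e
      exact isLabel_mu B

theorem DivLabel.isLabel {n m : ℕ} {N : HL.Formula Pr n} {D : HoleGraph (HL.Formula Pr) n m}
    (h : τ.DivLabel N D) : τ.IsLabel N := by
  cases h with
  | under i A B h _ => exact .form A _ h
  | box j A h _ => exact .form A _ h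
  | _ i A B h _ => exact .form A _ h

theorem DivLabel.rank_eq {n m : ℕ} {N : HL.Formula Pr n} {D : HoleGraph (HL.Formula Pr) n m}
    (h : τ.DivLabel N D) : n = k := by
  cases h <;> rfl

variable (τ) in
/-- The gadgets of a translation consist of hyperedges whose rank differs from that of translated
formulas. -/
structure Proper : Prop where
  rank_bin : ∀ i n, (τ.bin i).base.E n → n ≠ k
  rank_un : ∀ j n, (τ.un j).base.E n → n ≠ k
  edge_un : ∀ j, Nonempty (τ.un j).base.Edge

theorem facts_graph {P : Type} (R : BinGadget Pr k) (X Y : HL.Formula Pr k)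
    (ν : R.base.V → P) : facts (R.graph X Y) ν = facts R.prims ν +
      {fact X.cls fun i => ν (R.left i)} + {fact Y.cls fun i => ν (R.right i)} := by
  refine (facts_addEdge (R.prims.addEdge R.left X) R.right Y ν).trans ?_
  exact congrArg (· + _) (facts_addEdge R.prims R.left X ν)

theorem facts_un_graph {P : Type} (U : UnGadget Pr k) (X : HL.Formula Pr k)
    (ν : U.base.V → P) : facts (U.graph X) ν = facts U.prims ν +
      {fact X.cls fun i => ν (U.slot i)} := facts_addEdge U.prims U.slot X ν

theorem card_facts {n : ℕ} {P : Type} (G : HGraph (HL.Formula Pr) n) (ν : G.V → P) :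
    Multiset.card (facts G ν) = Fintype.card G.Edge := by
  simp [facts]

theorem GraphIso.card_eq {n : ℕ} {G G' : HGraph (HL.Formula Pr) n} (h : GraphIso G G') :
    Fintype.card G.Edge = Fintype.card G'.Edge := by
  obtain ⟨f, -, h⟩ := h.facts
  rw [← card_facts G (fun v => f v), ← card_facts G' id, ← h]
  rfl

/-- This excludes that decomposing a product leads to the handle of a mode label. For a diamond, the
second hyperedge is the one that `edge_un` demands of the gadget. -/
theorem two_le_card_of_timesLabel (hτ : τ.Proper) {n : ℕ} {M : HGraph (HL.Formula Pr) n}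
    (h : τ.TimesLabel M) : 2 ≤ Fintype.card M.Edge := by
  cases h with
  | prod i A B h =>
    rw [GraphIso.card_eq h]
    have h1 := congrArg Multiset.card (facts_graph (τ.bin i) (τ.mu A) (τ.mu B) id)
    rw [Multiset.card_add, Multiset.card_add, Multiset.card_singleton,
      Multiset.card_singleton] at h1
    have h2 := card_facts ((τ.bin i).graph (τ.mu A) (τ.mu B)) (id : (τ.bin i).base.V → _)
    exact le_of_le_of_eq (Nat.le_add_left 2 _) (h1.symm.trans h2)
  | dia j A h =>
    rw [GraphIso.card_eq h]
    have : Nonempty (τ.un j).prims.Edge := hτ.edge_un j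
    have h0 : 0 < Fintype.card (τ.un j).prims.Edge := Fintype.card_pos
    have h1 := congrArg Multiset.card (facts_un_graph (τ.un j) (τ.mu A) id)
    rw [Multiset.card_add, Multiset.card_singleton] at h1
    have h2 := card_facts ((τ.un j).graph (τ.mu A)) (id : (τ.un j).base.V → _)
    have h3 := card_facts (τ.un j).prims (id : (τ.un j).base.V → _)
    exact le_of_le_of_eq (Nat.succ_le_succ (le_of_le_of_eq h0 h3.symm)) (h1.symm.trans h2)

theorem plug_not_iso_handle {n m : ℕ} {K : HoleGraph (HL.Formula Pr) n m}
    {Z : HGraph (HL.Formula Pr) m} (hZ : 2 ≤ Fintype.card Z.Edge) (X : HL.Formula Pr n) :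
    ¬ GraphIso (plug K Z) (HGraph.handle X) := by
  intro h
  have h := GraphIso.card_eq h
  obtain ⟨F⟩ := plug_isFill K Z
  have h2 : Fintype.card (HGraph.handle X).Edge = 1 := by
    rw [← card_facts _ id, show facts (HGraph.handle X) id = {fact X.cls id} from facts_handle X id]
    rfl
  rw [← card_facts _ id, F.facts, h2] at h
  simp only [Finset.univ_unique, Finset.sum_singleton, Multiset.card_add, card_facts] at h
  omega

/-- The plugged handle contributes a hyperedge of rank `m`, while the only hyperedge on the other
side has rank `n`. -/
theorem plug_handle_not_iso_handle {n m : ℕ} {K : HoleGraph (HL.Formula Pr) n m}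
    {N : HL.Formula Pr m} {X : HL.Formula Pr n} (hn : n ≠ m) :
    ¬ GraphIso (plug K (HGraph.handle N)) (HGraph.handle X) := by
  intro h
  obtain ⟨F⟩ := plug_isFill K (HGraph.handle N)
  obtain ⟨f, g, -⟩ := h
  rcases g m ((F.edge m).symm (Sum.inr ⟨(), Sum.inr .mk⟩)) with e | e
  · exact Empty.elim e
  · cases e
    exact hn rfl

theorem Claim.iso_handle {n : ℕ} {G : HGraph (HL.Formula Pr) n} {X : HL.Formula Pr n}
    (h : τ.Claim G X) (hn : n ≠ k) : GraphIso G (HGraph.handle X) := by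
  cases h with
  | form => exact absurd rfl hn
  | mode _ h => exact h

theorem Claim.exists_rest {G : HGraph (HL.Formula Pr) k} {X : HL.Formula Pr k}
    (h : τ.Claim G X) : ∃ T, HL.Formula.Iso X (τ.mu T) ∧ τ.Rest G T := by
  cases h with
  | form T hX h => exact ⟨T, hX, h⟩
  | mode hn => exact absurd rfl hn

theorem rest_timesL {m : ℕ} {K : HoleGraph (HL.Formula Pr) k m} {M : HGraph (HL.Formula Pr) m}
    (hM : τ.TimesLabel M) {T : NLM.Formula At I J} (h : τ.Rest (plug K M) T) :
    τ.Rest (plug K (HGraph.handle (.times M))) T := by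
  cases hM with
  | prod i A B hM =>
    exact .iso (plug_congr K (.handle (GraphIso.times hM.symm)))
      (.prodL K i A B T (.iso (plug_congr K hM) h))
  | dia j A hM =>
    exact .iso (plug_congr K (.handle (GraphIso.times hM.symm)))
      (.diaL K j A T (.iso (plug_congr K hM) h))

/-- The primitive hyperedges of a gadget have rank different from `k`, so by the claim they are
replaced by their own handles. Only the two slots receive proper graphs, and the substitution is the
composition of the gadget. -/
theorem claim_timesR (hτ : τ.Proper) {m : ℕ} {M : HGraph (HL.Formula Pr) m}
    {H : ∀ y : M.Edge, HGraph (HL.Formula Pr) y.1} (hM : τ.TimesLabel M)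
    (h : ∀ y : M.Edge, τ.Claim (H y) (M.lab y.1 y.2)) : τ.Claim (M.subst H) (.times M) := by
  cases hM with
  | prod i A B hM =>
    obtain ⟨f, g, h1, h2, h3⟩ := hM.symm
    -- The formulas `A'` and `B'` obtained from the premises need not be `A` and `B`, only their
    -- translations are isomorphic. The product is therefore formed anew.
    obtain ⟨A', hA, hRA⟩ := (h ⟨k, g k (Sum.inl (Sum.inr .mk))⟩).exists_rest
    obtain ⟨B', hB, hRB⟩ := (h ⟨k, g k (Sum.inr .mk)⟩).exists_rest
    refine .form (.prod i A' B') (GraphIso.times (hM.trans (BinGadget.graph_congr _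
      ((h2 k (Sum.inl (Sum.inr .mk))).trans hA) ((h2 k (Sum.inr .mk)).trans hB))))
      (.iso ?_ (.prodR i hRA hRB))
    refine HGraph.subst_congr f g h1 h3 ?_
    rintro ⟨n, (e | o) | o⟩
    · exact (GraphIso.handle (h2 n (Sum.inl (Sum.inl e)))).trans
        ((h ⟨n, g n (Sum.inl (Sum.inl e))⟩).iso_handle (hτ.rank_bin i n e)).symm
    · cases o
      exact GraphIso.refl _
    · cases o
      exact GraphIso.refl _
  | dia j A hM =>
    obtain ⟨f, g, h1, h2, h3⟩ := hM.symm
    obtain ⟨A', hA, hRA⟩ := (h ⟨k, g k (Sum.inr .mk)⟩).exists_rest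
    refine .form (.dia j A') (GraphIso.times (hM.trans (GraphIso.addEdge (f := Equiv.refl _)
      (g := fun _ => Equiv.refl _) (fun _ _ _ => rfl) (fun _ _ => .refl _) (fun _ => rfl)
      (fun _ => rfl) ((h2 k (Sum.inr .mk)).trans hA)))) (.iso ?_ (.diaR j hRA))
    refine HGraph.subst_congr f g h1 h3 ?_
    rintro ⟨n, e | o⟩
    · exact (GraphIso.handle (h2 n (Sum.inl e))).trans
        ((h ⟨n, g n (Sum.inl e)⟩).iso_handle (hτ.rank_un j n e)).symm
    · cases o
      exact GraphIso.refl _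

theorem rest_divL (hτ : τ.Proper) {m d : ℕ} {K : HoleGraph (HL.Formula Pr) k m}
    {N : HL.Formula Pr m} {D : HoleGraph (HL.Formula Pr) m d}
    {F : ∀ y : D.toHGraph.Edge, HGraph (HL.Formula Pr) y.1} (hD : τ.DivLabel N D)
    {T : NLM.Formula At I J} (h : τ.Rest (plug K (HGraph.handle N)) T)
    (hF : ∀ y : D.toHGraph.Edge, τ.Claim (F y) (D.lab y.1 y.2)) :
    τ.Rest (plug K (D.fill (HGraph.handle (.div N D)) F)) T := by
  cases hD with
  | under i A B hN hD =>
    obtain ⟨f, g, h1, h2, h3, h4⟩ := hD.symm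
    obtain ⟨B', hB, hR⟩ := (hF ⟨k, g k (Sum.inr .mk)⟩).exists_rest
    refine .iso (plug_congr K ?_) (.underL K i A B' _ T (.iso (plug_congr K (.handle hN)) h) hR)
    refine HGraph.subst_congr f (fun n => Equiv.sumCongr (g n) (Equiv.refl _)) ?_ h3 ?_
    · rintro n (e | o) l
      · exact h1 n e l
      · cases o
        exact h4 l
    · rintro ⟨n, (e | o) | o⟩
      · exact (GraphIso.handle (h2 n (Sum.inl e))).trans
          ((hF ⟨n, g n (Sum.inl e)⟩).iso_handle (hτ.rank_bin i n e)).symm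
      · cases o
        exact GraphIso.refl _
      · cases o
        exact GraphIso.handle (HoleIso.div hN (hD.trans (BinGadget.holeRight_congr _
          ((h2 k (Sum.inr .mk)).trans hB)))).symm
  | box j A hN hD =>
    obtain ⟨f, g, h1, h2, h3, h4⟩ := hD.symm
    refine .iso (plug_congr K ?_) (.boxL K j A T (.iso (plug_congr K (.handle hN)) h))
    refine HGraph.subst_congr f (fun n => Equiv.sumCongr (g n) (Equiv.refl _)) ?_ h3 ?_
    · rintro n (e | o) l
      · exact h1 n e l
      · cases o
        exact h4 l
    · rintro ⟨n, e | o⟩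
      · exact (GraphIso.handle (h2 n e)).trans
          ((hF ⟨n, g n e⟩).iso_handle (hτ.rank_un j n e)).symm
      · cases o
        exact GraphIso.handle (HoleIso.div hN hD).symm
  | _ i A B hN hD =>
    obtain ⟨f, g, h1, h2, h3, h4⟩ := hD.symm
    obtain ⟨B', hB, hR⟩ := (hF ⟨k, g k (Sum.inr .mk)⟩).exists_rest
    refine .iso (plug_congr K ?_) (.overL K i A B' _ T (.iso (plug_congr K (.handle hN)) h) hR)
    -- Here the hole is the left slot and is added last, whereas `compose` adds the right slot last;
    -- the equivalence exchanges them.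
    refine HGraph.subst_congr f (fun n => (Equiv.mk
      (fun e => match e with
        | Sum.inl (Sum.inl e) => Sum.inl (Sum.inl e)
        | Sum.inl (Sum.inr o) => Sum.inr o
        | Sum.inr o => Sum.inl (Sum.inr o))
      (fun e => match e with
        | Sum.inl (Sum.inl e) => Sum.inl (Sum.inl e)
        | Sum.inl (Sum.inr o) => Sum.inr o
        | Sum.inr o => Sum.inl (Sum.inr o))
      (by rintro ((e | o) | o) <;> rfl) (by rintro ((e | o) | o) <;> rfl)).trans
      (Equiv.sumCongr (g n) (Equiv.refl _))) ?_ h3 ?_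
    · rintro n ((e | o) | o) l
      · exact h1 n (Sum.inl e) l
      · cases o
        exact h4 l
      · exact h1 n (Sum.inr o) l
    · rintro ⟨n, (e | o) | o⟩
      · exact (GraphIso.handle (h2 n (Sum.inl e))).trans
          ((hF ⟨n, g n (Sum.inl e)⟩).iso_handle (hτ.rank_bin i n e)).symm
      · cases o
        exact GraphIso.handle (HoleIso.div hN (hD.trans (BinGadget.holeLeft_congr _
          ((h2 k (Sum.inr .mk)).trans hB)))).symm
      · cases o
        exact GraphIso.refl _

/-- This is the subformula property. Every rule passes admissible labels to its premises; a
succedent of rank other than `k` is met only by the axiom, because after a left rule the antecedent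
cannot be a handle of that rank, and right rules produce translated formulas. -/
theorem claim_of_derivable (hτ : τ.Proper) {n : ℕ} {G : HGraph (HL.Formula Pr) n}
    {X : HL.Formula Pr n} (h : HL.Derivable G X) (hG : τ.Labelled G) (hX : τ.IsLabel X) :
    τ.Claim G X := by
  induction h with
  | iso h1 h2 _ ih =>
    cases ih (hG.iso h1.symm) (hX.iso h2.symm) with
    | form T hX' h => exact .form T (h2.symm.trans hX') (.iso h1 h)
    | mode hn h => exact .mode hn (h1.symm.trans (h.trans (.handle h2)))
  | ax X =>
    cases hX with
    | form A _ h => exact .form A h (.iso (.handle h.symm) (.ax A))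
    | bin i n e => exact .mode (hτ.rank_bin i _ e) (.refl _)
    | un j n e => exact .mode (hτ.rank_un j _ e) (.refl _)
  | timesL H e M X _ ih =>
    have h1 := labelled_plug.1 (hG.iso (replace_iso_plug H e _))
    have hM : τ.TimesLabel M := h1.2.of_handle.times
    have ih := ih (Labelled.iso (labelled_plug.2 ⟨h1.1, hM.labelled⟩)
      (replace_iso_plug H e M).symm) hX
    cases ih with
    | form T hX' h =>
      exact .form T hX' (.iso (replace_iso_plug H e _).symm
        (rest_timesL hM (.iso (replace_iso_plug H e M) h)))
    | mode hn h =>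
      -- The antecedent of a mode label has a single hyperedge, but `M` alone has at least two.
      exact absurd ((replace_iso_plug H e M).symm.trans h)
        (plug_not_iso_handle (two_le_card_of_timesLabel hτ hM) X)
  | timesR M H _ ih =>
    have hM := hX.times
    exact claim_timesR hτ hM fun y => ih y (fun m e => hG m ⟨y, e⟩) (hM.labelled _ _)
  | divL H e N D F X _ _ ih ihF =>
    have h1 := labelled_plug.1 (hG.iso (replace_iso_plug H e _))
    have hD : τ.DivLabel N D := IsLabel.div (h1.2 _ ⟨⟨_, Sum.inr .mk⟩, Sum.inr .mk⟩)
    have hF : ∀ y, τ.Claim (F y) (D.lab y.1 y.2) := fun y => ihF y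
      (fun n e => h1.2 n ⟨⟨y.1, Sum.inl y.2⟩, e⟩) (hD.labelled _ _)
    have ih := ih (Labelled.iso (labelled_plug.2 ⟨h1.1, .handle hD.isLabel⟩)
      (replace_iso_plug H e _).symm) hX
    cases ih with
    | form T hX' h =>
      exact .form T hX' (.iso (replace_iso_plug H e _).symm
        (rest_divL hτ hD (.iso (replace_iso_plug H e _) h) hF))
    | mode hn h =>
      refine absurd ((replace_iso_plug H e _).symm.trans h) (plug_handle_not_iso_handle ?_)
      exact fun he => hn (he.trans hD.rank_eq)
  | divR N D F _ ih =>
    have hD := hX.div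
    have ih := ih (labelled_plug.2 ⟨hD.labelled, hG⟩) hD.isLabel
    cases hD with
    | under i A B hN hD =>
      cases ih with
      | form T hX' h =>
        exact .form (.under i B T) (HoleIso.div hX' hD) (.underR i T B (.iso (hD.plug F) h))
      | mode hn => exact absurd rfl hn
    | box j A hN hD =>
      cases ih with
      | form T hX' h =>
        exact .form (.box j T) (HoleIso.div hX' hD) (.boxR j T (.iso (hD.plug F) h))
      | mode hn => exact absurd rfl hn
    | _ i A B hN hD =>
      cases ih with
      | form T hX' h =>
        exact .form (.over i T B) (HoleIso.div hX' hD) (.overR i T B (.iso (hD.plug F) h))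
      | mode hn => exact absurd rfl hn

end Translation

/-! ### Extending namings, and distinctness of points. -/

namespace HL

variable {Pr : ℕ → Type x} {k d : ℕ}

theorem sum_singleton {α β : Type*} [Fintype α] (f : α → β) :
    ∑ a, ({f a} : Multiset β) = Finset.univ.val.map f := by
  rw [← Multiset.sum_map_singleton (Finset.univ.val.map f), Multiset.map_map]
  rfl

theorem IsFill.facts_unit {B T : HGraph (Formula Pr) k} {slot : Unit → Fin d → B.V}
    {Z : HGraph (Formula Pr) d} (F : IsFill B slot (fun _ => Z) T) {P : Type} (ν : T.V → P) :
    HL.facts T ν = HL.facts B (fun v => ν (F.inl v)) + HL.facts Z fun v => ν (F.inr () v) := by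
  rw [F.facts]
  simp

theorem IsFill.facts_bool {B T : HGraph (Formula Pr) k} {slot : Bool → Fin d → B.V}
    {G H : HGraph (Formula Pr) d} (F : IsFill B slot (fun s => cond s H G) T) {P : Type}
    (ν : T.V → P) : HL.facts T ν = HL.facts B (fun v => ν (F.inl v)) +
      (HL.facts G fun v => ν (F.inr false v)) + (HL.facts H fun v => ν (F.inr true v)) := by
  rw [F.facts, Fintype.sum_bool, add_assoc]
  exact congrArg _ (add_comm _ _)

/-- If the external nodes of the inserted graph are distinct, gluing imposes no condition on the
names in `B`; the inner nodes receive an arbitrary name. -/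
theorem IsFill.exists_desc {B T : HGraph (Formula Pr) k} {slot : Unit → Fin d → B.V}
    {Z : HGraph (Formula Pr) d} (F : IsFill B slot (fun _ => Z) T)
    (hZ : Function.Injective Z.ext) {P : Type} [Nonempty P] (ν₀ : B.V → P) :
    ∃ ν : T.V → P, ∀ v, ν (F.inl v) = ν₀ v := by
  obtain ⟨ν, h, -⟩ := F.desc ν₀ (fun _ => Function.extend Z.ext (fun i => ν₀ (slot () i))
    fun _ => Classical.arbitrary P) fun _ i =>
      (hZ.extend_apply (fun i => ν₀ (slot () i)) _ i).symm
  exact ⟨ν, h⟩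

theorem IsFill.exists_desc_slot {B T : HGraph (Formula Pr) k} {slot : Unit → Fin d → B.V}
    {Z : HGraph (Formula Pr) d} (F : IsFill B slot (fun _ => Z) T)
    (hB : Function.Injective (slot ())) {P : Type} [Nonempty P] (ν₁ : Z.V → P) :
    ∃ ν : T.V → P, ∀ v, ν (F.inr () v) = ν₁ v := by
  obtain ⟨ν, -, h⟩ := F.desc (Function.extend (slot ()) (fun i => ν₁ (Z.ext i))
    fun _ => Classical.arbitrary P) (fun _ => ν₁) fun _ i => hB.extend_apply _ _ _
  exact ⟨ν, h ()⟩

open Classical in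
/-- The points at the output ports of a fact. -/
noncomputable def Fact.outs (Out : ∀ n, Fin n → Prop) {P : Type} (f : Fact Pr P) : Multiset P :=
  ∑ i : {i : Fin f.1 // Out f.1 i}, {f.2.2 i}

/-- The external points and the points at output ports. -/
noncomputable def points (Out : ∀ n, Fin n → Prop) {P : Type} (t : Fin k → P)
    (S : Multiset (Fact Pr P)) : Multiset P :=
  (∑ i, {t i}) + S.bind (Fact.outs Out)

-- External positions and output ports are sent injectively to nodes, because namings with values in
-- `Prop` separate them.
open Classical in
theorem Gen.nodup {Out : ∀ n, Fin n → Prop} {G : HGraph (Formula Pr) k} (hG : Gen Out G) :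
    (points Out G.ext (facts G id)).Nodup := by
  let Q := Fin k ⊕ Σ y : G.Edge, {i : Fin y.1 // Out y.1 i}
  let node : Q → G.V := Sum.elim G.ext fun q => G.att q.1.1 q.1.2 q.2.1
  have hinj : Function.Injective node := by
    intro q q' h
    by_contra hne
    -- The indicator of the port `q` extends to the nodes and is true at the node of `q` and false
    -- at those of all other ports.
    obtain ⟨ν, ⟨h1, h2⟩, -⟩ := hG Prop (fun i => q = Sum.inl i)
      fun n e i => ∃ hi : Out n i, q = Sum.inr ⟨⟨n, e⟩, i, hi⟩
    have hν : ∀ q₀, ν (node q₀) = (q = q₀) := by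
      rintro (i | ⟨⟨n, e⟩, i, hi⟩)
      · exact h1 i
      · refine (h2 n e i hi).trans ?_
        simp [hi]
    have := hν q'
    rw [← h, hν q] at this
    simp at this
    exact hne this
  have : points Out G.ext (facts G id) = Finset.univ.val.map node := by
    have e : Finset.univ.val.map node = ∑ q : Q, {node q} := (sum_singleton _).symm
    rw [e, points, Fintype.sum_sum_type, Fintype.sum_sigma, facts,
      sum_singleton (fun y => factAt G id y), Multiset.bind_map]
    rfl
  rw [this]
  exact (Finset.univ.nodup).map hinj

end HL

/-! ### Reading multisets of facts as databases. -/

namespace Translation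

open HL

variable {At : Type u} {I : Type v} {J : Type w} {Pr : ℕ → Type x} {k : ℕ}
  (τ : Translation At I J Pr k)

/-- The multiset `S` consists of the facts of the tree of a database whose external nodes are
named `t`. -/
def Tree {P : Type} : NLM.Database At I J → (Fin k → P) → Multiset (Fact Pr P) → Prop
  | .form A, t, S => S = {fact (τ.mu A).cls t}
  | .pair i W W', t, S => ∃ (ν : (τ.bin i).prims.V → P) (S₁ S₂ : Multiset (Fact Pr P)),
      (∀ l, ν ((τ.bin i).prims.ext l) = t l) ∧ S = facts (τ.bin i).prims ν + S₁ + S₂ ∧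
      Tree W (fun l => ν ((τ.bin i).left l)) S₁ ∧ Tree W' (fun l => ν ((τ.bin i).right l)) S₂
  | .bracket j W, t, S => ∃ (ν : (τ.un j).prims.V → P) (S₁ : Multiset (Fact Pr P)),
      (∀ l, ν ((τ.un j).prims.ext l) = t l) ∧ S = facts (τ.un j).prims ν + S₁ ∧
      Tree W (fun l => ν ((τ.un j).slot l)) S₁

/-- `Tree` with a root that contains the fact `f`. -/
def RootAt {P : Type} (f : Fact Pr P) :
    NLM.Database At I J → (Fin k → P) → Multiset (Fact Pr P) → Prop
  | .form A, t, S => f = fact (τ.mu A).cls t ∧ S = {fact (τ.mu A).cls t}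
  | .pair i W W', t, S => ∃ (ν : (τ.bin i).prims.V → P) (S₁ S₂ : Multiset (Fact Pr P)),
      f ∈ facts (τ.bin i).prims ν ∧
      (∀ l, ν ((τ.bin i).prims.ext l) = t l) ∧ S = facts (τ.bin i).prims ν + S₁ + S₂ ∧
      τ.Tree W (fun l => ν ((τ.bin i).left l)) S₁ ∧ τ.Tree W' (fun l => ν ((τ.bin i).right l)) S₂
  | .bracket j W, t, S => ∃ (ν : (τ.un j).prims.V → P) (S₁ : Multiset (Fact Pr P)),
      f ∈ facts (τ.un j).prims ν ∧
      (∀ l, ν ((τ.un j).prims.ext l) = t l) ∧ S = facts (τ.un j).prims ν + S₁ ∧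
      τ.Tree W (fun l => ν ((τ.un j).slot l)) S₁

variable {τ}

theorem Tree.map {P Q : Type} (h : P → Q) {W : NLM.Database At I J} {t : Fin k → P}
    {S : Multiset (Fact Pr P)} (hT : τ.Tree W t S) :
    τ.Tree W (fun l => h (t l)) (S.map (Fact.map h)) := by
  induction W generalizing t S with
  | form A =>
    cases hT
    simp [Tree, Fact.map]
  | pair i W W' ih ih' =>
    obtain ⟨ν, S₁, S₂, h1, rfl, h2, h3⟩ := hT
    exact ⟨fun v => h (ν v), _, _, fun l => congrArg h (h1 l), by
      rw [Multiset.map_add, Multiset.map_add, ← facts_map], ih h2, ih' h3⟩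
  | bracket j W ih =>
    obtain ⟨ν, S₁, h1, rfl, h2⟩ := hT
    exact ⟨fun v => h (ν v), _, fun l => congrArg h (h1 l), by
      rw [Multiset.map_add, ← facts_map], ih h2⟩

/-- Each fact belongs to the root of some subtree. The last clause says that this subtree may be
exchanged for any tree with the same external points, leaving the other facts untouched. -/
theorem Tree.locate {P : Type} {W : NLM.Database At I J} {t : Fin k → P}
    {S : Multiset (Fact Pr P)} (hT : τ.Tree W t S) {f : Fact Pr P} (hf : f ∈ S) :
    ∃ (D : NLM.Ctx At I J) (W₀ : NLM.Database At I J) (t₀ : Fin k → P)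
      (S₀ S' : Multiset (Fact Pr P)), W = D.fill W₀ ∧ S = S' + S₀ ∧ τ.RootAt f W₀ t₀ S₀ ∧
      ∀ W₁ S₁, τ.Tree W₁ t₀ S₁ → τ.Tree (D.fill W₁) t (S' + S₁) := by
  induction W generalizing t S with
  | form A =>
    cases hT
    exact ⟨.hole, _, t, _, 0, rfl, (zero_add _).symm, ⟨Multiset.mem_singleton.1 hf, rfl⟩,
      fun W₁ S₁ h => by rwa [zero_add]⟩
  | pair i W W' ih ih' =>
    obtain ⟨ν, S₁, S₂, h1, rfl, h2, h3⟩ := id hT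
    rw [Multiset.mem_add, Multiset.mem_add] at hf
    rcases hf with (hf | hf) | hf
    · exact ⟨.hole, _, t, _, 0, rfl, (zero_add _).symm, ⟨ν, S₁, S₂, hf, h1, rfl, h2, h3⟩,
        fun W₁ S₁ h => by rwa [zero_add]⟩
    · obtain ⟨D, W₀, t₀, S₀, S', rfl, rfl, hr, hD⟩ := ih h2 hf
      refine ⟨.pairL i D W', W₀, t₀, S₀, facts (τ.bin i).prims ν + S' + S₂, rfl, by abel, hr,
        fun W₁ S₁ h => ⟨ν, S' + S₁, S₂, h1, by abel, hD _ _ h, h3⟩⟩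
    · obtain ⟨D, W₀, t₀, S₀, S', rfl, rfl, hr, hD⟩ := ih' h3 hf
      refine ⟨.pairR i W D, W₀, t₀, S₀, facts (τ.bin i).prims ν + S₁ + S', rfl, by abel, hr,
        fun W₁ S₁' h => ⟨ν, S₁, S' + S₁', h1, by abel, h2, hD _ _ h⟩⟩
  | bracket j W ih =>
    obtain ⟨ν, S₁, h1, rfl, h2⟩ := id hT
    rw [Multiset.mem_add] at hf
    rcases hf with hf | hf
    · exact ⟨.hole, _, t, _, 0, rfl, (zero_add _).symm, ⟨ν, S₁, hf, h1, rfl, h2⟩,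
        fun W₁ S₁ h => by rwa [zero_add]⟩
    · obtain ⟨D, W₀, t₀, S₀, S', rfl, rfl, hr, hD⟩ := ih h2 hf
      refine ⟨.bracket j D, W₀, t₀, S₀, facts (τ.un j).prims ν + S', rfl, by abel, hr,
        fun W₁ S₁ h => ⟨ν, S' + S₁, h1, by abel, hD _ _ h⟩⟩

theorem tree_htree {P : Type} (W : NLM.Database At I J) (ν : (τ.htree W).V → P) :
    τ.Tree W (fun l => ν ((τ.htree W).ext l)) (facts (τ.htree W) ν) := by
  induction W with
  | form A => exact facts_handle _ _
  | pair i W W' ih ih' =>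
    obtain ⟨F⟩ := (τ.bin i).compose_isFill (τ.htree W) (τ.htree W')
    refine ⟨fun v => ν (F.inl v), _, _, fun l => ?_, F.facts_bool ν, ?_, ?_⟩
    · exact congrArg ν (F.ext l).symm
    · convert ih (fun v => ν (F.inr false v)) using 2 with l
      exact congrArg ν (F.glue false l)
    · convert ih' (fun v => ν (F.inr true v)) using 2 with l
      exact congrArg ν (F.glue true l)
  | bracket j W ih =>
    obtain ⟨F⟩ := (τ.un j).compose_isFill (τ.htree W)
    refine ⟨fun v => ν (F.inl v), _, fun l => ?_, F.facts_unit ν, ?_⟩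
    · exact congrArg ν (F.ext l).symm
    · convert ih (fun v => ν (F.inr () v)) using 2 with l
      exact congrArg ν (F.glue () l)

/-- The converse of `tree_htree`: trees in `P` are exactly the images of `htree W` under namings of
its nodes. -/
theorem Tree.exists_naming {P : Type} {W : NLM.Database At I J} {t : Fin k → P}
    {S : Multiset (Fact Pr P)} (hT : τ.Tree W t S) : ∃ ν : (τ.htree W).V → P,
      (∀ l, ν ((τ.htree W).ext l) = t l) ∧ facts (τ.htree W) ν = S := by
  induction W generalizing t S with
  | form A =>
    cases hT
    exact ⟨t, fun _ => rfl, facts_handle _ _⟩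
  | pair i W W' ih ih' =>
    obtain ⟨ν, S₁, S₂, h1, rfl, h2, h3⟩ := hT
    obtain ⟨ν₁, h4, h5⟩ := ih h2
    obtain ⟨ν₂, h6, h7⟩ := ih' h3
    obtain ⟨F⟩ := (τ.bin i).compose_isFill (τ.htree W) (τ.htree W')
    obtain ⟨ν', h8, h9⟩ := F.desc ν (fun s => match s with | false => ν₁ | true => ν₂) (by
      rintro (_ | _) l
      · exact (h4 l).symm
      · exact (h6 l).symm)
    refine ⟨ν', fun l => ?_, (F.facts_bool ν').trans ?_⟩
    · rw [← h1, ← h8]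
      exact congrArg ν' (F.ext l)
    · have e1 : (fun v => ν' (F.inr false v)) = ν₁ := funext (h9 false)
      have e2 : (fun v => ν' (F.inr true v)) = ν₂ := funext (h9 true)
      have e0 : (fun v => ν' (F.inl v)) = ν := funext h8
      exact congrArg₂ (· + ·) (congrArg₂ (· + ·) (congrArg _ e0) ((congrArg _ e1).trans h5))
        ((congrArg _ e2).trans h7)
  | bracket j W ih =>
    obtain ⟨ν, S₁, h1, rfl, h2⟩ := hT
    obtain ⟨ν₁, h4, h5⟩ := ih h2
    obtain ⟨F⟩ := (τ.un j).compose_isFill (τ.htree W)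
    obtain ⟨ν', h8, h9⟩ := F.desc ν (fun _ => ν₁) fun _ l => (h4 l).symm
    refine ⟨ν', fun l => ?_, (F.facts_unit ν').trans ?_⟩
    · rw [← h1, ← h8]
      exact congrArg ν' (F.ext l)
    · have e1 : (fun v => ν' (F.inr () v)) = ν₁ := funext (h9 ())
      have e0 : (fun v => ν' (F.inl v)) = ν := funext h8
      rw [e0, e1, h5]

variable (τ) in
/-- Structural properties of the gadgets of a translation. -/
structure Generated (Out : ∀ n, Fin n → Prop) : Prop extends τ.Proper where
  pos : 0 < k
  not_out : ∀ l : Fin k, ¬ Out k l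
  gen_bin : ∀ i, Gen Out (τ.bin i).prims
  gen_un : ∀ j, Gen Out (τ.un j).prims
  left_injective : ∀ i, Function.Injective (τ.bin i).left
  right_injective : ∀ i, Function.Injective (τ.bin i).right
  slot_injective : ∀ j, Function.Injective (τ.un j).slot

theorem gen_plug {Out : ∀ n, Fin n → Prop} {K : HoleGraph (HL.Formula Pr) k k}
    {Z : HGraph (HL.Formula Pr) k}
    (hK : Gen Out K.toHGraph) (hZ : Gen Out Z) : Gen Out (plug K Z) := by
  obtain ⟨F⟩ := plug_isFill K Z
  exact F.gen hK fun _ => hZ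

section Gen

variable {Out : ∀ n, Fin n → Prop} (hτ : τ.Generated Out)
include hτ

theorem Generated.gen_graph (i : I) (X Y : HL.Formula Pr k) :
    Gen Out ((τ.bin i).graph X Y) :=
  Gen.addEdge (Gen.addEdge (hτ.gen_bin i) hτ.not_out _ _) hτ.not_out _ _

theorem Generated.gen_un_graph (j : J) (X : HL.Formula Pr k) :
    Gen Out ((τ.un j).graph X) :=
  Gen.addEdge (hτ.gen_un j) hτ.not_out _ _

theorem Generated.gen_compose (i : I) {G H : HGraph (HL.Formula Pr) k} (hG : Gen Out G)
    (hH : Gen Out H) : Gen Out ((τ.bin i).compose G H) := by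
  obtain ⟨F⟩ := (τ.bin i).compose_isFill G H
  exact F.gen (hτ.gen_bin i) (by rintro (_ | _) <;> assumption)

theorem Generated.gen_ctx {K : HoleGraph (HL.Formula Pr) k k} {Z : HGraph (HL.Formula Pr) k}
    (h : Gen Out (plug K Z)) (hZ : Gen Out Z) : Gen Out K.toHGraph := by
  obtain ⟨F⟩ := plug_isFill K Z
  exact F.gen_base hτ.pos h fun _ => hZ

theorem Generated.gen_of_plug {K : HoleGraph (HL.Formula Pr) k k} {Z : HGraph (HL.Formula Pr) k}
    (h : Gen Out (plug K Z)) (hK : Gen Out K.toHGraph) (hinj : Function.Injective K.hole) :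
    Gen Out Z := by
  obtain ⟨F⟩ := plug_isFill K Z
  exact F.gen_slot hτ.pos h hK hinj

theorem Generated.gen_un_compose (j : J) {G : HGraph (HL.Formula Pr) k} (hG : Gen Out G) :
    Gen Out ((τ.un j).compose G) := gen_plug (K := (τ.un j).holeGraph) (hτ.gen_un j) hG

theorem Generated.gen_htree (W : NLM.Database At I J) : Gen Out (τ.htree W) := by
  induction W with
  | form A => exact .handle hτ.not_out _
  | pair i W W' ih ih' => exact hτ.gen_compose i ih ih'
  | bracket j W ih => exact hτ.gen_un_compose j ih

/-- Left rules exchange one generated graph for another in a context, which is generated by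
`gen_ctx`; right rules for divisions pass to the content of a slot, which is generated by
`gen_of_plug`. -/
theorem Generated.gen_of_rest {G : HGraph (HL.Formula Pr) k} {T : NLM.Formula At I J}
    (h : τ.Rest G T) : Gen Out G := by
  have hh : ∀ X : HL.Formula Pr k, Gen Out (HGraph.handle X) := .handle hτ.not_out
  induction h with
  | iso h _ ih => exact ih.iso h
  | ax T => exact hh _
  | prodL K i A B T _ ih => exact gen_plug (hτ.gen_ctx ih (hτ.gen_graph _ _ _)) (hh _)
  | diaL K j A T _ ih => exact gen_plug (hτ.gen_ctx ih (hτ.gen_un_graph _ _)) (hh _)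
  | prodR i _ _ ih1 ih2 => exact hτ.gen_compose i ih1 ih2
  | diaR j _ ih => exact hτ.gen_un_compose j ih
  | underL K i A B F T _ _ ih1 ih2 =>
    exact gen_plug (hτ.gen_ctx ih1 (hh _)) (hτ.gen_compose i ih2 (hh _))
  | overL K i A B F T _ _ ih1 ih2 =>
    exact gen_plug (hτ.gen_ctx ih1 (hh _)) (hτ.gen_compose i (hh _) ih2)
  | boxL K j A T _ ih => exact gen_plug (hτ.gen_ctx ih (hh _)) (hτ.gen_un_compose j (hh _))
  | underR i A B _ ih =>
    exact hτ.gen_of_plug ih (Gen.addEdge (hτ.gen_bin i) hτ.not_out _ _) (hτ.right_injective i)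
  | overR i A B _ ih =>
    exact hτ.gen_of_plug ih (Gen.addEdge (hτ.gen_bin i) hτ.not_out _ _) (hτ.left_injective i)
  | boxR j A _ ih => exact hτ.gen_of_plug ih (hτ.gen_un j) (hτ.slot_injective j)

/-- This leads from facts back to hypergraphs: for generated graphs a reading of the facts as a tree
already determines the isomorphism type. -/
theorem Generated.iso_htree {G : HGraph (HL.Formula Pr) k} {W : NLM.Database At I J}
    (hG : Gen Out G) (h : τ.Tree W G.ext (facts G id)) : GraphIso G (τ.htree W) := by
  obtain ⟨ν, h1, h2⟩ := h.exists_naming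
  exact (hG.iso_of_facts (hτ.gen_htree W) ν h1 h2).symm

end Gen

end Translation

/-! ### Private nodes. -/

namespace HL

variable {Pr : ℕ → Type x} {k d : ℕ}

theorem HoleIso.refl (D : HoleGraph (Formula Pr) k d) : HoleIso D D :=
  ⟨Equiv.refl _, fun _ => Equiv.refl _, fun _ _ _ => rfl, fun _ _ => .refl _, fun _ => rfl,
    fun _ => rfl⟩

theorem mem_facts {P : Type} {G : HGraph (Formula Pr) k} {ν : G.V → P} {f : Fact Pr P} :
    f ∈ facts G ν ↔ ∃ y, factAt G ν y = f := by
  rw [facts, sum_singleton]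
  simp

/-- An inner node of `Z` is glued to nothing, because its indicator function together with the
constant `False` on `B` is compatible with the gluing. -/
theorem IsFill.inr_private {B T : HGraph (Formula Pr) k} {slot : Unit → Fin d → B.V}
    {Z : HGraph (Formula Pr) d} (F : IsFill B slot (fun _ => Z) T) {v : Z.V}
    (hv : v ∉ Set.range Z.ext) :
    (∀ v', F.inr () v' = F.inr () v → v' = v) ∧ ∀ u, F.inl u ≠ F.inr () v := by
  obtain ⟨ν, h0, h1⟩ := F.desc (P := Prop) (fun _ => False) (fun _ v' => v' = v)
    fun _ i => (eq_false fun h => hv ⟨i, h⟩).symm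
  refine ⟨fun v' h => ?_, fun u h => ?_⟩
  · rw [← h1 () v', h, h1]
  · rw [← h0 u, h, h1]

theorem IsFill.inl_private {B T : HGraph (Formula Pr) k} {slot : Unit → Fin d → B.V}
    {Z : HGraph (Formula Pr) d} (F : IsFill B slot (fun _ => Z) T) {v : B.V}
    (hv : v ∉ Set.range (slot ())) :
    (∀ v', F.inl v' = F.inl v → v' = v) ∧ ∀ u, F.inr () u ≠ F.inl v := by
  obtain ⟨ν, h0, h1⟩ := F.desc (P := Prop) (fun v' => v' = v) (fun _ _ => False)
    fun _ i => eq_false fun h => hv ⟨i, h⟩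
  refine ⟨fun v' h => ?_, fun u h => ?_⟩
  · rw [← h0 v', h, h0]
  · rw [← h1 () u, h, h0]

/-- The name of the node `v` is not the name of another node and does not occur in `S`. -/
def Private {V P : Type} (ν : V → P) (v : V) (S : Multiset (Fact Pr P)) : Prop :=
  (∀ v', ν v' = ν v → v' = v) ∧ ∀ f ∈ S, ∀ l, f.2.2 l ≠ ν v

theorem IsFill.inr_private_facts {B T : HGraph (Formula Pr) k} {slot : Unit → Fin d → B.V}
    {Z : HGraph (Formula Pr) d} (F : IsFill B slot (fun _ => Z) T) {v : Z.V}
    (hv : v ∉ Set.range Z.ext) : Private (F.inr ()) v (HL.facts B F.inl) := by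
  refine ⟨(F.inr_private hv).1, fun f hf l => ?_⟩
  obtain ⟨y, rfl⟩ := mem_facts.1 hf
  exact (F.inr_private hv).2 _

theorem IsFill.inl_private_facts {B T : HGraph (Formula Pr) k} {slot : Unit → Fin d → B.V}
    {Z : HGraph (Formula Pr) d} (F : IsFill B slot (fun _ => Z) T) {v : B.V}
    (hv : v ∉ Set.range (slot ())) : Private F.inl v (HL.facts Z (F.inr ())) := by
  refine ⟨(F.inl_private hv).1, fun f hf l => ?_⟩
  obtain ⟨y, rfl⟩ := mem_facts.1 hf
  exact (F.inl_private hv).2 _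

end HL

/-! ### From derivable hypergraph sequents to derivable databases. -/

namespace Translation

open HL NLM

variable {At : Type u} {I : Type v} {J : Type w} {Pr : ℕ → Type x} {k : ℕ}
  {τ : Translation At I J Pr k} {C A : Set I} {Out : ∀ n, Fin n → Prop}

theorem Tree.congr {P : Type} {W : NLM.Database At I J} {t t' : Fin k → P}
    {S S' : Multiset (Fact Pr P)} (hW : τ.Tree W t S) (ht : ∀ l, t l = t' l) (hS : S = S') :
    τ.Tree W t' S' := by
  obtain rfl : t = t' := funext ht
  exact hS ▸ hW

theorem Tree.map_facts {P : Type} {W : NLM.Database At I J} {G : HGraph (HL.Formula Pr) k}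
    (hW : τ.Tree W G.ext (facts G id)) (ν : G.V → P) :
    τ.Tree W (fun l => ν (G.ext l)) (facts G ν) :=
  (hW.map ν).congr (fun _ => rfl) (facts_map G id ν).symm

/-- A leaf of a tree can be replaced by a tree. -/
theorem Tree.exists_leaf (hτ : τ.Proper) {P : Type} {W : NLM.Database At I J} {t s : Fin k → P}
    {S : Multiset (Fact Pr P)} {a : Lab Pr k} (hW : τ.Tree W t (S + {fact a s})) :
    ∃ (D : NLM.Ctx At I J) (N : NLM.Formula At I J), W = D.fill (.form N) ∧ (τ.mu N).cls = a ∧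
      ∀ W₁ S₁, τ.Tree W₁ s S₁ → τ.Tree (D.fill W₁) t (S + S₁) := by
  obtain ⟨D, W₀, t₀, S₀, S', rfl, hS, hr, hD⟩ := hW.locate
    (Multiset.mem_add.2 (.inr (Multiset.mem_singleton_self _)))
  -- Labels of gadgets do not have rank `k`, so a fact of rank `k` can only be a leaf.
  have hrank : ∀ {n : ℕ} {R : HGraph Pr n} (hR : ∀ m, R.E m → m ≠ k)
      {ν : R.V → P}, fact a s ∉ facts (R.relabel fun y => HL.Formula.prim (R.lab y.1 y.2)) ν := by
    intro n R hR ν h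
    obtain ⟨y, hy⟩ := mem_facts.1 h
    exact hR y.1 y.2 (congrArg Sigma.fst hy)
  cases W₀ with
  | form N =>
    obtain ⟨h1, rfl⟩ := hr
    rw [← h1] at hS
    obtain rfl := add_right_cancel hS
    obtain ⟨rfl, rfl⟩ : a = (τ.mu N).cls ∧ s = t₀ := by simpa using h1
    exact ⟨D, N, rfl, rfl, hD⟩
  | pair i W₁ W₂ =>
    obtain ⟨ν, S₁, S₂, h, -⟩ := hr
    exact absurd h (hrank (hτ.rank_bin i))
  | bracket j W₁ =>
    obtain ⟨ν, S₁, h, -⟩ := hr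
    exact absurd h (hrank (hτ.rank_un j))

variable (τ) (C A) (Out) in
/-- Conditions under which occurrences of gadgets in trees can be recognized. -/
structure Parses : Prop extends τ.Generated Out where
  -- `bin` and `un` are for the left rules of products and diamonds. The inner points of the gadget
  -- are private, since only its external nodes are glued to the context. The leaf `Z` is left free
  -- because the formula to be formed is built from `X` and `Y`, which agree with the given ones
  -- only up to isomorphism of translations.
  bin : ∀ (P : Type) (W : Database At I J) (t : Fin k → P) (Γ : Multiset (Fact Pr P)) (i : I)
    (ν : (τ.bin i).prims.V → P) (a b : Lab Pr k) (S : Multiset (Fact Pr P)),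
    S = Γ + (facts (τ.bin i).prims ν + {fact a fun l => ν ((τ.bin i).left l)} +
      {fact b fun l => ν ((τ.bin i).right l)}) →
    τ.Tree W t S → (points Out t S).Nodup →
    (∀ v, v ∉ Set.range (τ.bin i).prims.ext → Private ν v Γ ∧ ∀ l, t l ≠ ν v) →
    ∃ (D : Ctx At I J) (X Y : NLM.Formula At I J), a = (τ.mu X).cls ∧ b = (τ.mu Y).cls ∧
      Entails C A W (D.fill (.pair i (.form X) (.form Y))) ∧
      ∀ Z, τ.Tree (D.fill (.form Z)) t
        (Γ + {fact (τ.mu Z).cls fun l => ν ((τ.bin i).prims.ext l)})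
  un : ∀ (P : Type) (W : Database At I J) (t : Fin k → P) (Γ : Multiset (Fact Pr P)) (j : J)
    (ν : (τ.un j).prims.V → P) (a : Lab Pr k) (S : Multiset (Fact Pr P)),
    S = Γ + (facts (τ.un j).prims ν + {fact a fun l => ν ((τ.un j).slot l)}) →
    τ.Tree W t S → (points Out t S).Nodup →
    (∀ v, v ∉ Set.range (τ.un j).prims.ext → Private ν v Γ ∧ ∀ l, t l ≠ ν v) →
    ∃ (D : Ctx At I J) (X : NLM.Formula At I J), a = (τ.mu X).cls ∧
      Entails C A W (D.fill (.bracket j (.form X))) ∧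
      ∀ Z, τ.Tree (D.fill (.form Z)) t
        (Γ + {fact (τ.mu Z).cls fun l => ν ((τ.un j).prims.ext l)})
  -- `right`, `left` and `slot` are for the right rules of divisions and boxes: `Γ` are the facts of
  -- the graph in the hole, which touches the gadget only at the points of the hole.
  right : ∀ (P : Type) (W : Database At I J) (Γ : Multiset (Fact Pr P)) (i : I)
    (ν : (τ.bin i).prims.V → P) (b : Lab Pr k) (S : Multiset (Fact Pr P)),
    S = facts (τ.bin i).prims ν + {fact b fun l => ν ((τ.bin i).left l)} + Γ →
    τ.Tree W (fun l => ν ((τ.bin i).prims.ext l)) S →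
    (points Out (fun l => ν ((τ.bin i).prims.ext l)) S).Nodup →
    (∀ v, v ∉ Set.range (τ.bin i).right → Private ν v Γ) →
    ∃ (Y : NLM.Formula At I J) (W' : Database At I J), b = (τ.mu Y).cls ∧
      Entails C A W (.pair i (.form Y) W') ∧ τ.Tree W' (fun l => ν ((τ.bin i).right l)) Γ
  left : ∀ (P : Type) (W : Database At I J) (Γ : Multiset (Fact Pr P)) (i : I)
    (ν : (τ.bin i).prims.V → P) (b : Lab Pr k) (S : Multiset (Fact Pr P)),
    S = facts (τ.bin i).prims ν + {fact b fun l => ν ((τ.bin i).right l)} + Γ →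
    τ.Tree W (fun l => ν ((τ.bin i).prims.ext l)) S →
    (points Out (fun l => ν ((τ.bin i).prims.ext l)) S).Nodup →
    (∀ v, v ∉ Set.range (τ.bin i).left → Private ν v Γ) →
    ∃ (Y : NLM.Formula At I J) (W' : Database At I J), b = (τ.mu Y).cls ∧
      Entails C A W (.pair i W' (.form Y)) ∧ τ.Tree W' (fun l => ν ((τ.bin i).left l)) Γ
  slot : ∀ (P : Type) (W : Database At I J) (Γ : Multiset (Fact Pr P)) (j : J)
    (ν : (τ.un j).prims.V → P) (S : Multiset (Fact Pr P)), S = facts (τ.un j).prims ν + Γ →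
    τ.Tree W (fun l => ν ((τ.un j).prims.ext l)) S →
    (points Out (fun l => ν ((τ.un j).prims.ext l)) S).Nodup →
    (∀ v, v ∉ Set.range (τ.un j).slot → Private ν v Γ) →
    ∃ W' : Database At I J, Entails C A W (.bracket j W') ∧
      τ.Tree W' (fun l => ν ((τ.un j).slot l)) Γ
  comm : ∀ c ∈ C, ∀ (P : Type) (ν : (τ.bin c).prims.V → P), ∃ ν' : (τ.bin c).prims.V → P,
    (∀ l, ν' ((τ.bin c).prims.ext l) = ν ((τ.bin c).prims.ext l)) ∧
    facts (τ.bin c).prims ν' = facts (τ.bin c).prims ν ∧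
    (∀ l, ν' ((τ.bin c).left l) = ν ((τ.bin c).right l)) ∧
    ∀ l, ν' ((τ.bin c).right l) = ν ((τ.bin c).left l)
  assoc : ∀ a ∈ A, ∀ (P : Type) (W₁ W₂ W₃ : Database At I J) (t : Fin k → P)
    (S : Multiset (Fact Pr P)),
    τ.Tree (.pair a W₁ (.pair a W₂ W₃)) t S ↔ τ.Tree (.pair a (.pair a W₁ W₂) W₃) t S
  injective : ∀ X Y : NLM.Formula At I J, HL.Formula.Iso (τ.mu X) (τ.mu Y) → FEq C X Y

/-- Exchanging the content of a slot: the naming of the base by nodes of the new graph `T'` extends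
over the old content because the external nodes of `Z` are distinct. -/
theorem Tree.transfer {d : ℕ} {B T T' : HGraph (HL.Formula Pr) k} {slot : Unit → Fin d → B.V}
    {Z Z' : HGraph (HL.Formula Pr) d} (F : IsFill B slot (fun _ => Z) T)
    (F' : IsFill B slot (fun _ => Z') T') (hk : 0 < k) (hZ : Function.Injective Z.ext)
    {W : NLM.Database At I J} (hW : τ.Tree W T.ext (facts T id)) :
    ∃ ν : Z.V → T'.V, (∀ l, ν (Z.ext l) = F'.inl (slot () l)) ∧
      τ.Tree W T'.ext (facts B F'.inl + facts Z ν) := by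
  have : Nonempty T'.V := ⟨T'.ext ⟨0, hk⟩⟩
  obtain ⟨ν, hν⟩ := F.exists_desc hZ F'.inl
  refine ⟨fun v => ν (F.inr () v), fun l => (congrArg ν (F.glue () l)).symm.trans (hν _), ?_⟩
  have hν' : (fun v => ν (F.inl v)) = F'.inl := funext hν
  refine (hW.map_facts ν).congr (fun l => ?_) ?_
  · rw [F.ext, F'.ext, hν]
  · rw [F.facts_unit, hν']

theorem Tree.transfer_leaf {d : ℕ} {B T T' : HGraph (HL.Formula Pr) k}
    {slot : Unit → Fin d → B.V} {Z Z' : HGraph (HL.Formula Pr) d}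
    (F : IsFill B slot (fun _ => Z) T) (F' : IsFill B slot (fun _ => Z') T') (hk : 0 < k)
    (hZ : Function.Injective Z.ext) {W : NLM.Database At I J} {a : Lab Pr d}
    (hW : τ.Tree W T.ext (facts B F.inl + {fact a fun l => F.inr () (Z.ext l)})) :
    τ.Tree W T'.ext (facts B F'.inl + {fact a fun l => F'.inl (slot () l)}) := by
  have : Nonempty T'.V := ⟨T'.ext ⟨0, hk⟩⟩
  obtain ⟨ν, hν⟩ := F.exists_desc hZ F'.inl
  have := hW.map ν
  rw [Multiset.map_add, ← facts_map] at this
  convert this using 2 with l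
  · rw [F.ext, F'.ext, hν]
  · exact congrArg _ (funext fun v => (hν v).symm)
  · rw [Multiset.map_singleton]
    refine congrArg _ (congrArg (fact a) (funext fun l => ?_))
    exact (hν _).symm.trans (congrArg ν (F.glue () l))

theorem Tree.plug_handle {K : HoleGraph (HL.Formula Pr) k k} {Z : HGraph (HL.Formula Pr) k}
    (hτ : τ.Generated Out) {X : HL.Formula Pr k} {W : NLM.Database At I J}
    (hW : τ.Tree W (plug K (HGraph.handle X)).ext (facts (plug K (HGraph.handle X)) id))
    {T' : HGraph (HL.Formula Pr) k}
    (F' : IsFill K.toHGraph (fun _ : Unit => K.hole) (fun _ => Z) T') :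
    ∃ (D : NLM.Ctx At I J) (N : NLM.Formula At I J), W = D.fill (.form N) ∧
      HL.Formula.Iso (τ.mu N) X ∧ ∀ W₁, τ.Tree W₁ (fun l => F'.inr () (Z.ext l))
        (facts Z (F'.inr ())) → τ.Tree (D.fill W₁) T'.ext (facts T' id) := by
  obtain ⟨F⟩ := plug_isFill K (HGraph.handle X)
  obtain ⟨ν, h1, h2⟩ := hW.transfer F F' hτ.pos (Gen.handle hτ.not_out X).ext_injective
  have h3 := facts_handle X ν
  rw [h3] at h2
  obtain ⟨D, N, rfl, h4, h5⟩ := h2.exists_leaf hτ.toProper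
  refine ⟨D, N, rfl, HL.Formula.cls_eq_iff.1 h4, fun W₁ h6 => ?_⟩
  rw [F'.facts_unit]
  refine h5 _ _ ?_
  have h7 : ν = fun l => F'.inr () (Z.ext l) := funext fun l => (h1 l).trans (F'.glue () l)
  rwa [h7]

theorem tree_compose {i : I} {G H T' : HGraph (HL.Formula Pr) k}
    (F : IsFill (τ.bin i).prims (τ.bin i).slot (fun s => cond s H G) T') {W₁ W₂ : Database At I J}
    (h1 : τ.Tree W₁ G.ext (facts G id)) (h2 : τ.Tree W₂ H.ext (facts H id)) {P : Type}
    (ν : T'.V → P) : τ.Tree (.pair i W₁ W₂) (fun l => ν (T'.ext l)) (facts T' ν) := by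
  refine ⟨fun v => ν (F.inl v), _, _, fun l => ?_, F.facts_bool ν, ?_, ?_⟩
  · exact congrArg ν (F.ext l).symm
  · exact (h1.map_facts fun v => ν (F.inr false v)).congr
      (fun l => congrArg ν (F.glue false l).symm) rfl
  · exact (h2.map_facts fun v => ν (F.inr true v)).congr
      (fun l => congrArg ν (F.glue true l).symm) rfl

theorem tree_un_compose {j : J} {G T' : HGraph (HL.Formula Pr) k}
    (F : IsFill (τ.un j).prims (fun _ : Unit => (τ.un j).slot) (fun _ => G) T')
    {W : Database At I J} (h1 : τ.Tree W G.ext (facts G id)) {P : Type}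
    (ν : T'.V → P) : τ.Tree (.bracket j W) (fun l => ν (T'.ext l)) (facts T' ν) := by
  refine ⟨fun v => ν (F.inl v), _, fun l => ?_, F.facts_unit ν, ?_⟩
  · exact congrArg ν (F.ext l).symm
  · exact (h1.map_facts fun v => ν (F.inr () v)).congr
      (fun l => congrArg ν (F.glue () l).symm) rfl

theorem tree_handle {X : HL.Formula Pr k} {Y : NLM.Formula At I J}
    (h : HL.Formula.Iso (τ.mu Y) X) : τ.Tree (.form Y) (HGraph.handle X).ext
      (facts (HGraph.handle X) id) := by
  have := facts_handle X id
  rw [← h.cls_eq] at this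
  exact this

namespace Parses

variable (hτ : τ.Parses C A Out)
include hτ

/-- As the slot is injective, the naming of the nodes of `F` in `T` has a left inverse, and the tree
is pulled back along it. -/
theorem exists_slot {B T F : HGraph (HL.Formula Pr) k} {slot : Unit → Fin k → B.V}
    (Φ : IsFill B slot (fun _ => F) T) (hB : Function.Injective (slot ())) {W : Database At I J}
    (h : τ.Tree W (fun l => Φ.inl (slot () l)) (facts F (Φ.inr ()))) :
    τ.Tree W F.ext (facts F id) := by
  have : Nonempty F.V := ⟨F.ext ⟨0, hτ.pos⟩⟩
  obtain ⟨ν, hν⟩ := Φ.exists_desc_slot hB id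
  refine (h.map ν).congr (fun l => (congrArg ν (Φ.glue () l)).trans (hν _)) ?_
  rw [← facts_map]
  exact congrArg _ (funext hν)

/-- Derivable translated sequents are translations of derivable sequents. -/
theorem exists_tree {G : HGraph (HL.Formula Pr) k} {T : NLM.Formula At I J} (h : τ.Rest G T) :
    ∃ W, NLM.Derivable C A W T ∧ τ.Tree W G.ext (facts G id) := by
  induction h with
  | iso h _ ih =>
    obtain ⟨W, hd, hW⟩ := ih
    obtain ⟨f, h1, h2⟩ := h.facts
    exact ⟨W, hd, (hW.map_facts f).congr h1 (h2 id)⟩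
  | ax T => exact ⟨.form T, .ax T, tree_handle (.refl _)⟩
  | prodL K i B B' T hr ih =>
    obtain ⟨W, hd, hW⟩ := ih
    have hg := hτ.gen_of_rest hr
    obtain ⟨F⟩ := plug_isFill K ((τ.bin i).graph (τ.mu B) (τ.mu B'))
    obtain ⟨F'⟩ := plug_isFill K (HGraph.handle (τ.mu (.prod i B B')))
    have hs := (F.facts_unit id).trans (congrArg (_ + ·) (facts_graph _ _ _ (F.inr ())))
    -- The database found for the premise contains the gadget with its two leaves only up to
    -- structural rules; `he` carries them out.
    obtain ⟨D, X, Y, hX, hY, he, ht⟩ := hτ.bin _ W _ _ i (F.inr ()) _ _ _ hs hW hg.nodup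
      fun v hv => ⟨F.inr_private_facts hv, fun l => by
        rw [F.ext]
        exact (F.inr_private hv).2 _⟩
    refine ⟨D.fill (.form (.prod i X Y)), .prodL _ _ _ _ _ (he.derivable hd), ?_⟩
    have h1 := Tree.transfer_leaf F F' hτ.pos (hτ.gen_graph i _ _).ext_injective
      (ht (.prod i X Y))
    have h3 : (τ.mu (.prod i B B')).cls = (τ.mu (.prod i X Y)).cls :=
      (GraphIso.times (BinGadget.graph_congr _ (HL.Formula.cls_eq_iff.1 hX)
        (HL.Formula.cls_eq_iff.1 hY))).cls_eq
    refine h1.congr (fun _ => rfl) ?_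
    rw [F'.facts_unit]
    refine congrArg (_ + ·) (Eq.trans ?_ (facts_handle (τ.mu (.prod i B B')) (F'.inr ())).symm)
    rw [h3]
    exact congrArg _ (congrArg (fact _) (funext fun l => F'.glue () l))
  | diaL K j B T hr ih =>
    obtain ⟨W, hd, hW⟩ := ih
    have hg := hτ.gen_of_rest hr
    obtain ⟨F⟩ := plug_isFill K ((τ.un j).graph (τ.mu B))
    obtain ⟨F'⟩ := plug_isFill K (HGraph.handle (τ.mu (.dia j B)))
    have hs := (F.facts_unit id).trans (congrArg (_ + ·) (facts_un_graph _ _ (F.inr ())))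
    obtain ⟨D, X, hX, he, ht⟩ := hτ.un _ W _ _ j (F.inr ()) _ _ hs hW hg.nodup
      fun v hv => ⟨F.inr_private_facts hv, fun l => by
        rw [F.ext]
        exact (F.inr_private hv).2 _⟩
    refine ⟨D.fill (.form (.dia j X)), .diaL _ _ _ _ (he.derivable hd), ?_⟩
    have h1 := Tree.transfer_leaf F F' hτ.pos (hτ.gen_un_graph j _).ext_injective
      (ht (.dia j X))
    have h3 : (τ.mu (.dia j B)).cls = (τ.mu (.dia j X)).cls :=
      (GraphIso.times (GraphIso.addEdge (f := Equiv.refl _) (g := fun _ => Equiv.refl _)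
        (fun _ _ _ => rfl) (fun _ _ => .refl _) (fun _ => rfl) (fun _ => rfl)
        (HL.Formula.cls_eq_iff.1 hX))).cls_eq
    refine h1.congr (fun _ => rfl) ?_
    rw [F'.facts_unit]
    refine congrArg (_ + ·) (Eq.trans ?_ (facts_handle (τ.mu (.dia j B)) (F'.inr ())).symm)
    rw [h3]
    exact congrArg _ (congrArg (fact _) (funext fun l => F'.glue () l))
  | prodR i _ _ ih1 ih2 =>
    obtain ⟨W₁, hd1, h1⟩ := ih1
    obtain ⟨W₂, hd2, h2⟩ := ih2
    obtain ⟨F⟩ := (τ.bin i).compose_isFill _ _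
    exact ⟨_, .prodR i _ _ _ _ hd1 hd2, tree_compose F h1 h2 id⟩
  | diaR j _ ih =>
    obtain ⟨W, hd, h1⟩ := ih
    obtain ⟨F⟩ := (τ.un j).compose_isFill _
    exact ⟨_, .diaR j _ _ hd, tree_un_compose F h1 id⟩
  | underL K i B B' F T _ _ ih1 ih2 =>
    obtain ⟨W₁, hd1, h1⟩ := ih1
    obtain ⟨W₂, hd2, h2⟩ := ih2
    obtain ⟨F'⟩ := plug_isFill K ((τ.bin i).compose F (HGraph.handle (τ.mu (.under i B' B))))
    obtain ⟨F₂⟩ := (τ.bin i).compose_isFill F (HGraph.handle (τ.mu (.under i B' B)))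
    obtain ⟨D, N, rfl, hN, h3⟩ := h1.plug_handle hτ.toGenerated F'
    exact ⟨_, .underL D i W₂ N B' T hd1 hd2, h3 _ (tree_compose F₂ h2
      (tree_handle (Y := .under i B' N) (HoleIso.div hN (HoleIso.refl _))) _)⟩
  | overL K i B B' F T _ _ ih1 ih2 =>
    obtain ⟨W₁, hd1, h1⟩ := ih1
    obtain ⟨W₂, hd2, h2⟩ := ih2
    obtain ⟨F'⟩ := plug_isFill K ((τ.bin i).compose (HGraph.handle (τ.mu (.over i B B'))) F)
    obtain ⟨F₂⟩ := (τ.bin i).compose_isFill (HGraph.handle (τ.mu (.over i B B'))) F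
    obtain ⟨D, N, rfl, hN, h3⟩ := h1.plug_handle hτ.toGenerated F'
    exact ⟨_, .overL D i W₂ N B' T hd1 hd2, h3 _ (tree_compose F₂
      (tree_handle (Y := .over i N B') (HoleIso.div hN (HoleIso.refl _))) h2 _)⟩
  | boxL K j B T _ ih =>
    obtain ⟨W, hd, h1⟩ := ih
    obtain ⟨F'⟩ := plug_isFill K ((τ.un j).compose (HGraph.handle (τ.mu (.box j B))))
    obtain ⟨F₂⟩ := (τ.un j).compose_isFill (HGraph.handle (τ.mu (.box j B)))
    obtain ⟨D, N, rfl, hN, h3⟩ := h1.plug_handle hτ.toGenerated F'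
    exact ⟨_, .boxL D j N T hd, h3 _ (tree_un_compose F₂
      (tree_handle (Y := .box j N) (HoleIso.div hN (HoleIso.refl _))) _)⟩
  | @underR H i B B' hr ih =>
    obtain ⟨W, hd, hW⟩ := ih
    have hg := hτ.gen_of_rest hr
    obtain ⟨F⟩ := plug_isFill ((τ.bin i).holeRight (τ.mu B')) H
    have hs := F.facts_unit id
    have h1 := facts_addEdge (τ.bin i).prims (τ.bin i).left (τ.mu B') F.inl
    replace hs := hs.trans (congrArg (· + facts _ (F.inr ())) h1)
    have h2 := hg.nodup
    have he : (plug ((τ.bin i).holeRight (τ.mu B')) H).ext = _ := funext F.ext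
    rw [he] at h2 hW
    obtain ⟨Y, W', hY, h3, h4⟩ := hτ.right _ W _ i F.inl _ _ hs hW h2
      fun v hv => F.inl_private_facts hv
    refine ⟨W', ?_, hτ.exists_slot F (hτ.right_injective i) h4⟩
    -- The label of the leaf determines its formula only up to commutativity, and the succedent is
    -- corrected accordingly.
    exact (Derivable.underR i W' _ _ (h3.derivable hd)).of_refines (.refl _)
      (.underCongr (.refl _) (hτ.injective _ _ (HL.Formula.cls_eq_iff.1 hY.symm)))
  | @overR H i B B' hr ih =>
    obtain ⟨W, hd, hW⟩ := ih
    have hg := hτ.gen_of_rest hr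
    obtain ⟨F⟩ := plug_isFill ((τ.bin i).holeLeft (τ.mu B')) H
    have hs := F.facts_unit id
    have h1 := facts_addEdge (τ.bin i).prims (τ.bin i).right (τ.mu B') F.inl
    replace hs := hs.trans (congrArg (· + facts _ (F.inr ())) h1)
    have h2 := hg.nodup
    have he : (plug ((τ.bin i).holeLeft (τ.mu B')) H).ext = _ := funext F.ext
    rw [he] at h2 hW
    obtain ⟨Y, W', hY, h3, h4⟩ := hτ.left _ W _ i F.inl _ _ hs hW h2
      fun v hv => F.inl_private_facts hv
    refine ⟨W', ?_, hτ.exists_slot F (hτ.left_injective i) h4⟩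
    exact (Derivable.overR i W' _ _ (h3.derivable hd)).of_refines (.refl _)
      (.overCongr (.refl _) (hτ.injective _ _ (HL.Formula.cls_eq_iff.1 hY.symm)))
  | @boxR H j B hr ih =>
    obtain ⟨W, hd, hW⟩ := ih
    have hg := hτ.gen_of_rest hr
    obtain ⟨F⟩ := plug_isFill (τ.un j).holeGraph H
    have h2 := hg.nodup
    have he : (plug (τ.un j).holeGraph H).ext = _ := funext F.ext
    rw [he] at h2 hW
    obtain ⟨W', h3, h4⟩ := hτ.slot _ W _ j F.inl _ (F.facts_unit id) hW h2
      fun v hv => F.inl_private_facts hv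
    exact ⟨W', .boxR j W' _ (h3.derivable hd), hτ.exists_slot F (hτ.slot_injective j) h4⟩

end Parses

end Translation

/-! ### From derivable databases to derivable hypergraph sequents. -/

namespace HL

variable {Pr : ℕ → Type x} {k d : ℕ}

theorem Derivable.plug_times {K : HoleGraph (Formula Pr) k d} {M : HGraph (Formula Pr) d}
    {X : Formula Pr k} (h : Derivable (plug K M) X) :
    Derivable (plug K (HGraph.handle (.times M))) X :=
  .iso (addEdge_replace_iso_plug K (.times M) _) (.refl _)
    (.timesL _ (⟨d, Sum.inr .mk⟩ : (K.toHGraph.addEdge K.hole (Formula.times M)).Edge) M X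
      (.iso (addEdge_replace_iso_plug K (.times M) M).symm (.refl _) h))

theorem Derivable.plug_div {m : ℕ} {K : HoleGraph (Formula Pr) k d} {N : Formula Pr d}
    {D : HoleGraph (Formula Pr) d m} {F : ∀ y : D.toHGraph.Edge, HGraph (Formula Pr) y.1}
    {X : Formula Pr k} (h : Derivable (plug K (HGraph.handle N)) X)
    (hF : ∀ y : D.toHGraph.Edge, Derivable (F y) (D.lab y.1 y.2)) :
    Derivable (plug K (D.fill (HGraph.handle (.div N D)) F)) X :=
  .iso (addEdge_replace_iso_plug K N _) (.refl _)
    (.divL _ (⟨d, Sum.inr .mk⟩ : (K.toHGraph.addEdge K.hole N).Edge) N D F X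
      (.iso (addEdge_replace_iso_plug K N (HGraph.handle N)).symm (.refl _) h) hF)

end HL

namespace BinGadget

open HL

variable {Pr : ℕ → Type x} {k : ℕ} (R : BinGadget Pr k)

/-- The hypergraphs that replace the hyperedges of `R(A, B)`, the primitive ones being kept. -/
def parts (A B : HL.Formula Pr k) (G H : HGraph (HL.Formula Pr) k) :
    ∀ y : (R.graph A B).Edge, HGraph (HL.Formula Pr) y.1
  | ⟨n, Sum.inl (Sum.inl e)⟩ => HGraph.handle (.prim (R.base.lab n e))
  | ⟨_, Sum.inl (Sum.inr .mk)⟩ => G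
  | ⟨_, Sum.inr .mk⟩ => H

/-- The hypergraphs that replace the hyperedges of a gadget with one hole. -/
def holeParts (s : Fin k → R.base.V) (B : HL.Formula Pr k) (G : HGraph (HL.Formula Pr) k) :
    ∀ y : (R.prims.addEdge s B).Edge, HGraph (HL.Formula Pr) y.1
  | ⟨n, Sum.inl e⟩ => HGraph.handle (.prim (R.base.lab n e))
  | ⟨_, Sum.inr .mk⟩ => G

theorem derivable_holeParts (s : Fin k → R.base.V) {B : HL.Formula Pr k}
    {G : HGraph (HL.Formula Pr) k} (h : Derivable G B) (y : (R.prims.addEdge s B).Edge) :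
    Derivable (R.holeParts s B G y) ((R.prims.addEdge s B).lab y.1 y.2) := by
  rcases y with ⟨n, e | e⟩
  · exact .ax _
  · cases e
    exact h

theorem derivable_compose {A B : HL.Formula Pr k} {G H : HGraph (HL.Formula Pr) k}
    (hG : Derivable G A) (hH : Derivable H B) :
    Derivable (R.compose G H) (.times (R.graph A B)) := by
  refine .iso ?_ (.refl _) (.timesR (R.graph A B) (R.parts A B G H) ?_)
  · refine HGraph.subst_congr (Equiv.refl _) (fun n => Equiv.refl _) (fun _ _ _ => rfl)
      (fun _ => rfl) ?_
    rintro ⟨n, (e | e) | e⟩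
    · exact GraphIso.refl _
    · cases e
      exact GraphIso.refl _
    · cases e
      exact GraphIso.refl _
  · rintro ⟨n, (e | e) | e⟩
    · exact .ax _
    · cases e
      exact hG
    · cases e
      exact hH

theorem fill_holeRight_iso (B : HL.Formula Pr k) (G H : HGraph (HL.Formula Pr) k) :
    GraphIso ((R.holeRight B).fill H (R.holeParts R.left B G)) (R.compose G H) := by
  refine HGraph.subst_congr (Equiv.refl _) (fun n => Equiv.refl _) (fun _ _ _ => rfl)
    (fun _ => rfl) ?_
  rintro ⟨n, (e | e) | e⟩
  · exact GraphIso.refl _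
  · cases e
    exact GraphIso.refl _
  · cases e
    exact GraphIso.refl _

theorem fill_holeLeft_iso (B : HL.Formula Pr k) (G H : HGraph (HL.Formula Pr) k) :
    GraphIso ((R.holeLeft B).fill G (R.holeParts R.right B H)) (R.compose G H) := by
  refine HGraph.subst_congr (Equiv.refl _) (fun n =>
    { toFun := fun e => match e with
        | Sum.inl (Sum.inl e) => Sum.inl (Sum.inl e)
        | Sum.inl (Sum.inr o) => Sum.inr o
        | Sum.inr o => Sum.inl (Sum.inr o)
      invFun := fun e => match e with
        | Sum.inl (Sum.inl e) => Sum.inl (Sum.inl e)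
        | Sum.inl (Sum.inr o) => Sum.inr o
        | Sum.inr o => Sum.inl (Sum.inr o)
      left_inv := by rintro ((e | o) | o) <;> rfl
      right_inv := by rintro ((e | o) | o) <;> rfl }) ?_ (fun _ => rfl) ?_
  · rintro n ((e | o) | o) i <;> rfl
  · rintro ⟨n, (e | e) | e⟩
    · exact GraphIso.refl _
    · cases e
      exact GraphIso.refl _
    · cases e
      exact GraphIso.refl _

theorem plug_holeRight_iso (B : HL.Formula Pr k) (H : HGraph (HL.Formula Pr) k) :
    GraphIso (plug (R.holeRight B) H) (R.compose (HGraph.handle B) H) := by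
  refine HGraph.subst_congr (Equiv.refl _) (fun n => Equiv.refl _) (fun _ _ _ => rfl)
    (fun _ => rfl) ?_
  rintro ⟨n, (e | e) | e⟩
  · exact GraphIso.refl _
  · cases e
    exact GraphIso.refl _
  · cases e
    exact GraphIso.refl _

theorem plug_holeLeft_iso (B : HL.Formula Pr k) (G : HGraph (HL.Formula Pr) k) :
    GraphIso (plug (R.holeLeft B) G) (R.compose G (HGraph.handle B)) := by
  refine GraphIso.trans ?_ (R.fill_holeLeft_iso B G (HGraph.handle B))
  refine HGraph.subst_congr (Equiv.refl _) (fun n => Equiv.refl _) (fun _ _ _ => rfl)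
    (fun _ => rfl) ?_
  rintro ⟨n, (e | e) | e⟩
  · exact GraphIso.refl _
  · cases e
    exact GraphIso.refl _
  · cases e
    exact GraphIso.refl _

end BinGadget

namespace UnGadget

open HL

variable {Pr : ℕ → Type x} {k : ℕ} (U : UnGadget Pr k)

/-- The hypergraphs that replace the hyperedges of `U(A)`, the primitive ones being kept. -/
def parts (A : HL.Formula Pr k) (G : HGraph (HL.Formula Pr) k) :
    ∀ y : (U.graph A).Edge, HGraph (HL.Formula Pr) y.1
  | ⟨n, Sum.inl e⟩ => HGraph.handle (.prim (U.base.lab n e))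
  | ⟨_, Sum.inr .mk⟩ => G

theorem derivable_compose {A : HL.Formula Pr k} {G : HGraph (HL.Formula Pr) k}
    (hG : Derivable G A) : Derivable (U.compose G) (.times (U.graph A)) := by
  refine .iso ?_ (.refl _) (.timesR (U.graph A) (U.parts A G) ?_)
  · refine HGraph.subst_congr (Equiv.refl _) (fun n => Equiv.refl _) (fun _ _ _ => rfl)
      (fun _ => rfl) ?_
    rintro ⟨n, e | e⟩
    · exact GraphIso.refl _
    · cases e
      exact GraphIso.refl _
  · rintro ⟨n, e | e⟩
    · exact .ax _
    · cases e
      exact hG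

end UnGadget

namespace Translation

open HL NLM

variable {At : Type u} {I : Type v} {J : Type w} {Pr : ℕ → Type x} {k : ℕ}
  {τ : Translation At I J Pr k} {C A : Set I} {Out : ∀ n, Fin n → Prop}

theorem Tree.fill_mono {P : Type} {W W' : Database At I J}
    (h : ∀ (t : Fin k → P) S, τ.Tree W t S → τ.Tree W' t S) (D : Ctx At I J) {t : Fin k → P}
    {S : Multiset (Fact Pr P)} (hW : τ.Tree (D.fill W) t S) : τ.Tree (D.fill W') t S := by
  induction D generalizing t S with
  | hole => exact h _ _ hW
  | pairL i D Q ih =>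
    obtain ⟨ν, S₁, S₂, h1, h2, h3, h4⟩ := hW
    exact ⟨ν, S₁, S₂, h1, h2, ih h3, h4⟩
  | pairR i Q D ih =>
    obtain ⟨ν, S₁, S₂, h1, h2, h3, h4⟩ := hW
    exact ⟨ν, S₁, S₂, h1, h2, h3, ih h4⟩
  | bracket j D ih =>
    obtain ⟨ν, S₁, h1, h2, h3⟩ := hW
    exact ⟨ν, S₁, h1, h2, ih h3⟩

theorem Tree.card_pos {P : Type} {W : Database At I J} {t : Fin k → P}
    {S : Multiset (Fact Pr P)} (hW : τ.Tree W t S) : 0 < Multiset.card S := by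
  induction W generalizing t S with
  | form X =>
    cases hW
    simp
  | pair i P Q ih1 ih2 =>
    obtain ⟨ν, S₁, S₂, -, rfl, h4, h5⟩ := hW
    have := ih1 h4
    simp only [Multiset.card_add]
    omega
  | bracket j P ih =>
    obtain ⟨ν, S₁, -, rfl, h4⟩ := hW
    have := ih h4
    simp only [Multiset.card_add]
    omega

/-- A pair has at least one fact in each of its two parts. A bracket has one in its content and, by
`edge_un`, one in its gadget. -/
theorem Tree.eq_form (hτ : τ.Proper) {P : Type} {W : Database At I J} {t : Fin k → P}
    {S : Multiset (Fact Pr P)} (hW : τ.Tree W t S) (hS : Multiset.card S = 1) :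
    ∃ X, W = .form X ∧ S = {fact (τ.mu X).cls t} := by
  cases W with
  | form X => exact ⟨X, rfl, hW⟩
  | pair i P Q =>
    obtain ⟨ν, S₁, S₂, -, rfl, h4, h5⟩ := hW
    have h4 := h4.card_pos
    have h5 := h5.card_pos
    simp only [Multiset.card_add] at hS
    omega
  | bracket j P =>
    obtain ⟨ν, S₁, -, rfl, h4⟩ := hW
    have h4 := h4.card_pos
    have h5 : 0 < Multiset.card (facts (τ.un j).prims ν) := by
      rw [card_facts]
      have : Nonempty (τ.un j).prims.Edge := hτ.edge_un j
      exact Fintype.card_pos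
    simp only [Multiset.card_add] at hS
    omega

namespace Generated

variable (hτ : τ.Generated Out)
include hτ

/-- The hole graph is built along the context in the way `htree` is built along a database. Only its
facts are followed; isomorphisms are obtained afterwards from `iso_htree`. -/
theorem exists_ctx (D : Ctx At I J) : ∃ K : HoleGraph (HL.Formula Pr) k k, Gen Out K.toHGraph ∧
    ∀ (P : Type) (ν : K.V → P) (W : Database At I J) (S : Multiset (Fact Pr P)),
      τ.Tree W (fun l => ν (K.hole l)) S →
      τ.Tree (D.fill W) (fun l => ν (K.ext l)) (facts K.toHGraph ν + S) := by
  induction D with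
  | hole =>
    refine ⟨{ toHGraph := HGraph.discrete k id, hole := id }, Gen.discrete, fun P ν W S h => ?_⟩
    refine h.congr (fun _ => rfl) ?_
    exact ((congrArg (· + S) (facts_eq_zero (HGraph.discrete k id) ν)).trans (zero_add S)).symm
  | pairL i D Q ih =>
    obtain ⟨K, hK, h⟩ := ih
    obtain ⟨F⟩ := (τ.bin i).compose_isFill K.toHGraph (τ.htree Q)
    refine ⟨{ toHGraph := (τ.bin i).compose K.toHGraph (τ.htree Q)
              hole := fun l => F.inr false (K.hole l) },
      hτ.gen_compose i hK (hτ.gen_htree Q), fun P ν W S hW => ?_⟩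
    refine ⟨fun v => ν (F.inl v), _, _, fun l => congrArg ν (F.ext l).symm, ?_,
      (h P (fun v => ν (F.inr false v)) W S hW).congr
        (fun l => congrArg ν (F.glue false l).symm) rfl,
      (tree_htree Q (fun v => ν (F.inr true v))).congr
        (fun l => congrArg ν (F.glue true l).symm) rfl⟩
    refine (congrArg (· + S) (F.facts_bool ν)).trans ?_
    abel
  | pairR i Q D ih =>
    obtain ⟨K, hK, h⟩ := ih
    obtain ⟨F⟩ := (τ.bin i).compose_isFill (τ.htree Q) K.toHGraph
    refine ⟨{ toHGraph := (τ.bin i).compose (τ.htree Q) K.toHGraph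
              hole := fun l => F.inr true (K.hole l) },
      hτ.gen_compose i (hτ.gen_htree Q) hK, fun P ν W S hW => ?_⟩
    refine ⟨fun v => ν (F.inl v), _, _, fun l => congrArg ν (F.ext l).symm, ?_,
      (tree_htree Q (fun v => ν (F.inr false v))).congr
        (fun l => congrArg ν (F.glue false l).symm) rfl,
      (h P (fun v => ν (F.inr true v)) W S hW).congr
        (fun l => congrArg ν (F.glue true l).symm) rfl⟩
    refine (congrArg (· + S) (F.facts_bool ν)).trans ?_
    abel
  | bracket j D ih =>
    obtain ⟨K, hK, h⟩ := ih
    obtain ⟨F⟩ := (τ.un j).compose_isFill K.toHGraph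
    refine ⟨{ toHGraph := (τ.un j).compose K.toHGraph
              hole := fun l => F.inr () (K.hole l) },
      hτ.gen_un_compose j hK, fun P ν W S hW => ?_⟩
    refine ⟨fun v => ν (F.inl v), _, fun l => congrArg ν (F.ext l).symm, ?_,
      (h P (fun v => ν (F.inr () v)) W S hW).congr
        (fun l => congrArg ν (F.glue () l).symm) rfl⟩
    refine (congrArg (· + S) (F.facts_unit ν)).trans ?_
    abel

/-- Databases in context are translated to hypergraphs in context. -/
theorem exists_ctx_iso (D : Ctx At I J) : ∃ K : HoleGraph (HL.Formula Pr) k k,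
    ∀ (Z : HGraph (HL.Formula Pr) k) (W : Database At I J), Gen Out Z →
      τ.Tree W Z.ext (facts Z id) → GraphIso (plug K Z) (τ.htree (D.fill W)) := by
  obtain ⟨K, hK, h⟩ := hτ.exists_ctx D
  refine ⟨K, fun Z W hZ hW => hτ.iso_htree (gen_plug hK hZ) ?_⟩
  obtain ⟨F⟩ := plug_isFill K Z
  refine (h _ F.inl W _ ((hW.map_facts (F.inr ())).congr (fun l => (F.glue () l).symm) rfl)).congr
    (fun l => (F.ext l).symm) (F.facts_unit id).symm

/-- The structural rules reduce to this: it suffices that every multiset that reads as `W` also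
reads as `W'`, and one direction is enough. -/
theorem iso_of_tree_imp {W W' : Database At I J}
    (h : ∀ (P : Type) (t : Fin k → P) S, τ.Tree W t S → τ.Tree W' t S) (D : Ctx At I J) :
    GraphIso (τ.htree (D.fill W)) (τ.htree (D.fill W')) :=
  hτ.iso_htree (hτ.gen_htree _) ((tree_htree (D.fill W) id).fill_mono (h _) D)

theorem gen_handle (X : HL.Formula Pr k) : Gen Out (HGraph.handle X) := .handle hτ.not_out X

theorem derivable_prodL {D : Ctx At I J} {i : I} {X Y : NLM.Formula At I J}
    {T : HL.Formula Pr k}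
    (h : HL.Derivable (τ.htree (D.fill (.pair i (.form X) (.form Y)))) T) :
    HL.Derivable (τ.htree (D.fill (.form (.prod i X Y)))) T := by
  obtain ⟨K, hK⟩ := hτ.exists_ctx_iso D
  have h1 := hK ((τ.bin i).graph (τ.mu X) (τ.mu Y)) (.pair i (.form X) (.form Y))
    (hτ.gen_graph i _ _) ⟨id, _, _, fun _ => rfl, facts_graph _ _ _ id, rfl, rfl⟩
  exact .iso (hK _ _ (hτ.gen_handle _) (tree_handle (.refl (τ.mu (.prod i X Y))))) (.refl _)
    (.plug_times (.iso h1.symm (.refl _) h))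

theorem derivable_diaL {D : Ctx At I J} {j : J} {X : NLM.Formula At I J} {T : HL.Formula Pr k}
    (h : HL.Derivable (τ.htree (D.fill (.bracket j (.form X)))) T) :
    HL.Derivable (τ.htree (D.fill (.form (.dia j X)))) T := by
  obtain ⟨K, hK⟩ := hτ.exists_ctx_iso D
  have h1 := hK ((τ.un j).graph (τ.mu X)) (.bracket j (.form X))
    (hτ.gen_un_graph j _) ⟨id, _, fun _ => rfl, facts_un_graph _ _ id, rfl⟩
  exact .iso (hK _ _ (hτ.gen_handle _) (tree_handle (.refl (τ.mu (.dia j X))))) (.refl _)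
    (.plug_times (.iso h1.symm (.refl _) h))

/-- Applying the left rules for products and diamonds bottom-up collapses a database in any context
to one formula. -/
theorem derivable_toFormula {W : Database At I J} (D : Ctx At I J) {T : HL.Formula Pr k}
    (h : HL.Derivable (τ.htree (D.fill W)) T) :
    HL.Derivable (τ.htree (D.fill (.form W.toFormula))) T := by
  induction W generalizing D with
  | form X => exact h
  | pair i P Q ih1 ih2 =>
    have h1 := ih1 (D.comp (.pairL i .hole Q)) (by rwa [Ctx.fill_comp])
    rw [Ctx.fill_comp] at h1
    have h2 := ih2 (D.comp (.pairR i (.form P.toFormula) .hole)) (by rwa [Ctx.fill_comp])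
    rw [Ctx.fill_comp] at h2
    exact hτ.derivable_prodL h2
  | bracket j P ih =>
    have h1 := ih (D.comp (.bracket j .hole)) (by rwa [Ctx.fill_comp])
    rw [Ctx.fill_comp] at h1
    exact hτ.derivable_diaL h1

end Generated

namespace Parses

variable (hτ : τ.Parses C A Out)
include hτ

theorem derivable_htree {W : Database At I J} {T : NLM.Formula At I J}
    (h : NLM.Derivable C A W T) : HL.Derivable (τ.htree W) (τ.mu T) := by
  induction h with
  | ax X => exact .ax _
  | prodL D i X Y Z _ ih => exact hτ.derivable_prodL ih
  | prodR i P Q X Y _ _ ih1 ih2 => exact (τ.bin i).derivable_compose ih1 ih2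
  | underL D i P X Y Z _ _ ih1 ih2 =>
    obtain ⟨K, hK⟩ := hτ.exists_ctx_iso D
    have h1 := hK _ _ (hτ.gen_handle _) (tree_handle (.refl (τ.mu X)))
    have h2 := hK _ _ (hτ.gen_htree _) (tree_htree (.pair i P (.form (.under i Y X))) id)
    refine .iso ((plug_congr K ((τ.bin i).fill_holeRight_iso (τ.mu Y) _ _)).trans h2) (.refl _) ?_
    exact .plug_div (.iso h1.symm (.refl _) ih1)
      ((τ.bin i).derivable_holeParts (τ.bin i).left ih2)
  | underR i P X Y _ ih =>
    exact .divR _ _ _ (.iso ((τ.bin i).plug_holeRight_iso (τ.mu Y) (τ.htree P)).symm (.refl _) ih)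
  | overL D i P X Y Z _ _ ih1 ih2 =>
    obtain ⟨K, hK⟩ := hτ.exists_ctx_iso D
    have h1 := hK _ _ (hτ.gen_handle _) (tree_handle (.refl (τ.mu X)))
    have h2 := hK _ _ (hτ.gen_htree _) (tree_htree (.pair i (.form (.over i X Y)) P) id)
    refine .iso ((plug_congr K ((τ.bin i).fill_holeLeft_iso (τ.mu Y) _ _)).trans h2) (.refl _) ?_
    exact .plug_div (.iso h1.symm (.refl _) ih1)
      ((τ.bin i).derivable_holeParts (τ.bin i).right ih2)
  | overR i P X Y _ ih =>
    exact .divR _ _ _ (.iso ((τ.bin i).plug_holeLeft_iso (τ.mu Y) (τ.htree P)).symm (.refl _) ih)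
  | diaL D j X Z _ ih => exact hτ.derivable_diaL ih
  | diaR j P X _ ih => exact (τ.un j).derivable_compose ih
  | boxL D j X Z _ ih =>
    obtain ⟨K, hK⟩ := hτ.exists_ctx_iso D
    have h1 := hK _ _ (hτ.gen_handle _) (tree_handle (.refl (τ.mu X)))
    have h2 := hK _ _ (hτ.gen_htree _) (tree_htree (.bracket j (.form (.box j X))) id)
    have h3 := HL.Derivable.plug_div (D := (τ.un j).holeGraph)
      (F := fun y => HGraph.handle ((τ.un j).holeGraph.lab y.1 y.2))
      (.iso h1.symm (.refl _) ih) fun y => .ax _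
    exact .iso h2 (.refl _) h3
  | boxR j P X _ ih => exact .divR _ _ _ ih
  | perm D c hc P Q Z _ ih =>
    -- The facts of the gadget stay the same when its two slots are exchanged by renaming the inner
    -- nodes.
    refine .iso (hτ.iso_of_tree_imp (fun P' t S h => ?_) D) (.refl _) ih
    obtain ⟨ν, S₁, S₂, h1, h2, h3, h4⟩ := h
    obtain ⟨ν', h5, h6, h7, h8⟩ := hτ.comm c hc P' ν
    exact ⟨ν', S₂, S₁, fun l => (h5 l).trans (h1 l), by rw [h6, h2]; abel,
      h4.congr (fun l => (h7 l).symm) rfl, h3.congr (fun l => (h8 l).symm) rfl⟩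
  | assocL D a ha P Q R Z _ ih =>
    exact .iso (hτ.iso_of_tree_imp (fun P' t S => (hτ.assoc a ha P' P Q R t S).1) D) (.refl _) ih
  | assocR D a ha P Q R Z _ ih =>
    exact .iso (hτ.iso_of_tree_imp (fun P' t S => (hτ.assoc a ha P' P Q R t S).2) D) (.refl _) ih

theorem exists_database {G : HGraph (HL.Formula Pr) k} {X : HL.Formula Pr k} (hG : τ.Labelled G)
    (hX : ∃ T, HL.Formula.Iso X (τ.mu T)) (h : HL.Derivable G X) :
    ∃ (W : Database At I J) (T : NLM.Formula At I J),
      GraphIso G (τ.htree W) ∧ HL.Formula.Iso X (τ.mu T) ∧ NLM.Derivable C A W T := by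
  obtain ⟨T, hT⟩ := hX
  obtain ⟨T, hT, hr⟩ := (claim_of_derivable hτ.toProper h hG (.form T X hT)).exists_rest
  obtain ⟨W, hd, hW⟩ := hτ.exists_tree hr
  exact ⟨W, T, hτ.iso_htree (hτ.gen_of_rest hr) hW, hT, hd⟩

/-- `exists_tree` only yields some database with the same hypergraph, and comparing two databases
with isomorphic hypergraphs would mean tracing structural rules. Collapsing `W` to a formula first
avoids this: the antecedent is then a handle, its reading is a single formula that is determined up
to commutativity, and `Refines` expands it to `W`. -/
theorem derivable_of_htree {W : Database At I J} {T : NLM.Formula At I J}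
    (h : HL.Derivable (τ.htree W) (τ.mu T)) : NLM.Derivable C A W T := by
  have h1 : HL.Derivable (HGraph.handle (τ.mu W.toFormula)) (τ.mu T) :=
    hτ.derivable_toFormula .hole h
  obtain ⟨T', hT, hr⟩ := (claim_of_derivable hτ.toProper h1 (.handle (isLabel_mu _))
    (isLabel_mu T)).exists_rest
  obtain ⟨W', hd, hW⟩ := hτ.exists_tree hr
  have h2 := facts_handle (τ.mu W.toFormula) (id : Fin k → Fin k)
  replace hW := hW.congr (fun _ => rfl) h2
  -- The hypergraph is a handle, so its reading has exactly one fact.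
  obtain ⟨X, rfl, h3⟩ := hW.eq_form hτ.toProper (Multiset.card_singleton _)
  have h4 := (Prod.mk.inj (eq_of_heq (Sigma.mk.inj (Multiset.singleton_inj.1 h3)).2)).1
  exact (hd.of_refines (.form (hτ.injective _ _ (HL.Formula.cls_eq_iff.1 h4.symm)))
    (hτ.injective _ _ hT.symm)).of_refines (refines_toFormula W) (.refl _)

theorem embeds : τ.Embeds C A :=
  ⟨fun _ _ => hτ.derivable_htree, fun _ _ => hτ.derivable_of_htree,
    fun _ _ hG hX h => hτ.exists_database hG hX h⟩

end Parses

end Translation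

/-! ### Facts with primitive labels. -/

namespace HL

variable {Pr : ℕ → Type x} {k d : ℕ}

theorem cls_prim_inj {n : ℕ} {p q : Pr n} :
    (Formula.prim p).cls = (Formula.prim q).cls ↔ p = q := by
  rw [Formula.cls_eq_iff]
  refine ⟨fun h => ?_, fun h => h ▸ .refl _⟩
  have := h.eq_of_prim
  cases this
  rfl

/-- A fact about a primitive label. -/
abbrev pfact {P : Type} {n : ℕ} (p : Pr n) (t : Fin n → P) : Fact Pr P :=
  fact (Formula.prim p).cls t

theorem fact_inj {P : Type} {n : ℕ} {a b : Lab Pr n} {s t : Fin n → P} :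
    fact a s = fact b t ↔ a = b ∧ s = t := by
  constructor
  · intro h
    cases h
    exact ⟨rfl, rfl⟩
  · rintro ⟨rfl, rfl⟩
    rfl

theorem pfact_inj {P : Type} {n : ℕ} {p q : Pr n} {s t : Fin n → P} :
    pfact p s = pfact q t ↔ p = q ∧ s = t := by
  rw [fact_inj, cls_prim_inj]

/-- A graph labelled by primitive formulas. -/
def ofPrims (G : HGraph Pr k) : HGraph (Formula Pr) k :=
  G.relabel fun y => Formula.prim (G.lab y.1 y.2)

theorem facts_ofPrims_addEdge {P : Type} (G : HGraph Pr k) (pos : Fin d → G.V) (p : Pr d)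
    (ν : G.V → P) : facts (ofPrims (G.addEdge pos p)) ν =
      facts (ofPrims G) ν + {pfact p fun i => ν (pos i)} := by
  -- Relabelling commutes with `addEdge` only after a case distinction on hyperedges, so the
  -- labelling is rewritten as a function.
  have h : (fun n e => Formula.prim ((G.addEdge pos p).lab n e)) =
      ((ofPrims G).addEdge pos (Formula.prim p)).lab := by
    funext n e
    rcases e with e | e
    · rfl
    · cases e
      rfl
  exact (congrArg (fun lab => facts (k := k) ⟨G.V, _, (G.addEdge pos p).att, lab, G.ext, G.finV,
    (G.addEdge pos p).finE⟩ ν) h).trans (facts_addEdge (ofPrims G) pos (.prim p) ν)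

theorem facts_ofPrims_discrete {P : Type} (m : ℕ) (ext : Fin k → Fin m) (ν : Fin m → P) :
    facts (ofPrims (HGraph.discrete (L := Pr) m ext)) ν = 0 := by
  have : IsEmpty (ofPrims (HGraph.discrete (L := Pr) m ext)).Edge := ⟨fun e => Empty.elim e.2⟩
  exact facts_eq_zero _ _

theorem facts_ofPrims_single {P : Type} (m : ℕ) (ext : Fin k → Fin m) (pos : Fin d → Fin m)
    (p : Pr d) (ν : Fin m → P) :
    facts (ofPrims ((HGraph.discrete (L := Pr) m ext).addEdge pos p)) ν =
      {pfact p fun i => ν (pos i)} := by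
  refine (facts_ofPrims_addEdge _ _ _ _).trans ?_
  exact (congrArg (· + _) (facts_ofPrims_discrete m ext ν)).trans (zero_add _)

theorem pfact_congr {P : Type} {n : ℕ} {p : Pr n} {s t : Fin n → P} (h : ∀ i, s i = t i) :
    ({pfact p s} : Multiset (Fact Pr P)) = {pfact p t} := by rw [funext h]

end HL

/-! ### Gadgets of rank two: five kinds of modes, and the modalities. -/

section Kinds

variable {Pr : ℕ → Type x}

/-- A gadget for a commutative mode in the presence of parallel composition. -/
def symGadget (p : Pr 4) (q : Pr 3) : BinGadget Pr 2 where
  base := (((HGraph.discrete 6 ![0, 1]).addEdge (![0, 1, 2, 3] : Fin 4 → Fin 6) p).addEdge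
    (![2, 3, 4] : Fin 3 → Fin 6) q).addEdge (![2, 3, 5] : Fin 3 → Fin 6) q
  left := (![2, 4] : Fin 2 → Fin 6)
  right := (![2, 5] : Fin 2 → Fin 6)

/-- Parallel composition, for a commutative associative mode. -/
def parGadget (p : Pr 0) : BinGadget Pr 2 where
  base := (HGraph.discrete 2 ![0, 1]).addEdge (![] : Fin 0 → Fin 2) p
  left := (![0, 1] : Fin 2 → Fin 2)
  right := (![0, 1] : Fin 2 → Fin 2)

/-- The kinds of modes. -/
inductive Kind (Pr : ℕ → Type x) : Type x
  | tree (p : Pr 6)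
  | quad (p : Pr 4)
  | series (p : Pr 1)
  | sym (p : Pr 4) (q : Pr 3)
  | par (p : Pr 0)

namespace Kind

/-- The gadget of a kind. -/
def gadget : Kind Pr → BinGadget Pr 2
  | tree p => barR p
  | quad p => barK p
  | series p => barO p
  | sym p q => symGadget p q
  | par p => parGadget p

/-- The label by which a mode is recognized. -/
def label : Kind Pr → Σ n, Pr n
  | tree p => ⟨6, p⟩
  | quad p => ⟨4, p⟩
  | series p => ⟨1, p⟩
  | sym p _ => ⟨4, p⟩
  | par p => ⟨0, p⟩

/-- The kinds of commutative modes. -/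
def IsComm : Kind Pr → Prop
  | tree _ => False
  | quad _ => True
  | series _ => False
  | sym _ _ => True
  | par _ => True

/-- The kinds of associative modes. -/
def IsAssoc : Kind Pr → Prop
  | tree _ => False
  | quad _ => False
  | series _ => True
  | sym _ _ => False
  | par _ => True

open HL

/-- `K.Frame x y B l l' r r'` says that `B` consists of the facts of the gadget with external points
`x, y`, the left slot being `l, l'` and the right slot being `r, r'`. -/
def Frame {P : Type} (x y : P) (B : Multiset (Fact Pr P)) (l l' r r' : P) : Kind Pr → Prop
  | tree p => B = {pfact p ![x, y, l, l', r, r']}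
  | quad p => B = {pfact p ![x, y, l, l']} ∧ r = l ∧ r' = l'
  | series p => B = {pfact p ![l']} ∧ l = x ∧ r = l' ∧ r' = y
  | sym p q => ∃ z, B = {pfact p ![x, y, l, z]} + {pfact q ![l, z, l']} + {pfact q ![l, z, r']} ∧
      r = l
  | par p => B = {pfact p ![]} ∧ l = x ∧ l' = y ∧ r = x ∧ r' = y

theorem facts_tree {P : Type} (p : Pr 6) (ν : Fin 6 → P) :
    facts (barR p).prims ν = {pfact p ν} :=
  facts_ofPrims_single 6 ![0, 1] id p ν

theorem facts_quad {P : Type} (p : Pr 4) (ν : Fin 4 → P) :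
    facts (barK p).prims ν = {pfact p ν} :=
  facts_ofPrims_single 4 ![0, 1] id p ν

theorem facts_un {P : Type} (p : Pr 4) (ν : Fin 4 → P) :
    facts (barU p).prims ν = {pfact p ν} :=
  facts_ofPrims_single 4 ![0, 1] id p ν

theorem facts_series {P : Type} (p : Pr 1) (ν : Fin 3 → P) :
    facts (barO p).prims ν = {pfact p ![ν 1]} :=
  (facts_ofPrims_single 3 ![0, 2] ![1] p ν).trans (pfact_congr fun l => by fin_cases l; rfl)

theorem facts_par {P : Type} (p : Pr 0) (ν : Fin 2 → P) :
    facts (parGadget p).prims ν = {pfact p ![]} :=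
  (facts_ofPrims_single 2 ![0, 1] ![] p ν).trans (pfact_congr fun l => l.elim0)

theorem facts_sym {P : Type} (p : Pr 4) (q : Pr 3) (ν : Fin 6 → P) :
    facts (symGadget p q).prims ν = {pfact p ![ν 0, ν 1, ν 2, ν 3]} + {pfact q ![ν 2, ν 3, ν 4]} +
      {pfact q ![ν 2, ν 3, ν 5]} := by
  refine (facts_ofPrims_addEdge (((HGraph.discrete 6 ![0, 1]).addEdge
    (![0, 1, 2, 3] : Fin 4 → Fin 6) p).addEdge (![2, 3, 4] : Fin 3 → Fin 6) q)
    (![2, 3, 5] : Fin 3 → Fin 6) q ν).trans ?_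
  refine congrArg₂ (· + ·) ((facts_ofPrims_addEdge ((HGraph.discrete 6 ![0, 1]).addEdge
    (![0, 1, 2, 3] : Fin 4 → Fin 6) p) (![2, 3, 4] : Fin 3 → Fin 6) q ν).trans ?_) ?_
  · refine congrArg₂ (· + ·) ((facts_ofPrims_single 6 ![0, 1] ![0, 1, 2, 3] p ν).trans ?_) ?_
    · exact pfact_congr fun l => by fin_cases l <;> rfl
    · exact pfact_congr fun l => by fin_cases l <;> rfl
  · exact pfact_congr fun l => by fin_cases l <;> rfl

theorem frame {P : Type} (K : Kind Pr) (ν : K.gadget.prims.V → P) :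
    K.Frame (ν (K.gadget.prims.ext 0)) (ν (K.gadget.prims.ext 1)) (facts K.gadget.prims ν)
      (ν (K.gadget.left 0)) (ν (K.gadget.left 1)) (ν (K.gadget.right 0))
      (ν (K.gadget.right 1)) := by
  cases K with
  | tree p =>
    exact (facts_tree p ν).trans (pfact_congr fun l : Fin 6 => by fin_cases l <;> rfl)
  | quad p =>
    exact ⟨(facts_quad p ν).trans (pfact_congr fun l : Fin 4 => by fin_cases l <;> rfl), rfl, rfl⟩
  | series p => exact ⟨facts_series p ν, rfl, rfl, rfl⟩
  | sym p q => exact ⟨ν (3 : Fin 6), facts_sym p q ν, rfl⟩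
  | par p => exact ⟨facts_par p ν, rfl, rfl, rfl, rfl⟩

/-- Together with `frame` this says that copies of the gadget are exactly the solutions of `Frame`:
external points, slot points and, for `sym`, the extra point `z` exhaust its nodes. -/
theorem exists_of_frame {P : Type} {K : Kind Pr} {x y l l' r r' : P} {B : Multiset (Fact Pr P)}
    (h : K.Frame x y B l l' r r') : ∃ ν : K.gadget.prims.V → P,
      ν (K.gadget.prims.ext 0) = x ∧ ν (K.gadget.prims.ext 1) = y ∧ facts K.gadget.prims ν = B ∧
      ν (K.gadget.left 0) = l ∧ ν (K.gadget.left 1) = l' ∧ ν (K.gadget.right 0) = r ∧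
      ν (K.gadget.right 1) = r' := by
  cases K with
  | tree p =>
    exact ⟨![x, y, l, l', r, r'], rfl, rfl, (facts_tree p _).trans h.symm, rfl, rfl, rfl, rfl⟩
  | quad p =>
    obtain ⟨rfl, rfl, rfl⟩ := h
    exact ⟨![x, y, r, r'], rfl, rfl, facts_quad p _, rfl, rfl, rfl, rfl⟩
  | series p =>
    obtain ⟨rfl, rfl, rfl, rfl⟩ := h
    exact ⟨![l, r, r'], rfl, rfl, facts_series p _, rfl, rfl, rfl, rfl⟩
  | sym p q =>
    obtain ⟨z, rfl, rfl⟩ := h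
    exact ⟨![x, y, r, z, l', r'], rfl, rfl, facts_sym p q _, rfl, rfl, rfl, rfl⟩
  | par p =>
    obtain ⟨rfl, rfl, rfl, rfl, rfl⟩ := h
    exact ⟨![r, r'], rfl, rfl, facts_par p _, rfl, rfl, rfl, rfl⟩

theorem Frame.swap {P : Type} {K : Kind Pr} {x y l l' r r' : P} {B : Multiset (Fact Pr P)}
    (h : K.Frame x y B l l' r r') (hK : K.IsComm) : K.Frame x y B r r' l l' := by
  cases K with
  | tree p => exact hK.elim
  | quad p =>
    obtain ⟨rfl, rfl, rfl⟩ := h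
    exact ⟨rfl, rfl, rfl⟩
  | series p => exact hK.elim
  | sym p q =>
    obtain ⟨z, rfl, rfl⟩ := h
    exact ⟨z, by abel, rfl⟩
  | par p =>
    obtain ⟨rfl, rfl, rfl, rfl, rfl⟩ := h
    exact ⟨rfl, rfl, rfl, rfl, rfl⟩

end Kind

/-- The output ports. -/
def Output (n : ℕ) (i : Fin n) : Prop := n = 1 ∨ 2 ≤ i.val

open HL

/-- The output ports are chosen so that each inner node of a gadget has exactly one: ports from the
third on introduce a node, the single port of a series label introduces the middle node, and
hyperedges of rank 2, the slots, introduce none. For `sym` the mode label introduces the source and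
the centre, and each arm introduces one target. -/
theorem gen_tree (p : Pr 6) : Gen Output (barR p).prims := by
  intro P t o
  refine ⟨(![t 0, t 1, o 6 (Sum.inr .mk) 2, o 6 (Sum.inr .mk) 3,
    o 6 (Sum.inr .mk) 4, o 6 (Sum.inr .mk) 5] : Fin 6 → P), ⟨fun l => ?_, ?_⟩, ?_⟩
  · fin_cases l <;> rfl
  · rintro n (e | e) l hl
    · exact Empty.elim e
    · cases e
      revert hl
      revert l
      intro l hl
      fin_cases l <;> first | rfl | simp [Output] at hl
  · rintro ν ⟨h1, h2⟩
    refine funext fun v : Fin 6 => ?_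
    fin_cases v
    · exact h1 0
    · exact h1 1
    · exact h2 6 (Sum.inr .mk) 2 (by simp [Output])
    · exact h2 6 (Sum.inr .mk) 3 (by simp [Output])
    · exact h2 6 (Sum.inr .mk) 4 (by simp [Output])
    · exact h2 6 (Sum.inr .mk) 5 (by simp [Output])

theorem gen_quad (p : Pr 4) : Gen Output (barK p).prims := by
  intro P t o
  refine ⟨(![t 0, t 1, o 4 (Sum.inr .mk) 2, o 4 (Sum.inr .mk) 3] : Fin 4 → P),
    ⟨fun l => ?_, ?_⟩, ?_⟩
  · fin_cases l <;> rfl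
  · rintro n (e | e) l hl
    · exact Empty.elim e
    · cases e
      revert hl
      revert l
      intro l hl
      fin_cases l <;> first | rfl | simp [Output] at hl
  · rintro ν ⟨h1, h2⟩
    refine funext fun v : Fin 4 => ?_
    fin_cases v
    · exact h1 0
    · exact h1 1
    · exact h2 4 (Sum.inr .mk) 2 (by simp [Output])
    · exact h2 4 (Sum.inr .mk) 3 (by simp [Output])

theorem gen_un (p : Pr 4) : Gen Output (barU p).prims := by
  intro P t o
  refine ⟨(![t 0, t 1, o 4 (Sum.inr .mk) 2, o 4 (Sum.inr .mk) 3] : Fin 4 → P),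
    ⟨fun l => ?_, ?_⟩, ?_⟩
  · fin_cases l <;> rfl
  · rintro n (e | e) l hl
    · exact Empty.elim e
    · cases e
      revert hl
      revert l
      intro l hl
      fin_cases l <;> first | rfl | simp [Output] at hl
  · rintro ν ⟨h1, h2⟩
    refine funext fun v : Fin 4 => ?_
    fin_cases v
    · exact h1 0
    · exact h1 1
    · exact h2 4 (Sum.inr .mk) 2 (by simp [Output])
    · exact h2 4 (Sum.inr .mk) 3 (by simp [Output])

theorem gen_series (p : Pr 1) : Gen Output (barO p).prims := by
  intro P t o
  refine ⟨(![t 0, o 1 (Sum.inr .mk) 0, t 1] : Fin 3 → P), ⟨fun l => ?_, ?_⟩, ?_⟩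
  · fin_cases l <;> rfl
  · rintro n (e | e) l hl
    · exact Empty.elim e
    · cases e
      revert hl
      revert l
      change ∀ l : Fin 1, _
      intro l hl
      fin_cases l
      rfl
  · rintro ν ⟨h1, h2⟩
    refine funext fun v : Fin 3 => ?_
    fin_cases v
    · exact h1 0
    · exact h2 1 (Sum.inr .mk) 0 (by simp [Output])
    · exact h1 1

theorem gen_par (p : Pr 0) : Gen Output (parGadget p).prims := by
  intro P t o
  refine ⟨(![t 0, t 1] : Fin 2 → P), ⟨fun l => ?_, ?_⟩, ?_⟩
  · fin_cases l <;> rfl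
  · rintro n (e | e) l hl
    · exact Empty.elim e
    · cases e
      exact l.elim0
  · rintro ν ⟨h1, h2⟩
    refine funext fun v : Fin 2 => ?_
    fin_cases v
    · exact h1 0
    · exact h1 1

theorem gen_sym (p : Pr 4) (q : Pr 3) : Gen Output (symGadget p q).prims := by
  intro P t o
  refine ⟨(![t 0, t 1, o 4 (Sum.inl (Sum.inl (Sum.inr .mk))) 2,
    o 4 (Sum.inl (Sum.inl (Sum.inr .mk))) 3, o 3 (Sum.inl (Sum.inr .mk)) 2,
    o 3 (Sum.inr .mk) 2] : Fin 6 → P), ⟨fun l => ?_, ?_⟩, ?_⟩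
  · fin_cases l <;> rfl
  · rintro n (((e | e) | e) | e) l hl
    · exact Empty.elim e
    · cases e
      revert hl
      revert l
      change ∀ l : Fin 4, _
      intro l hl
      fin_cases l <;> first | rfl | simp [Output] at hl
    · cases e
      revert hl
      revert l
      change ∀ l : Fin 3, _
      intro l hl
      fin_cases l <;> first | rfl | simp [Output] at hl
    · cases e
      revert hl
      revert l
      change ∀ l : Fin 3, _
      intro l hl
      fin_cases l <;> first | rfl | simp [Output] at hl
  · rintro ν ⟨h1, h2⟩
    refine funext fun v : Fin 6 => ?_
    fin_cases v
    · exact h1 0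
    · exact h1 1
    · exact h2 4 (Sum.inl (Sum.inl (Sum.inr .mk))) 2 (by simp [Output])
    · exact h2 4 (Sum.inl (Sum.inl (Sum.inr .mk))) 3 (by simp [Output])
    · exact h2 3 (Sum.inl (Sum.inr .mk)) 2 (by simp [Output])
    · exact h2 3 (Sum.inr .mk) 2 (by simp [Output])

theorem Kind.gen (K : Kind Pr) : Gen Output K.gadget.prims := by
  cases K with
  | tree p => exact gen_tree p
  | quad p => exact gen_quad p
  | series p => exact gen_series p
  | sym p q => exact gen_sym p q
  | par p => exact gen_par p

theorem Kind.left_injective (K : Kind Pr) : Function.Injective K.gadget.left := by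
  cases K with
  | tree p => exact (by decide : Function.Injective (![2, 3] : Fin 2 → Fin 6))
  | quad p => exact (by decide : Function.Injective (![2, 3] : Fin 2 → Fin 4))
  | series p => exact (by decide : Function.Injective (![0, 1] : Fin 2 → Fin 3))
  | sym p q => exact (by decide : Function.Injective (![2, 4] : Fin 2 → Fin 6))
  | par p => exact (by decide : Function.Injective (![0, 1] : Fin 2 → Fin 2))

theorem Kind.right_injective (K : Kind Pr) : Function.Injective K.gadget.right := by
  cases K with
  | tree p => exact (by decide : Function.Injective (![4, 5] : Fin 2 → Fin 6))
  | quad p => exact (by decide : Function.Injective (![2, 3] : Fin 2 → Fin 4))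
  | series p => exact (by decide : Function.Injective (![1, 2] : Fin 2 → Fin 3))
  | sym p q => exact (by decide : Function.Injective (![2, 5] : Fin 2 → Fin 6))
  | par p => exact (by decide : Function.Injective (![0, 1] : Fin 2 → Fin 2))

theorem Kind.rank_ne (K : Kind Pr) (n : ℕ) (e : K.gadget.base.E n) : n ≠ 2 := by
  cases K with
  | tree p =>
    rcases e with e | e
    · exact Empty.elim e
    · cases e; decide
  | quad p =>
    rcases e with e | e
    · exact Empty.elim e
    · cases e; decide
  | series p =>
    rcases e with e | e
    · exact Empty.elim e
    · cases e; decide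
  | sym p q =>
    rcases e with ((e | e) | e) | e
    · exact Empty.elim e
    all_goals cases e; decide
  | par p =>
    rcases e with e | e
    · exact Empty.elim e
    · cases e; decide

/-- The translation given by kinds of modes and labels of modalities. -/
def kindTranslation {At : Type u} {I : Type v} {J : Type w} (atom : At ↪ Pr 2) (κ : I → Kind Pr)
    (m : J → Pr 4) : Translation At I J Pr 2 where
  atom := atom
  bin := fun i => (κ i).gadget
  un := fun j => barU (m j)

theorem kindTranslation_generated {At : Type u} {I : Type v} {J : Type w} (atom : At ↪ Pr 2)
    (κ : I → Kind Pr) (m : J → Pr 4) : (kindTranslation atom κ m).Generated Output where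
  rank_bin := fun i => (κ i).rank_ne
  rank_un := by
    rintro j n (e | e)
    · exact Empty.elim e
    · cases e; decide
  edge_un := fun j => ⟨⟨4, Sum.inr .mk⟩⟩
  pos := by decide
  not_out := by simp [Output]
  gen_bin := fun i => (κ i).gen
  gen_un := fun j => gen_un (m j)
  left_injective := fun i => (κ i).left_injective
  right_injective := fun i => (κ i).right_injective
  slot_injective := fun j => (by decide : Function.Injective (![2, 3] : Fin 2 → Fin 4))

end Kinds

open HL NLM Translation

/-! ### Shapes of trees, and the facts that touch their external points. -/

section KindTrees

variable {At : Type u} {I : Type v} {J : Type w} {Pr : ℕ → Type x} {atom : At ↪ Pr 2}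
  {κ : I → Kind Pr} {m : J → Pr 4} {P : Type}

theorem vec_eq (t : Fin 2 → P) : ![t 0, t 1] = t := by
  funext l
  fin_cases l <;> rfl

theorem eq_vec {t : Fin 2 → P} {x y : P} (h0 : t 0 = x) (h1 : t 1 = y) : t = ![x, y] := by
  rw [← vec_eq t, h0, h1]

theorem tree_pair_iff {i : I} {W₁ W₂ : Database At I J} {x y : P} {S : Multiset (Fact Pr P)} :
    (kindTranslation atom κ m).Tree (.pair i W₁ W₂) ![x, y] S ↔
      ∃ (B : Multiset (Fact Pr P)) (l l' r r' : P) (S₁ S₂ : Multiset (Fact Pr P)),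
        (κ i).Frame x y B l l' r r' ∧ S = B + S₁ + S₂ ∧
        (kindTranslation atom κ m).Tree W₁ ![l, l'] S₁ ∧
        (kindTranslation atom κ m).Tree W₂ ![r, r'] S₂ := by
  constructor
  · rintro ⟨ν, S₁, S₂, h1, rfl, h2, h3⟩
    have h4 := (κ i).frame ν
    have h5 : ν ((κ i).gadget.prims.ext 0) = x := h1 0
    have h6 : ν ((κ i).gadget.prims.ext 1) = y := h1 1
    rw [h5, h6] at h4
    exact ⟨_, _, _, _, _, S₁, S₂, h4, rfl,
      h2.congr (fun l => congrFun (vec_eq fun l => ν ((κ i).gadget.left l)).symm l) rfl,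
      h3.congr (fun l => congrFun (vec_eq fun l => ν ((κ i).gadget.right l)).symm l) rfl⟩
  · rintro ⟨B, l, l', r, r', S₁, S₂, h, rfl, h2, h3⟩
    obtain ⟨ν, h4, h5, h6, h7, h8, h9, h10⟩ := Kind.exists_of_frame h
    exact ⟨ν, S₁, S₂, congrFun (eq_vec h4 h5), congrArg (· + S₁ + S₂) h6.symm,
      h2.congr (congrFun (eq_vec h7 h8).symm) rfl,
      h3.congr (congrFun (eq_vec h9 h10).symm) rfl⟩

theorem tree_bracket_iff {j : J} {W : Database At I J} {x y : P} {S : Multiset (Fact Pr P)} :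
    (kindTranslation atom κ m).Tree (.bracket j W) ![x, y] S ↔
      ∃ (l l' : P) (S₁ : Multiset (Fact Pr P)), S = {pfact (m j) ![x, y, l, l']} + S₁ ∧
        (kindTranslation atom κ m).Tree W ![l, l'] S₁ := by
  constructor
  · rintro ⟨ν, S₁, h1, rfl, h2⟩
    refine ⟨ν (2 : Fin 4), ν (3 : Fin 4), S₁, congrArg (· + S₁) ?_,
      h2.congr (fun l => by fin_cases l <;> rfl) rfl⟩
    refine (Kind.facts_un (m j) ν).trans (pfact_congr fun l => ?_)
    fin_cases l
    · exact h1 0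
    · exact h1 1
    · rfl
    · rfl
  · rintro ⟨l, l', S₁, rfl, h⟩
    refine ⟨(![x, y, l, l'] : Fin 4 → P), S₁, fun l => by fin_cases l <;> rfl,
      congrArg (· + S₁) (Kind.facts_un (m j) _).symm,
      h.congr (fun l => by fin_cases l <;> rfl) rfl⟩

theorem rootAt_pair {f : Fact Pr P} {i : I} {W₁ W₂ : Database At I J} {t : Fin 2 → P}
    {S : Multiset (Fact Pr P)}
    (h : (kindTranslation atom κ m).RootAt f (.pair i W₁ W₂) t S) :
      ∃ (B : Multiset (Fact Pr P)) (l l' r r' : P) (S₁ S₂ : Multiset (Fact Pr P)),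
        f ∈ B ∧ (κ i).Frame (t 0) (t 1) B l l' r r' ∧ S = B + S₁ + S₂ ∧
        (kindTranslation atom κ m).Tree W₁ ![l, l'] S₁ ∧
        (kindTranslation atom κ m).Tree W₂ ![r, r'] S₂ := by
  obtain ⟨ν, S₁, S₂, hf, h1, rfl, h2, h3⟩ := h
  have h4 := (κ i).frame ν
  have h5 : ν ((κ i).gadget.prims.ext 0) = t 0 := h1 0
  have h6 : ν ((κ i).gadget.prims.ext 1) = t 1 := h1 1
  rw [h5, h6] at h4
  exact ⟨_, _, _, _, _, S₁, S₂, hf, h4, rfl,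
    h2.congr (fun l => congrFun (vec_eq fun l => ν ((κ i).gadget.left l)).symm l) rfl,
    h3.congr (fun l => congrFun (vec_eq fun l => ν ((κ i).gadget.right l)).symm l) rfl⟩

theorem rootAt_pair_of {f : Fact Pr P} {i : I} {W₁ W₂ : Database At I J} {x y : P}
    {B S₁ S₂ : Multiset (Fact Pr P)} {l l' r r' : P} (hf : f ∈ B)
    (h : (κ i).Frame x y B l l' r r') (h2 : (kindTranslation atom κ m).Tree W₁ ![l, l'] S₁)
    (h3 : (kindTranslation atom κ m).Tree W₂ ![r, r'] S₂) :
    (kindTranslation atom κ m).RootAt f (.pair i W₁ W₂) ![x, y] (B + S₁ + S₂) := by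
  obtain ⟨ν, h4, h5, h6, h7, h8, h9, h10⟩ := Kind.exists_of_frame h
  subst h6
  exact ⟨ν, S₁, S₂, hf, congrFun (eq_vec h4 h5), rfl,
    h2.congr (congrFun (eq_vec h7 h8).symm) rfl,
    h3.congr (congrFun (eq_vec h9 h10).symm) rfl⟩

theorem rootAt_bracket {f : Fact Pr P} {j : J} {W : Database At I J} {t : Fin 2 → P}
    {S : Multiset (Fact Pr P)}
    (h : (kindTranslation atom κ m).RootAt f (.bracket j W) t S) :
      ∃ (l l' : P) (S₁ : Multiset (Fact Pr P)), f = pfact (m j) ![t 0, t 1, l, l'] ∧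
        S = {f} + S₁ ∧ (kindTranslation atom κ m).Tree W ![l, l'] S₁ := by
  obtain ⟨ν, S₁, hf, h1, rfl, h2⟩ := h
  have h3 : facts (barU (m j)).prims ν =
      {pfact (m j) ![t 0, t 1, ν (2 : Fin 4), ν (3 : Fin 4)]} := by
    refine (Kind.facts_un (m j) ν).trans (pfact_congr fun l => ?_)
    fin_cases l
    · exact h1 0
    · exact h1 1
    · rfl
    · rfl
  have h4 := Multiset.mem_singleton.1 (h3 ▸ hf :
    f ∈ ({pfact (m j) ![t 0, t 1, ν (2 : Fin 4), ν (3 : Fin 4)]} : Multiset (Fact Pr P)))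
  exact ⟨_, _, S₁, h4, by rw [h4]; exact congrArg (· + S₁) h3,
    h2.congr (fun l => by fin_cases l <;> rfl) rfl⟩

theorem rootAt_bracket_of {j : J} {W : Database At I J} {x y l l' : P}
    {S : Multiset (Fact Pr P)} (h : (kindTranslation atom κ m).Tree W ![l, l'] S) :
    (kindTranslation atom κ m).RootAt (pfact (m j) ![x, y, l, l']) (.bracket j W) ![x, y]
      ({pfact (m j) ![x, y, l, l']} + S) := by
  have h1 := Kind.facts_un (m j) ![x, y, l, l']
  refine ⟨(![x, y, l, l'] : Fin 4 → P), S, ?_, fun l => by fin_cases l <;> rfl,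
      congrArg (· + S) h1.symm, h.congr (fun l => by fin_cases l <;> rfl) rfl⟩
  change _ ∈ facts (barU (m j)).prims _
  rw [h1]
  exact Multiset.mem_singleton_self _

/-- No fact contains the point `p`. -/
def Avoids (p : P) (S : Multiset (Fact Pr P)) : Prop := ∀ f ∈ S, ∀ l, f.2.2 l ≠ p

theorem Avoids.notMem {p : P} {S : Multiset (Fact Pr P)} (h : Avoids p S) {f : Fact Pr P}
    (hf : ∃ l, f.2.2 l = p) : f ∉ S := fun h' => hf.elim fun l hl => h f h' l hl

theorem Avoids.add {p : P} {S S' : Multiset (Fact Pr P)} (h : Avoids p S) (h' : Avoids p S') :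
    Avoids p (S + S') := fun f hf => (Multiset.mem_add.1 hf).elim (h f) (h' f)

theorem avoids_singleton {p : P} {f : Fact Pr P} (h : ∀ l, f.2.2 l ≠ p) : Avoids p {f} := by
  intro g hg
  rw [Multiset.mem_singleton.1 hg]
  exact h

/-- Two parts of a tree would each need a fact outside `Γ`, but with multiplicity there is only one,
`f`. -/
theorem false_of_two {B S₁ S₂ Γ : Multiset (Fact Pr P)} {f f₁ f₂ : Fact Pr P}
    (h : B + S₁ + S₂ ≤ {f} + Γ) (h1 : f₁ ∈ S₁) (h2 : f₂ ∈ S₂) (h1' : f₁ ∉ Γ) (h2' : f₂ ∉ Γ) :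
    False := by
  have e1 : f₁ = f := by
    have := Multiset.mem_of_le h (Multiset.mem_add.2 (.inl (Multiset.mem_add.2 (.inr h1))))
    simpa [h1'] using this
  have e2 : f₂ = f := by
    have := Multiset.mem_of_le h (Multiset.mem_add.2 (.inr h2))
    simpa [h2'] using this
  subst e1 e2
  have h3 : {f₂} + {f₂} ≤ B + S₁ + S₂ :=
    add_le_add ((Multiset.singleton_le.2 h1).trans (Multiset.le_add_left _ _))
      (Multiset.singleton_le.2 h2)
  exact h2' (Multiset.singleton_le.1 ((add_le_add_iff_left _).1 (h3.trans h)))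

/-- The four shapes of a tree. -/
theorem tree_cases {W : Database At I J} {x y : P} {S : Multiset (Fact Pr P)}
    (h : (kindTranslation atom κ m).Tree W ![x, y] S) :
    (∃ X, W = .form X ∧ S = {fact ((kindTranslation atom κ m).mu X).cls ![x, y]}) ∨
    (∃ f S', 4 ≤ f.1 ∧ (∃ l, f.2.2 l = x) ∧ (∃ l, f.2.2 l = y) ∧ S = {f} + S' ∧
      (kindTranslation atom κ m).RootAt f W ![x, y] S) ∨
    (∃ i W₁ W₂ p z S₁ S₂, κ i = .series p ∧ W = .pair i W₁ W₂ ∧ S = {pfact p ![z]} + S₁ + S₂ ∧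
      (kindTranslation atom κ m).Tree W₁ ![x, z] S₁ ∧
      (kindTranslation atom κ m).Tree W₂ ![z, y] S₂) ∨
    ∃ i W₁ W₂ p S₁ S₂, κ i = .par p ∧ W = .pair i W₁ W₂ ∧ S = {pfact p ![]} + S₁ + S₂ ∧
      (kindTranslation atom κ m).Tree W₁ ![x, y] S₁ ∧
      (kindTranslation atom κ m).Tree W₂ ![x, y] S₂ := by
  cases W with
  | form X => exact .inl ⟨X, rfl, h⟩
  | bracket j W =>
    obtain ⟨l, l', S₁, rfl, h1⟩ := tree_bracket_iff.1 h
    exact .inr (.inl ⟨_, _, le_refl 4, ⟨(0 : Fin 4), rfl⟩, ⟨(1 : Fin 4), rfl⟩, rfl,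
      rootAt_bracket_of h1⟩)
  | pair i W₁ W₂ =>
    obtain ⟨B, l, l', r, r', S₁, S₂, hF, rfl, h1, h2⟩ := tree_pair_iff.1 h
    have hR := fun f hf => rootAt_pair_of (f := f) hf hF h1 h2
    revert hF
    generalize hK : κ i = K
    intro hF
    cases K with
    | tree p =>
      subst hF
      exact .inr (.inl ⟨_, _, (by decide : 4 ≤ 6), ⟨(0 : Fin 6), rfl⟩, ⟨(1 : Fin 6), rfl⟩,
        add_assoc _ _ _, hR _ (Multiset.mem_singleton_self _)⟩)
    | quad p =>
      obtain ⟨rfl, -⟩ := hF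
      exact .inr (.inl ⟨_, _, le_refl 4, ⟨(0 : Fin 4), rfl⟩, ⟨(1 : Fin 4), rfl⟩,
        add_assoc _ _ _, hR _ (Multiset.mem_singleton_self _)⟩)
    | sym p q =>
      obtain ⟨z, rfl, -⟩ := hF
      exact .inr (.inl ⟨_, _, le_refl 4, ⟨(0 : Fin 4), rfl⟩, ⟨(1 : Fin 4), rfl⟩,
        by rw [add_assoc, add_assoc, add_assoc], hR _ (by simp)⟩)
    | series p =>
      obtain ⟨rfl, rfl, rfl, rfl⟩ := hF
      exact .inr (.inr (.inl ⟨i, W₁, W₂, p, _, S₁, S₂, hK, rfl, rfl, h1, h2⟩))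
    | par p =>
      obtain ⟨rfl, rfl, rfl, rfl, rfl⟩ := hF
      exact .inr (.inr (.inr ⟨i, W₁, W₂, p, S₁, S₂, hK, rfl, rfl, h1, h2⟩))

/-- Every tree touches its external points. -/
theorem exists_touch {W : Database At I J} {x y : P} {S : Multiset (Fact Pr P)}
    (h : (kindTranslation atom κ m).Tree W ![x, y] S) :
    (∃ f ∈ S, ∃ l, f.2.2 l = x) ∧ ∃ f ∈ S, ∃ l, f.2.2 l = y := by
  induction W generalizing x y S with
  | form X =>
    cases h
    exact ⟨⟨_, Multiset.mem_singleton_self _, (0 : Fin 2), rfl⟩,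
      ⟨_, Multiset.mem_singleton_self _, (1 : Fin 2), rfl⟩⟩
  | bracket j W ih =>
    rcases tree_cases h with ⟨X, hW, -⟩ | ⟨f, S', -, h1, h2, rfl, -⟩ | ⟨i, W₁, W₂, p, z, S₁, S₂, -,
      hW, -⟩ | ⟨i, W₁, W₂, p, S₁, S₂, -, hW, -⟩
    · cases hW
    · exact ⟨⟨f, by simp, h1⟩, ⟨f, by simp, h2⟩⟩
    · cases hW
    · cases hW
  | pair i W₁ W₂ ih1 ih2 =>
    rcases tree_cases h with ⟨X, hW, -⟩ | ⟨f, S', -, h1, h2, rfl, -⟩ | ⟨i, W₁, W₂, p, z, S₁, S₂, -,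
      hW, rfl, h1, h2⟩ | ⟨i, W₁, W₂, p, S₁, S₂, -, hW, rfl, h1, h2⟩
    · cases hW
    · exact ⟨⟨f, by simp, h1⟩, ⟨f, by simp, h2⟩⟩
    all_goals
      cases hW
      obtain ⟨⟨f, hf, hf'⟩, -⟩ := ih1 h1
      obtain ⟨-, ⟨g, hg, hg'⟩⟩ := ih2 h2
      exact ⟨⟨f, by simp [hf], hf'⟩, ⟨g, by simp [hg], hg'⟩⟩

/-- A tree in which only one fact, of rank two, touches the external points is a leaf. -/
theorem tree_single {W : Database At I J} {x y : P} {S Γ : Multiset (Fact Pr P)} {a : Lab Pr 2}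
    {s : Fin 2 → P} (h : (kindTranslation atom κ m).Tree W ![x, y] S) (hS : S ≤ {fact a s} + Γ)
    (hy : Avoids y Γ) (hx : Avoids x Γ ∨ ∀ i p, κ i ≠ .series p) :
    ∃ X, W = .form X ∧ S = {fact a s} ∧ a = ((kindTranslation atom κ m).mu X).cls ∧
      s = ![x, y] := by
  rcases tree_cases h with ⟨X, rfl, rfl⟩ | ⟨f, S', h4, h1, h2, rfl, -⟩ | ⟨i, W₁, W₂, p, z, S₁, S₂,
      hi, rfl, rfl, h1, h2⟩ | ⟨i, W₁, W₂, p, S₁, S₂, -, rfl, rfl, h1, h2⟩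
  · have h1 := Multiset.mem_of_le hS (Multiset.mem_singleton_self _)
    rw [Multiset.mem_add, Multiset.mem_singleton, fact_inj] at h1
    obtain ⟨h1, h2⟩ := h1.resolve_right (hy.notMem ⟨(1 : Fin 2), rfl⟩)
    exact ⟨X, rfl, by rw [← h1, ← h2], h1.symm, h2.symm⟩
  · have h5 := Multiset.mem_of_le hS (Multiset.mem_add.2 (.inl (Multiset.mem_singleton_self _)))
    rw [Multiset.mem_add, Multiset.mem_singleton] at h5
    have h6 := h5.resolve_right (hy.notMem h2)
    rw [h6] at h4
    exact absurd h4 (by change ¬ 4 ≤ 2; decide)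
  -- Of the two parts of a series composition one touches only the source for certain and the other
  -- the target; this is the only case that needs the condition on `x`. In a parallel composition
  -- both parts touch `y`.
  · obtain ⟨⟨f, hf, hf'⟩, -⟩ := exists_touch h1
    obtain ⟨-, ⟨g, hg, hg'⟩⟩ := exists_touch h2
    exact (false_of_two hS hf hg ((hx.resolve_right fun h => h i p hi).notMem hf')
      (hy.notMem hg')).elim
  · obtain ⟨-, ⟨f, hf, hf'⟩⟩ := exists_touch h1
    obtain ⟨-, ⟨g, hg, hg'⟩⟩ := exists_touch h2
    exact (false_of_two hS hf hg (hy.notMem hf') (hy.notMem hg')).elim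

/-- If only one fact touches the external points, and its rank is not two, then it belongs to the
root. -/
theorem rootAt_of_avoids {W : Database At I J} {x y : P} {S Γ : Multiset (Fact Pr P)}
    {f : Fact Pr P} (h : (kindTranslation atom κ m).Tree W ![x, y] S) (hS : S ≤ {f} + Γ)
    (hf : f.1 ≠ 2) (hx : Avoids x Γ) (hy : Avoids y Γ) :
    (kindTranslation atom κ m).RootAt f W ![x, y] S := by
  rcases tree_cases h with ⟨X, rfl, rfl⟩ | ⟨f, S', h4, h1, h2, rfl, h5⟩ | ⟨i, W₁, W₂, p, z, S₁, S₂,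
      hi, rfl, rfl, h1, h2⟩ | ⟨i, W₁, W₂, p, S₁, S₂, -, rfl, rfl, h1, h2⟩
  · have h1 := Multiset.mem_of_le hS (Multiset.mem_singleton_self _)
    rw [Multiset.mem_add, Multiset.mem_singleton] at h1
    exact absurd (congrArg Sigma.fst (h1.resolve_right (hy.notMem ⟨(1 : Fin 2), rfl⟩))).symm hf
  · have h6 := Multiset.mem_of_le hS (Multiset.mem_add.2 (.inl (Multiset.mem_singleton_self _)))
    rw [Multiset.mem_add, Multiset.mem_singleton] at h6
    rw [← h6.resolve_right (hy.notMem h2)]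
    exact h5
  · obtain ⟨⟨f, hf, hf'⟩, -⟩ := exists_touch h1
    obtain ⟨-, ⟨g, hg, hg'⟩⟩ := exists_touch h2
    exact (false_of_two hS hf hg (hx.notMem hf') (hy.notMem hg')).elim
  · obtain ⟨-, ⟨f, hf, hf'⟩⟩ := exists_touch h1
    obtain ⟨-, ⟨g, hg, hg'⟩⟩ := exists_touch h2
    exact (false_of_two hS hf hg (hy.notMem hf') (hy.notMem hg')).elim

end KindTrees

open HL NLM Translation

/-! ### Recognizing a gadget by its label. -/

section KindTrees

variable {At : Type u} {I : Type v} {J : Type w} {Pr : ℕ → Type x} {atom : At ↪ Pr 2}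
  {κ : I → Kind Pr} {m : J → Pr 4} {P : Type} {C A : Set I}

/-- Labels determine modes, and the gadgets fit the structural rules. -/
structure KindSpec (C A : Set I) (κ : I → Kind Pr) (m : J → Pr 4) : Prop where
  label_inj : ∀ i i', (κ i).label = (κ i').label → i = i'
  label_ne : ∀ i j, (κ i).label ≠ ⟨4, m j⟩
  un_inj : Function.Injective m
  comm : ∀ i, i ∈ C ↔ (κ i).IsComm
  assoc : ∀ i, i ∈ A ↔ (κ i).IsAssoc
  sub : A.Subsingleton
  -- The two settings are kept apart: `quad` is ambiguous in the presence of parallel composition,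
  -- and the reading of `sym`, whose slots share their source, uses that there is no series
  -- composition.
  world : ((∀ i p, κ i ≠ .par p) ∧ ∀ i p q, κ i ≠ .sym p q) ∨
    ((∀ i p, κ i ≠ .quad p) ∧ ∀ i p, κ i ≠ .series p)

theorem label_eq_of_pfact {n n' : ℕ} {p : Pr n} {p' : Pr n'} {s : Fin n → P} {s' : Fin n' → P}
    (h : pfact p s = pfact p' s') : (⟨n, p⟩ : Σ n, Pr n) = ⟨n', p'⟩ := by
  obtain rfl : n = n' := congrArg Sigma.fst h
  rw [pfact_inj] at h
  rw [h.1]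

theorem Kind.label_rank_ne_two (K : Kind Pr) : K.label.1 ≠ 2 := by
  cases K <;> simp [Kind.label]

theorem Kind.label_rank_ne_three (K : Kind Pr) : K.label.1 ≠ 3 := by
  cases K <;> simp [Kind.label]

/-- Rank 3 is excluded because arms do not identify the mode: different commutative modes may use
the same arm label. -/
theorem Kind.Frame.label_eq {K : Kind Pr} {x y l l' r r' : P} {B : Multiset (Fact Pr P)}
    (h : K.Frame x y B l l' r r') {n : ℕ} {p : Pr n} {s : Fin n → P} (hn : n ≠ 3)
    (hp : pfact p s ∈ B) : K.label = ⟨n, p⟩ := by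
  cases K with
  | tree q =>
    subst h
    exact (label_eq_of_pfact (Multiset.mem_singleton.1 hp)).symm
  | quad q =>
    obtain ⟨rfl, -⟩ := h
    exact (label_eq_of_pfact (Multiset.mem_singleton.1 hp)).symm
  | series q =>
    obtain ⟨rfl, -⟩ := h
    exact (label_eq_of_pfact (Multiset.mem_singleton.1 hp)).symm
  | par q =>
    obtain ⟨rfl, -⟩ := h
    exact (label_eq_of_pfact (Multiset.mem_singleton.1 hp)).symm
  | sym q q' =>
    obtain ⟨z, rfl, -⟩ := h
    rw [Multiset.mem_add, Multiset.mem_add, Multiset.mem_singleton, Multiset.mem_singleton,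
      Multiset.mem_singleton] at hp
    rcases hp with (hp | hp) | hp
    · exact (label_eq_of_pfact hp).symm
    · exact absurd (congrArg Sigma.fst hp) hn
    · exact absurd (congrArg Sigma.fst hp) hn

/-- Leaves have rank 2 and the labels of modalities differ from those of modes, so the root is a
pair; injectivity of labels gives its mode. -/
theorem rootAt_label (hs : KindSpec C A κ m) {i : I} {K : Kind Pr} (hK : κ i = K)
    {s : Fin K.label.1 → P} {W : Database At I J} {t : Fin 2 → P} {S : Multiset (Fact Pr P)}
    (h : (kindTranslation atom κ m).RootAt (pfact K.label.2 s) W t S) :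
    ∃ (W₁ W₂ : Database At I J) (B : Multiset (Fact Pr P)) (l l' r r' : P)
      (S₁ S₂ : Multiset (Fact Pr P)), W = .pair i W₁ W₂ ∧ pfact K.label.2 s ∈ B ∧
      K.Frame (t 0) (t 1) B l l' r r' ∧ S = B + S₁ + S₂ ∧
      (kindTranslation atom κ m).Tree W₁ ![l, l'] S₁ ∧
      (kindTranslation atom κ m).Tree W₂ ![r, r'] S₂ := by
  cases W with
  | form X => exact absurd (congrArg Sigma.fst h.1) K.label_rank_ne_two
  | bracket j W =>
    obtain ⟨l, l', S₁, h1, -⟩ := rootAt_bracket h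
    exact absurd ((congrArg Kind.label hK).trans (label_eq_of_pfact h1)) (hs.label_ne i j)
  | pair i' W₁ W₂ =>
    obtain ⟨B, l, l', r, r', S₁, S₂, hf, hF, rfl, h1, h2⟩ := rootAt_pair h
    obtain rfl := hs.label_inj i' i ((hF.label_eq K.label_rank_ne_three hf).trans
      (congrArg Kind.label hK).symm)
    exact ⟨W₁, W₂, B, l, l', r, r', S₁, S₂, rfl, hf, hK ▸ hF, rfl, h1, h2⟩

theorem rootAt_un (hs : KindSpec C A κ m) {j : J} {s : Fin 4 → P} {W : Database At I J}
    {t : Fin 2 → P} {S : Multiset (Fact Pr P)}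
    (h : (kindTranslation atom κ m).RootAt (pfact (m j) s) W t S) :
    ∃ (W₁ : Database At I J) (S₁ : Multiset (Fact Pr P)), W = .bracket j W₁ ∧ t 0 = s 0 ∧
      t 1 = s 1 ∧ S = {pfact (m j) s} + S₁ ∧
      (kindTranslation atom κ m).Tree W₁ ![s 2, s 3] S₁ := by
  cases W with
  | form X => exact absurd (congrArg Sigma.fst h.1) (by change ¬ (4 = 2); decide)
  | bracket j' W =>
    obtain ⟨l, l', S₁, h1, rfl, h2⟩ := rootAt_bracket h
    rw [pfact_inj] at h1
    obtain ⟨h1, rfl⟩ := h1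
    obtain rfl := hs.un_inj h1
    exact ⟨W, S₁, rfl, rfl, rfl, rfl, h2⟩
  | pair i' W₁ W₂ =>
    obtain ⟨B, l, l', r, r', S₁, S₂, hf, hF, rfl, h1, h2⟩ := rootAt_pair h
    exact absurd (hF.label_eq (by decide) hf) (hs.label_ne i' j)

theorem locate_label (hs : KindSpec C A κ m) {i : I} {K : Kind Pr} (hK : κ i = K)
    {s : Fin K.label.1 → P} {W : Database At I J} {t : Fin 2 → P} {S : Multiset (Fact Pr P)}
    (h : (kindTranslation atom κ m).Tree W t S) (hf : pfact K.label.2 s ∈ S) :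
    ∃ (D : Ctx At I J) (W₁ W₂ : Database At I J) (x y : P) (B : Multiset (Fact Pr P))
      (l l' r r' : P) (S₁ S₂ S' : Multiset (Fact Pr P)), W = D.fill (.pair i W₁ W₂) ∧
      S = S' + (B + S₁ + S₂) ∧ pfact K.label.2 s ∈ B ∧ K.Frame x y B l l' r r' ∧
      (kindTranslation atom κ m).Tree W₁ ![l, l'] S₁ ∧
      (kindTranslation atom κ m).Tree W₂ ![r, r'] S₂ ∧
      ∀ W' S₁, (kindTranslation atom κ m).Tree W' ![x, y] S₁ →
        (kindTranslation atom κ m).Tree (D.fill W') t (S' + S₁) := by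
  obtain ⟨D, W₀, t₀, S₀, S', rfl, rfl, hR, hD⟩ := h.locate hf
  obtain ⟨W₁, W₂, B, l, l', r, r', S₁, S₂, rfl, hB, hF, rfl, h1, h2⟩ := rootAt_label hs hK hR
  refine ⟨D, W₁, W₂, t₀ 0, t₀ 1, B, l, l', r, r', S₁, S₂, S', rfl, rfl, hB, hF, h1, h2, ?_⟩
  intro W' S₁ h
  rw [vec_eq] at h
  exact hD W' S₁ h

variable (atom κ m C A) in
/-- The database `W` can be rearranged so that the formulas with labels `a` and `b` are next to each
other, in mode `i`, at the points `x, y`; the remaining facts are `Γ`. -/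
def Splits (W : Database At I J) (i : I) (t : Fin 2 → P) (Γ : Multiset (Fact Pr P)) (a b : Lab Pr 2)
    (x y : P) : Prop :=
  ∃ (D : Ctx At I J) (X Y : NLM.Formula At I J), a = ((kindTranslation atom κ m).mu X).cls ∧
    b = ((kindTranslation atom κ m).mu Y).cls ∧
    Entails C A W (D.fill (.pair i (.form X) (.form Y))) ∧
    ∀ Z, (kindTranslation atom κ m).Tree (D.fill (.form Z)) t
      (Γ + {fact ((kindTranslation atom κ m).mu Z).cls ![x, y]})

/-- The mode label is located and fixes all six points. Each slot is then a tree whose two external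
points are touched by just one of the available facts, hence a leaf by `tree_single`. -/
theorem splits_tree (hs : KindSpec C A κ m) {i : I} {p : Pr 6} (hi : κ i = .tree p)
    {W : Database At I J} {t : Fin 2 → P} {Γ : Multiset (Fact Pr P)} {x y l l' r r' : P}
    {a b : Lab Pr 2}
    (h : (kindTranslation atom κ m).Tree W t
      (Γ + ({pfact p ![x, y, l, l', r, r']} + {fact a ![l, l']} + {fact b ![r, r']})))
    (hl : Avoids l Γ) (hl' : Avoids l' Γ) (hr : Avoids r Γ) (hr' : Avoids r' Γ)
    (h1 : l ≠ r) (h2 : l ≠ r') (h3 : l' ≠ r) (h4 : l' ≠ r') :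
    Splits atom κ m C A W i t Γ a b x y := by
  obtain ⟨D, W₁, W₂, x₀, y₀, B, k, k', q, q', S₁, S₂, S', rfl, hS, hB, hF, hW₁, hW₂, hD⟩ :=
    locate_label hs hi (s := ![x, y, l, l', r, r']) h (by
      simp only [Multiset.mem_add, Multiset.mem_singleton]
      exact .inr (.inl (.inl rfl)))
  change B = _ at hF
  subst hF
  have h5 := (pfact_inj.1 (Multiset.mem_singleton.1 hB)).2
  obtain rfl : x = x₀ := congrFun h5 (0 : Fin 6)
  obtain rfl : y = y₀ := congrFun h5 (1 : Fin 6)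
  obtain rfl : l = k := congrFun h5 (2 : Fin 6)
  obtain rfl : l' = k' := congrFun h5 (3 : Fin 6)
  obtain rfl : r = q := congrFun h5 (4 : Fin 6)
  obtain rfl : r' = q' := congrFun h5 (5 : Fin 6)
  have hS' : S' + S₁ + S₂ = Γ + {fact a ![l, l']} + {fact b ![r, r']} := by
    refine add_left_cancel (a := {pfact p ![x, y, l, l', r, r']})
      (Eq.trans ?_ (hS.symm.trans ?_)) <;> abel
  have avoid : ∀ {c d e : P} {f : Lab Pr 2}, c ≠ d → c ≠ e → Avoids c {fact f ![d, e]} := by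
    intro c d e f hd he
    refine avoids_singleton fun l : Fin 2 => ?_
    fin_cases l
    · exact hd.symm
    · exact he.symm
  obtain ⟨X, rfl, rfl, rfl, -⟩ := tree_single (a := a) (s := ![l, l'])
    (Γ := Γ + {fact b ![r, r']}) hW₁
    (le_iff_exists_add.2 ⟨S' + S₂, Eq.trans (by abel) (hS'.symm.trans (by abel))⟩)
    (hl'.add (avoid h3 h4)) (.inl (hl.add (avoid h1 h2)))
  obtain ⟨Y, rfl, rfl, rfl, -⟩ := tree_single (a := b) (s := ![r, r'])
    (Γ := Γ + {fact ((kindTranslation atom κ m).mu X).cls ![l, l']}) hW₂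
    (le_iff_exists_add.2 ⟨S' + {fact ((kindTranslation atom κ m).mu X).cls ![l, l']},
      Eq.trans (by abel) (hS'.symm.trans (by abel))⟩)
    (hr'.add (avoid h2.symm h4.symm)) (.inl (hr.add (avoid h1.symm h3.symm)))
  obtain rfl := add_right_cancel (add_right_cancel hS')
  exact ⟨D, X, Y, rfl, rfl, .refl _, fun Z => hD _ _ rfl⟩

end KindTrees

open HL NLM Translation

/-! ### Gathering the leaves of modalities and of commutative gadgets. -/

section KindTrees

variable {At : Type u} {I : Type v} {J : Type w} {Pr : ℕ → Type x} {atom : At ↪ Pr 2}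
  {κ : I → Kind Pr} {m : J → Pr 4} {P : Type} {C A : Set I}

theorem avoids_pair {c d e : P} {f : Lab Pr 2} (hd : c ≠ d) (he : c ≠ e) :
    Avoids c {fact f ![d, e]} := by
  refine avoids_singleton fun l : Fin 2 => ?_
  fin_cases l
  · exact hd.symm
  · exact he.symm

theorem splits_un (hs : KindSpec C A κ m) {j : J} {W : Database At I J} {t : Fin 2 → P}
    {Γ : Multiset (Fact Pr P)} {x y l l' : P} {a : Lab Pr 2}
    (h : (kindTranslation atom κ m).Tree W t
      (Γ + ({pfact (m j) ![x, y, l, l']} + {fact a ![l, l']})))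
    (hl : Avoids l Γ) (hl' : Avoids l' Γ) :
    ∃ (D : Ctx At I J) (X : NLM.Formula At I J), a = ((kindTranslation atom κ m).mu X).cls ∧
      Entails C A W (D.fill (.bracket j (.form X))) ∧
      ∀ Z, (kindTranslation atom κ m).Tree (D.fill (.form Z)) t
        (Γ + {fact ((kindTranslation atom κ m).mu Z).cls ![x, y]}) := by
  obtain ⟨D, W₀, t₀, S₀, S', rfl, hS, hR, hD⟩ := h.locate (f := pfact (m j) ![x, y, l, l'])
    (by simp)
  obtain ⟨W₁, S₁, rfl, h0, h1, rfl, hW₁⟩ := rootAt_un hs hR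
  change (kindTranslation atom κ m).Tree W₁ ![l, l'] S₁ at hW₁
  have hS' : S' + S₁ = Γ + {fact a ![l, l']} := by
    refine add_left_cancel (a := {pfact (m j) ![x, y, l, l']})
      (Eq.trans ?_ (hS.symm.trans ?_)) <;> abel
  obtain ⟨X, rfl, rfl, rfl, -⟩ := tree_single (a := a) (s := ![l, l']) (Γ := Γ) hW₁
    (le_iff_exists_add.2 ⟨S', Eq.trans (by abel) (hS'.symm.trans (by abel))⟩) hl' (.inl hl)
  obtain rfl := add_right_cancel hS'
  refine ⟨D, X, rfl, .refl _, fun Z => hD _ _ ?_⟩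
  have : t₀ = ![x, y] := eq_vec h0 h1
  rw [this]
  rfl

/-- Each tree has a fact at `l`, and `Γ` has none, so each takes one of the two given facts. What is
left for it is part of `Γ`, and `tree_single` makes it a leaf. -/
theorem tree_pair_leaves {W₁ W₂ : Database At I J} {l l' : P} {S' S₁ S₂ Γ : Multiset (Fact Pr P)}
    {a b : Lab Pr 2} {s s' : Fin 2 → P} (h1 : (kindTranslation atom κ m).Tree W₁ ![l, l'] S₁)
    (h2 : (kindTranslation atom κ m).Tree W₂ ![l, l'] S₂)
    (hS : S' + S₁ + S₂ = Γ + {fact a s} + {fact b s'}) (hl : Avoids l Γ) (hl' : Avoids l' Γ) :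
    (S₁ = {fact a s} ∧ S₂ = {fact b s'} ∨ S₁ = {fact b s'} ∧ S₂ = {fact a s}) ∧ S' = Γ ∧
      ∃ X Y, W₁ = .form X ∧ W₂ = .form Y := by
  have key : ∀ {a b : Lab Pr 2} {s s' : Fin 2 → P}, S' + S₁ + S₂ = Γ + {fact a s} + {fact b s'} →
      fact b s' ∈ S₂ → S₁ = {fact a s} ∧ S₂ = {fact b s'} ∧ S' = Γ ∧
      ∃ X Y, W₁ = .form X ∧ W₂ = .form Y := by
    intro a b s s' hS hb
    obtain ⟨R, rfl⟩ := Multiset.exists_cons_of_mem hb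
    rw [← Multiset.singleton_add] at hS ⊢
    have hS' : S' + S₁ + R = Γ + {fact a s} :=
      add_right_cancel (b := {fact b s'}) (Eq.trans (by abel) hS)
    obtain ⟨X, rfl, rfl, -⟩ := tree_single (a := a) (s := s) (Γ := Γ) h1
      (le_iff_exists_add.2 ⟨S' + R, Eq.trans (by abel) (hS'.symm.trans (by abel))⟩) hl' (.inl hl)
    have hR : S' + R = Γ := add_right_cancel (b := {fact a s}) (Eq.trans (by abel) hS')
    obtain ⟨Y, rfl, h5, -⟩ := tree_single (a := b) (s := s') (Γ := Γ) h2
      (le_iff_exists_add.2 ⟨S', by rw [← hR, ← Multiset.singleton_add]; abel⟩)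
      hl' (.inl hl)
    have h6 : R = 0 := by
      have := congrArg Multiset.card h5
      simpa using this
    subst h6
    exact ⟨rfl, rfl, by simpa using hR, X, Y, rfl, rfl⟩
  obtain ⟨⟨f, hf, hf'⟩, -⟩ := exists_touch h2
  have h3 : f ∈ Γ + {fact a s} + {fact b s'} := by
    rw [← hS]
    exact Multiset.mem_add.2 (.inr hf)
  rw [Multiset.mem_add, Multiset.mem_add, Multiset.mem_singleton, Multiset.mem_singleton] at h3
  rcases h3 with (h3 | rfl) | rfl
  · exact absurd h3 (hl.notMem hf')
  · obtain ⟨h4, h5, h6, h7⟩ := key (a := b) (b := a) (hS.trans (by abel)) hf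
    exact ⟨.inr ⟨h4, h5⟩, h6, h7⟩
  · obtain ⟨h4, h5, h6, h7⟩ := key hS hf
    exact ⟨.inl ⟨h4, h5⟩, h6, h7⟩

theorem eq_cls_of_tree_form {X : NLM.Formula At I J} {x y : P} {a : Lab Pr 2} {s : Fin 2 → P}
    (h : (kindTranslation atom κ m).Tree (.form X) ![x, y] {fact a s}) :
    a = ((kindTranslation atom κ m).mu X).cls := (fact_inj.1 (Multiset.singleton_inj.1 h)).1

/-- Both slots have the same points, so the facts do not tell which leaf is on the left;
commutativity of the mode repairs the order. -/
theorem splits_quad (hs : KindSpec C A κ m) {i : I} {p : Pr 4} (hi : κ i = .quad p)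
    {W : Database At I J} {t : Fin 2 → P} {Γ : Multiset (Fact Pr P)} {x y l l' : P}
    {a b : Lab Pr 2}
    (h : (kindTranslation atom κ m).Tree W t
      (Γ + ({pfact p ![x, y, l, l']} + {fact a ![l, l']} + {fact b ![l, l']})))
    (hl : Avoids l Γ) (hl' : Avoids l' Γ) : Splits atom κ m C A W i t Γ a b x y := by
  obtain ⟨D, W₁, W₂, x₀, y₀, B, k, k', q, q', S₁, S₂, S', rfl, hS, hB, hF, hW₁, hW₂, hD⟩ :=
    locate_label hs hi (s := ![x, y, l, l']) h (by
      simp only [Multiset.mem_add, Multiset.mem_singleton]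
      exact .inr (.inl (.inl rfl)))
  obtain ⟨rfl, rfl, rfl⟩ := hF
  have h5 := (pfact_inj.1 (Multiset.mem_singleton.1 hB)).2
  obtain rfl : x = x₀ := congrFun h5 (0 : Fin 4)
  obtain rfl : y = y₀ := congrFun h5 (1 : Fin 4)
  obtain rfl : l = q := congrFun h5 (2 : Fin 4)
  obtain rfl : l' = q' := congrFun h5 (3 : Fin 4)
  have hS' : S' + S₁ + S₂ = Γ + {fact a ![l, l']} + {fact b ![l, l']} := by
    refine add_left_cancel (a := {pfact p ![x, y, l, l']})
      (Eq.trans ?_ (hS.symm.trans ?_)) <;> abel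
  have hC : i ∈ C := by
    rw [hs.comm, hi]
    trivial
  obtain ⟨⟨rfl, rfl⟩ | ⟨rfl, rfl⟩, rfl, X, Y, rfl, rfl⟩ := tree_pair_leaves hW₁ hW₂ hS' hl hl'
  · exact ⟨D, X, Y, eq_cls_of_tree_form hW₁, eq_cls_of_tree_form hW₂, .refl _, fun Z => hD _ _ rfl⟩
  · exact ⟨D, Y, X, eq_cls_of_tree_form hW₂, eq_cls_of_tree_form hW₁, (Entails.swap hC _ _).fill D,
      fun Z => hD _ _ rfl⟩

/-- No other fact touches the centre `z`, so the two arms, and with them the two targets, are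
determined up to order. -/
theorem arms_unique {q : Pr 3} {l z c d c' d' : P} {Ω Ω' : Multiset (Fact Pr P)}
    (h : Ω + {pfact q ![l, z, c]} + {pfact q ![l, z, d]} =
      Ω' + {pfact q ![l, z, c']} + {pfact q ![l, z, d']}) (hz : Avoids z Ω) :
    Ω = Ω' ∧ (c' = c ∧ d' = d ∨ c' = d ∧ d' = c) := by
  have hmem : ∀ {e f g : P} {Ω' : Multiset (Fact Pr P)}, pfact q ![l, z, e] ∈
      Ω + {pfact q ![l, z, f]} + {pfact q ![l, z, g]} → e = f ∨ e = g := by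
    intro e f g Ω' h
    rw [Multiset.mem_add, Multiset.mem_add, Multiset.mem_singleton, Multiset.mem_singleton] at h
    rcases h with (h | h) | h
    · exact absurd h (hz.notMem ⟨(1 : Fin 3), rfl⟩)
    · exact .inl (congrFun (pfact_inj.1 h).2 2)
    · exact .inr (congrFun (pfact_inj.1 h).2 2)
  have hmem' : ∀ {e f : P} {Ω' : Multiset (Fact Pr P)}, pfact q ![l, z, e] ∈
      Ω + {pfact q ![l, z, f]} → e = f := by
    intro e f Ω' h
    rw [Multiset.mem_add, Multiset.mem_singleton] at h
    rcases h with h | h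
    · exact absurd h (hz.notMem ⟨(1 : Fin 3), rfl⟩)
    · exact congrFun (pfact_inj.1 h).2 2
  rcases hmem (Ω' := Ω) (e := c') (f := c) (g := d) (by rw [h]; simp) with rfl | rfl
  · have h' : Ω + {pfact q ![l, z, d]} = Ω' + {pfact q ![l, z, d']} :=
      add_right_cancel (b := {pfact q ![l, z, c']}) (Eq.trans (by abel) (h.trans (by abel)))
    obtain rfl := hmem' (Ω' := Ω) (e := d') (f := d) (by rw [h']; simp)
    exact ⟨add_right_cancel h', .inl ⟨rfl, rfl⟩⟩
  · have h' : Ω + {pfact q ![l, z, c]} = Ω' + {pfact q ![l, z, d']} :=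
      add_right_cancel (b := {pfact q ![l, z, c']}) (Eq.trans (by abel) (h.trans (by abel)))
    obtain rfl := hmem' (Ω' := Ω) (e := d') (f := c) (by rw [h']; simp)
    exact ⟨add_right_cancel h', .inr ⟨rfl, rfl⟩⟩

theorem KindSpec.not_series_of_sym (hs : KindSpec C A κ m) {i : I} {p : Pr 4} {q : Pr 3}
    (hi : κ i = .sym p q) (i' : I) (p' : Pr 1) : κ i' ≠ .series p' :=
  (hs.world.resolve_left fun h => h.2 i p q hi).2 i' p'

theorem avoids_triple {c d e f : P} {n : Pr 3} (hd : c ≠ d) (he : c ≠ e) (hf : c ≠ f) :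
    Avoids c {pfact n ![d, e, f]} := by
  refine avoids_singleton fun l : Fin 3 => ?_
  fin_cases l
  · exact hd.symm
  · exact he.symm
  · exact hf.symm

/-- The arms give the targets of the two slots up to a swap, which commutativity allows. Each target
is touched by only one of the facts that are left for the slots. -/
theorem splits_sym (hs : KindSpec C A κ m) {i : I} {p : Pr 4} {q : Pr 3} (hi : κ i = .sym p q)
    {W : Database At I J} {t : Fin 2 → P} {Γ : Multiset (Fact Pr P)} {x y l z c d : P}
    {a b : Lab Pr 2}
    (h : (kindTranslation atom κ m).Tree W t
      (Γ + ({pfact p ![x, y, l, z]} + {pfact q ![l, z, c]} + {pfact q ![l, z, d]} +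
        {fact a ![l, c]} + {fact b ![l, d]})))
    (hz : Avoids z Γ) (hc : Avoids c Γ) (hd : Avoids d Γ)
    (hzl : z ≠ l) (hzc : z ≠ c) (hzd : z ≠ d) (hcl : c ≠ l) (hdl : d ≠ l) (hcd : c ≠ d) :
    Splits atom κ m C A W i t Γ a b x y := by
  obtain ⟨D, W₁, W₂, x₀, y₀, B, k, k', r, r', S₁, S₂, S', rfl, hS, hB, hF, hW₁, hW₂, hD⟩ :=
    locate_label hs hi (s := ![x, y, l, z]) h (by
      simp only [Multiset.mem_add, Multiset.mem_singleton]
      exact .inr (.inl (.inl (.inl (.inl rfl)))))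
  obtain ⟨z', rfl, rfl⟩ := hF
  have h5 : (![x, y, l, z] : Fin 4 → P) = ![x₀, y₀, r, z'] := by
    rw [Multiset.mem_add, Multiset.mem_add, Multiset.mem_singleton, Multiset.mem_singleton,
      Multiset.mem_singleton] at hB
    rcases hB with (hB | hB) | hB
    · exact (pfact_inj.1 hB).2
    · exact absurd (congrArg Sigma.fst hB) (by change ¬ (4 = 3); decide)
    · exact absurd (congrArg Sigma.fst hB) (by change ¬ (4 = 3); decide)
  obtain rfl : x = x₀ := congrFun h5 (0 : Fin 4)
  obtain rfl : y = y₀ := congrFun h5 (1 : Fin 4)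
  obtain rfl : l = r := congrFun h5 (2 : Fin 4)
  obtain rfl : z = z' := congrFun h5 (3 : Fin 4)
  have hS' : Γ + {fact a ![l, c]} + {fact b ![l, d]} + {pfact q ![l, z, c]} +
      {pfact q ![l, z, d]} = S' + S₁ + S₂ + {pfact q ![l, z, k']} + {pfact q ![l, z, r']} := by
    refine add_left_cancel (a := {pfact p ![x, y, l, z]}) (Eq.trans ?_ (hS.trans ?_)) <;> abel
  have key : ∀ {W₁ W₂ : Database At I J} {S₁ S₂ : Multiset (Fact Pr P)},
      (kindTranslation atom κ m).Tree W₁ ![l, c] S₁ →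
      (kindTranslation atom κ m).Tree W₂ ![l, d] S₂ →
      Γ + {fact a ![l, c]} + {fact b ![l, d]} = S' + S₁ + S₂ → ∃ X Y, W₁ = .form X ∧
        W₂ = .form Y ∧ a = ((kindTranslation atom κ m).mu X).cls ∧
        b = ((kindTranslation atom κ m).mu Y).cls ∧ S' = Γ := by
    intro W₁ W₂ S₁ S₂ hW₁ hW₂ hS'
    obtain ⟨X, rfl, rfl, hX, -⟩ := tree_single (a := a) (s := ![l, c])
      (Γ := Γ + {fact b ![l, d]}) hW₁
      (le_iff_exists_add.2 ⟨S' + S₂, Eq.trans (by abel) (hS'.trans (by abel))⟩)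
      -- The source `l` is also touched by the other leaf, so the absence of series composition
      -- takes the place of a condition on it.
      (hc.add (avoids_pair hcl hcd)) (.inr (hs.not_series_of_sym hi))
    obtain ⟨Y, rfl, rfl, hY, -⟩ := tree_single (a := b) (s := ![l, d])
      (Γ := Γ + {fact a ![l, c]}) hW₂
      (le_iff_exists_add.2 ⟨S' + {fact a ![l, c]}, Eq.trans (by abel) (hS'.trans (by abel))⟩)
      (hd.add (avoids_pair hdl hcd.symm)) (.inr (hs.not_series_of_sym hi))
    exact ⟨X, Y, rfl, rfl, hX, hY, (add_right_cancel (add_right_cancel hS')).symm⟩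
  have hC : i ∈ C := by
    rw [hs.comm, hi]
    trivial
  obtain ⟨h6, ⟨rfl, rfl⟩ | ⟨rfl, rfl⟩⟩ := arms_unique hS'
    ((hz.add (avoids_pair hzl hzc)).add (avoids_pair hzl hzd))
  · obtain ⟨X, Y, rfl, rfl, hX, hY, rfl⟩ := key hW₁ hW₂ h6
    exact ⟨D, X, Y, hX, hY, .refl _, fun Z => hD _ _ rfl⟩
  · obtain ⟨X, Y, rfl, rfl, hX, hY, rfl⟩ := key hW₂ hW₁ (h6.trans (by abel))
    exact ⟨D, X, Y, hX, hY, (Entails.swap hC _ _).fill D, fun Z => hD _ _ rfl⟩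

/-! ### Generic trees -/

/-- The points at output ports. -/
noncomputable abbrev outs (S : Multiset (Fact Pr P)) : Multiset P := S.bind (Fact.outs Output)

open Classical in
theorem fact_outs_eq (f : Fact Pr P) :
    f.outs Output = ∑ i, if Output f.1 i then {f.2.2 i} else (0 : Multiset P) := by
  rw [← Finset.sum_filter]
  exact (Finset.sum_subtype (Finset.univ.filter (Output f.1)) (by simp)
    fun i => ({f.2.2 i} : Multiset P)).symm

theorem outs_six (a : Lab Pr 6) (s : Fin 6 → P) :
    outs {fact a s} = {s 2} + {s 3} + {s 4} + {s 5} := by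
  rw [outs, Multiset.singleton_bind, fact_outs_eq]
  exact (Fin.sum_univ_six _).trans (by simp [Output])

theorem outs_four (a : Lab Pr 4) (s : Fin 4 → P) : outs {fact a s} = {s 2} + {s 3} := by
  rw [outs, Multiset.singleton_bind, fact_outs_eq]
  exact (Fin.sum_univ_four _).trans (by simp [Output])

theorem outs_three (a : Lab Pr 3) (s : Fin 3 → P) : outs {fact a s} = {s 2} := by
  rw [outs, Multiset.singleton_bind, fact_outs_eq]
  exact (Fin.sum_univ_three _).trans (by simp [Output])

theorem outs_one (a : Lab Pr 1) (s : Fin 1 → P) : outs {fact a s} = {s 0} := by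
  rw [outs, Multiset.singleton_bind, fact_outs_eq]
  exact (Fin.sum_univ_one _).trans (by simp [Output])

theorem outs_add (S S' : Multiset (Fact Pr P)) : outs (S + S') = outs S + outs S' :=
  Multiset.add_bind _ _ _

theorem points_output (x y : P) (S : Multiset (Fact Pr P)) :
    points Output ![x, y] S = {x} + {y} + outs S := by
  rw [points, Fin.sum_univ_two]
  rfl

theorem Kind.Frame.slot_mem {K : Kind Pr} {x y l l' r r' : P} {B : Multiset (Fact Pr P)}
    (h : K.Frame x y B l l' r r') : (l = x ∨ l ∈ outs B) ∧ (l' = y ∨ l' ∈ outs B) ∧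
      (r = x ∨ r ∈ outs B) ∧ (r' = y ∨ r' ∈ outs B) := by
  cases K with
  | tree p =>
    subst h
    rw [outs_six]
    simp
  | quad p =>
    obtain ⟨rfl, rfl, rfl⟩ := h
    rw [outs_four]
    simp
  | series p =>
    obtain ⟨rfl, rfl, rfl, rfl⟩ := h
    rw [outs_one]
    simp
  | sym p q =>
    obtain ⟨z, rfl, rfl⟩ := h
    rw [outs_add, outs_add, outs_four, outs_three, outs_three]
    simp
  | par p =>
    obtain ⟨rfl, rfl, rfl, rfl, rfl⟩ := h
    simp

/-- Unless the gadget is the parallel composition, its slots contain inner points. -/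
theorem Kind.Frame.inner {K : Kind Pr} {x y l l' r r' : P} {B : Multiset (Fact Pr P)}
    (h : K.Frame x y B l l' r r') (hK : ∀ p, K ≠ .par p) :
    (l ∈ outs B ∨ l' ∈ outs B) ∧ (r ∈ outs B ∨ r' ∈ outs B) := by
  cases K with
  | tree p =>
    subst h
    rw [outs_six]
    simp
  | quad p =>
    obtain ⟨rfl, rfl, rfl⟩ := h
    rw [outs_four]
    simp
  | series p =>
    obtain ⟨rfl, rfl, rfl, rfl⟩ := h
    rw [outs_one]
    simp
  | sym p q =>
    obtain ⟨z, rfl, rfl⟩ := h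
    rw [outs_add, outs_add, outs_four, outs_three, outs_three]
    simp
  | par p => exact absurd rfl (hK p)

theorem Kind.Frame.rank_ne {K : Kind Pr} {x y l l' r r' : P} {B : Multiset (Fact Pr P)}
    (h : K.Frame x y B l l' r r') {f : Fact Pr P} (hf : f ∈ B) : f.1 ≠ 2 := by
  cases K with
  | tree p =>
    subst h
    rw [Multiset.mem_singleton.1 hf]
    exact (by decide : 6 ≠ 2)
  | quad p =>
    obtain ⟨rfl, -⟩ := h
    rw [Multiset.mem_singleton.1 hf]
    exact (by decide : 4 ≠ 2)
  | series p =>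
    obtain ⟨rfl, -⟩ := h
    rw [Multiset.mem_singleton.1 hf]
    exact (by decide : 1 ≠ 2)
  | sym p q =>
    obtain ⟨z, rfl, rfl⟩ := h
    rw [Multiset.mem_add, Multiset.mem_add, Multiset.mem_singleton, Multiset.mem_singleton,
      Multiset.mem_singleton] at hf
    rcases hf with (rfl | rfl) | rfl
    · exact (by decide : 4 ≠ 2)
    · exact (by decide : 3 ≠ 2)
    · exact (by decide : 3 ≠ 2)
  | par p =>
    obtain ⟨rfl, -⟩ := h
    rw [Multiset.mem_singleton.1 hf]
    exact (by decide : 0 ≠ 2)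

/-- The points of a leaf are external points of the tree or points at output ports. -/
theorem leaf_mem {W : Database At I J} {x y : P} {S : Multiset (Fact Pr P)} {a : Lab Pr 2}
    {s : Fin 2 → P} (h : (kindTranslation atom κ m).Tree W ![x, y] S) (hs : fact a s ∈ S) :
    (s 0 = x ∨ s 0 ∈ outs S) ∧ (s 1 = y ∨ s 1 ∈ outs S) := by
  induction W generalizing x y S with
  | form X =>
    cases h
    rw [Multiset.mem_singleton, fact_inj] at hs
    obtain ⟨rfl, rfl⟩ := hs
    exact ⟨.inl rfl, .inl rfl⟩
  | bracket j W ih =>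
    obtain ⟨l, l', S₁, rfl, h1⟩ := tree_bracket_iff.1 h
    rw [Multiset.mem_add, Multiset.mem_singleton] at hs
    rcases hs with hs | hs
    · exact absurd (congrArg Sigma.fst hs) (by change ¬ (2 = 4); decide)
    · obtain ⟨h2, h3⟩ := ih h1 hs
      rw [outs_add, outs_four]
      constructor
      · rcases h2 with h2 | h2 <;> simp [h2]
      · rcases h3 with h3 | h3 <;> simp [h3]
  | pair i W₁ W₂ ih1 ih2 =>
    obtain ⟨B, l, l', r, r', S₁, S₂, hF, rfl, h1, h2⟩ := tree_pair_iff.1 h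
    obtain ⟨g1, g2, g3, g4⟩ := hF.slot_mem
    simp only [outs_add, Multiset.mem_add] at hs ⊢
    rcases hs with (hs | hs) | hs
    · exact absurd rfl (hF.rank_ne hs)
    · obtain ⟨h2, h3⟩ := ih1 h1 hs
      exact ⟨h2.elim (fun e => by rw [e]; exact g1.imp_right fun h => .inl (.inl h))
        fun h => .inr (.inl (.inr h)),
        h3.elim (fun e => by rw [e]; exact g2.imp_right fun h => .inl (.inl h))
        fun h => .inr (.inl (.inr h))⟩
    · obtain ⟨h2, h3⟩ := ih2 h2 hs
      exact ⟨h2.elim (fun e => by rw [e]; exact g3.imp_right fun h => .inl (.inl h))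
        fun h => .inr (.inr h),
        h3.elim (fun e => by rw [e]; exact g4.imp_right fun h => .inl (.inl h))
        fun h => .inr (.inr h)⟩

end KindTrees

open HL NLM Translation

/-! ### Parallel composition: a mode that is both commutative and associative. -/

section KindTrees

variable {At : Type u} {I : Type v} {J : Type w} {Pr : ℕ → Type x} {atom : At ↪ Pr 2}
  {κ : I → Kind Pr} {m : J → Pr 4} {P : Type} {C A : Set I}

theorem KindSpec.eq_of_par (hs : KindSpec C A κ m) {i i' : I} {p p' : Pr 0} (hi : κ i = .par p)
    (hi' : κ i' = .par p') : i = i' ∧ p = p' := by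
  obtain rfl := hs.sub ((hs.assoc i).2 (hi ▸ trivial)) ((hs.assoc i').2 (hi' ▸ trivial))
  rw [hi] at hi'
  cases hi'
  exact ⟨rfl, rfl⟩

theorem KindSpec.eq_of_series (hs : KindSpec C A κ m) {i i' : I} {p p' : Pr 1}
    (hi : κ i = .series p) (hi' : κ i' = .series p') : i = i' ∧ p = p' := by
  obtain rfl := hs.sub ((hs.assoc i).2 (hi ▸ trivial)) ((hs.assoc i').2 (hi' ▸ trivial))
  rw [hi] at hi'
  cases hi'
  exact ⟨rfl, rfl⟩

theorem tree_form (Z : NLM.Formula At I J) (x y : P) :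
    (kindTranslation atom κ m).Tree (.form Z) ![x, y]
      {fact ((kindTranslation atom κ m).mu Z).cls ![x, y]} := rfl

theorem tree_par {i : I} {p : Pr 0} (hi : κ i = .par p) {W₁ W₂ : Database At I J} {x y : P}
    {S₁ S₂ : Multiset (Fact Pr P)} (h1 : (kindTranslation atom κ m).Tree W₁ ![x, y] S₁)
    (h2 : (kindTranslation atom κ m).Tree W₂ ![x, y] S₂) :
    (kindTranslation atom κ m).Tree (.pair i W₁ W₂) ![x, y] ({pfact p ![]} + S₁ + S₂) :=
  tree_pair_iff.2 ⟨_, x, y, x, y, S₁, S₂, by rw [hi]; exact ⟨rfl, rfl, rfl, rfl, rfl⟩, rfl, h1, h2⟩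

theorem tree_series {i : I} {p : Pr 1} (hi : κ i = .series p) {W₁ W₂ : Database At I J} {x y z : P}
    {S₁ S₂ : Multiset (Fact Pr P)} (h1 : (kindTranslation atom κ m).Tree W₁ ![x, z] S₁)
    (h2 : (kindTranslation atom κ m).Tree W₂ ![z, y] S₂) :
    (kindTranslation atom κ m).Tree (.pair i W₁ W₂) ![x, y] ({pfact p ![z]} + S₁ + S₂) :=
  tree_pair_iff.2 ⟨_, x, z, z, y, S₁, S₂, by rw [hi]; exact ⟨rfl, rfl, rfl, rfl⟩, rfl, h1, h2⟩

/-- Counted with multiplicity, the points of one slot are among the external points and outputs of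
the gadget. Hence distinctness of points is inherited by subtrees. -/
theorem Kind.Frame.slot_le {K : Kind Pr} {x y l l' r r' : P} {B : Multiset (Fact Pr P)}
    (h : K.Frame x y B l l' r r') : {l} + {l'} ≤ {x} + {y} + outs B ∧
      {r} + {r'} ≤ {x} + {y} + outs B := by
  cases K with
  | tree p =>
    subst h
    rw [outs_six]
    exact ⟨le_iff_exists_add.2 ⟨{x} + {y} + {r} + {r'}, by
      change _ + ({l} + {l'} + {r} + {r'}) = _; abel⟩,
      le_iff_exists_add.2 ⟨{x} + {y} + {l} + {l'}, by
      change _ + ({l} + {l'} + {r} + {r'}) = _; abel⟩⟩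
  | quad p =>
    obtain ⟨rfl, rfl, rfl⟩ := h
    rw [outs_four]
    exact ⟨Multiset.le_add_left _ _, Multiset.le_add_left _ _⟩
  | series p =>
    obtain ⟨rfl, rfl, rfl, rfl⟩ := h
    rw [outs_one]
    exact ⟨le_iff_exists_add.2 ⟨{r'}, by change _ + {r} = _; abel⟩,
      le_iff_exists_add.2 ⟨{l}, by change _ + {r} = _; abel⟩⟩
  | sym p q =>
    obtain ⟨z, rfl, rfl⟩ := h
    rw [outs_add, outs_add, outs_four, outs_three, outs_three]
    exact ⟨le_iff_exists_add.2 ⟨{x} + {y} + {z} + {r'}, by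
      change _ + ({r} + {z} + {l'} + {r'}) = _; abel⟩,
      le_iff_exists_add.2 ⟨{x} + {y} + {z} + {l'}, by
      change _ + ({r} + {z} + {l'} + {r'}) = _; abel⟩⟩
  | par p =>
    obtain ⟨rfl, rfl, rfl, rfl, rfl⟩ := h
    exact ⟨Multiset.le_add_right _ _, Multiset.le_add_right _ _⟩

/-- In the setting of parallel composition, the two slots of every other gadget end at different new
points; therefore leaves from different slots cannot be parallel there. -/
theorem Kind.Frame.target_le {K : Kind Pr} {x y l l' r r' : P} {B : Multiset (Fact Pr P)}
    (h : K.Frame x y B l l' r r') (h1 : ∀ p, K ≠ .par p) (h2 : ∀ p, K ≠ .quad p)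
    (h3 : ∀ p, K ≠ .series p) : {l'} + {r'} ≤ outs B := by
  cases K with
  | tree p =>
    subst h
    rw [outs_six]
    exact le_iff_exists_add.2 ⟨{l} + {r}, by
      change {l} + {l'} + {r} + {r'} = _; abel⟩
  | quad p => exact absurd rfl (h2 p)
  | series p => exact absurd rfl (h3 p)
  | sym p q =>
    obtain ⟨z, rfl, rfl⟩ := h
    rw [outs_add, outs_add, outs_four, outs_three, outs_three]
    exact le_iff_exists_add.2 ⟨{r} + {z}, by
      change {r} + {z} + {l'} + {r'} = _; abel⟩
  | par p => exact absurd rfl (h1 p)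

/-- Subtrees of a tree with distinct points have distinct points. -/
theorem Kind.Frame.nodup {K : Kind Pr} {x y l l' r r' : P} {B S₁ S₂ : Multiset (Fact Pr P)}
    (h : K.Frame x y B l l' r r') (hn : ({x} + {y} + outs (B + S₁ + S₂)).Nodup) :
    ({l} + {l'} + outs S₁).Nodup ∧ ({r} + {r'} + outs S₂).Nodup := by
  rw [outs_add, outs_add] at hn
  constructor
  · refine Multiset.nodup_of_le ?_ hn
    refine (add_le_add_left h.slot_le.1 _).trans (le_iff_exists_add.2 ⟨outs S₂, ?_⟩)
    abel
  · refine Multiset.nodup_of_le ?_ hn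
    refine (add_le_add_left h.slot_le.2 _).trans (le_iff_exists_add.2 ⟨outs S₁, ?_⟩)
    abel

variable (atom κ m C A) in
/-- `W` is a formula with label `a`, or can be rearranged to a parallel composition of such a
formula and a database with the facts `Γ`. -/
def Peels (W : Database At I J) (x y : P) (Γ : Multiset (Fact Pr P)) (a : Lab Pr 2) : Prop :=
  ∃ X : NLM.Formula At I J, a = ((kindTranslation atom κ m).mu X).cls ∧ (W = .form X ∧ Γ = 0 ∨
    ∃ (i : I) (p : Pr 0) (W' : Database At I J) (Γ' : Multiset (Fact Pr P)), κ i = .par p ∧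
      Γ = {pfact p ![]} + Γ' ∧ Entails C A W (.pair i (.form X) W') ∧
      (kindTranslation atom κ m).Tree W' ![x, y] Γ')

theorem peels_pair (hs : KindSpec C A κ m) {i : I} {p : Pr 0} (hi : κ i = .par p)
    {W W₁ W₂ : Database At I J} {x y : P} {Γ S₂ : Multiset (Fact Pr P)} {a : Lab Pr 2}
    (h1 : Peels atom κ m C A W₁ x y Γ a) (h2 : (kindTranslation atom κ m).Tree W₂ ![x, y] S₂)
    (hW : Entails C A W (.pair i W₁ W₂)) :
    Peels atom κ m C A W x y ({pfact p ![]} + Γ + S₂) a := by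
  obtain ⟨X, hX, ⟨rfl, rfl⟩ | ⟨i', p', W', Γ', hi', rfl, hE, hT⟩⟩ := h1
  · exact ⟨X, hX, .inr ⟨i, p, W₂, S₂, hi, by rw [add_zero], hW, h2⟩⟩
  · obtain ⟨rfl, rfl⟩ := hs.eq_of_par hi hi'
    refine ⟨X, hX, .inr ⟨i, p, .pair i W' W₂, _, hi, ?_, ?_, tree_par hi hT h2⟩⟩
    · abel
    · exact hW.trans ((Entails.pair i hE (.refl _)).trans
        (.assocR ((hs.assoc i).2 (hi ▸ trivial)) _ _ _))

/-- A leaf at the external points of a tree lies below parallel compositions only. Every other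
gadget gives each slot at least one new point, so a leaf at both `x` and `y` below it would make one
of them an output, against distinctness. Through parallel compositions the leaf is moved to the
front by associativity and commutativity. -/
theorem tree_extract (hs : KindSpec C A κ m) {W : Database At I J} {x y : P}
    {S Γ : Multiset (Fact Pr P)} {a : Lab Pr 2} (h : (kindTranslation atom κ m).Tree W ![x, y] S)
    (hn : ({x} + {y} + outs S).Nodup) (hS : S = Γ + {fact a ![x, y]}) :
    Peels atom κ m C A W x y Γ a := by
  induction W generalizing S Γ with
  | form X =>
    have hc := congrArg Multiset.card hS
    have h' : S = _ := h
    rw [h'] at hc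
    have hΓ : Γ = 0 := by simpa using hc
    subst hΓ
    rw [zero_add, h', Multiset.singleton_inj, fact_inj] at hS
    exact ⟨X, hS.1.symm, .inl ⟨rfl, rfl⟩⟩
  | bracket j W ih =>
    obtain ⟨l, l', S₁, rfl, h1⟩ := tree_bracket_iff.1 h
    have hm : fact a ![x, y] ∈ {pfact (m j) ![x, y, l, l']} + S₁ := by
      rw [hS]
      simp
    rw [Multiset.mem_add, Multiset.mem_singleton] at hm
    rcases hm with hm | hm
    · exact absurd (congrArg Sigma.fst hm) (by change ¬ (2 = 4); decide)
    · have h2 : x ∈ outs ({pfact (m j) ![x, y, l, l']} + S₁) := by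
        rw [outs_add, outs_four]
        rcases (leaf_mem h1 hm).1 with h | h
        · change x = l at h
          simp [h]
        · exact Multiset.mem_add.2 (.inr h)
      rw [Multiset.nodup_add] at hn
      exact absurd h2 (Multiset.disjoint_left.1 hn.2.2 (by simp))
  | pair i W₁ W₂ ih1 ih2 =>
    obtain ⟨B, l, l', r, r', S₁, S₂, hF, rfl, h1, h2⟩ := tree_pair_iff.1 h
    have hm : fact a ![x, y] ∈ B + S₁ + S₂ := by
      rw [hS]
      simp
    by_cases hK : ∀ p, κ i ≠ .par p
    · have hn' := hn
      rw [Multiset.nodup_add] at hn'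
      have hx : x ∉ outs (B + S₁ + S₂) := Multiset.disjoint_left.1 hn'.2.2 (by simp)
      have hy : y ∉ outs (B + S₁ + S₂) := Multiset.disjoint_left.1 hn'.2.2 (by simp)
      simp only [outs_add, Multiset.mem_add, not_or] at hx hy hm
      -- A leaf at `x, y` forces the slot containing it to be `x, y`, while one of its points is an
      -- output of the gadget.
      obtain ⟨g1, g2⟩ := hF.inner hK
      rcases hm with (hm | hm) | hm
      · exact absurd rfl (hF.rank_ne hm)
      · obtain ⟨k1, k2⟩ := leaf_mem h1 hm
        have e1 : x = l := k1.resolve_right hx.1.2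
        have e2 : y = l' := k2.resolve_right hy.1.2
        rw [← e1, ← e2] at g1
        tauto
      · obtain ⟨k1, k2⟩ := leaf_mem h2 hm
        have e1 : x = r := k1.resolve_right hx.2
        have e2 : y = r' := k2.resolve_right hy.2
        rw [← e1, ← e2] at g2
        tauto
    · push Not at hK
      obtain ⟨p, hp⟩ := hK
      obtain ⟨hn1, hn2⟩ := hF.nodup hn
      rw [hp] at hF
      obtain ⟨rfl, rfl, rfl, rfl, rfl⟩ := hF
      rw [Multiset.mem_add, Multiset.mem_add, Multiset.mem_singleton] at hm
      rcases hm with (hm | hm) | hm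
      · exact absurd (congrArg Sigma.fst hm) (by change ¬ (2 = 0); decide)
      · obtain ⟨R, rfl⟩ := Multiset.exists_cons_of_mem hm
        rw [← Multiset.singleton_add] at *
        obtain rfl : {pfact p ![]} + R + S₂ = Γ :=
          add_right_cancel (b := {fact a ![r, r']}) (Eq.trans (by abel) hS)
        exact peels_pair hs hp (ih1 h1 hn1 (add_comm _ _)) h2 (.refl _)
      · obtain ⟨R, rfl⟩ := Multiset.exists_cons_of_mem hm
        rw [← Multiset.singleton_add] at *
        obtain rfl : {pfact p ![]} + R + S₁ = Γ :=
          add_right_cancel (b := {fact a ![r, r']}) (Eq.trans (by abel) hS)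
        exact peels_pair hs hp (ih2 h2 hn2 (add_comm _ _)) h1
          (.swap ((hs.comm i).2 (hp ▸ trivial)) _ _)

theorem Splits.lift {W : Database At I J} {i : I} {t t' : Fin 2 → P}
    {Γ Γ' S : Multiset (Fact Pr P)} {a b : Lab Pr 2} {x y : P} {E : Ctx At I J}
    {V : Database At I J}
    (h : Splits atom κ m C A W i t Γ a b x y) (hV : Entails C A V (E.fill W))
    (hE : ∀ W' S, (kindTranslation atom κ m).Tree W' t S →
      (kindTranslation atom κ m).Tree (E.fill W') t' (Γ' + S)) (hS : S = Γ' + Γ) :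
    Splits atom κ m C A V i t' S a b x y := by
  obtain ⟨D, X, Y, hX, hY, hD, hT⟩ := h
  refine ⟨E.comp D, X, Y, hX, hY, ?_, fun Z => ?_⟩
  · rw [Ctx.fill_comp]
    exact hV.trans (hD.fill E)
  · rw [Ctx.fill_comp, hS, add_assoc]
    exact hE _ _ (hT Z)

/-- Both sides are peeled, and the two leaves are brought together by reassociating; the four cases
record whether anything is left on either side. -/
theorem splits_par_root (hs : KindSpec C A κ m) {i : I} {p : Pr 0} (hi : κ i = .par p)
    {W W₁ W₂ : Database At I J} {x y : P} {Γ₁ Γ₂ : Multiset (Fact Pr P)} {a b : Lab Pr 2}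
    (h1 : Peels atom κ m C A W₁ x y Γ₁ a) (h2 : Peels atom κ m C A W₂ x y Γ₂ b)
    (hW : Entails C A W (.pair i W₁ W₂)) :
    Splits atom κ m C A W i ![x, y] (Γ₁ + Γ₂) a b x y := by
  have hA : i ∈ A := (hs.assoc i).2 (hi ▸ trivial)
  have hC : i ∈ C := (hs.comm i).2 (hi ▸ trivial)
  obtain ⟨X, hX, ⟨rfl, rfl⟩ | ⟨i₁, p₁, V₁, G₁, hi₁, rfl, hE₁, hT₁⟩⟩ := h1
  · obtain ⟨Y, hY, ⟨rfl, rfl⟩ | ⟨i₂, p₂, V₂, G₂, hi₂, rfl, hE₂, hT₂⟩⟩ := h2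
    · exact ⟨.hole, X, Y, hX, hY, hW, fun Z => by rw [zero_add, zero_add]; rfl⟩
    · obtain ⟨rfl, rfl⟩ := hs.eq_of_par hi hi₂
      refine ⟨.pairL i .hole V₂, X, Y, hX, hY,
        hW.trans ((Entails.pair i (.refl _) hE₂).trans (.assocL hA _ _ _)), fun Z => ?_⟩
      exact (tree_par hi (tree_form Z x y) hT₂).congr (fun _ => rfl) (by abel)
  · obtain ⟨rfl, rfl⟩ := hs.eq_of_par hi hi₁
    -- The remainder `V₁` is moved past `V`, so that the formula stands next to `V`.
    have hstep : ∀ V : Database At I J, Entails C A (.pair i W₁ V)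
        (.pair i (.pair i (.form X) V) V₁) := fun V =>
      (Entails.pair i hE₁ (.refl _)).trans ((Entails.assocR hA _ _ _).trans
        ((Entails.pair i (.refl _) (.swap hC _ _)).trans (.assocL hA _ _ _)))
    obtain ⟨Y, hY, ⟨rfl, rfl⟩ | ⟨i₂, p₂, V₂, G₂, hi₂, rfl, hE₂, hT₂⟩⟩ := h2
    · refine ⟨.pairL i .hole V₁, X, Y, hX, hY, hW.trans (hstep _), fun Z => ?_⟩
      exact (tree_par hi (tree_form Z x y) hT₁).congr (fun _ => rfl) (by abel)
    · obtain ⟨rfl, rfl⟩ := hs.eq_of_par hi hi₂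
      refine ⟨.pairL i (.pairL i .hole V₂) V₁, X, Y, hX, hY, hW.trans ((hstep _).trans
        (Entails.pair i ((Entails.pair i (.refl _) hE₂).trans (.assocL hA _ _ _)) (.refl _))),
        fun Z => ?_⟩
      exact (tree_par hi (tree_par hi (tree_form Z x y) hT₂) hT₁).congr (fun _ => rfl) (by abel)

theorem exists_of_add_eq {α : Type*} {B S Γ : Multiset α} {f g : α}
    (h : B + S = Γ + {f} + {g}) (hf : f ∉ B) (hg : g ∉ B) :
    ∃ Γ', Γ = B + Γ' ∧ S = Γ' + {f} + {g} := by
  have hfg : ∀ {f : α} {Γ S : Multiset α}, f ∉ B → B + S = Γ + {f} →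
      ∃ S', S = S' + {f} ∧ B + S' = Γ := by
    intro f Γ S hf h
    have hm : f ∈ B + S := by rw [h]; simp
    obtain ⟨S', rfl⟩ := Multiset.exists_cons_of_mem ((Multiset.mem_add.1 hm).resolve_left hf)
    rw [← Multiset.singleton_add] at *
    exact ⟨S', add_comm _ _, add_right_cancel (b := {f}) (Eq.trans (by abel) h)⟩
  obtain ⟨S₁, rfl, h1⟩ := hfg hg h
  obtain ⟨S₂, rfl, h2⟩ := hfg hf h1
  exact ⟨S₂, h2.symm, rfl⟩

theorem cases_of_add_eq {α : Type*} {S₁ S₂ Γ : Multiset α} {f g : α}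
    (h : S₁ + S₂ = Γ + {f} + {g}) :
    (∃ R, S₁ = R + {f} + {g} ∧ Γ = R + S₂) ∨ (∃ R, S₂ = R + {f} + {g} ∧ Γ = S₁ + R) ∨
    (∃ R₁ R₂, S₁ = R₁ + {f} ∧ S₂ = R₂ + {g} ∧ Γ = R₁ + R₂) ∨
    ∃ R₁ R₂, S₁ = R₁ + {g} ∧ S₂ = R₂ + {f} ∧ Γ = R₁ + R₂ := by
  have key : ∀ {f : α} {Γ S₁ S₂ : Multiset α}, S₁ + S₂ = Γ + {f} →
      (∃ R, S₁ = R + {f} ∧ Γ = R + S₂) ∨ ∃ R, S₂ = R + {f} ∧ Γ = S₁ + R := by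
    intro f Γ S₁ S₂ h
    have hm : f ∈ S₁ + S₂ := by rw [h]; simp
    rcases Multiset.mem_add.1 hm with hm | hm
    · obtain ⟨R, rfl⟩ := Multiset.exists_cons_of_mem hm
      rw [← Multiset.singleton_add] at *
      exact .inl ⟨R, add_comm _ _, add_right_cancel (b := {f}) (h.symm.trans (by abel))⟩
    · obtain ⟨R, rfl⟩ := Multiset.exists_cons_of_mem hm
      rw [← Multiset.singleton_add] at *
      exact .inr ⟨R, add_comm _ _, add_right_cancel (b := {f}) (h.symm.trans (by abel))⟩
  rcases key h with ⟨R, rfl, h1⟩ | ⟨R, rfl, h1⟩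
  · rcases key h1.symm with ⟨R, rfl, rfl⟩ | ⟨R, rfl, rfl⟩
    · exact .inl ⟨R, rfl, rfl⟩
    · exact .inr (.inr (.inr ⟨_, _, rfl, rfl, rfl⟩))
  · rcases key h1.symm with ⟨R, rfl, rfl⟩ | ⟨R, rfl, rfl⟩
    · exact .inr (.inr (.inl ⟨_, _, rfl, rfl, rfl⟩))
    · exact .inr (.inl ⟨R, rfl, rfl⟩)

/-- Two facts at the same points can be brought together by a parallel composition. -/
theorem splits_par (hs : KindSpec C A κ m) {i : I} {p : Pr 0} (hi : κ i = .par p)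
    {W : Database At I J} {x y x₀ y₀ : P} {S Γ : Multiset (Fact Pr P)} {a b : Lab Pr 2}
    (h : (kindTranslation atom κ m).Tree W ![x₀, y₀] S) (hn : ({x₀} + {y₀} + outs S).Nodup)
    (hS : S = Γ + {fact a ![x, y]} + {fact b ![x, y]}) :
    ∃ Γ', Γ = {pfact p ![]} + Γ' ∧ Splits atom κ m C A W i ![x₀, y₀] Γ' a b x y := by
  induction W generalizing x₀ y₀ S Γ with
  | form X =>
    have hc := congrArg Multiset.card hS
    have h' : S = _ := h
    rw [h'] at hc
    simp at hc
  | bracket j W ih =>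
    obtain ⟨l, l', S₁, rfl, h1⟩ := tree_bracket_iff.1 h
    obtain ⟨Γ₁, rfl, rfl⟩ := exists_of_add_eq hS
      (fun h => absurd (congrArg Sigma.fst (Multiset.mem_singleton.1 h))
        (by change ¬ (2 = 4); decide))
      (fun h => absurd (congrArg Sigma.fst (Multiset.mem_singleton.1 h))
        (by change ¬ (2 = 4); decide))
    obtain ⟨Γ', rfl, h2⟩ := ih h1 (by
      rw [outs_add, outs_four] at hn
      exact Multiset.nodup_of_le (le_iff_exists_add.2 ⟨{x₀} + {y₀}, by
        rw [add_comm]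
        rfl⟩) hn) rfl
    refine ⟨{pfact (m j) ![x₀, y₀, l, l']} + Γ', by abel, ?_⟩
    exact h2.lift (E := .bracket j .hole) (.refl _)
      (fun W' S hW' => tree_bracket_iff.2 ⟨l, l', S, rfl, hW'⟩) rfl
  | pair i' W₁ W₂ ih1 ih2 =>
    obtain ⟨B, l, l', r, r', S₁, S₂, hF, rfl, h1, h2⟩ := tree_pair_iff.1 h
    obtain ⟨hn1, hn2⟩ := hF.nodup hn
    obtain ⟨Γ₁, rfl, hS₁⟩ := exists_of_add_eq ((add_assoc B S₁ S₂).symm.trans hS)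
      (fun h => hF.rank_ne h rfl) (fun h => hF.rank_ne h rfl)
    -- If the two leaves lie in different slots, the root must be the parallel composition at their
    -- own points.
    have apart : ∀ {R₁ R₂ : Multiset (Fact Pr P)} {a b : Lab Pr 2}, S₁ = R₁ + {fact a ![x, y]} →
        S₂ = R₂ + {fact b ![x, y]} → i' = i ∧ x₀ = x ∧ y₀ = y ∧ B = {pfact p ![]} ∧
        Peels atom κ m C A W₁ x y R₁ a ∧ Peels atom κ m C A W₂ x y R₂ b := by
      intro R₁ R₂ a b e1 e2
      have m1 := leaf_mem h1 (a := a) (s := ![x, y]) (by rw [e1]; simp)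
      have m2 := leaf_mem h2 (a := b) (s := ![x, y]) (by rw [e2]; simp)
      rw [outs_add, outs_add] at hn
      have hd : ∀ q, q ∈ outs S₁ → q ∈ outs S₂ → False := fun q hq1 hq2 => by
        rw [← add_assoc, Multiset.nodup_add] at hn
        exact Multiset.disjoint_left.1 hn.2.2 (Multiset.mem_add.2 (.inr
          (Multiset.mem_add.2 (.inr hq1)))) hq2
      by_cases hK : ∀ p, κ i' ≠ .par p
      -- For any other gadget in this setting the targets of the two slots, and the outputs inside
      -- them, are all different, so the leaves could not share the target `y`.
      · exfalso
        obtain ⟨R, hR⟩ := le_iff_exists_add.1 (hF.target_le hK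
          ((hs.world.resolve_left fun h => h.1 i p hi).1 i')
          ((hs.world.resolve_left fun h => h.1 i p hi).2 i'))
        rw [hR] at hn
        have hn' : ({l'} + {r'} + (outs S₁ + outs S₂)).Nodup :=
          Multiset.nodup_of_le (le_iff_exists_add.2 ⟨{x₀} + {y₀} + R, by abel⟩) hn
        have hd1 : l' ≠ r' := by
          rintro rfl
          have := (Multiset.nodup_add.1 hn').1
          simp at this
        have hd2 := (Multiset.nodup_add.1 hn').2.2
        rw [Multiset.disjoint_left] at hd2
        rcases m1.2 with e1 | e1
        · change y = l' at e1
          rcases m2.2 with e2 | e2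
          · change y = r' at e2
            exact hd1 (e1.symm.trans e2)
          · exact hd2 (a := y) (by simp [e1]) (Multiset.mem_add.2 (.inr e2))
        · rcases m2.2 with e2 | e2
          · change y = r' at e2
            exact hd2 (a := y) (by simp [e2]) (Multiset.mem_add.2 (.inl e1))
          · exact hd y e1 e2
      · push Not at hK
        obtain ⟨p', hp⟩ := hK
        obtain ⟨rfl, rfl⟩ := hs.eq_of_par hi hp
        rw [hp] at hF
        obtain ⟨rfl, rfl, rfl, rfl, rfl⟩ := hF
        have k1 : r = x := by
          rcases m1.1 with e | e
          · exact e.symm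
          · exact m2.1.elim (fun e => e.symm) fun e' => (hd x e e').elim
        have k2 : r' = y := by
          rcases m1.2 with e | e
          · exact e.symm
          · exact m2.2.elim (fun e => e.symm) fun e' => (hd y e e').elim
        subst k1 k2
        exact ⟨rfl, rfl, rfl, rfl, tree_extract hs h1 hn1 e1, tree_extract hs h2 hn2 e2⟩
    rcases cases_of_add_eq hS₁ with ⟨R, rfl, rfl⟩ | ⟨R, rfl, rfl⟩ | ⟨R₁, R₂, e1, e2, rfl⟩ |
        ⟨R₁, R₂, e1, e2, rfl⟩
    · obtain ⟨Γ', rfl, h3⟩ := ih1 h1 hn1 rfl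
      refine ⟨B + Γ' + S₂, by abel, ?_⟩
      refine h3.lift (E := .pairL i' .hole W₂) (Γ' := B + S₂) (.refl _)
        (fun W' S hW' => ?_) (by abel)
      exact tree_pair_iff.2 ⟨B, l, l', r, r', S, S₂, hF, by abel, hW', h2⟩
    · obtain ⟨Γ', rfl, h3⟩ := ih2 h2 hn2 rfl
      refine ⟨B + S₁ + Γ', by abel, ?_⟩
      refine h3.lift (E := .pairR i' W₁ .hole) (Γ' := B + S₁) (.refl _)
        (fun W' S hW' => ?_) (by abel)
      exact tree_pair_iff.2 ⟨B, l, l', r, r', S₁, S, hF, by abel, h1, hW'⟩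
    · obtain ⟨rfl, rfl, rfl, rfl, p1, p2⟩ := apart e1 e2
      exact ⟨_, rfl, splits_par_root hs hi p1 p2 (.refl _)⟩
    · obtain ⟨rfl, rfl, rfl, rfl, p1, p2⟩ := apart e1 e2
      exact ⟨_, by rw [add_comm R₁], splits_par_root hs hi p2 p1
        (.swap ((hs.comm i').2 (hi ▸ trivial)) _ _)⟩

end KindTrees

open HL NLM Translation

/-! ### Series composition: the associative, non-commutative mode. -/

section KindTrees

variable {At : Type u} {I : Type v} {J : Type w} {Pr : ℕ → Type x} {atom : At ↪ Pr 2}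
  {κ : I → Kind Pr} {m : J → Pr 4} {P : Type} {C A : Set I}

theorem KindSpec.not_par_of_series (hs : KindSpec C A κ m) {i : I} {p : Pr 1}
    (hi : κ i = .series p) (i' : I) (p' : Pr 0) : κ i' ≠ .par p' :=
  (hs.world.resolve_right fun h => h.2 i p hi).1 i' p'

/-- If only one fact, of rank two, touches the target of a tree, then the tree is a leaf or a series
composition which ends with this fact. -/
theorem tree_ends (hs : KindSpec C A κ m) {i : I} {p : Pr 1} (hi : κ i = .series p)
    {W : Database At I J} {x y : P} {S Γ : Multiset (Fact Pr P)} {a : Lab Pr 2} {s : Fin 2 → P}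
    (h : (kindTranslation atom κ m).Tree W ![x, y] S) (hS : S ≤ {fact a s} + Γ)
    (hy : Avoids y Γ) :
    ∃ X : NLM.Formula At I J, a = ((kindTranslation atom κ m).mu X).cls ∧ s 1 = y ∧
      (W = .form X ∧ S = {fact a s} ∧ s 0 = x ∨ ∃ (W' : Database At I J)
        (R : Multiset (Fact Pr P)), Entails C A W (.pair i W' (.form X)) ∧
        S = {pfact p ![s 0]} + {fact a s} + R ∧
        (kindTranslation atom κ m).Tree W' ![x, s 0] R) := by
  -- Any root other than a leaf or a series composition would contribute a fact of rank at least 4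
  -- at `y`, which is not available.
  have main : ∀ {W : Database At I J} {x : P} {S : Multiset (Fact Pr P)},
      (kindTranslation atom κ m).Tree W ![x, y] S → S ≤ {fact a s} + Γ → (∃ X, W = .form X ∧
        S = {fact ((kindTranslation atom κ m).mu X).cls ![x, y]}) ∨
      ∃ W₁ W₂ z S₁ S₂, W = .pair i W₁ W₂ ∧ S = {pfact p ![z]} + S₁ + S₂ ∧
      (kindTranslation atom κ m).Tree W₁ ![x, z] S₁ ∧
      (kindTranslation atom κ m).Tree W₂ ![z, y] S₂ := by
    intro W x S h hS
    rcases tree_cases h with h | ⟨f, S', h4, h1, h2, rfl, -⟩ | ⟨i', W₁, W₂, p', z, S₁, S₂,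
      hi', rfl, rfl, h1, h2⟩ | ⟨i', W₁, W₂, p', S₁, S₂, hi', -⟩
    · exact .inl h
    · have h5 := Multiset.mem_of_le hS (Multiset.mem_add.2 (.inl (Multiset.mem_singleton_self _)))
      rw [Multiset.mem_add, Multiset.mem_singleton] at h5
      rw [h5.resolve_right (hy.notMem h2)] at h4
      exact absurd h4 (by change ¬ 4 ≤ 2; decide)
    · obtain ⟨rfl, rfl⟩ := hs.eq_of_series hi hi'
      exact .inr ⟨W₁, W₂, z, S₁, S₂, rfl, rfl, h1, h2⟩
    · exact absurd hi' (hs.not_par_of_series hi i' p')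
  induction W generalizing x S with
  | form X =>
    rcases main h hS with ⟨X', hX, rfl⟩ | ⟨W₁, W₂, z, S₁, S₂, hX, -⟩
    · cases hX
      have h1 := Multiset.mem_of_le hS (Multiset.mem_singleton_self _)
      rw [Multiset.mem_add, Multiset.mem_singleton, fact_inj] at h1
      obtain ⟨rfl, rfl⟩ := h1.resolve_right (hy.notMem ⟨(1 : Fin 2), rfl⟩)
      exact ⟨X, rfl, rfl, .inl ⟨rfl, rfl, rfl⟩⟩
    · cases hX
  | bracket j W ih =>
    rcases main h hS with ⟨X', hX, -⟩ | ⟨W₁, W₂, z, S₁, S₂, hX, -⟩ <;> cases hX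
  | pair i' W₁ W₂ ih1 ih2 =>
    rcases main h hS with ⟨X', hX, -⟩ | ⟨W₁, W₂, z, S₁, S₂, hX, rfl, h1, h2⟩
    · cases hX
    · cases hX
      obtain ⟨X, hX, h3, ⟨rfl, rfl, rfl⟩ | ⟨W', R, hE, rfl, hT⟩⟩ :=
        ih2 h2 ((Multiset.le_add_left _ _).trans hS)
      · exact ⟨X, hX, h3, .inr ⟨W₁, S₁, .refl _, by abel, h1⟩⟩
      · exact ⟨X, hX, h3, .inr ⟨.pair i W₁ W', _, (Entails.pair i (.refl _) hE).trans
          (.assocL ((hs.assoc i).2 (hi ▸ trivial)) _ _ _), by abel, tree_series hi h1 hT⟩⟩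

/-- If only one fact, of rank two, touches the source of a tree, then the tree is a leaf or a series
composition which starts with this fact. -/
theorem tree_starts (hs : KindSpec C A κ m) {i : I} {p : Pr 1} (hi : κ i = .series p)
    {W : Database At I J} {x y : P} {S Γ : Multiset (Fact Pr P)} {a : Lab Pr 2} {s : Fin 2 → P}
    (h : (kindTranslation atom κ m).Tree W ![x, y] S) (hS : S ≤ {fact a s} + Γ)
    (hx : Avoids x Γ) :
    ∃ X : NLM.Formula At I J, a = ((kindTranslation atom κ m).mu X).cls ∧ s 0 = x ∧
      (W = .form X ∧ S = {fact a s} ∧ s 1 = y ∨ ∃ (W' : Database At I J)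
        (R : Multiset (Fact Pr P)), Entails C A W (.pair i (.form X) W') ∧
        S = {pfact p ![s 1]} + {fact a s} + R ∧
        (kindTranslation atom κ m).Tree W' ![s 1, y] R) := by
  have main : ∀ {W : Database At I J} {y : P} {S : Multiset (Fact Pr P)},
      (kindTranslation atom κ m).Tree W ![x, y] S → S ≤ {fact a s} + Γ → (∃ X, W = .form X ∧
        S = {fact ((kindTranslation atom κ m).mu X).cls ![x, y]}) ∨
      ∃ W₁ W₂ z S₁ S₂, W = .pair i W₁ W₂ ∧ S = {pfact p ![z]} + S₁ + S₂ ∧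
      (kindTranslation atom κ m).Tree W₁ ![x, z] S₁ ∧
      (kindTranslation atom κ m).Tree W₂ ![z, y] S₂ := by
    intro W y S h hS
    rcases tree_cases h with h | ⟨f, S', h4, h1, h2, rfl, -⟩ | ⟨i', W₁, W₂, p', z, S₁, S₂,
      hi', rfl, rfl, h1, h2⟩ | ⟨i', W₁, W₂, p', S₁, S₂, hi', -⟩
    · exact .inl h
    · have h5 := Multiset.mem_of_le hS (Multiset.mem_add.2 (.inl (Multiset.mem_singleton_self _)))
      rw [Multiset.mem_add, Multiset.mem_singleton] at h5
      rw [h5.resolve_right (hx.notMem h1)] at h4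
      exact absurd h4 (by change ¬ 4 ≤ 2; decide)
    · obtain ⟨rfl, rfl⟩ := hs.eq_of_series hi hi'
      exact .inr ⟨W₁, W₂, z, S₁, S₂, rfl, rfl, h1, h2⟩
    · exact absurd hi' (hs.not_par_of_series hi i' p')
  induction W generalizing y S with
  | form X =>
    rcases main h hS with ⟨X', hX, rfl⟩ | ⟨W₁, W₂, z, S₁, S₂, hX, -⟩
    · cases hX
      have h1 := Multiset.mem_of_le hS (Multiset.mem_singleton_self _)
      rw [Multiset.mem_add, Multiset.mem_singleton, fact_inj] at h1
      obtain ⟨rfl, rfl⟩ := h1.resolve_right (hx.notMem ⟨(0 : Fin 2), rfl⟩)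
      exact ⟨X, rfl, rfl, .inl ⟨rfl, rfl, rfl⟩⟩
    · cases hX
  | bracket j W ih =>
    rcases main h hS with ⟨X', hX, -⟩ | ⟨W₁, W₂, z, S₁, S₂, hX, -⟩ <;> cases hX
  | pair i' W₁ W₂ ih1 ih2 =>
    rcases main h hS with ⟨X', hX, -⟩ | ⟨W₁, W₂, z, S₁, S₂, hX, rfl, h1, h2⟩
    · cases hX
    · cases hX
      obtain ⟨X, hX, h3, ⟨rfl, rfl, rfl⟩ | ⟨W', R, hE, rfl, hT⟩⟩ :=
        ih1 h1 (((Multiset.le_add_left _ _).trans (Multiset.le_add_right _ _)).trans hS)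
      · exact ⟨X, hX, h3, .inr ⟨W₂, S₂, .refl _, rfl, h2⟩⟩
      · exact ⟨X, hX, h3, .inr ⟨.pair i W' W₂, _, (Entails.pair i hE (.refl _)).trans
          (.assocR ((hs.assoc i).2 (hi ▸ trivial)) _ _ _), by abel, tree_series hi hT h2⟩⟩

theorem eq_of_touch {Γ : Multiset (Fact Pr P)} {f g₁ g₂ : Fact Pr P} {z : P} (hz : Avoids z Γ)
    (hf : f ∈ Γ + {g₁} + {g₂}) (hf' : ∃ l, f.2.2 l = z) : f = g₁ ∨ f = g₂ := by
  rw [Multiset.mem_add, Multiset.mem_add, Multiset.mem_singleton, Multiset.mem_singleton] at hf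
  rcases hf with (hf | hf) | hf
  · exact absurd hf (hz.notMem hf')
  · exact .inl hf
  · exact .inr hf

/-- The label at `z` marks a series composition whose parts meet at `z`. Only the two leaves touch
`z`, so the first part ends with one and the second starts with the other; associativity brings them
together. -/
theorem splits_series (hs : KindSpec C A κ m) {i : I} {p : Pr 1} (hi : κ i = .series p)
    {W : Database At I J} {t : Fin 2 → P} {Γ : Multiset (Fact Pr P)} {x y z : P} {a b : Lab Pr 2}
    (h : (kindTranslation atom κ m).Tree W t
      (Γ + ({pfact p ![z]} + {fact a ![x, z]} + {fact b ![z, y]})))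
    (hz : Avoids z Γ) (hx : z ≠ x) (hy : z ≠ y) : Splits atom κ m C A W i t Γ a b x y := by
  have hA : i ∈ A := (hs.assoc i).2 (hi ▸ trivial)
  obtain ⟨D, W₁, W₂, x₀, y₀, B, k, k', q, q', S₁, S₂, S', rfl, hS, hB, hF, hW₁, hW₂, hD⟩ :=
    locate_label hs hi (s := ![z]) h (by
      simp only [Multiset.mem_add, Multiset.mem_singleton]
      exact .inr (.inl (.inl rfl)))
  obtain ⟨rfl, rfl, rfl, rfl⟩ := hF
  obtain rfl : z = q := congrFun (pfact_inj.1 (Multiset.mem_singleton.1 hB)).2 (0 : Fin 1)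
  have hS' : S' + S₁ + S₂ = Γ + {fact a ![x, z]} + {fact b ![z, y]} := by
    refine add_left_cancel (a := {pfact p ![z]}) (Eq.trans ?_ (hS.symm.trans ?_)) <;> abel
  obtain ⟨-, f, hf, hf'⟩ := exists_touch hW₁
  obtain ⟨⟨g, hg, hg'⟩, -⟩ := exists_touch hW₂
  have hab : (fact a ![x, z] : Fact Pr P) ≠ fact b ![z, y] := fun h =>
    hx (congrFun (fact_inj.1 h).2 0).symm
  obtain ⟨R₁, rfl⟩ := Multiset.exists_cons_of_mem hf
  obtain ⟨R₂, rfl⟩ := Multiset.exists_cons_of_mem hg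
  rw [← Multiset.singleton_add, ← Multiset.singleton_add] at *
  have hf₁ := eq_of_touch hz (f := f) (by rw [← hS']; simp) hf'
  have hg₁ := eq_of_touch hz (f := g) (by rw [← hS']; simp) hg'
  -- The two leaves are different and do not occur in `Γ`, so each occurs once and the two parts
  -- cannot both contain the same one.
  have hne : f ≠ g := by
    have twice : ∀ {Γ : Multiset (Fact Pr P)} {g₁ g₂ : Fact Pr P}, g₁ ≠ g₂ → g₁ ∉ Γ →
        S' + ({g₁} + R₁) + ({g₁} + R₂) = Γ + {g₁} + {g₂} → False := by
      intro Γ g₁ g₂ h1 h2 h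
      have h' : S' + R₁ + R₂ + {g₁} = Γ + {g₂} :=
        add_right_cancel (b := {g₁}) (Eq.trans (by abel) (h.trans (by abel)))
      have : g₁ ∈ Γ + {g₂} := by rw [← h']; simp
      rw [Multiset.mem_add, Multiset.mem_singleton] at this
      exact this.elim h2 h1
    rintro rfl
    rcases hf₁ with rfl | rfl
    · exact twice hab (hz.notMem hf') hS'
    · exact twice hab.symm (hz.notMem hf') (hS'.trans (by abel))
  rcases hf₁ with rfl | rfl
  · obtain rfl := hg₁.resolve_left hne.symm
    have hS'' : S' + R₁ + R₂ = Γ := by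
      refine add_right_cancel (b := {fact a ![x, z]} + {fact b ![z, y]})
        (Eq.trans ?_ (hS'.trans ?_)) <;> abel
    subst hS''
    -- Whatever precedes the last leaf of `W₁` is put into a context `E`; it is empty if `W₁` is
    -- itself the leaf. The side `right` is treated in the same way.
    have left : ∃ (X : NLM.Formula At I J) (E : Ctx At I J),
        a = ((kindTranslation atom κ m).mu X).cls ∧
        (∀ V, Entails C A (.pair i W₁ V) (E.fill (.pair i (.form X) V))) ∧
        ∀ W' S y₀, (kindTranslation atom κ m).Tree W' ![x, y₀] S →
          (kindTranslation atom κ m).Tree (E.fill W') ![k, y₀] (R₁ + S) := by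
      obtain ⟨X, hX, -, ⟨rfl, h1, h2⟩ | ⟨W', R, hE, h1, hT⟩⟩ := tree_ends (a := a)
        (s := ![x, z]) (Γ := S' + R₁ + R₂) hs hi hW₁
        (le_iff_exists_add.2 ⟨S' + R₂, by abel⟩) hz
      · refine ⟨X, .hole, hX, fun V => .refl _, fun W' S y₀ hV => ?_⟩
        obtain rfl : R₁ = 0 := by simpa using congrArg Multiset.card h1
        change x = k at h2
        subst h2
        exact hV.congr (fun _ => rfl) (zero_add _).symm
      · refine ⟨X, .pairR i W' .hole, hX, fun V =>
          (Entails.pair i hE (.refl _)).trans (.assocR hA _ _ _), fun W₀ S y₀ hV => ?_⟩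
        obtain rfl : R₁ = {pfact p ![x]} + R := by
          refine add_right_cancel (b := {fact a ![x, z]}) (Eq.trans ?_ (h1.trans ?_))
          · abel
          · change {pfact p ![x]} + _ + _ = _
            abel
        exact tree_series hi hT hV
    have right : ∃ (Y : NLM.Formula At I J) (E : Ctx At I J),
        b = ((kindTranslation atom κ m).mu Y).cls ∧
        (∀ V, Entails C A (.pair i V W₂) (E.fill (.pair i V (.form Y)))) ∧
        ∀ W' S x₀, (kindTranslation atom κ m).Tree W' ![x₀, y] S →
          (kindTranslation atom κ m).Tree (E.fill W') ![x₀, q'] (R₂ + S) := by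
      obtain ⟨X, hX, -, ⟨rfl, h1, h2⟩ | ⟨W', R, hE, h1, hT⟩⟩ := tree_starts (a := b)
        (s := ![z, y]) (Γ := S' + R₁ + R₂) hs hi hW₂
        (le_iff_exists_add.2 ⟨S' + R₁, by abel⟩) hz
      · refine ⟨X, .hole, hX, fun V => .refl _, fun W' S x₀ hV => ?_⟩
        obtain rfl : R₂ = 0 := by simpa using congrArg Multiset.card h1
        change y = q' at h2
        subst h2
        exact hV.congr (fun _ => rfl) (zero_add _).symm
      · refine ⟨X, .pairL i .hole W', hX, fun V =>
          (Entails.pair i (.refl _) hE).trans (.assocL hA _ _ _), fun W₀ S x₀ hV => ?_⟩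
        obtain rfl : R₂ = {pfact p ![y]} + R := by
          refine add_right_cancel (b := {fact b ![z, y]}) (Eq.trans ?_ (h1.trans ?_))
          · abel
          · change {pfact p ![y]} + _ + _ = _
            abel
        exact (tree_series hi hV hT).congr (fun _ => rfl) (by abel)
    obtain ⟨X, E, hX, hE, hE'⟩ := left
    obtain ⟨Y, F, hY, hF, hF'⟩ := right
    refine ⟨(D.comp E).comp F, X, Y, hX, hY, ?_, fun Z => ?_⟩
    · rw [Ctx.fill_comp, Ctx.fill_comp]
      exact ((hE W₂).trans ((hF _).fill E)).fill D
    · rw [Ctx.fill_comp, Ctx.fill_comp]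
      exact (hD _ _ (hE' _ _ _ (hF' _ _ _ (tree_form Z x y)))).congr (fun _ => rfl) (by abel)
  -- With the leaves exchanged, the leaf of `b` would end the first part, so its target `y` would be
  -- `z`.
  · exfalso
    obtain rfl := hg₁.resolve_right hne.symm
    have hS'' : S' + R₁ + R₂ = Γ := by
      refine add_right_cancel (b := {fact a ![x, z]} + {fact b ![z, y]})
        (Eq.trans ?_ (hS'.trans ?_)) <;> abel
    obtain ⟨X, hX, h1, -⟩ := tree_ends (a := b) (s := ![z, y]) (Γ := Γ) hs hi hW₁
        (le_iff_exists_add.2 ⟨S' + R₂, by rw [← hS'']; abel⟩) hz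
    exact hy h1.symm

end KindTrees

open HL NLM Translation

/-! ### Splitting off one argument at the root. -/

section KindTrees

variable {At : Type u} {I : Type v} {J : Type w} {Pr : ℕ → Type x} {atom : At ↪ Pr 2}
  {κ : I → Kind Pr} {m : J → Pr 4} {P : Type} {C A : Set I}

variable (atom κ m C A) in
/-- `W` can be rearranged so that in mode `i` it is composed of a formula with label `b` on the left
and a database with the facts `Γ` on the right. -/
def SplitsRight (W : Database At I J) (i : I) (b : Lab Pr 2) (x y : P)
    (Γ : Multiset (Fact Pr P)) : Prop :=
  ∃ (Y : NLM.Formula At I J) (W' : Database At I J), b = ((kindTranslation atom κ m).mu Y).cls ∧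
    Entails C A W (.pair i (.form Y) W') ∧ (kindTranslation atom κ m).Tree W' ![x, y] Γ

variable (atom κ m C A) in
/-- As `SplitsRight`, with the sides exchanged. -/
def SplitsLeft (W : Database At I J) (i : I) (b : Lab Pr 2) (x y : P)
    (Γ : Multiset (Fact Pr P)) : Prop :=
  ∃ (Y : NLM.Formula At I J) (W' : Database At I J), b = ((kindTranslation atom κ m).mu Y).cls ∧
    Entails C A W (.pair i W' (.form Y)) ∧ (kindTranslation atom κ m).Tree W' ![x, y] Γ

theorem SplitsRight.swap {W : Database At I J} {i : I} {b : Lab Pr 2} {x y : P}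
    {Γ : Multiset (Fact Pr P)} (h : SplitsRight atom κ m C A W i b x y Γ) (hi : i ∈ C) :
    SplitsLeft atom κ m C A W i b x y Γ := by
  obtain ⟨Y, W', hY, hE, hT⟩ := h
  exact ⟨Y, W', hY, hE.trans (.swap hi _ _), hT⟩

/-- The label is the only fact at the external points, so it belongs to the root and not to a deeper
gadget. -/
theorem root_tree (hs : KindSpec C A κ m) {i : I} {p : Pr 6} (hi : κ i = .tree p)
    {W : Database At I J} {x y l l' r r' : P} {S Γ : Multiset (Fact Pr P)}
    (h : (kindTranslation atom κ m).Tree W ![x, y] S)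
    (hS : S = {pfact p ![x, y, l, l', r, r']} + Γ) (hx : Avoids x Γ) (hy : Avoids y Γ) :
    ∃ W₁ W₂ S₁ S₂, W = .pair i W₁ W₂ ∧ Γ = S₁ + S₂ ∧
      (kindTranslation atom κ m).Tree W₁ ![l, l'] S₁ ∧
      (kindTranslation atom κ m).Tree W₂ ![r, r'] S₂ := by
  have h1 := rootAt_of_avoids (f := pfact p ![x, y, l, l', r, r']) h hS.le
    (by change ¬ 6 = 2; decide) hx hy
  obtain ⟨W₁, W₂, B, k, k', q, q', S₁, S₂, rfl, hB, hF, hS', hW₁, hW₂⟩ :=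
    rootAt_label hs hi (s := ![x, y, l, l', r, r']) h1
  change B = _ at hF
  subst hF
  have h5 := (pfact_inj.1 (Multiset.mem_singleton.1 hB)).2
  obtain rfl : l = k := congrFun h5 (2 : Fin 6)
  obtain rfl : l' = k' := congrFun h5 (3 : Fin 6)
  obtain rfl : r = q := congrFun h5 (4 : Fin 6)
  obtain rfl : r' = q' := congrFun h5 (5 : Fin 6)
  exact ⟨W₁, W₂, S₁, S₂, rfl,
    add_left_cancel (hS.symm.trans (hS'.trans (add_assoc _ _ _))), hW₁, hW₂⟩

theorem splitsRight_tree (hs : KindSpec C A κ m) {i : I} {p : Pr 6} (hi : κ i = .tree p)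
    {W : Database At I J} {x y l l' r r' : P} {S Γ : Multiset (Fact Pr P)} {b : Lab Pr 2}
    (h : (kindTranslation atom κ m).Tree W ![x, y] S)
    (hS : S = {pfact p ![x, y, l, l', r, r']} + {fact b ![l, l']} + Γ)
    (hx : Avoids x Γ) (hy : Avoids y Γ) (hl : Avoids l Γ) (hl' : Avoids l' Γ)
    (h1 : x ≠ l) (h2 : x ≠ l') (h3 : y ≠ l) (h4 : y ≠ l') :
    SplitsRight atom κ m C A W i b r r' Γ := by
  obtain ⟨W₁, W₂, S₁, S₂, rfl, h5, hW₁, hW₂⟩ := root_tree hs hi h (hS.trans (add_assoc _ _ _))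
    ((avoids_pair h1 h2).add hx) ((avoids_pair h3 h4).add hy)
  obtain ⟨X, rfl, rfl, hX, -⟩ := tree_single (a := b) (s := ![l, l']) (Γ := Γ) hW₁
    (le_iff_exists_add.2 ⟨_, h5⟩) hl' (.inl hl)
  obtain rfl := add_left_cancel h5
  exact ⟨X, W₂, hX, .refl _, hW₂⟩

theorem splitsLeft_tree (hs : KindSpec C A κ m) {i : I} {p : Pr 6} (hi : κ i = .tree p)
    {W : Database At I J} {x y l l' r r' : P} {S Γ : Multiset (Fact Pr P)} {b : Lab Pr 2}
    (h : (kindTranslation atom κ m).Tree W ![x, y] S)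
    (hS : S = {pfact p ![x, y, l, l', r, r']} + {fact b ![r, r']} + Γ)
    (hx : Avoids x Γ) (hy : Avoids y Γ) (hr : Avoids r Γ) (hr' : Avoids r' Γ)
    (h1 : x ≠ r) (h2 : x ≠ r') (h3 : y ≠ r) (h4 : y ≠ r') :
    SplitsLeft atom κ m C A W i b l l' Γ := by
  obtain ⟨W₁, W₂, S₁, S₂, rfl, h5, hW₁, hW₂⟩ := root_tree hs hi h (hS.trans (add_assoc _ _ _))
    ((avoids_pair h1 h2).add hx) ((avoids_pair h3 h4).add hy)
  obtain ⟨X, rfl, rfl, hX, -⟩ := tree_single (a := b) (s := ![r, r']) (Γ := Γ) hW₂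
    (le_iff_exists_add.2 ⟨S₁, h5.trans (add_comm _ _)⟩) hr' (.inl hr)
  obtain rfl := add_left_cancel (h5.trans (add_comm _ _))
  exact ⟨X, W₁, hX, .refl _, hW₁⟩

/-- Here `Γ` does touch `l` and `l'`, so `tree_single` is not available. The slot that contains the
leaf is found first, and `tree_extract` shows that, without parallel composition, it consists of the
leaf alone. -/
theorem splitsRight_quad (hs : KindSpec C A κ m) {i : I} {p : Pr 4} (hi : κ i = .quad p)
    {W : Database At I J} {x y l l' : P} {S Γ : Multiset (Fact Pr P)} {b : Lab Pr 2}
    (h : (kindTranslation atom κ m).Tree W ![x, y] S) (hn : ({x} + {y} + outs S).Nodup)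
    (hS : S = {pfact p ![x, y, l, l']} + {fact b ![l, l']} + Γ)
    (hx : Avoids x Γ) (hy : Avoids y Γ) (h1 : x ≠ l) (h2 : x ≠ l') (h3 : y ≠ l) (h4 : y ≠ l') :
    SplitsRight atom κ m C A W i b l l' Γ := by
  have h5 := rootAt_of_avoids (f := pfact p ![x, y, l, l']) h (hS.trans (add_assoc _ _ _)).le
    (by change ¬ 4 = 2; decide) ((avoids_pair h1 h2).add hx) ((avoids_pair h3 h4).add hy)
  obtain ⟨W₁, W₂, B, k, k', q, q', S₁, S₂, rfl, hB, hF, rfl, hW₁, hW₂⟩ :=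
    rootAt_label hs hi (s := ![x, y, l, l']) h5
  obtain ⟨hn1, hn2⟩ := hF.nodup hn
  obtain ⟨rfl, rfl, rfl⟩ := hF
  have h6 := (pfact_inj.1 (Multiset.mem_singleton.1 hB)).2
  obtain rfl : l = q := congrFun h6 (2 : Fin 4)
  obtain rfl : l' = q' := congrFun h6 (3 : Fin 4)
  have h7 : S₁ + S₂ = {fact b ![l, l']} + Γ := by
    refine add_left_cancel (a := {pfact p ![x, y, l, l']}) (Eq.trans ?_ (hS.trans ?_))
    · exact (add_assoc _ _ _).symm
    · exact add_assoc _ _ _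
  have key : ∀ {W₁ W₂ W : Database At I J} {R S₂ : Multiset (Fact Pr P)},
      (kindTranslation atom κ m).Tree W₁ ![l, l'] ({fact b ![l, l']} + R) →
      (kindTranslation atom κ m).Tree W₂ ![l, l'] S₂ →
      ({l} + {l'} + outs ({fact b ![l, l']} + R)).Nodup → {fact b ![l, l']} + R + S₂ =
      {fact b ![l, l']} + Γ → Entails C A W (.pair i W₁ W₂) →
      SplitsRight atom κ m C A W i b l l' Γ := by
    intro W₁ W₂ W R S₂ hW₁ hW₂ hn h7 hE
    obtain ⟨X, hX, ⟨rfl, rfl⟩ | ⟨i', p', -, -, hi', -⟩⟩ := tree_extract hs hW₁ hn (add_comm _ _)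
    · obtain rfl : S₂ = Γ := add_left_cancel (a := {fact b ![l, l']}) (by simpa using h7)
      exact ⟨X, W₂, hX, hE, hW₂⟩
    -- `quad` and parallel composition do not occur in the same setting.
    · exact absurd hi ((hs.world.resolve_left fun h => h.1 i' p' hi').1 i p)
  have hm : fact b ![l, l'] ∈ S₁ + S₂ := by
    rw [h7]
    simp
  rcases Multiset.mem_add.1 hm with hm | hm
  · obtain ⟨R, rfl⟩ := Multiset.exists_cons_of_mem hm
    rw [← Multiset.singleton_add] at *
    exact key hW₁ hW₂ hn1 h7 (.refl _)
  · obtain ⟨R, rfl⟩ := Multiset.exists_cons_of_mem hm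
    rw [← Multiset.singleton_add] at *
    exact key hW₂ hW₁ hn2 ((add_comm _ _).trans h7) (.swap ((hs.comm i).2 (hi ▸ trivial)) _ _)

/-- Privacy of `x` and `y` puts the label at the root, that of `z` makes the arms known, and that of
`c` makes the slot ending at `c` a leaf. -/
theorem splitsRight_sym (hs : KindSpec C A κ m) {i : I} {p : Pr 4} {q : Pr 3}
    (hi : κ i = .sym p q) {W : Database At I J} {x y l z c d : P} {S Γ : Multiset (Fact Pr P)}
    {b : Lab Pr 2} (h : (kindTranslation atom κ m).Tree W ![x, y] S)
    (hS : S = {pfact p ![x, y, l, z]} + {pfact q ![l, z, c]} + {pfact q ![l, z, d]} +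
      {fact b ![l, c]} + Γ) (hx : Avoids x Γ) (hy : Avoids y Γ) (hz : Avoids z Γ) (hc : Avoids c Γ)
    (hxl : x ≠ l) (hxz : x ≠ z) (hxc : x ≠ c) (hxd : x ≠ d) (hyl : y ≠ l) (hyz : y ≠ z)
    (hyc : y ≠ c) (hyd : y ≠ d) (hzl : z ≠ l) (hzc : z ≠ c) :
    SplitsRight atom κ m C A W i b l d Γ := by
  have h5 := rootAt_of_avoids (f := pfact p ![x, y, l, z])
    (Γ := {pfact q ![l, z, c]} + {pfact q ![l, z, d]} + {fact b ![l, c]} + Γ) h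
    (hS.trans (by abel)).le (by change ¬ 4 = 2; decide)
    ((((avoids_triple hxl hxz hxc).add (avoids_triple hxl hxz hxd)).add
      (avoids_pair hxl hxc)).add hx)
    ((((avoids_triple hyl hyz hyc).add (avoids_triple hyl hyz hyd)).add
      (avoids_pair hyl hyc)).add hy)
  obtain ⟨W₁, W₂, B, k, k', r, r', S₁, S₂, rfl, hB, hF, rfl, hW₁, hW₂⟩ :=
    rootAt_label hs hi (s := ![x, y, l, z]) h5
  obtain ⟨z', rfl, rfl⟩ := hF
  have h6 : (![x, y, l, z] : Fin 4 → P) = ![x, y, r, z'] := by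
    rw [Multiset.mem_add, Multiset.mem_add, Multiset.mem_singleton, Multiset.mem_singleton,
      Multiset.mem_singleton] at hB
    rcases hB with (hB | hB) | hB
    · exact (pfact_inj.1 hB).2
    · exact absurd (congrArg Sigma.fst hB) (by change ¬ (4 = 3); decide)
    · exact absurd (congrArg Sigma.fst hB) (by change ¬ (4 = 3); decide)
  obtain rfl : l = r := congrFun h6 (2 : Fin 4)
  obtain rfl : z = z' := congrFun h6 (3 : Fin 4)
  have hS' : {fact b ![l, c]} + Γ + {pfact q ![l, z, c]} + {pfact q ![l, z, d]} =
      S₁ + S₂ + {pfact q ![l, z, k']} + {pfact q ![l, z, r']} := by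
    refine add_left_cancel (a := {pfact p ![x, y, l, z]}) (Eq.trans ?_ (hS.symm.trans ?_))
    · abel
    · change {pfact p ![x, y, l, z]} + _ + _ + _ + _ = _
      abel
  have key : ∀ {W₁ W₂ W : Database At I J} {S₁ S₂ : Multiset (Fact Pr P)},
      (kindTranslation atom κ m).Tree W₁ ![l, c] S₁ →
      (kindTranslation atom κ m).Tree W₂ ![l, d] S₂ → {fact b ![l, c]} + Γ = S₁ + S₂ →
      Entails C A W (.pair i W₁ W₂) → SplitsRight atom κ m C A W i b l d Γ := by
    intro W₁ W₂ W S₁ S₂ hW₁ hW₂ h7 hE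
    obtain ⟨X, rfl, rfl, hX, -⟩ := tree_single (a := b) (s := ![l, c]) (Γ := Γ) hW₁
      (le_iff_exists_add.2 ⟨_, h7⟩) hc (.inr (hs.not_series_of_sym hi))
    obtain rfl := add_left_cancel h7
    exact ⟨X, W₂, hX, hE, hW₂⟩
  obtain ⟨h6, ⟨rfl, rfl⟩ | ⟨rfl, rfl⟩⟩ := arms_unique hS' ((avoids_pair hzl hzc).add hz)
  · exact key hW₁ hW₂ h6 (.refl _)
  · exact key hW₂ hW₁ (h6.trans (add_comm _ _)) (.swap ((hs.comm i).2 (hi ▸ trivial)) _ _)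

/-- The leaf lies at the external points themselves, so this is `tree_extract`; the presence of a
label excludes that nothing remains. -/
theorem splitsRight_par (hs : KindSpec C A κ m) {i : I} {p : Pr 0} (hi : κ i = .par p)
    {W : Database At I J} {x y : P} {S Γ : Multiset (Fact Pr P)} {b : Lab Pr 2}
    (h : (kindTranslation atom κ m).Tree W ![x, y] S) (hn : ({x} + {y} + outs S).Nodup)
    (hS : S = {pfact p ![]} + {fact b ![x, y]} + Γ) :
    SplitsRight atom κ m C A W i b x y Γ := by
  obtain ⟨X, hX, ⟨-, h0⟩ | ⟨i', p', W', Γ', hi', h1, hE, hT⟩⟩ :=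
    tree_extract (Γ := {pfact p ![]} + Γ) hs h hn (hS.trans (by abel))
  · exact absurd (congrArg Multiset.card h0) (by simp)
  · obtain ⟨rfl, rfl⟩ := hs.eq_of_par hi hi'
    obtain rfl := add_left_cancel h1
    exact ⟨X, W', hX, hE, hT⟩

/-- The leaf is the only fact at the source, so the reading can be reassociated to start with it. -/
theorem splitsRight_series (hs : KindSpec C A κ m) {i : I} {p : Pr 1} (hi : κ i = .series p)
    {W : Database At I J} {x y z : P} {S Γ : Multiset (Fact Pr P)} {b : Lab Pr 2}
    (h : (kindTranslation atom κ m).Tree W ![x, y] S)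
    (hS : S = {pfact p ![z]} + {fact b ![x, z]} + Γ) (hx : Avoids x Γ) (hz : x ≠ z) :
    SplitsRight atom κ m C A W i b z y Γ := by
  obtain ⟨X, hX, -, ⟨-, h1, -⟩ | ⟨W', R, hE, h1, hT⟩⟩ := tree_starts (a := b) (s := ![x, z])
    (Γ := {pfact p ![z]} + Γ) hs hi h (hS.trans (by abel)).le
    ((avoids_singleton fun l : Fin 1 => by fin_cases l; exact hz.symm).add hx)
  · have := congrArg Multiset.card (hS.symm.trans h1)
    simp at this
  · obtain rfl := add_left_cancel (hS.symm.trans h1)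
    exact ⟨X, W', hX, hE, hT⟩

theorem splitsLeft_series (hs : KindSpec C A κ m) {i : I} {p : Pr 1} (hi : κ i = .series p)
    {W : Database At I J} {x y z : P} {S Γ : Multiset (Fact Pr P)} {b : Lab Pr 2}
    (h : (kindTranslation atom κ m).Tree W ![x, y] S)
    (hS : S = {pfact p ![z]} + {fact b ![z, y]} + Γ) (hy : Avoids y Γ) (hz : y ≠ z) :
    SplitsLeft atom κ m C A W i b x z Γ := by
  obtain ⟨X, hX, -, ⟨-, h1, -⟩ | ⟨W', R, hE, h1, hT⟩⟩ := tree_ends (a := b) (s := ![z, y])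
    (Γ := {pfact p ![z]} + Γ) hs hi h (hS.trans (by abel)).le
    ((avoids_singleton fun l : Fin 1 => by fin_cases l; exact hz.symm).add hy)
  · have := congrArg Multiset.card (hS.symm.trans h1)
    simp at this
  · obtain rfl := add_left_cancel (hS.symm.trans h1)
    exact ⟨X, W', hX, hE, hT⟩

theorem splits_slot (hs : KindSpec C A κ m) {j : J} {W : Database At I J} {x y l l' : P}
    {S Γ : Multiset (Fact Pr P)} (h : (kindTranslation atom κ m).Tree W ![x, y] S)
    (hS : S = {pfact (m j) ![x, y, l, l']} + Γ) (hx : Avoids x Γ) (hy : Avoids y Γ) :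
    ∃ W' : Database At I J, Entails C A W (.bracket j W') ∧
      (kindTranslation atom κ m).Tree W' ![l, l'] Γ := by
  have h1 := rootAt_of_avoids (f := pfact (m j) ![x, y, l, l']) h hS.le
    (by change ¬ 4 = 2; decide) hx hy
  obtain ⟨W₁, S₁, rfl, -, -, h2, h3⟩ := rootAt_un hs h1
  obtain rfl := add_left_cancel (hS.symm.trans h2)
  exact ⟨W₁, .refl _, h3⟩

end KindTrees

open HL NLM Translation

/-! ### All kinds of gadgets together. -/

section KindTrees

variable {At : Type u} {I : Type v} {J : Type w} {Pr : ℕ → Type x} {atom : At ↪ Pr 2}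
  {κ : I → Kind Pr} {m : J → Pr 4} {P : Type} {C A : Set I}

theorem fact_eq_vec (a : Lab Pr 2) (s : Fin 2 → P) :
    ({fact a s} : Multiset (Fact Pr P)) = {fact a ![s 0, s 1]} := by rw [vec_eq]

theorem HL.Private.ne {n : ℕ} {ν : Fin n → P} {v : Fin n} {Γ : Multiset (Fact Pr P)}
    (h : Private ν v Γ) (w : Fin n) (hw : w ≠ v) : ν v ≠ ν w := fun e => hw (h.1 w e.symm)

theorem splits_gadget (hs : KindSpec C A κ m) {i : I} {K : Kind Pr} (hi : κ i = K)
    {W : Database At I J} {t : Fin 2 → P} {Γ S : Multiset (Fact Pr P)} {a b : Lab Pr 2}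
    (ν : K.gadget.prims.V → P) (h : (kindTranslation atom κ m).Tree W t S)
    (hn : ({t 0} + {t 1} + outs S).Nodup)
    (hS : S = Γ + (facts K.gadget.prims ν + {fact a fun l => ν (K.gadget.left l)} +
      {fact b fun l => ν (K.gadget.right l)}))
    (hp : ∀ v, (∀ l, K.gadget.prims.ext l ≠ v) → Private ν v Γ) :
    Splits atom κ m C A W i t Γ a b (ν (K.gadget.prims.ext 0)) (ν (K.gadget.prims.ext 1)) := by
  have hF := K.frame ν
  rw [fact_eq_vec, fact_eq_vec b] at hS
  cases K with
  | tree p =>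
    revert ν
    change ∀ ν : Fin 6 → P, _
    intro ν hS hp hF
    change _ = _ at hF
    rw [hF] at hS
    subst hS
    have h2 : Private ν 2 Γ := hp (2 : Fin 6)
      (by decide : ∀ l : Fin 2, (![0, 1] : Fin 2 → Fin 6) l ≠ 2)
    have h3 : Private ν 3 Γ := hp (3 : Fin 6)
      (by decide : ∀ l : Fin 2, (![0, 1] : Fin 2 → Fin 6) l ≠ 3)
    have h4 : Private ν 4 Γ := hp (4 : Fin 6)
      (by decide : ∀ l : Fin 2, (![0, 1] : Fin 2 → Fin 6) l ≠ 4)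
    have h5 : Private ν 5 Γ := hp (5 : Fin 6)
      (by decide : ∀ l : Fin 2, (![0, 1] : Fin 2 → Fin 6) l ≠ 5)
    exact splits_tree hs hi h h2.2 h3.2 h4.2 h5.2 (h4.ne 2 (by decide)).symm
      (h5.ne 2 (by decide)).symm (h4.ne 3 (by decide)).symm
      (h5.ne 3 (by decide)).symm
  | quad p =>
    revert ν
    change ∀ ν : Fin 4 → P, _
    intro ν hS hp hF
    rw [hF.1] at hS
    subst hS
    have h2 : Private ν 2 Γ := hp (2 : Fin 4)
      (by decide : ∀ l : Fin 2, (![0, 1] : Fin 2 → Fin 4) l ≠ 2)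
    have h3 : Private ν 3 Γ := hp (3 : Fin 4)
      (by decide : ∀ l : Fin 2, (![0, 1] : Fin 2 → Fin 4) l ≠ 3)
    exact splits_quad hs hi h h2.2 h3.2
  | series p =>
    revert ν
    change ∀ ν : Fin 3 → P, _
    intro ν hS hp hF
    rw [hF.1] at hS
    subst hS
    have h1 : Private ν 1 Γ := hp (1 : Fin 3)
      (by decide : ∀ l : Fin 2, (![0, 2] : Fin 2 → Fin 3) l ≠ 1)
    exact splits_series hs hi h h1.2 (h1.ne 0 (by decide))
      (h1.ne 2 (by decide))
  | sym p q =>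
    revert ν
    change ∀ ν : Fin 6 → P, _
    intro ν hS hp _
    have hS' := hS
    rw [show facts (Kind.sym p q).gadget.prims ν = _ from Kind.facts_sym p q ν] at hS
    have h2 : Private ν 2 Γ := hp (2 : Fin 6)
      (by decide : ∀ l : Fin 2, (![0, 1] : Fin 2 → Fin 6) l ≠ 2)
    have h3 : Private ν 3 Γ := hp (3 : Fin 6)
      (by decide : ∀ l : Fin 2, (![0, 1] : Fin 2 → Fin 6) l ≠ 3)
    have h4 : Private ν 4 Γ := hp (4 : Fin 6)
      (by decide : ∀ l : Fin 2, (![0, 1] : Fin 2 → Fin 6) l ≠ 4)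
    have h5 : Private ν 5 Γ := hp (5 : Fin 6)
      (by decide : ∀ l : Fin 2, (![0, 1] : Fin 2 → Fin 6) l ≠ 5)
    subst hS
    exact splits_sym hs hi h h3.2 h4.2 h5.2 (h2.ne 3 (by decide)).symm
      (h4.ne 3 (by decide)).symm (h5.ne 3 (by decide)).symm
      (h2.ne 4 (by decide)).symm (h2.ne 5 (by decide)).symm
      (h5.ne 4 (by decide)).symm
  | par p =>
    revert ν
    change ∀ ν : Fin 2 → P, _
    intro ν hS hp hF
    rw [hF.1] at hS
    rw [← vec_eq t] at h ⊢
    -- A label of rank 0 has no nodes, so its occurrences are indistinguishable. It is counted among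
    -- the remaining facts, and `splits_par` takes one occurrence out.
    obtain ⟨Γ', h1, h2⟩ := splits_par (x := ν 0) (y := ν 1) (Γ := Γ + {pfact p ![]}) hs hi h hn
      (hS.trans (by rw [← add_assoc, ← add_assoc]; rfl))
    obtain rfl := add_left_cancel ((add_comm _ _).trans h1)
    exact h2

theorem splitsRight_gadget (hs : KindSpec C A κ m) {i : I} {K : Kind Pr} (hi : κ i = K)
    {W : Database At I J} {Γ S : Multiset (Fact Pr P)} {b : Lab Pr 2}
    (ν : K.gadget.prims.V → P)
    (h : (kindTranslation atom κ m).Tree W ![ν (K.gadget.prims.ext 0), ν (K.gadget.prims.ext 1)] S)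
    (hn : ({ν (K.gadget.prims.ext 0)} + {ν (K.gadget.prims.ext 1)} + outs S).Nodup)
    (hS : S = facts K.gadget.prims ν + {fact b fun l => ν (K.gadget.left l)} + Γ)
    (hp : ∀ v, (∀ l, K.gadget.right l ≠ v) → Private ν v Γ) :
    SplitsRight atom κ m C A W i b (ν (K.gadget.right 0)) (ν (K.gadget.right 1)) Γ := by
  have hF := K.frame ν
  rw [fact_eq_vec] at hS
  cases K with
  | tree p =>
    revert ν
    change ∀ ν : Fin 6 → P, _
    intro ν h hn hS hp hF
    change _ = _ at hF
    rw [hF] at hS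
    have h0 : Private ν 0 Γ := hp (0 : Fin 6)
      (by decide : ∀ l : Fin 2, (![4, 5] : Fin 2 → Fin 6) l ≠ 0)
    have h1 : Private ν 1 Γ := hp (1 : Fin 6)
      (by decide : ∀ l : Fin 2, (![4, 5] : Fin 2 → Fin 6) l ≠ 1)
    have h2 : Private ν 2 Γ := hp (2 : Fin 6)
      (by decide : ∀ l : Fin 2, (![4, 5] : Fin 2 → Fin 6) l ≠ 2)
    have h3 : Private ν 3 Γ := hp (3 : Fin 6)
      (by decide : ∀ l : Fin 2, (![4, 5] : Fin 2 → Fin 6) l ≠ 3)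
    exact splitsRight_tree hs hi h hS h0.2 h1.2 h2.2 h3.2
      (h2.ne 0 (by decide)).symm (h3.ne 0 (by decide)).symm
      (h2.ne 1 (by decide)).symm (h3.ne 1 (by decide)).symm
  | quad p =>
    revert ν
    change ∀ ν : Fin 4 → P, _
    intro ν h hn hS hp hF
    rw [hF.1] at hS
    have h0 : Private ν 0 Γ := hp (0 : Fin 4)
      (by decide : ∀ l : Fin 2, (![2, 3] : Fin 2 → Fin 4) l ≠ 0)
    have h1 : Private ν 1 Γ := hp (1 : Fin 4)
      (by decide : ∀ l : Fin 2, (![2, 3] : Fin 2 → Fin 4) l ≠ 1)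
    exact splitsRight_quad hs hi h hn hS h0.2 h1.2
      (h0.ne 2 (by decide)) (h0.ne 3 (by decide))
      (h1.ne 2 (by decide)) (h1.ne 3 (by decide))
  | series p =>
    revert ν
    change ∀ ν : Fin 3 → P, _
    intro ν h hn hS hp hF
    rw [hF.1] at hS
    have h0 : Private ν 0 Γ := hp (0 : Fin 3)
      (by decide : ∀ l : Fin 2, (![1, 2] : Fin 2 → Fin 3) l ≠ 0)
    exact splitsRight_series hs hi h hS h0.2 (h0.ne 1 (by decide))
  | sym p q =>
    revert ν
    change ∀ ν : Fin 6 → P, _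
    intro ν h hn hS hp _
    rw [show facts (Kind.sym p q).gadget.prims ν = _ from Kind.facts_sym p q ν] at hS
    have h0 : Private ν 0 Γ := hp (0 : Fin 6)
      (by decide : ∀ l : Fin 2, (![2, 5] : Fin 2 → Fin 6) l ≠ 0)
    have h1 : Private ν 1 Γ := hp (1 : Fin 6)
      (by decide : ∀ l : Fin 2, (![2, 5] : Fin 2 → Fin 6) l ≠ 1)
    have h3 : Private ν 3 Γ := hp (3 : Fin 6)
      (by decide : ∀ l : Fin 2, (![2, 5] : Fin 2 → Fin 6) l ≠ 3)
    have h4 : Private ν 4 Γ := hp (4 : Fin 6)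
      (by decide : ∀ l : Fin 2, (![2, 5] : Fin 2 → Fin 6) l ≠ 4)
    exact splitsRight_sym hs hi h hS h0.2 h1.2 h3.2 h4.2
      (h0.ne 2 (by decide)) (h0.ne 3 (by decide))
      (h0.ne 4 (by decide)) (h0.ne 5 (by decide))
      (h1.ne 2 (by decide)) (h1.ne 3 (by decide))
      (h1.ne 4 (by decide)) (h1.ne 5 (by decide))
      (h3.ne 2 (by decide)) (h3.ne 4 (by decide))
  | par p =>
    rw [hF.1] at hS
    exact splitsRight_par hs hi h hn hS

theorem splitsLeft_gadget (hs : KindSpec C A κ m) {i : I} {K : Kind Pr} (hi : κ i = K)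
    {W : Database At I J} {Γ S : Multiset (Fact Pr P)} {b : Lab Pr 2}
    (ν : K.gadget.prims.V → P)
    (h : (kindTranslation atom κ m).Tree W ![ν (K.gadget.prims.ext 0), ν (K.gadget.prims.ext 1)] S)
    (hn : ({ν (K.gadget.prims.ext 0)} + {ν (K.gadget.prims.ext 1)} + outs S).Nodup)
    (hS : S = facts K.gadget.prims ν + {fact b fun l => ν (K.gadget.right l)} + Γ)
    (hp : ∀ v, (∀ l, K.gadget.left l ≠ v) → Private ν v Γ) :
    SplitsLeft atom κ m C A W i b (ν (K.gadget.left 0)) (ν (K.gadget.left 1)) Γ := by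
  have hF := K.frame ν
  rw [fact_eq_vec] at hS
  have hC : K.IsComm → i ∈ C := fun h => (hs.comm i).2 (hi.symm ▸ h)
  cases K with
  | tree p =>
    revert ν
    change ∀ ν : Fin 6 → P, _
    intro ν h hn hS hp hF
    change _ = _ at hF
    rw [hF] at hS
    have h0 : Private ν 0 Γ := hp (0 : Fin 6)
      (by decide : ∀ l : Fin 2, (![2, 3] : Fin 2 → Fin 6) l ≠ 0)
    have h1 : Private ν 1 Γ := hp (1 : Fin 6)
      (by decide : ∀ l : Fin 2, (![2, 3] : Fin 2 → Fin 6) l ≠ 1)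
    have h4 : Private ν 4 Γ := hp (4 : Fin 6)
      (by decide : ∀ l : Fin 2, (![2, 3] : Fin 2 → Fin 6) l ≠ 4)
    have h5 : Private ν 5 Γ := hp (5 : Fin 6)
      (by decide : ∀ l : Fin 2, (![2, 3] : Fin 2 → Fin 6) l ≠ 5)
    exact splitsLeft_tree hs hi h hS h0.2 h1.2 h4.2 h5.2
      (h4.ne 0 (by decide)).symm (h5.ne 0 (by decide)).symm
      (h4.ne 1 (by decide)).symm (h5.ne 1 (by decide)).symm
  | quad p =>
    -- The two slots of `quad` coincide, so the statement for the other side applies directly.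
    exact (splitsRight_gadget hs hi ν h hn (hS.trans (by
      rw [fact_eq_vec b fun l => ν ((Kind.quad p).gadget.left l)]; rfl)) hp).swap (hC trivial)
  | series p =>
    revert ν
    change ∀ ν : Fin 3 → P, _
    intro ν h hn hS hp hF
    rw [hF.1] at hS
    have h2 : Private ν 2 Γ := hp (2 : Fin 3)
      (by decide : ∀ l : Fin 2, (![0, 1] : Fin 2 → Fin 3) l ≠ 2)
    exact splitsLeft_series hs hi h hS h2.2 (h2.ne 1 (by decide))
  | sym p q =>
    revert ν
    change ∀ ν : Fin 6 → P, _
    intro ν h hn hS hp _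
    rw [show facts (Kind.sym p q).gadget.prims ν = _ from Kind.facts_sym p q ν] at hS
    have h0 : Private ν 0 Γ := hp (0 : Fin 6)
      (by decide : ∀ l : Fin 2, (![2, 4] : Fin 2 → Fin 6) l ≠ 0)
    have h1 : Private ν 1 Γ := hp (1 : Fin 6)
      (by decide : ∀ l : Fin 2, (![2, 4] : Fin 2 → Fin 6) l ≠ 1)
    have h3 : Private ν 3 Γ := hp (3 : Fin 6)
      (by decide : ∀ l : Fin 2, (![2, 4] : Fin 2 → Fin 6) l ≠ 3)
    have h5 : Private ν 5 Γ := hp (5 : Fin 6)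
      (by decide : ∀ l : Fin 2, (![2, 4] : Fin 2 → Fin 6) l ≠ 5)
    -- The gadget is symmetric under exchange of its two arms.
    refine SplitsRight.swap (splitsRight_sym (x := ν 0) (y := ν 1) (l := ν 2) (z := ν 3) (c := ν 5)
      (d := ν 4) hs hi h (hS.trans ?_) h0.2 h1.2 h3.2 h5.2
      (h0.ne 2 (by decide)) (h0.ne 3 (by decide))
      (h0.ne 5 (by decide)) (h0.ne 4 (by decide))
      (h1.ne 2 (by decide)) (h1.ne 3 (by decide))
      (h1.ne 5 (by decide)) (h1.ne 4 (by decide))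
      (h3.ne 2 (by decide)) (h3.ne 5 (by decide)))
      (hC trivial)
    refine congrArg₂ (· + ·) (congrArg₂ (· + ·) ?_ rfl) rfl
    abel
  | par p =>
    rw [hF.1] at hS
    exact (splitsRight_par hs hi h hn hS).swap (hC trivial)

end KindTrees

/-! ### The translation of formulas is injective up to commutativity. -/

namespace HL

theorem HoleIso.facts {Pr : ℕ → Type x} {k d : ℕ} {D D' : HoleGraph (Formula Pr) k d}
    (h : HoleIso D D') : ∃ f : D.V ≃ D'.V, (∀ i, f (D.ext i) = D'.ext i) ∧
      (∀ i, f (D.hole i) = D'.hole i) ∧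
      ∀ {P : Type} (ν : D'.V → P), facts D.toHGraph (fun v => ν (f v)) = facts D'.toHGraph ν := by
  obtain ⟨f, g, h1, h2, h3, h4⟩ := h
  refine ⟨f, h3, h4, fun {P} ν => ?_⟩
  refine Fintype.sum_equiv (HGraph.edgeEquiv g) _ _ ?_
  rintro ⟨n, e⟩
  change {fact _ _} = ({fact (D'.lab n (g n e)).cls (fun i => ν (D'.att n (g n e) i))} :
    Multiset (Fact Pr P))
  simp only [← h1, ← (h2 n e).cls_eq]

end HL

open HL NLM Translation

section KindTrees

variable {At : Type u} {I : Type v} {J : Type w} {Pr : ℕ → Type x} {atom : At ↪ Pr 2}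
  {κ : I → Kind Pr} {m : J → Pr 4} {P : Type} {C A : Set I}

/-- The gadgets of modes that are not commutative have two different slots. -/
theorem Kind.left_ne_right {K : Kind Pr} (hK : ¬ K.IsComm) : K.gadget.left ≠ K.gadget.right := by
  cases K with
  | tree p => exact (by decide : (![2, 3] : Fin 2 → Fin 6) ≠ ![4, 5])
  | quad p => exact absurd trivial hK
  | series p => exact (by decide : (![0, 1] : Fin 2 → Fin 3) ≠ ![1, 2])
  | sym p q => exact absurd trivial hK
  | par p => exact absurd trivial hK

theorem Kind.Frame.exists_label {K : Kind Pr} {x y l l' r r' : P} {B : Multiset (Fact Pr P)}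
    (h : K.Frame x y B l l' r r') : ∃ s, pfact K.label.2 s ∈ B := by
  cases K with
  | tree p =>
    subst h
    exact ⟨_, Multiset.mem_singleton_self _⟩
  | quad p =>
    obtain ⟨rfl, -⟩ := h
    exact ⟨_, Multiset.mem_singleton_self _⟩
  | series p =>
    obtain ⟨rfl, -⟩ := h
    exact ⟨_, Multiset.mem_singleton_self _⟩
  | sym p q =>
    obtain ⟨z, rfl, -⟩ := h
    exact ⟨![x, y, l, z], by simp [Kind.label]⟩
  | par p =>
    obtain ⟨rfl, -⟩ := h
    exact ⟨_, Multiset.mem_singleton_self _⟩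

theorem eq_or_swap_of_add {α : Type*} {a b c d : α} (h : ({a} + {b} : Multiset α) = {c} + {d}) :
    a = c ∧ b = d ∨ a = d ∧ b = c := by
  have h1 : a ∈ ({c} + {d} : Multiset α) := by
    rw [← h]
    simp
  rw [Multiset.mem_add, Multiset.mem_singleton, Multiset.mem_singleton] at h1
  rcases h1 with rfl | rfl
  · exact .inl ⟨rfl, Multiset.singleton_inj.1 (add_left_cancel h)⟩
  · exact .inr ⟨rfl, Multiset.singleton_inj.1 (add_left_cancel (h.trans (add_comm _ _)))⟩

/-- The facts of a gadget determine its mode and, up to commutativity, its slots. -/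
theorem frame_unique (hs : KindSpec C A κ m) {i i' : I} {x y l l' r r' k k' q q' : P}
    {B : Multiset (Fact Pr P)} (h : (κ i).Frame x y B l l' r r')
    (h' : (κ i').Frame x y B k k' q q') :
    i = i' ∧ ((k = l ∧ k' = l' ∧ q = r ∧ q' = r') ∨ i ∈ C ∧ k = r ∧ k' = r' ∧ q = l ∧ q' = l') := by
  obtain ⟨s, hs'⟩ := h.exists_label
  obtain rfl := hs.label_inj i i' (h'.label_eq (κ i).label_rank_ne_three hs').symm
  refine ⟨rfl, ?_⟩
  rw [hs.comm]
  revert h h'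
  generalize κ i = K
  intro h h'
  cases K with
  | tree p =>
    have h1 := h.symm.trans h'
    rw [Multiset.singleton_inj, pfact_inj] at h1
    exact .inl ⟨(congrFun h1.2 2).symm, (congrFun h1.2 3).symm, (congrFun h1.2 4).symm,
      (congrFun h1.2 5).symm⟩
  | quad p =>
    obtain ⟨rfl, rfl, rfl⟩ := h
    obtain ⟨h1, rfl, rfl⟩ := h'
    rw [Multiset.singleton_inj, pfact_inj] at h1
    have h2 : r = q := congrFun h1.2 2
    have h3 : r' = q' := congrFun h1.2 3
    exact .inl ⟨h2.symm, h3.symm, h2.symm, h3.symm⟩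
  | series p =>
    obtain ⟨rfl, rfl, rfl, rfl⟩ := h
    obtain ⟨h1, rfl, rfl, rfl⟩ := h'
    rw [Multiset.singleton_inj, pfact_inj] at h1
    have h2 : r = q := congrFun h1.2 0
    exact .inl ⟨rfl, h2.symm, h2.symm, rfl⟩
  | sym p p' =>
    obtain ⟨z, rfl, rfl⟩ := h
    obtain ⟨z', h1, rfl⟩ := h'
    have h2 : pfact p ![x, y, r, z] ∈ ({pfact p ![x, y, q, z']} + {pfact p' ![q, z', k']} +
        {pfact p' ![q, z', q']} : Multiset (Fact Pr P)) := by
      rw [← h1]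
      simp
    have h3 : (![x, y, r, z] : Fin 4 → P) = ![x, y, q, z'] := by
      rw [Multiset.mem_add, Multiset.mem_add, Multiset.mem_singleton, Multiset.mem_singleton,
        Multiset.mem_singleton] at h2
      rcases h2 with (hB | hB) | hB
      · exact (pfact_inj.1 hB).2
      · exact absurd (congrArg Sigma.fst hB) (by change ¬ (4 = 3); decide)
      · exact absurd (congrArg Sigma.fst hB) (by change ¬ (4 = 3); decide)
    obtain rfl : r = q := congrFun h3 2
    obtain rfl : z = z' := congrFun h3 3
    rw [add_assoc, add_assoc] at h1
    rcases eq_or_swap_of_add (add_left_cancel h1) with ⟨h4, h5⟩ | ⟨h4, h5⟩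
    · exact .inl ⟨rfl, (congrFun (pfact_inj.1 h4).2 2).symm, rfl,
        (congrFun (pfact_inj.1 h5).2 2).symm⟩
    · exact .inr ⟨trivial, rfl, (congrFun (pfact_inj.1 h5).2 2).symm, rfl,
        (congrFun (pfact_inj.1 h4).2 2).symm⟩
  | par p =>
    obtain ⟨rfl, rfl, rfl, rfl, rfl⟩ := h
    obtain ⟨h1, rfl, rfl, rfl, rfl⟩ := h'
    exact .inl ⟨rfl, rfl, rfl, rfl⟩

/-- Rank 2 is reserved for leaves, so filtering by rank separates a gadget from the contents of its
slots. -/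
theorem eq_of_rank {B B' S S' : Multiset (Fact Pr P)} (h : B + S = B' + S')
    (hB : ∀ f ∈ B, f.1 ≠ 2) (hB' : ∀ f ∈ B', f.1 ≠ 2) (hS : ∀ f ∈ S, f.1 = 2)
    (hS' : ∀ f ∈ S', f.1 = 2) : B = B' ∧ S = S' := by
  have key : B = B' := by
    have h1 := congrArg (Multiset.filter fun f => f.1 ≠ 2) h
    rwa [Multiset.filter_add, Multiset.filter_add, Multiset.filter_eq_self.2 hB,
      Multiset.filter_eq_self.2 hB', Multiset.filter_eq_nil.2 fun f hf => not_not.2 (hS f hf),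
      Multiset.filter_eq_nil.2 fun f hf => not_not.2 (hS' f hf), add_zero, add_zero] at h1
  subst key
  exact ⟨rfl, add_left_cancel h⟩

theorem rank_of_leaves {a b : Lab Pr 2} {s t : Fin 2 → P} :
    ∀ f ∈ ({fact a s} + {fact b t} : Multiset (Fact Pr P)), f.1 = 2 := by
  intro f hf
  rw [Multiset.mem_add, Multiset.mem_singleton, Multiset.mem_singleton] at hf
  rcases hf with rfl | rfl <;> rfl

theorem rank_of_leaf {a : Lab Pr 2} {s : Fin 2 → P} :
    ∀ f ∈ ({fact a s} : Multiset (Fact Pr P)), f.1 = 2 := by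
  intro f hf
  rw [Multiset.mem_singleton.1 hf]

theorem rank_of_un {j : J} {s : Fin 4 → P} :
    ∀ f ∈ ({pfact (m j) s} : Multiset (Fact Pr P)), f.1 ≠ 2 := by
  intro f hf
  rw [Multiset.mem_singleton.1 hf]
  change ¬ 4 = 2
  decide

/-- Two copies of gadgets with the same external points and the same facts. -/
theorem gadget_unique (hs : KindSpec C A κ m) {i i' : I} (f : (κ i).gadget.prims.V ≃
    (κ i').gadget.prims.V) (hext : ∀ l, f ((κ i).gadget.prims.ext l) = (κ i').gadget.prims.ext l)
    (hB : facts (κ i).gadget.prims (fun v => f v) = facts (κ i').gadget.prims fun v => v) :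
    i = i' ∧ ((∀ l, f ((κ i).gadget.left l) = (κ i').gadget.left l) ∧
      (∀ l, f ((κ i).gadget.right l) = (κ i').gadget.right l) ∧
      (i ∉ C → (fun l => f ((κ i).gadget.left l)) ≠ fun l => f ((κ i).gadget.right l)) ∨ i ∈ C ∧
      (∀ l, f ((κ i).gadget.left l) = (κ i').gadget.right l) ∧
      ∀ l, f ((κ i).gadget.right l) = (κ i').gadget.left l) := by
  have h1 := (κ i).frame (fun v => f v)
  have h2 := (κ i').frame (fun v => v)
  rw [hext, hext, hB] at h1
  obtain ⟨rfl, ⟨h3, h4, h5, h6⟩ | ⟨hi, h3, h4, h5, h6⟩⟩ := frame_unique hs h1 h2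
  · refine ⟨rfl, .inl ⟨Fin.forall_fin_two.2 ⟨h3.symm, h4.symm⟩,
      Fin.forall_fin_two.2 ⟨h5.symm, h6.symm⟩, fun hi h => ?_⟩⟩
    refine Kind.left_ne_right (mt (hs.comm i).2 hi) (funext fun l => ?_)
    exact f.injective (congrFun h l)
  · exact ⟨rfl, .inr ⟨hi, Fin.forall_fin_two.2 ⟨h5.symm, h6.symm⟩,
      Fin.forall_fin_two.2 ⟨h3.symm, h4.symm⟩⟩⟩

theorem label_ne_un (hs : KindSpec C A κ m) {i : I} {j : J} {ν : (κ i).gadget.prims.V → P}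
    {ν' : Fin 4 → P} (h : facts (κ i).gadget.prims ν = facts (barU (m j)).prims ν') : False := by
  obtain ⟨s, h1⟩ := ((κ i).frame ν).exists_label
  rw [h, show facts (barU (m j)).prims ν' = _ from Kind.facts_un (m j) ν',
    Multiset.mem_singleton] at h1
  exact hs.label_ne i j (label_eq_of_pfact h1)

end KindTrees

open HL NLM Translation

section KindTrees

variable {At : Type u} {I : Type v} {J : Type w} {Pr : ℕ → Type x} {atom : At ↪ Pr 2}
  {κ : I → Kind Pr} {m : J → Pr 4} {C A : Set I}

theorem HL.Formula.eq_of_div {k d : ℕ} {N N' : HL.Formula Pr k}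
    {D D' : HoleGraph (HL.Formula Pr) k d} (h : Formula.div N D = Formula.div N' D') :
    N = N' ∧ D = D' := by
  obtain ⟨_, h⟩ := Formula.div_injective h
  exact h

theorem rank_of_gadget {P : Type} (K : Kind Pr) (ν : K.gadget.prims.V → P) :
    ∀ f ∈ facts K.gadget.prims ν, f.1 ≠ 2 := fun _ hf => (K.frame ν).rank_ne hf

theorem rank_of_un_gadget {P : Type} (j : J) (ν : (barU (m j)).prims.V → P) :
    ∀ f ∈ facts (barU (m j)).prims ν, f.1 ≠ 2 := by
  rw [show facts (barU (m j)).prims ν = _ from Kind.facts_un (m j) ν]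
  exact rank_of_un

theorem un_unique (hs : KindSpec C A κ m) {j j' : J} {P : Type} {ν : (barU (m j)).prims.V → P}
    {ν' : (barU (m j')).prims.V → P}
    (h : facts (barU (m j)).prims ν = facts (barU (m j')).prims ν') : j = j' := by
  have h1 := (Kind.facts_un (m j) ν).symm.trans (h.trans (Kind.facts_un (m j') ν'))
  exact hs.un_inj (pfact_inj.1 (Multiset.singleton_inj.1 h1)).1

theorem cls_eq_of_singleton {P : Type} {a b : Lab Pr 2} {s t : Fin 2 → P}
    (h : ({fact a s} : Multiset (Fact Pr P)) = {fact b t}) : a = b ∧ s = t :=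
  fact_inj.1 (Multiset.singleton_inj.1 h)

/-- An isomorphism carries facts to facts; separated by rank, the gadgets give the mode and the
matching of the slots, and the leaves give the components. A crossed matching occurs only if the
mode is commutative, because otherwise the two slots differ. -/
theorem kindTranslation_injective (hs : KindSpec C A κ m) (X Y : NLM.Formula At I J)
    (h : HL.Formula.Iso ((kindTranslation atom κ m).mu X) ((kindTranslation atom κ m).mu Y)) :
    FEq C X Y := by
  induction X generalizing Y with
  | atom p =>
    have h1 := h.eq_of_prim
    cases Y with
    | atom q =>
      have h2 : HL.Formula.prim (atom q) = HL.Formula.prim (atom p) := h1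
      obtain rfl : q = p := atom.injective (by injection h2)
      exact .atom q
    | prod => cases h1
    | under => cases h1
    | dia => cases h1
    | box => cases h1
    | _ => cases h1
  | prod i X X' ih ih' =>
    obtain ⟨M', hM, hI⟩ := Formula.Iso.exists_of_times h
    cases Y with
    | atom q => cases hM
    | prod i' Y Y' =>
      obtain rfl := Formula.times_injective hM
      obtain ⟨f, hext, hf⟩ := hI.facts
      have h1 := hf fun v => v
      erw [facts_graph, facts_graph, add_assoc, add_assoc] at h1
      obtain ⟨h2, h3⟩ := eq_of_rank h1 (rank_of_gadget _ _) (rank_of_gadget _ _) rank_of_leaves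
        rank_of_leaves
      obtain ⟨rfl, ⟨hl, hr, hne⟩ | ⟨hi, hl, hr⟩⟩ := gadget_unique hs f hext h2
      · rcases eq_or_swap_of_add h3 with ⟨h4, h5⟩ | ⟨h4, h5⟩
        · exact .prod (ih _ (Formula.cls_eq_iff.1 (fact_inj.1 h4).1))
            (ih' _ (Formula.cls_eq_iff.1 (fact_inj.1 h5).1))
        -- The slots match straight but the leaves match crosswise, so both slots have the same
        -- points; this happens only for commutative modes.
        · refine .prodSwap (by_contra fun hi => hne hi ?_)
            (ih _ (Formula.cls_eq_iff.1 (fact_inj.1 h4).1))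
            (ih' _ (Formula.cls_eq_iff.1 (fact_inj.1 h5).1))
          exact (fact_inj.1 h4).2.trans (funext fun l => (hr l).symm)
      · rcases eq_or_swap_of_add h3 with ⟨h4, h5⟩ | ⟨h4, h5⟩
        · exact .prod (ih _ (Formula.cls_eq_iff.1 (fact_inj.1 h4).1))
            (ih' _ (Formula.cls_eq_iff.1 (fact_inj.1 h5).1))
        · exact .prodSwap hi (ih _ (Formula.cls_eq_iff.1 (fact_inj.1 h4).1))
            (ih' _ (Formula.cls_eq_iff.1 (fact_inj.1 h5).1))
    | dia j Y =>
      obtain rfl := Formula.times_injective hM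
      obtain ⟨f, hext, hf⟩ := hI.facts
      have h1 := hf fun v => v
      erw [facts_graph, facts_un_graph, add_assoc] at h1
      exact (label_ne_un hs (eq_of_rank h1 (rank_of_gadget _ _) (rank_of_un_gadget j _)
        rank_of_leaves rank_of_leaf).1).elim
    | under => cases hM
    | box => cases hM
    | _ => cases hM
  | under i Z X ihZ ihX =>
    obtain ⟨N', D', hM, hN, hI⟩ := Formula.Iso.exists_of_div h
    cases Y with
    | atom q => cases hM
    | prod i' Y Y' => cases hM
    | dia j Y => cases hM
    | under i' Z' Y =>
      obtain ⟨rfl, rfl⟩ := Formula.eq_of_div hM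
      obtain ⟨f, hext, hhole, hf⟩ := hI.facts
      have h1 := hf fun v => v
      erw [facts_addEdge, facts_addEdge] at h1
      obtain ⟨h2, h3⟩ := eq_of_rank h1 (rank_of_gadget _ _) (rank_of_gadget _ _) rank_of_leaf
        rank_of_leaf
      obtain ⟨rfl, -⟩ := gadget_unique hs f hext h2
      exact .underCongr (ihX _ hN) (ihZ _ (Formula.cls_eq_iff.1 (cls_eq_of_singleton h3).1))
    | box j Y =>
      obtain ⟨rfl, rfl⟩ := Formula.eq_of_div hM
      obtain ⟨f, hext, hhole, hf⟩ := hI.facts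
      have h1 := hf fun v => v
      erw [facts_addEdge] at h1
      exact (label_ne_un hs (eq_of_rank (h1.trans (add_zero _).symm) (rank_of_gadget _ _)
        (rank_of_un_gadget j _) rank_of_leaf (by simp)).1).elim
    | _ i' Y Z' =>
      obtain ⟨rfl, rfl⟩ := Formula.eq_of_div hM
      obtain ⟨f, hext, hhole, hf⟩ := hI.facts
      have h1 := hf fun v => v
      erw [facts_addEdge, facts_addEdge] at h1
      obtain ⟨h2, h3⟩ := eq_of_rank h1 (rank_of_gadget _ _) (rank_of_gadget _ _) rank_of_leaf
        rank_of_leaf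
      have h4 := cls_eq_of_singleton h3
      obtain ⟨rfl, hu⟩ := gadget_unique hs f hext h2
      refine .underOver ?_ (ihX _ hN) (ihZ _ (Formula.cls_eq_iff.1 h4.1))
      rcases hu with ⟨hl, hr, hne⟩ | ⟨hi, -⟩
      · exact by_contra fun hi => hne hi (h4.2.trans (funext fun l => (hr l).symm))
      · exact hi
  | dia j X ih =>
    obtain ⟨M', hM, hI⟩ := Formula.Iso.exists_of_times h
    cases Y with
    | atom q => cases hM
    | prod i Y Y' =>
      obtain rfl := Formula.times_injective hM
      obtain ⟨f, hext, hf⟩ := hI.facts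
      have h1 := hf fun v => v
      erw [facts_graph, facts_un_graph, add_assoc] at h1
      exact (label_ne_un hs (eq_of_rank h1 (rank_of_un_gadget j _) (rank_of_gadget _ _)
        rank_of_leaf rank_of_leaves).1.symm).elim
    | dia j' Y =>
      obtain rfl := Formula.times_injective hM
      obtain ⟨f, hext, hf⟩ := hI.facts
      have h1 := hf fun v => v
      erw [facts_un_graph, facts_un_graph] at h1
      obtain ⟨h2, h3⟩ := eq_of_rank h1 (rank_of_un_gadget j _) (rank_of_un_gadget j' _) rank_of_leaf
        rank_of_leaf
      obtain rfl := un_unique hs h2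
      exact .dia (ih _ (Formula.cls_eq_iff.1 (cls_eq_of_singleton h3).1))
    | under => cases hM
    | box => cases hM
    | _ => cases hM
  | box j X ih =>
    obtain ⟨N', D', hM, hN, hI⟩ := Formula.Iso.exists_of_div h
    cases Y with
    | atom q => cases hM
    | prod i' Y Y' => cases hM
    | dia j Y => cases hM
    | box j' Y =>
      obtain ⟨rfl, rfl⟩ := Formula.eq_of_div hM
      obtain ⟨f, hext, hhole, hf⟩ := hI.facts
      obtain rfl := un_unique hs (hf fun v => v)
      exact .box (ih _ hN)
    | under i Z' Y =>
      obtain ⟨rfl, rfl⟩ := Formula.eq_of_div hM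
      obtain ⟨f, hext, hhole, hf⟩ := hI.facts
      have h1 := hf fun v => v
      erw [facts_addEdge] at h1
      exact (label_ne_un hs (eq_of_rank ((add_zero _).trans h1) (rank_of_un_gadget j _)
        (rank_of_gadget _ _) (by simp) rank_of_leaf).1.symm).elim
    | _ i Y Z' =>
      obtain ⟨rfl, rfl⟩ := Formula.eq_of_div hM
      obtain ⟨f, hext, hhole, hf⟩ := hI.facts
      have h1 := hf fun v => v
      erw [facts_addEdge] at h1
      exact (label_ne_un hs (eq_of_rank ((add_zero _).trans h1) (rank_of_un_gadget j _)
        (rank_of_gadget _ _) (by simp) rank_of_leaf).1.symm).elim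
  | _ i X Z ihX ihZ =>
    obtain ⟨N', D', hM, hN, hI⟩ := Formula.Iso.exists_of_div h
    cases Y with
    | atom q => cases hM
    | prod i' Y Y' => cases hM
    | dia j Y => cases hM
    | under i' Z' Y =>
      obtain ⟨rfl, rfl⟩ := Formula.eq_of_div hM
      obtain ⟨f, hext, hhole, hf⟩ := hI.facts
      have h1 := hf fun v => v
      erw [facts_addEdge, facts_addEdge] at h1
      obtain ⟨h2, h3⟩ := eq_of_rank h1 (rank_of_gadget _ _) (rank_of_gadget _ _) rank_of_leaf
        rank_of_leaf
      have h4 := cls_eq_of_singleton h3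
      obtain ⟨rfl, hu⟩ := gadget_unique hs f hext h2
      refine .overUnder ?_ (ihX _ hN) (ihZ _ (Formula.cls_eq_iff.1 h4.1))
      rcases hu with ⟨hl, hr, hne⟩ | ⟨hi, -⟩
      · exact by_contra fun hi => hne hi ((h4.2.trans (funext fun l => (hl l).symm)).symm)
      · exact hi
    | box j Y =>
      obtain ⟨rfl, rfl⟩ := Formula.eq_of_div hM
      obtain ⟨f, hext, hhole, hf⟩ := hI.facts
      have h1 := hf fun v => v
      erw [facts_addEdge] at h1
      exact (label_ne_un hs (eq_of_rank (h1.trans (add_zero _).symm) (rank_of_gadget _ _)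
        (rank_of_un_gadget j _) rank_of_leaf (by simp)).1).elim
    | _ i' Y Z' =>
      obtain ⟨rfl, rfl⟩ := Formula.eq_of_div hM
      obtain ⟨f, hext, hhole, hf⟩ := hI.facts
      have h1 := hf fun v => v
      erw [facts_addEdge, facts_addEdge] at h1
      obtain ⟨h2, h3⟩ := eq_of_rank h1 (rank_of_gadget _ _) (rank_of_gadget _ _) rank_of_leaf
        rank_of_leaf
      obtain ⟨rfl, -⟩ := gadget_unique hs f hext h2
      exact .overCongr (ihX _ hN) (ihZ _ (Formula.cls_eq_iff.1 (cls_eq_of_singleton h3).1))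

end KindTrees

open HL NLM Translation

/-! ### The conditions for an embedding, verified for all choices of kinds. -/

section KindTrees

variable {At : Type u} {I : Type v} {J : Type w} {Pr : ℕ → Type x} {atom : At ↪ Pr 2}
  {κ : I → Kind Pr} {m : J → Pr 4} {C A : Set I}

theorem nodup_of_points {P : Type} {t : Fin 2 → P} {S : Multiset (Fact Pr P)}
    (h : (points Output t S).Nodup) : ({t 0} + {t 1} + outs S).Nodup := by
  rw [← vec_eq t, points_output] at h
  exact h

theorem not_mem_range {α β : Type*} {f : α → β} {v : β} (h : ∀ l, f l ≠ v) : v ∉ Set.range f :=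
  fun ⟨l, hl⟩ => h l hl

/-- Both bracketings consist of two labels of the mode and the same three subtrees, along a path for
`series` and at one pair of points for `par`. -/
theorem tree_series_iff (hs : KindSpec C A κ m) {a : I} (ha : a ∈ A) {P : Type}
    (W₁ W₂ W₃ : Database At I J) (t : Fin 2 → P) (S : Multiset (Fact Pr P)) :
    (kindTranslation atom κ m).Tree (.pair a W₁ (.pair a W₂ W₃)) t S ↔
      (kindTranslation atom κ m).Tree (.pair a (.pair a W₁ W₂) W₃) t S := by
  rw [← vec_eq t]
  have hK := (hs.assoc a).1 ha
  constructor
  · intro h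
    obtain ⟨B, l, l', r, r', S₁, S₂, hF, rfl, h1, h2⟩ := tree_pair_iff.1 h
    obtain ⟨B', k, k', q, q', S₃, S₄, hF', rfl, h3, h4⟩ := tree_pair_iff.1 h2
    cases hK' : κ a with
    | series p =>
      rw [hK'] at hF hF'
      obtain ⟨rfl, rfl, rfl, rfl⟩ := hF
      obtain ⟨rfl, rfl, rfl, rfl⟩ := hF'
      exact (tree_series hK' (tree_series hK' h1 h3) h4).congr (fun _ => rfl) (by abel)
    | par p =>
      rw [hK'] at hF hF'
      obtain ⟨rfl, rfl, rfl, rfl, rfl⟩ := hF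
      obtain ⟨rfl, rfl, rfl, rfl, rfl⟩ := hF'
      exact (tree_par hK' (tree_par hK' h1 h3) h4).congr (fun _ => rfl) (by abel)
    | _ =>
      rw [hK'] at hK
      exact hK.elim
  · intro h
    obtain ⟨B, l, l', r, r', S₁, S₂, hF, rfl, h1, h2⟩ := tree_pair_iff.1 h
    obtain ⟨B', k, k', q, q', S₃, S₄, hF', rfl, h3, h4⟩ := tree_pair_iff.1 h1
    cases hK' : κ a with
    | series p =>
      rw [hK'] at hF hF'
      obtain ⟨rfl, rfl, rfl, rfl⟩ := hF
      obtain ⟨rfl, rfl, rfl, rfl⟩ := hF'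
      exact (tree_series hK' h3 (tree_series hK' h4 h2)).congr (fun _ => rfl) (by abel)
    | par p =>
      rw [hK'] at hF hF'
      obtain ⟨rfl, rfl, rfl, rfl, rfl⟩ := hF
      obtain ⟨rfl, rfl, rfl, rfl, rfl⟩ := hF'
      exact (tree_par hK' h3 (tree_par hK' h4 h2)).congr (fun _ => rfl) (by abel)
    | _ =>
      rw [hK'] at hK
      exact hK.elim

theorem kindTranslation_parses (hs : KindSpec C A κ m) :
    (kindTranslation atom κ m).Parses C A Output where
  toGenerated := kindTranslation_generated atom κ m
  bin P W t Γ i ν a b S hS h hn hp := by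
    obtain ⟨D, X, Y, hX, hY, hE, hT⟩ := splits_gadget hs (rfl : κ i = κ i) ν h (nodup_of_points hn)
      hS fun v hv => (hp v (not_mem_range hv)).1
    refine ⟨D, X, Y, hX, hY, hE, fun Z => (hT Z).congr (fun _ => rfl) ?_⟩
    exact congrArg (Γ + ·) (fact_eq_vec ((kindTranslation atom κ m).mu Z).cls
      fun l => ν (((kindTranslation atom κ m).bin i).prims.ext l)).symm
  un P W t Γ j ν a S hS h hn hp := by
    revert ν
    change ∀ ν : Fin 4 → P, _
    intro ν hS hp
    have h1 := Kind.facts_un (m j) ν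
    have h2 : Private ν 2 Γ := (hp (2 : Fin 4) (not_mem_range
      (by decide : ∀ l : Fin 2, (![0, 1] : Fin 2 → Fin 4) l ≠ 2))).1
    have h3 : Private ν 3 Γ := (hp (3 : Fin 4) (not_mem_range
      (by decide : ∀ l : Fin 2, (![0, 1] : Fin 2 → Fin 4) l ≠ 3))).1
    have h4 : ({pfact (m j) ν} : Multiset (Fact Pr P)) = {pfact (m j) ![ν 0, ν 1, ν 2, ν 3]} :=
      pfact_congr fun l => by fin_cases l <;> rfl
    obtain ⟨D, X, hX, hE, hT⟩ := splits_un (x := ν 0) (y := ν 1) (l := ν 2) (l' := ν 3) (a := a)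
      (Γ := Γ) hs (h.congr (fun _ => rfl) (hS.trans (congrArg (Γ + ·)
        (congrArg₂ (· + ·) (h1.trans h4) (fact_eq_vec _ _))))) h2.2 h3.2
    refine ⟨D, X, hX, hE, fun Z => (hT Z).congr (fun _ => rfl) ?_⟩
    exact congrArg (Γ + ·) (fact_eq_vec ((kindTranslation atom κ m).mu Z).cls
      fun l => ν (((kindTranslation atom κ m).un j).prims.ext l)).symm
  right P W Γ i ν b S hS h hn hp := by
    rw [← vec_eq fun l => ν (((kindTranslation atom κ m).bin i).prims.ext l)] at h
    rw [← vec_eq fun l => ν (((kindTranslation atom κ m).bin i).right l)]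
    exact splitsRight_gadget hs (rfl : κ i = κ i) ν h (nodup_of_points hn) hS
      fun v hv => hp v (not_mem_range hv)
  left P W Γ i ν b S hS h hn hp := by
    rw [← vec_eq fun l => ν (((kindTranslation atom κ m).bin i).prims.ext l)] at h
    rw [← vec_eq fun l => ν (((kindTranslation atom κ m).bin i).left l)]
    exact splitsLeft_gadget hs (rfl : κ i = κ i) ν h (nodup_of_points hn) hS
      fun v hv => hp v (not_mem_range hv)
  slot P W Γ j ν S hS h hn hp := by
    revert ν
    change ∀ ν : Fin 4 → P, _
    intro ν hS h hn hp
    have h0 : Private ν 0 Γ := hp (0 : Fin 4) (not_mem_range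
      (by decide : ∀ l : Fin 2, (![2, 3] : Fin 2 → Fin 4) l ≠ 0))
    have h1 : Private ν 1 Γ := hp (1 : Fin 4) (not_mem_range
      (by decide : ∀ l : Fin 2, (![2, 3] : Fin 2 → Fin 4) l ≠ 1))
    have h4 : ({pfact (m j) ν} : Multiset (Fact Pr P)) = {pfact (m j) ![ν 0, ν 1, ν 2, ν 3]} :=
      pfact_congr fun l => by fin_cases l <;> rfl
    rw [← vec_eq fun l => ν (((kindTranslation atom κ m).un j).prims.ext l)] at h
    rw [← vec_eq fun l => ν (((kindTranslation atom κ m).un j).slot l)]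
    exact splits_slot hs h (hS.trans (congrArg (· + Γ) ((Kind.facts_un (m j) ν).trans h4)))
      h0.2 h1.2
  comm c hc P ν := by
    obtain ⟨ν', h1, h2, h3, h4, h5, h6, h7⟩ := Kind.exists_of_frame
      (((κ c).frame ν).swap ((hs.comm c).1 hc))
    exact ⟨ν', Fin.forall_fin_two.2 ⟨h1, h2⟩, h3, Fin.forall_fin_two.2 ⟨h4, h5⟩,
      Fin.forall_fin_two.2 ⟨h6, h7⟩⟩
  assoc a ha P W₁ W₂ W₃ t S := tree_series_iff hs ha W₁ W₂ W₃ t S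
  injective X Y h := kindTranslation_injective hs X Y h

theorem kindTranslation_embeds (hs : KindSpec C A κ m) : (kindTranslation atom κ m).Embeds C A :=
  (kindTranslation_parses hs).embeds

end KindTrees

/-! ### The two translations of the theorem. -/

section Bar

variable {At : Type u} {I : Type v} {J : Type w} {Pr : ℕ → Type x} {C A : Set I}

open Classical in
/-- The kinds of modes in `barTranslation`. -/
noncomputable def barKind (C A : Set I) (tree : {i : I // i ∉ C ∧ i ∉ A} ↪ Pr 6)
    (quad : {i : I // i ∈ C} ⊕ J ↪ Pr 4) (assoc : {i : I // i ∈ A} ↪ Pr 1) (i : I) : Kind Pr :=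
  if hC : i ∈ C then .quad (quad (Sum.inl ⟨i, hC⟩))
  else if hA : i ∈ A then .series (assoc ⟨i, hA⟩)
  else .tree (tree ⟨i, hC, hA⟩)

theorem barTranslation_eq (atom : At ↪ Pr 2) (tree : {i : I // i ∉ C ∧ i ∉ A} ↪ Pr 6)
    (quad : {i : I // i ∈ C} ⊕ J ↪ Pr 4) (assoc : {i : I // i ∈ A} ↪ Pr 1) :
    barTranslation C A atom tree quad assoc =
      kindTranslation atom (barKind C A tree quad assoc) fun j => quad (Sum.inr j) := by
  unfold barTranslation kindTranslation
  congr 1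
  funext i
  unfold barKind
  split_ifs <;> rfl

theorem barKind_spec (hA : A.Subsingleton) (hCA : ∀ i ∈ A, i ∉ C)
    (tree : {i : I // i ∉ C ∧ i ∉ A} ↪ Pr 6) (quad : {i : I // i ∈ C} ⊕ J ↪ Pr 4)
    (assoc : {i : I // i ∈ A} ↪ Pr 1) :
    KindSpec C A (barKind C A tree quad assoc) fun j => quad (Sum.inr j) where
  label_inj i i' h := by
    unfold barKind at h
    split_ifs at h <;> simp only [Kind.label, Sigma.mk.injEq] at h
    · exact congrArg Subtype.val (Sum.inl_injective (quad.injective (eq_of_heq h.2)))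
    · exact absurd h.1 (by decide)
    · exact absurd h.1 (by decide)
    · exact absurd h.1 (by decide)
    · exact congrArg Subtype.val (assoc.injective (eq_of_heq h.2))
    · exact absurd h.1 (by decide)
    · exact absurd h.1 (by decide)
    · exact absurd h.1 (by decide)
    · exact congrArg Subtype.val (tree.injective (eq_of_heq h.2))
  label_ne i j h := by
    unfold barKind at h
    split_ifs at h <;> simp only [Kind.label, Sigma.mk.injEq] at h
    · exact absurd (quad.injective (eq_of_heq h.2)) Sum.inl_ne_inr
    · exact absurd h.1 (by decide)
    · exact absurd h.1 (by decide)
  un_inj j j' h := Sum.inr_injective (quad.injective h)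
  comm i := by
    unfold barKind
    split_ifs with h1 h2 <;> simp [Kind.IsComm, h1]
  assoc i := by
    unfold barKind
    split_ifs with h1 h2
    -- `barKind` tests commutativity first, so a mode with both properties would wrongly receive
    -- `quad`.
    · simpa [Kind.IsAssoc] using fun h => hCA i h h1
    · simp [Kind.IsAssoc, h2]
    · simp [Kind.IsAssoc, h2]
  sub := hA
  world := by
    refine .inl ⟨fun i p h => ?_, fun i p q h => ?_⟩ <;>
    · unfold barKind at h
      split_ifs at h

theorem barTranslation_embeds (hA : A.Subsingleton) (hCA : ∀ i ∈ A, i ∉ C)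
    (atom : At ↪ Pr 2) (tree : {i : I // i ∉ C ∧ i ∉ A} ↪ Pr 6)
    (quad : {i : I // i ∈ C} ⊕ J ↪ Pr 4) (assoc : {i : I // i ∈ A} ↪ Pr 1) :
    (barTranslation C A atom tree quad assoc).Embeds C A := by
  rw [barTranslation_eq]
  exact kindTranslation_embeds (barKind_spec hA hCA tree quad assoc)

open Classical in
/-- Kinds of modes for a mode `O` that is both commutative and associative. -/
noncomputable def symKind (C : Set I) (O : I) (par : Pr 0) (arm : Pr 3) (tree : I ↪ Pr 6)
    (quad : I ⊕ J ↪ Pr 4) (i : I) : Kind Pr :=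
  if i = O then .par par else if i ∈ C then .sym (quad (Sum.inl i)) arm else .tree (tree i)

theorem symKind_spec {O : I} (hO : O ∈ C) (par : Pr 0) (arm : Pr 3) (tree : I ↪ Pr 6)
    (quad : I ⊕ J ↪ Pr 4) :
    KindSpec C {O} (symKind C O par arm tree quad) fun j => quad (Sum.inr j) where
  label_inj i i' h := by
    unfold symKind at h
    split_ifs at h with h1 h2 h2 h3 h4 <;> simp only [Kind.label, Sigma.mk.injEq] at h
    · exact h1.trans h2.symm
    · exact absurd h.1 (by decide)
    · exact absurd h.1 (by decide)
    · exact absurd h.1 (by decide)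
    · exact Sum.inl_injective (quad.injective (eq_of_heq h.2))
    · exact absurd h.1 (by decide)
    · exact absurd h.1 (by decide)
    · exact absurd h.1 (by decide)
    · exact tree.injective (eq_of_heq h.2)
  label_ne i j h := by
    unfold symKind at h
    split_ifs at h <;> simp only [Kind.label, Sigma.mk.injEq] at h
    · exact absurd h.1 (by decide)
    · exact absurd (quad.injective (eq_of_heq h.2)) Sum.inl_ne_inr
    · exact absurd h.1 (by decide)
  un_inj j j' h := Sum.inr_injective (quad.injective h)
  comm i := by
    unfold symKind
    split_ifs with h1 h2
    · simp [Kind.IsComm, h1, hO]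
    · simp [Kind.IsComm, h2]
    · simp [Kind.IsComm, h2]
  assoc i := by
    unfold symKind
    split_ifs with h1 h2 <;> simp [Kind.IsAssoc, h1]
  sub := Set.subsingleton_singleton
  world := by
    refine .inr ⟨fun i p h => ?_, fun i p h => ?_⟩ <;>
    · unfold symKind at h
      split_ifs at h

theorem mainTheorem3 {At : Type u} {I : Type v} {J : Type w} {Pr : ℕ → Type x} (C : Set I) :
    (∀ O : I, O ∉ C →
      ∀ (atom : At ↪ Pr 2) (tree : {i : I // i ∉ C ∧ i ∉ ({O} : Set I)} ↪ Pr 6)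
        (quad : {i : I // i ∈ C} ⊕ J ↪ Pr 4) (assoc : {i : I // i ∈ ({O} : Set I)} ↪ Pr 1),
        (barTranslation C {O} atom tree quad assoc).Embeds C {O}) ∧
    (∀ A : Set I, A.Subsingleton → (∀ n, Nonempty (At ⊕ I ⊕ J ↪ Pr n)) →
      ∃ (k : ℕ) (τ : Translation At I J Pr k), τ.Embeds C A) := by
  refine ⟨fun O hO atom tree quad assoc => barTranslation_embeds Set.subsingleton_singleton
    (fun i hi => by rwa [Set.mem_singleton_iff.1 hi]) atom tree quad assoc, fun A hA hPr => ⟨2, ?_⟩⟩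
  have emb := fun n => Classical.choice (hPr n)
  have atom : At ↪ Pr 2 := Function.Embedding.inl.trans (emb 2)
  have mode : ∀ n, I ↪ Pr n := fun n =>
    (Function.Embedding.inl.trans Function.Embedding.inr).trans (emb n)
  -- This case includes that there is no associative mode; the translation of the first part then
  -- works without a series gadget.
  by_cases hCA : ∀ i ∈ A, i ∉ C
  · refine ⟨_, barTranslation_embeds hA hCA atom ((Function.Embedding.subtype _).trans (mode 6))
      (((Function.Embedding.subtype _).sumMap (.refl J)).trans
        (Function.Embedding.inr.trans (emb 4)))
      ((Function.Embedding.subtype _).trans (mode 1))⟩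
  · push Not at hCA
    obtain ⟨O, hOA, hOC⟩ := hCA
    obtain rfl : A = {O} := hA.eq_singleton_of_mem hOA
    -- Any primitive formulas of ranks 0 and 3 serve as the label of `O` and as arms; the embeddings
    -- supply some at `O`. One arm label suffices for all commutative modes, which are told apart by
    -- their labels of rank 4.
    exact ⟨_, kindTranslation_embeds (atom := atom) (symKind_spec hOC (mode 0 O) (mode 3 O) (mode 6)
      (Function.Embedding.inr.trans (emb 4)))⟩

end Bar
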